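/- **Setting.** Let $\epsilon>0$, $a\neq0$, $b\in\mathbb R$, $x_0\in[0,1]$, $c_1,c_2>0$. Consider the viscous Hamilton–Jacobi system $$u_t=\epsilon u_{xx}-au_x(b+u_x),\qquad u_x(0,t)=U_0(t),\quad u_x(1,t)=U_1(t),\qquad x\in[0,1],\ t\ge t_0\ge0. \tag{1}$$ *Function classes.* $\|f\|_{L^2}=(\int_0^1f^2dx)^{1/2}$ and $\|f\|_{H^1}=\|f\|_{L^2}+\|f'\|_{L^2}$. $G_{F,M,\gamma}$ is the set of $f\in C^\infty([0,\infty))$ with $\sup_{t\ge0}|f^{(n)}(t)|\le FM^n(n!)^\gamma$ for all $n\ge0$. A continuous $\beta:[0,\infty)^2\to[0,\infty)$ is of class $\mathcal{KL}$ if for each fixed $t$ the map $s\mapsto\beta(s,t)$ is continuous, strictly increasing and zero at $0$, and for each fixed $s$ the map $t\mapsto\beta(s,t)$ is nonincreasing and tends to $0$ as $t\to\infty$. *Reference trajectory.* For $y_1,y_2:[0,\infty)\to\mathbb R$ put $y_{1,v}=e^{-\frac{ab}{2\epsilon}x_0}(e^{-\frac a\epsilon y_1}-1)$, $y_{2,v}=e^{-\frac{ab}{2\epsilon}x_0}\bigl(-\frac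 a\epsilon e^{-\frac a\epsilon y_1}y_2-\frac{ab}{2\epsilon}(e^{-\frac a\epsilon y_1}-1)\bigr)$, $$v^r(x,t)=\sum_{k\ge0}\frac{(x-x_0)^{2k}}{\epsilon^k(2k)!}\sum_{m=0}^k\binom km\Bigl(\tfrac{a^2b^2}{4\epsilon}\Bigr)^{k-m}y_{1,v}^{(m)}(t)+\sum_{k\ge0}\frac{(x-x_0)^{2k+1}}{\epsilon^k(2k+1)!}\sum_{m=0}^k\binom km\Bigl(\tfrac{a^2b^2}{4\epsilon}\Bigr)^{k-m}y_{2,v}^{(m)}(t),$$ $$u^r(x,t)=-\tfrac\epsilon a\ln\bigl(e^{\frac{ab}{2\epsilon}x}v^r(x,t)+1\bigr),$$ $$U_0^r(t)=-\frac\epsilon a\,\frac{v_x^r(0,t)+\frac{ab}{2\epsilon}v^r(0,t)}{1+v^r(0,t)},\qquad U_1^r(t)=-\frac{\epsilon e^{\frac{ab}{2\epsilon}}}{a}\,\frac{v_x^r(1,t)+\frac{ab}{2\epsilon}v^r(1,t)}{1+e^{\frac{ab}{2\epsilon}}v^r(1,t)}.$$ *Kernels and gains.* Let $I_1$ be the modified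 Bessel function of the first kind of order one and let $$k(x,\xi)=-\frac12\sqrt{\frac{c_1}\epsilon}\,\frac{I_1\Bigl(\sqrt{\frac{c_1}\epsilon\bigl((x-\frac12)^2-(\xi-\frac12)^2\bigr)}\Bigr)}{\sqrt{(x-\frac12)^2-(\xi-\frac12)^2}}\,(x+\xi-1),$$ $$P(x,\xi)=-\frac12\sqrt{\frac{c_2}\epsilon}\,\frac{I_1\Bigl(\sqrt{\frac{c_2}\epsilon\bigl((\xi-\frac12)^2-(x-\frac12)^2\bigr)}\Bigr)}{\sqrt{(\xi-\frac12)^2-(x-\frac12)^2}}\,(x+\xi-1),$$ extended analytically across their removable singularities. The gains are $p_2(x)=-\epsilon P_\xi(x,0)$, $p_1(x)=-\epsilon P_\xi(x,1)$, $p_{00}=-P(0,0)$, $p_{11}=-P(1,1)$. *Feedback laws and observer.* Put $\tilde u=u-u^r$, $\tilde v(0,t)=(e^{-\frac a\epsilon\tilde u(0,t)}-1)e^{-\frac a\epsilon u^r(0,t)}$ and $\tilde v(1,t)=(e^{-\frac a\epsilon\tilde u(1,t)}-1)e^{-\frac{ab}{2\epsilon}-\frac a\epsilon u^r(1,t)}$.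 The feedback laws are $$U_0=-\tfrac\epsilon a e^{\frac a\epsilon\tilde u(0,t)}\Bigl(\bigl(k(0,0)+\tfrac{ab}{2\epsilon}\bigr)(e^{-\frac a\epsilon\tilde u(0,t)}-1)-e^{\frac a\epsilon u^r(0,t)}\int_0^1k_x(0,\xi)\hat{\tilde v}(\xi,t)d\xi\Bigr)+U_0^re^{\frac a\epsilon\tilde u(0,t)}, \tag{2}$$ $$U_1=-\tfrac\epsilon a e^{\frac a\epsilon\tilde u(1,t)}\Bigl(\bigl(k(1,1)+\tfrac{ab}{2\epsilon}\bigr)(e^{-\frac a\epsilon\tilde u(1,t)}-1)+e^{\frac{ab}{2\epsilon}+\frac a\epsilon u^r(1,t)}\int_0^1k_x(1,\xi)\hat{\tilde v}(\xi,t)d\xi\Bigr)+U_1^re^{\frac a\epsilon\tilde u(1,t)}, \tag{3}$$ and the observer is $$\hat{\tilde v}_t=\epsilon\hat{\tilde v}_{xx}-\tfrac{a^2b^2}{4\epsilon}\hat{\tilde v}+p_2(x)\bigl(\tilde v(0,t)-\hat{\tilde v}(0,t)\bigr)+p_1(x)\bigl(\tilde v(1,t)-\hat{\tilde v}(1,t)\bigr),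 \tag{4}$$ $$\hat{\tilde v}_x(0,t)=k(0,0)\tilde v(0,t)-\int_0^1k_x(0,\xi)\hat{\tilde v}(\xi,t)d\xi+p_{00}\bigl(\tilde v(0,t)-\hat{\tilde v}(0,t)\bigr), \tag{5}$$ $$\hat{\tilde v}_x(1,t)=k(1,1)\tilde v(1,t)+\int_0^1k_x(1,\xi)\hat{\tilde v}(\xi,t)d\xi+p_{11}\bigl(\tilde v(1,t)-\hat{\tilde v}(1,t)\bigr). \tag{6}$$ Initial data $(u_0,\hat{\tilde v}_0)\in H^2(0,1)^2$ at time $t_0$ are *compatible* if the four boundary conditions of the closed loop (1)–(6) hold for them at $t=t_0$. Put $\Omega(t)=\|\tilde u(t)\|_{H^1}+\|\hat{\tilde v}(t)\|_{H^1}$. **Theorem 3.** Let $\epsilon>0$, $a\ne0$, $b\in\mathbb R$, $x_0\in[0,1]$, $M>0$ and $1\le\gamma<2$. There is $\mu_1>0$ such that for all $0<F\le\mu_1$ and all $y_1,y_2\in G_{F,M,\gamma}$ the following holds. (i) The two series defining $v^r$ converge on $[0,1]\times[0,\infty)$, $e^{\frac{ab}{2\epsilon}x}v^r+1>0$ there,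 $u^r\in C^{2,1}([0,1]\times[0,\infty))$, and $(u^r,U_0^r,U_1^r)$ solves (1) for $t\ge0$ with $u^r(x_0,t)=y_1(t)$ and $u^r_x(x_0,t)=y_2(t)$. (ii) For all $c_1,c_2>0$ there exist $\mu^*>0$ and a class $\mathcal{KL}$ function $\beta^*$ such that, for every $t_0\ge0$ and all compatible $(u_0,\hat{\tilde v}_0)\in H^2(0,1)\times H^2(0,1)$ with $$\|\tilde u(t_0)\|_{H^1}+\|\hat{\tilde v}(t_0)\|_{H^1}<\mu^*,$$ the closed-loop system (1)–(6) with $u(\cdot,t_0)=u_0$, $\hat{\tilde v}(\cdot,t_0)=\hat{\tilde v}_0$ has a unique solution $(u,\hat{\tilde v})$ with $u,\hat{\tilde v}\in C([t_0,\infty);H^2(0,1))\cap C^{2,1}([0,1]\times(t_0,\infty))$, and $$\Omega(t)\le\beta^*(\Omega(t_0),t-t_0)\qquad\text{for all }t\ge t_0.$$ -/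

import Mathlib

open Set Filter Topology MeasureTheory
open scoped Nat ContDiff

noncomputable section

namespace ViscousHJ

/-! ### Function spaces on `[0,1]` -/

/-- `‖f‖_{L²}` on `(0,1)`. -/
def L2norm (f : ℝ → ℝ) : ℝ := Real.sqrt (∫ x in (0 : ℝ)..1, f x ^ 2)

/-- Spatial derivative on `[0,1]` (one-sided at the end points). -/
def D (f : ℝ → ℝ) : ℝ → ℝ := fun x => derivWithin f (Icc 0 1) x

/-- `‖f‖_{H¹} = ‖f‖_{L²} + ‖f'‖_{L²}`. -/
def H1norm (f : ℝ → ℝ) : ℝ := L2norm f + L2norm (D f)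

/-- `‖f‖_{H²} = ‖f‖_{L²} + ‖f'‖_{L²} + ‖f''‖_{L²}`; for `f ∈ H²(0,1)` the pointwise
second derivative exists almost everywhere and is the weak one. -/
def H2norm (f : ℝ → ℝ) : ℝ := L2norm f + L2norm (D f) + L2norm (D (D f))

/-- `f` is (the continuous representative of) an element of `H²(0,1)`: it is differentiable on
`[0,1]`, its derivative is absolutely continuous, and the second derivative is in `L²(0,1)`. -/
structure MemH2 (f : ℝ → ℝ) : Prop where
  diff : DifferentiableOn ℝ f (Icc 0 1)
  ac : AbsolutelyContinuousOnInterval (D f) 0 1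
  memLp : MemLp (D (D f)) 2 (volume.restrict (Icc (0 : ℝ) 1))

/-- `u ∈ C([t₀,∞); H²(0,1))`. -/
structure ContinuousH2 (t₀ : ℝ) (u : ℝ → ℝ → ℝ) : Prop where
  mem : ∀ t, t₀ ≤ t → MemH2 (fun x => u x t)
  cont : ∀ s, t₀ ≤ s →
    Tendsto (fun t => H2norm (fun x => u x t - u x s)) (𝓝[Ici t₀] s) (𝓝 0)

/-- `u_x(x,t)`, for `x ∈ [0,1]`. -/
def dx (u : ℝ → ℝ → ℝ) (x t : ℝ) : ℝ := D (fun y => u y t) x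

/-- `u_{xx}(x,t)`, for `x ∈ [0,1]`. -/
def dxx (u : ℝ → ℝ → ℝ) (x t : ℝ) : ℝ := dx (dx u) x t

/-- `u_t(x,t)` for a time set `S` (the usual derivative when `S` is open, one-sided at an
end point of `S`). -/
def dt (S : Set ℝ) (u : ℝ → ℝ → ℝ) (x t : ℝ) : ℝ := derivWithin (fun s => u x s) S t

/-- `u ∈ C^{2,1}([0,1] × S)`. -/
structure IsC21 (S : Set ℝ) (u : ℝ → ℝ → ℝ) : Prop where
  diff_x : ∀ t ∈ S, DifferentiableOn ℝ (fun x => u x t) (Icc 0 1)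
  diff_xx : ∀ t ∈ S, DifferentiableOn ℝ (fun x => dx u x t) (Icc 0 1)
  diff_t : ∀ x ∈ Icc (0 : ℝ) 1, DifferentiableOn ℝ (fun t => u x t) S
  cont : ContinuousOn (fun p : ℝ × ℝ => u p.1 p.2) (Icc 0 1 ×ˢ S)
  cont_x : ContinuousOn (fun p : ℝ × ℝ => dx u p.1 p.2) (Icc 0 1 ×ˢ S)
  cont_xx : ContinuousOn (fun p : ℝ × ℝ => dxx u p.1 p.2) (Icc 0 1 ×ˢ S)
  cont_t : ContinuousOn (fun p : ℝ × ℝ => dt S u p.1 p.2) (Icc 0 1 ×ˢ S)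

/-- Class `𝒦` functions `[0,∞) → [0,∞)`. -/
structure IsClassK (α : ℝ → ℝ) : Prop where
  cont : ContinuousOn α (Ici 0)
  strictMono : StrictMonoOn α (Ici 0)
  zero : α 0 = 0

/-- Class `𝒦ℒ` functions `[0,∞) × [0,∞) → [0,∞)`. -/
structure IsClassKL (β : ℝ → ℝ → ℝ) : Prop where
  cont : ContinuousOn (fun p : ℝ × ℝ => β p.1 p.2) (Ici 0 ×ˢ Ici 0)
  classK : ∀ t, 0 ≤ t → IsClassK (fun s => β s t)
  anti : ∀ s, 0 ≤ s → AntitoneOn (fun t => β s t) (Ici 0)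
  tendsto : ∀ s, 0 ≤ s → Tendsto (fun t => β s t) atTop (𝓝 0)

/-- The Gevrey class `G_{F,M,γ}([0,∞))`. -/
structure IsGevrey (F M γ : ℝ) (f : ℝ → ℝ) : Prop where
  smooth : ContDiffOn ℝ ∞ f (Ici 0)
  bound : ∀ n : ℕ, ∀ t, 0 ≤ t →
    |iteratedDerivWithin n f (Ici 0) t| ≤ F * M ^ n * (n ! : ℝ) ^ γ

/-! ### Bessel kernels -/

/-- The modified Bessel function of the first kind of order one. -/
def besselI1 (z : ℝ) : ℝ := ∑' k : ℕ, (z / 2) ^ (2 * k + 1) / ((k ! : ℝ) * ((k + 1)! : ℝ))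

/-- The entire function `s ↦ I₁(√s)/√s`, with its removable singularity removed. -/
def besselI1Div (s : ℝ) : ℝ :=
  ∑' k : ℕ, s ^ k / (2 ^ (2 * k + 1) * ((k ! : ℝ) * ((k + 1)! : ℝ)))

theorem besselI1Div_eq {s : ℝ} (hs : 0 < s) :
    besselI1Div s = besselI1 (Real.sqrt s) / Real.sqrt s := by
  have h : Real.sqrt s ≠ 0 := (Real.sqrt_pos.2 hs).ne'
  unfold besselI1Div besselI1
  rw [← tsum_div_const]
  refine tsum_congr fun k => ?_
  have h2 : Real.sqrt s ^ (2 * k + 1) = s ^ k * Real.sqrt s := by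
    rw [pow_succ, pow_mul, Real.sq_sqrt hs.le]
  rw [div_pow, h2]
  field_simp

/-- The control kernel `k(x,ξ)`, for `c = c₁`. -/
def ctrlKernel (ε c x ξ : ℝ) : ℝ :=
  -(1 / 2) * (c / ε) * besselI1Div (c / ε * ((x - 1 / 2) ^ 2 - (ξ - 1 / 2) ^ 2)) * (x + ξ - 1)

/-- The observer kernel `P(x,ξ)`, for `c = c₂`. -/
def obsKernel (ε c x ξ : ℝ) : ℝ :=
  -(1 / 2) * (c / ε) * besselI1Div (c / ε * ((ξ - 1 / 2) ^ 2 - (x - 1 / 2) ^ 2)) * (ξ + x - 1)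

/-- Off the two diagonals of its domain, `ctrlKernel` is the usual Bessel expression. -/
theorem ctrlKernel_eq {ε c x ξ : ℝ} (hε : 0 < ε) (hc : 0 < c)
    (h : 0 < (x - 1 / 2) ^ 2 - (ξ - 1 / 2) ^ 2) :
    ctrlKernel ε c x ξ = -(1 / 2) * Real.sqrt (c / ε)
      * (besselI1 (Real.sqrt (c / ε * ((x - 1 / 2) ^ 2 - (ξ - 1 / 2) ^ 2)))
        / Real.sqrt ((x - 1 / 2) ^ 2 - (ξ - 1 / 2) ^ 2)) * (x + ξ - 1) := by
  have hq : 0 < c / ε := div_pos hc hε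
  have hs := Real.sqrt_pos.2 hq
  have hs2 := Real.sqrt_pos.2 h
  unfold ctrlKernel
  rw [besselI1Div_eq (mul_pos hq h)]
  generalize (x - 1 / 2) ^ 2 - (ξ - 1 / 2) ^ 2 = σ at *
  rw [Real.sqrt_mul hq.le]
  generalize besselI1 (√(c / ε) * √σ) = B
  have : c / ε = √(c / ε) * √(c / ε) := (Real.mul_self_sqrt hq.le).symm
  generalize √(c / ε) = r at *
  rw [this]
  field_simp

theorem obsKernel_eq_ctrlKernel (ε c x ξ : ℝ) : obsKernel ε c x ξ = ctrlKernel ε c ξ x := rfl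

/-- `k_x(x,ξ)`. -/
def ctrlKernelX (ε c x ξ : ℝ) : ℝ := deriv (fun y => ctrlKernel ε c y ξ) x

/-- `P_ξ(x,ξ)`. -/
def obsKernelXi (ε c x ξ : ℝ) : ℝ := deriv (fun y => obsKernel ε c x y) ξ

/-- Output-injection gains. -/
def p1 (ε c x : ℝ) : ℝ := -ε * obsKernelXi ε c x 1

/-- Output-injection gains. -/
def p2 (ε c x : ℝ) : ℝ := -ε * obsKernelXi ε c x 0

/-- Output-injection gains. -/
def p00 (ε c : ℝ) : ℝ := -obsKernel ε c 0 0

/-- Output-injection gains. -/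
def p11 (ε c : ℝ) : ℝ := -obsKernel ε c 1 1

/-! ### Reference trajectory -/

/-- `y_{1,v}^r`. -/
def y1v (ε a b x₀ : ℝ) (y₁ : ℝ → ℝ) (t : ℝ) : ℝ :=
  Real.exp (-(a * b / (2 * ε)) * x₀) * (Real.exp (-(a / ε) * y₁ t) - 1)

/-- `y_{2,v}^r`. -/
def y2v (ε a b x₀ : ℝ) (y₁ y₂ : ℝ → ℝ) (t : ℝ) : ℝ :=
  Real.exp (-(a * b / (2 * ε)) * x₀) *
    (-(a / ε) * Real.exp (-(a / ε) * y₁ t) * y₂ t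
      - a * b / (2 * ε) * (Real.exp (-(a / ε) * y₁ t) - 1))

/-- `∑_{m ≤ k} C(k,m) (a²b²/(4ε))^{k-m} f^{(m)}(t)`. -/
def binomDeriv (ε a b : ℝ) (f : ℝ → ℝ) (k : ℕ) (t : ℝ) : ℝ :=
  ∑ m ∈ Finset.range (k + 1), (k.choose m : ℝ) * (a ^ 2 * b ^ 2 / (4 * ε)) ^ (k - m)
    * iteratedDerivWithin m f (Ici 0) t

/-- Terms of the even part of the series for `v^r`. -/
def vrEven (ε a b x₀ : ℝ) (y₁ : ℝ → ℝ) (x t : ℝ) (k : ℕ) : ℝ :=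
  1 / ε ^ k * ((x - x₀) ^ (2 * k) / ((2 * k)! : ℝ)) * binomDeriv ε a b (y1v ε a b x₀ y₁) k t

/-- Terms of the odd part of the series for `v^r`. -/
def vrOdd (ε a b x₀ : ℝ) (y₁ y₂ : ℝ → ℝ) (x t : ℝ) (k : ℕ) : ℝ :=
  1 / ε ^ k * ((x - x₀) ^ (2 * k + 1) / ((2 * k + 1)! : ℝ))
    * binomDeriv ε a b (y2v ε a b x₀ y₁ y₂) k t

/-- `v^r(x,t)`. -/
def vr (ε a b x₀ : ℝ) (y₁ y₂ : ℝ → ℝ) (x t : ℝ) : ℝ :=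
  (∑' k, vrEven ε a b x₀ y₁ x t k) + ∑' k, vrOdd ε a b x₀ y₁ y₂ x t k

/-- The reference trajectory `u^r(x,t)`. -/
def ur (ε a b x₀ : ℝ) (y₁ y₂ : ℝ → ℝ) (x t : ℝ) : ℝ :=
  -(ε / a) * Real.log (Real.exp (a * b / (2 * ε) * x) * vr ε a b x₀ y₁ y₂ x t + 1)

/-- The reference input `U_0^r(t)`. -/
def U0r (ε a b x₀ : ℝ) (y₁ y₂ : ℝ → ℝ) (t : ℝ) : ℝ :=
  -(ε / a) * ((dx (vr ε a b x₀ y₁ y₂) 0 t + a * b / (2 * ε) * vr ε a b x₀ y₁ y₂ 0 t)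
    / (1 + vr ε a b x₀ y₁ y₂ 0 t))

/-- The reference input `U_1^r(t)`. -/
def U1r (ε a b x₀ : ℝ) (y₁ y₂ : ℝ → ℝ) (t : ℝ) : ℝ :=
  -(ε * Real.exp (a * b / (2 * ε)) / a) *
    ((dx (vr ε a b x₀ y₁ y₂) 1 t + a * b / (2 * ε) * vr ε a b x₀ y₁ y₂ 1 t)
      / (1 + Real.exp (a * b / (2 * ε)) * vr ε a b x₀ y₁ y₂ 1 t))

/-- `u_t = ε u_xx - a u_x (b + u_x)` on `[0,1] × S`. -/
def SolvesPDE (ε a b : ℝ) (S : Set ℝ) (u : ℝ → ℝ → ℝ) : Prop :=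
  ∀ x ∈ Icc (0 : ℝ) 1, ∀ t ∈ S,
    dt S u x t = ε * dxx u x t - a * dx u x t * (b + dx u x t)

/-- The functions `u^r`, `U_0^r`, `U_1^r` are well defined, solve the plant equations for all
`t ≥ 0`, and generate the outputs `y₁`, `y₂` at `x₀`. -/
structure IsReference (ε a b x₀ : ℝ) (y₁ y₂ : ℝ → ℝ) : Prop where
  summable_even : ∀ x ∈ Icc (0 : ℝ) 1, ∀ t, 0 ≤ t → Summable (vrEven ε a b x₀ y₁ x t)
  summable_odd : ∀ x ∈ Icc (0 : ℝ) 1, ∀ t, 0 ≤ t → Summable (vrOdd ε a b x₀ y₁ y₂ x t)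
  log_pos : ∀ x ∈ Icc (0 : ℝ) 1, ∀ t, 0 ≤ t →
    0 < Real.exp (a * b / (2 * ε) * x) * vr ε a b x₀ y₁ y₂ x t + 1
  regular : IsC21 (Ici 0) (ur ε a b x₀ y₁ y₂)
  pde : SolvesPDE ε a b (Ici 0) (ur ε a b x₀ y₁ y₂)
  bc0 : ∀ t, 0 ≤ t → dx (ur ε a b x₀ y₁ y₂) 0 t = U0r ε a b x₀ y₁ y₂ t
  bc1 : ∀ t, 0 ≤ t → dx (ur ε a b x₀ y₁ y₂) 1 t = U1r ε a b x₀ y₁ y₂ t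
  out1 : ∀ t, 0 ≤ t → ur ε a b x₀ y₁ y₂ x₀ t = y₁ t
  out2 : ∀ t, 0 ≤ t → dx (ur ε a b x₀ y₁ y₂) x₀ t = y₂ t

/-! ### Control laws and observer

In this part `e` is a profile of the tracking error `u(·,t) - u^r(·,t)`, `v` is a profile of the
observer state, `r` is the reference profile `u^r(·,t)`, and `R` is the value of the reference
input at time `t`. -/

/-- The measured quantity `ṽ(0,t) = (e^{-(a/ε) ũ(0,t)} - 1) e^{-(a/ε) u^r(0,t)}`. -/
def meas0 (ε a : ℝ) (r e : ℝ → ℝ) : ℝ :=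
  (Real.exp (-(a / ε) * e 0) - 1) * Real.exp (-(a / ε) * r 0)

/-- The measured quantity
`ṽ(1,t) = (e^{-(a/ε) ũ(1,t)} - 1) e^{-ab/(2ε) - (a/ε) u^r(1,t)}`. -/
def meas1 (ε a b : ℝ) (r e : ℝ → ℝ) : ℝ :=
  (Real.exp (-(a / ε) * e 1) - 1) * Real.exp (-(a * b / (2 * ε)) - a / ε * r 1)

/-- `Ṽ_0`. -/
def V0 (ε a c₁ : ℝ) (r e v : ℝ → ℝ) : ℝ :=
  ctrlKernel ε c₁ 0 0 * meas0 ε a r e - ∫ ξ in (0 : ℝ)..1, ctrlKernelX ε c₁ 0 ξ * v ξ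

/-- `Ṽ_1`. -/
def V1 (ε a b c₁ : ℝ) (r e v : ℝ → ℝ) : ℝ :=
  ctrlKernel ε c₁ 1 1 * meas1 ε a b r e + ∫ ξ in (0 : ℝ)..1, ctrlKernelX ε c₁ 1 ξ * v ξ

/-- The feedback law `U_0`. -/
def U0 (ε a b c₁ R : ℝ) (r e v : ℝ → ℝ) : ℝ :=
  -(ε / a) * Real.exp (a / ε * e 0) *
      ((ctrlKernel ε c₁ 0 0 + a * b / (2 * ε)) * (Real.exp (-(a / ε) * e 0) - 1)
        - Real.exp (a / ε * r 0) * ∫ ξ in (0 : ℝ)..1, ctrlKernelX ε c₁ 0 ξ * v ξ)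
    + R * Real.exp (a / ε * e 0)

/-- The feedback law `U_1`. -/
def U1 (ε a b c₁ R : ℝ) (r e v : ℝ → ℝ) : ℝ :=
  -(ε / a) * Real.exp (a / ε * e 1) *
      ((ctrlKernel ε c₁ 1 1 + a * b / (2 * ε)) * (Real.exp (-(a / ε) * e 1) - 1)
        + Real.exp (a * b / (2 * ε) + a / ε * r 1)
          * ∫ ξ in (0 : ℝ)..1, ctrlKernelX ε c₁ 1 ξ * v ξ)
    + R * Real.exp (a / ε * e 1)

/-- The four boundary conditions of the closed loop (plant with feedback laws, and observer) at
time `t`, for a plant profile `u` and an observer profile `v`. At the initial time these are the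
compatibility conditions on the initial data. -/
structure BoundaryConditions (ε a b x₀ c₁ c₂ : ℝ) (y₁ y₂ : ℝ → ℝ) (t : ℝ) (u v : ℝ → ℝ) :
    Prop where
  plant0 : D u 0 = U0 ε a b c₁ (U0r ε a b x₀ y₁ y₂ t) (fun x => ur ε a b x₀ y₁ y₂ x t)
    (fun x => u x - ur ε a b x₀ y₁ y₂ x t) v
  plant1 : D u 1 = U1 ε a b c₁ (U1r ε a b x₀ y₁ y₂ t) (fun x => ur ε a b x₀ y₁ y₂ x t)
    (fun x => u x - ur ε a b x₀ y₁ y₂ x t) v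
  obs0 : D v 0 =
    V0 ε a c₁ (fun x => ur ε a b x₀ y₁ y₂ x t) (fun x => u x - ur ε a b x₀ y₁ y₂ x t) v
      + p00 ε c₂ * (meas0 ε a (fun x => ur ε a b x₀ y₁ y₂ x t)
          (fun x => u x - ur ε a b x₀ y₁ y₂ x t) - v 0)
  obs1 : D v 1 =
    V1 ε a b c₁ (fun x => ur ε a b x₀ y₁ y₂ x t) (fun x => u x - ur ε a b x₀ y₁ y₂ x t) v
      + p11 ε c₂ * (meas1 ε a b (fun x => ur ε a b x₀ y₁ y₂ x t)
          (fun x => u x - ur ε a b x₀ y₁ y₂ x t) - v 1)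

/-- The observer equation on `[0,1] × S`. -/
def SolvesObserver (ε a b x₀ c₂ : ℝ) (y₁ y₂ : ℝ → ℝ) (S : Set ℝ) (u v : ℝ → ℝ → ℝ) : Prop :=
  ∀ x ∈ Icc (0 : ℝ) 1, ∀ t ∈ S,
    dt S v x t = ε * dxx v x t - a ^ 2 * b ^ 2 / (4 * ε) * v x t
      + p2 ε c₂ x * (meas0 ε a (fun z => ur ε a b x₀ y₁ y₂ z t)
          (fun z => u z t - ur ε a b x₀ y₁ y₂ z t) - v 0 t)
      + p1 ε c₂ x * (meas1 ε a b (fun z => ur ε a b x₀ y₁ y₂ z t)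
          (fun z => u z t - ur ε a b x₀ y₁ y₂ z t) - v 1 t)

/-- `(u, v)` is a solution of the closed-loop system on `[0,1] × [t₀,∞)` with initial data
`(u₀, v₀)`, in the class `C([t₀,∞); H²(0,1)) ∩ C^{2,1}([0,1] × (t₀,∞))`. -/
structure IsClosedLoopSolution (ε a b x₀ c₁ c₂ : ℝ) (y₁ y₂ : ℝ → ℝ) (t₀ : ℝ) (u₀ v₀ : ℝ → ℝ)
    (u v : ℝ → ℝ → ℝ) : Prop where
  contH2_u : ContinuousH2 t₀ u
  contH2_v : ContinuousH2 t₀ v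
  c21_u : IsC21 (Ioi t₀) u
  c21_v : IsC21 (Ioi t₀) v
  plant : SolvesPDE ε a b (Ioi t₀) u
  observer : SolvesObserver ε a b x₀ c₂ y₁ y₂ (Ioi t₀) u v
  boundary : ∀ t, t₀ ≤ t →
    BoundaryConditions ε a b x₀ c₁ c₂ y₁ y₂ t (fun x => u x t) (fun x => v x t)
  init_u : ∀ x ∈ Icc (0 : ℝ) 1, u x t₀ = u₀ x
  init_v : ∀ x ∈ Icc (0 : ℝ) 1, v x t₀ = v₀ x

/-- `Ω = ‖u - u^r(t)‖_{H¹} + ‖v‖_{H¹}` for a plant profile `u` and an observer profile `v`. -/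
def Omega (ε a b x₀ : ℝ) (y₁ y₂ : ℝ → ℝ) (t : ℝ) (u v : ℝ → ℝ) : ℝ :=
  H1norm (fun x => u x - ur ε a b x₀ y₁ y₂ x t) + H1norm v

end ViscousHJ

end

/-! The Hopf–Cole substitution v = e^{-abx/(2ε)}(e^{-au/ε} - 1) turns the plant into the linear
equation v_t = ε v_xx - l v with l = a²b²/(4ε) (`hopf_pde`, `hopfV_pde`). The feedback laws are
built so that the transformed tracking error ṽ = v - v^r satisfies linear boundary conditions in
which the reference no longer appears (`feedback_iff`, `RefData.boundary_iff`). What remains is a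
study of v^r, a global theorem on one autonomous linear system, and a transfer of norms.

Reference. v^r solves the linear equation as a Cauchy problem in x with data on the line x = x₀: its
even and odd Taylor coefficients at x₀ are ε^{-k}(∂ₜ + l)^k applied to the two transformed outputs.
Gevrey classes of order γ ≥ 1 are stable under products and exponentials, so these outputs are
Gevrey with a bound proportional to F (`exists_gevrey_outputs`). The k-th derivative grows like
(k!)^γ against (2k)!, and γ < 2 gives convergence, with two space derivatives, uniformly in t. Small
F gives |e^{abx/(2ε)} v^r| ≤ 1/2, so the logarithm defining u^r makes sense.

Linear loop (`exists_linear_closed_loop`). Write m for the observer state and q = c/ε. The kernels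
solve k_xx - k_yy = q k with k(x,1-x) = 0 and k(x,x) = -(q/2)(x - 1/2), a consequence of Bessel's
equation. The observer error e = ṽ - m evolves on its own, and it is the image under 1 - `obsOp` of
a solution of the Neumann heat equation with damping l + c₂. The function w = (1 - `ctrlOp`) ṽ has
damping l + c₁, and its boundary fluxes are integrals of e, because the controller uses m = ṽ - e in
place of ṽ. These fluxes decay exponentially; so do their time derivatives, since integration by
parts rewrites them as bounded functionals of e (`exists_test_functional`). Removing the fluxes by
quadratic profiles leaves a forced Neumann heat equation, solved by cosine series: Parseval gives
decay in H¹ and continuity in H² at the initial time, and the exponential factors give smoothness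
afterwards. Both transformations are inverted on C([0,1]) by a contraction in a weighted sup norm,
so no inverse kernel has to be computed.

Transfer. H¹ embeds in C([0,1]), so for small initial data the decay of ṽ keeps the argument of the
logarithm away from zero for all time. On this range the Hopf–Cole map and its inverse are Lipschitz
at the reference in H¹ (`RefBound.exists_errV_le`, `RefBound.exists_hopfU_le`). This yields Ω(t) ≤ K
e^{-δ(t-t₀)} Ω(t₀), and β*(s,t) = K e^{-δt} s.

Uniqueness needs no smallness. The difference of two solutions, after Hopf–Cole, solves the linear
loop with zero initial data; the energy identity, a trace inequality with small constant and
Grönwall's argument force it to vanish (`linear_closed_loop_unique`). -/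

noncomputable section

namespace ViscousHJ

/-! ### Square integrable functions on `[0,1]` -/

/-- `f ∈ L²(0,1)`. -/
abbrev L2I (f : ℝ → ℝ) : Prop := MemLp f 2 (volume.restrict (Icc (0 : ℝ) 1))

theorem D_eq {f : ℝ → ℝ} {f' x : ℝ} (hx : x ∈ Icc (0 : ℝ) 1)
    (h : HasDerivWithinAt f f' (Icc 0 1) x) : D f x = f' :=
  h.derivWithin (uniqueDiffOn_Icc zero_lt_one x hx)

theorem L2norm_nonneg (f : ℝ → ℝ) : 0 ≤ L2norm f := Real.sqrt_nonneg _

theorem integral_sq_nonneg (f : ℝ → ℝ) : 0 ≤ ∫ x in (0 : ℝ)..1, f x ^ 2 :=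
  intervalIntegral.integral_nonneg zero_le_one fun _ _ => sq_nonneg _

theorem L2norm_sq (f : ℝ → ℝ) : L2norm f ^ 2 = ∫ x in (0 : ℝ)..1, f x ^ 2 :=
  Real.sq_sqrt (integral_sq_nonneg f)

theorem L2I.integrable_sq {f : ℝ → ℝ} (hf : L2I f) :
    IntervalIntegrable (fun x => f x ^ 2) volume 0 1 := by
  rw [intervalIntegrable_iff_integrableOn_Icc_of_le zero_le_one]
  exact MemLp.integrable_sq hf

theorem L2I.integrable {f : ℝ → ℝ} (hf : L2I f) : IntervalIntegrable f volume 0 1 := by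
  rw [intervalIntegrable_iff_integrableOn_Icc_of_le zero_le_one]
  exact MemLp.integrable (by norm_num) hf

theorem L2I.of_continuousOn {f : ℝ → ℝ} (hf : ContinuousOn f (Icc 0 1)) : L2I f := by
  obtain ⟨C, hC⟩ := isCompact_Icc.exists_bound_of_continuousOn hf
  refine MemLp.of_bound (hf.aestronglyMeasurable measurableSet_Icc) C ?_
  exact (ae_restrict_iff' measurableSet_Icc).2 (ae_of_all _ hC)

theorem L2I.mul_continuousOn {f g : ℝ → ℝ} (hf : L2I f) (hg : ContinuousOn g (Icc 0 1)) :
    L2I (fun x => g x * f x) := by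
  obtain ⟨C, hC⟩ := isCompact_Icc.exists_bound_of_continuousOn hg
  refine hf.of_le_mul (c := C) ((hg.aestronglyMeasurable measurableSet_Icc).mul
    hf.aestronglyMeasurable) ?_
  refine (ae_restrict_iff' measurableSet_Icc).2 (ae_of_all _ fun x hx => ?_)
  rw [norm_mul]
  exact mul_le_mul_of_nonneg_right (hC x hx) (norm_nonneg _)

/-- Lets Minkowski's inequality for `eLpNorm` supply the triangle inequality of `L2norm`. -/
theorem L2norm_eq_eLpNorm {f : ℝ → ℝ} (hf : L2I f) :
    L2norm f = (eLpNorm f 2 (volume.restrict (Icc (0 : ℝ) 1))).toReal := by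
  rw [hf.eLpNorm_eq_integral_rpow_norm (by norm_num) (by norm_num),
    ENNReal.toReal_ofReal (by positivity), L2norm, Real.sqrt_eq_rpow,
    intervalIntegral.integral_of_le zero_le_one, ← integral_Icc_eq_integral_Ioc]
  norm_num

theorem L2norm_add_le {f g : ℝ → ℝ} (hf : L2I f) (hg : L2I g) :
    L2norm (fun x => f x + g x) ≤ L2norm f + L2norm g := by
  rw [L2norm_eq_eLpNorm hf, L2norm_eq_eLpNorm hg, L2norm_eq_eLpNorm (f := fun x => f x + g x) (hf.add hg),
    ← ENNReal.toReal_add hf.eLpNorm_lt_top.ne hg.eLpNorm_lt_top.ne]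
  exact ENNReal.toReal_mono (ENNReal.add_lt_top.2 ⟨hf.eLpNorm_lt_top, hg.eLpNorm_lt_top⟩).ne
    (eLpNorm_add_le hf.aestronglyMeasurable hg.aestronglyMeasurable (by norm_num))

theorem L2norm_congr {f g : ℝ → ℝ} (h : ∀ x ∈ Icc (0 : ℝ) 1, f x = g x) :
    L2norm f = L2norm g := by
  unfold L2norm
  congr 1
  refine intervalIntegral.integral_congr fun x hx => ?_
  rw [uIcc_of_le zero_le_one] at hx
  simp only [h x hx]

theorem L2norm_congr_ae {f g : ℝ → ℝ} (h : ∀ᵐ x, x ∈ Icc (0 : ℝ) 1 → f x = g x) :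
    L2norm f = L2norm g := by
  unfold L2norm
  congr 1
  refine intervalIntegral.integral_congr_ae ?_
  filter_upwards [h] with x hx hx'
  rw [uIoc_of_le zero_le_one] at hx'
  simp only [hx (Ioc_subset_Icc_self hx')]

theorem L2norm_mono {f g : ℝ → ℝ} (hg : L2I g) (h : ∀ x ∈ Icc (0 : ℝ) 1, |f x| ≤ |g x|) :
    L2norm f ≤ L2norm g := by
  refine Real.sqrt_le_sqrt ?_
  rw [intervalIntegral.integral_of_le zero_le_one, intervalIntegral.integral_of_le zero_le_one]
  refine integral_mono_of_nonneg (ae_of_all _ fun _ => sq_nonneg _)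
    ((intervalIntegrable_iff_integrableOn_Ioc_of_le zero_le_one).1 hg.integrable_sq) ?_
  refine (ae_restrict_iff' measurableSet_Ioc).2 (ae_of_all _ fun x hx => ?_)
  exact sq_le_sq.2 (h x (Ioc_subset_Icc_self hx))

theorem L2norm_const (c : ℝ) : L2norm (fun _ => c) = |c| := by
  simp [L2norm, Real.sqrt_sq_eq_abs]

theorem L2norm_const_mul (c : ℝ) (f : ℝ → ℝ) : L2norm (fun x => c * f x) = |c| * L2norm f := by
  simp only [L2norm, mul_pow]
  rw [intervalIntegral.integral_const_mul, Real.sqrt_mul (sq_nonneg c), Real.sqrt_sq_eq_abs]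

theorem L2norm_abs (f : ℝ → ℝ) : L2norm (fun x => |f x|) = L2norm f := by
  simp [L2norm]

/-- A pointwise bound by a linear combination gives the same bound of `L²` norms. -/
theorem L2norm_le_of_le {f g h : ℝ → ℝ} {A B C : ℝ} (hA : 0 ≤ A) (hB : 0 ≤ B) (hC : 0 ≤ C)
    (hg : L2I g) (hh : L2I h)
    (hle : ∀ x ∈ Icc (0 : ℝ) 1, |f x| ≤ A * |g x| + B * |h x| + C) :
    L2norm f ≤ A * L2norm g + B * L2norm h + C := by
  have h1 : L2I (fun x => A * |g x|) := (hg.norm).const_mul A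
  have h2 : L2I (fun x => B * |h x|) := (hh.norm).const_mul B
  have h3 : L2I (fun _ => C) := memLp_const C
  calc L2norm f ≤ L2norm (fun x => A * |g x| + B * |h x| + C) := by
        refine L2norm_mono ((h1.add h2).add h3) fun x hx => (hle x hx).trans (le_abs_self _)
    _ ≤ L2norm (fun x => A * |g x| + B * |h x|) + L2norm (fun _ => C) :=
        L2norm_add_le (h1.add h2) h3
    _ ≤ L2norm (fun x => A * |g x|) + L2norm (fun x => B * |h x|) + L2norm (fun _ => C) := by
        gcongr
        exact L2norm_add_le h1 h2
    _ = _ := by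
        rw [L2norm_const_mul, L2norm_const_mul, L2norm_const, L2norm_abs, L2norm_abs,
          abs_of_nonneg hA, abs_of_nonneg hB, abs_of_nonneg hC]

theorem L2norm_le_of_bound {f : ℝ → ℝ} {C : ℝ} (hC : 0 ≤ C)
    (h : ∀ x ∈ Icc (0 : ℝ) 1, |f x| ≤ C) : L2norm f ≤ C := by
  have := L2norm_le_of_le (f := f) (g := fun _ => 0) (h := fun _ => 0) le_rfl le_rfl hC
    (memLp_const 0) (memLp_const 0) (by simpa using h)
  simpa using this

/-- The variance of |f| on the unit interval, a probability space, is nonnegative. -/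
theorem integral_abs_le_L2norm {f : ℝ → ℝ} (hf : L2I f) :
    ∫ x in (0 : ℝ)..1, |f x| ≤ L2norm f := by
  set m := ∫ x in (0 : ℝ)..1, |f x| with hm
  have h0 : 0 ≤ ∫ x in (0 : ℝ)..1, (|f x| - m) ^ 2 :=
    intervalIntegral.integral_nonneg zero_le_one fun _ _ => sq_nonneg _
  have hi := hf.integrable.abs
  have h1 : ∫ x in (0 : ℝ)..1, (|f x| - m) ^ 2 = (∫ x in (0 : ℝ)..1, f x ^ 2) - m ^ 2 := by
    have : ∀ x, (|f x| - m) ^ 2 = f x ^ 2 - 2 * m * |f x| + m ^ 2 := fun x => by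
      rw [← sq_abs (f x)]; ring
    simp_rw [this]
    rw [intervalIntegral.integral_add (hf.integrable_sq.sub (hi.const_mul _)) (by simp),
      intervalIntegral.integral_sub hf.integrable_sq (hi.const_mul _),
      intervalIntegral.integral_const_mul, ← hm]
    simp
    ring
  refine Real.le_sqrt_of_sq_le ?_
  linarith

/-! ### Sobolev embedding in one dimension -/

theorem abs_sub_le_integral_abs {f f1 : ℝ → ℝ}
    (hd : ∀ x ∈ Icc (0 : ℝ) 1, HasDerivWithinAt f (f1 x) (Icc 0 1) x)
    (hc : ContinuousOn f1 (Icc 0 1)) {x y : ℝ} (hx : x ∈ Icc (0 : ℝ) 1)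
    (hy : y ∈ Icc (0 : ℝ) 1) : |f x - f y| ≤ ∫ z in (0 : ℝ)..1, |f1 z| := by
  have hf : ContinuousOn f (Icc 0 1) := fun y hy => (hd y hy).continuousWithinAt
  have hsub : uIcc y x ⊆ Icc 0 1 := uIcc_subset_Icc hy hx
  have h2 : ∫ z in y..x, f1 z = f x - f y := by
    refine intervalIntegral.integral_eq_sub_of_hasDeriv_right (hf.mono hsub) (fun z hz => ?_)
      ((hc.mono hsub).intervalIntegrable)
    have hz' : z ∈ Ioo (0 : ℝ) 1 :=
      ⟨lt_of_le_of_lt (le_min hy.1 hx.1) hz.1, lt_of_lt_of_le hz.2 (max_le hy.2 hx.2)⟩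
    exact ((hd z (Ioo_subset_Icc_self hz')).hasDerivAt
      (Icc_mem_nhds hz'.1 hz'.2)).hasDerivWithinAt
  rw [← h2]
  refine (intervalIntegral.norm_integral_le_integral_norm_uIoc (f := f1) (μ := volume)).trans ?_
  rw [intervalIntegral.integral_of_le zero_le_one]
  refine setIntegral_mono_set ?_ (ae_of_all _ fun _ => abs_nonneg _) ?_
  · exact (intervalIntegrable_iff_integrableOn_Ioc_of_le zero_le_one).1
      (L2I.of_continuousOn hc).integrable.norm
  · refine (ae_of_all _ fun z hz => ?_)
    have hz' : z ∈ Ioc (min y x) (max y x) := hz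
    exact ⟨lt_of_le_of_lt (le_min hy.1 hx.1) hz'.1, hz'.2.trans (max_le hy.2 hx.2)⟩

/-- Sobolev embedding: at a minimum point of |f| the value is at most the L² norm, and the
oscillation away from that point is at most the L¹ norm of the derivative. -/
theorem abs_le_L2norm_add {f f1 : ℝ → ℝ}
    (hd : ∀ x ∈ Icc (0 : ℝ) 1, HasDerivWithinAt f (f1 x) (Icc 0 1) x)
    (hc : ContinuousOn f1 (Icc 0 1)) {x : ℝ} (hx : x ∈ Icc (0 : ℝ) 1) :
    |f x| ≤ L2norm f + L2norm f1 := by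
  have hf : ContinuousOn f (Icc 0 1) := fun y hy => (hd y hy).continuousWithinAt
  obtain ⟨y, hy, hmin⟩ := isCompact_Icc.exists_isMinOn (nonempty_Icc.2 zero_le_one) hf.abs
  have h1 : |f y| ≤ L2norm f := by
    have := L2norm_mono (f := fun _ => |f y|) (L2I.of_continuousOn hf)
      (fun z hz => by simpa using hmin hz)
    simpa [L2norm_const] using this
  have h3 := abs_sub_le_integral_abs hd hc hx hy
  have h4 := integral_abs_le_L2norm (L2I.of_continuousOn hc)
  calc |f x| = |f y + (f x - f y)| := by ring_nf
    _ ≤ |f y| + |f x - f y| := abs_add_le _ _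
    _ ≤ _ := by linarith

/-- The trace inequality with a small constant in front of the derivative. -/
theorem sq_le_integral_add {f f1 : ℝ → ℝ}
    (hd : ∀ x ∈ Icc (0 : ℝ) 1, HasDerivWithinAt f (f1 x) (Icc 0 1) x)
    (hc : ContinuousOn f1 (Icc 0 1)) {x η : ℝ} (hx : x ∈ Icc (0 : ℝ) 1) (hη : 0 < η) :
    f x ^ 2 ≤ (1 + 1 / η) * (∫ z in (0 : ℝ)..1, f z ^ 2) + η * ∫ z in (0 : ℝ)..1, f1 z ^ 2 := by
  have hf : ContinuousOn f (Icc 0 1) := fun y hy => (hd y hy).continuousWithinAt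
  have hii : ∀ {g : ℝ → ℝ}, ContinuousOn g (Icc 0 1) → IntervalIntegrable g volume 0 1 :=
    fun hg => ContinuousOn.intervalIntegrable (by rwa [uIcc_of_le zero_le_one])
  -- The embedding argument is applied to f², whose derivative 2 f f' is split by Young's inequality
  -- with weight η.
  obtain ⟨y, hy, hmin⟩ := isCompact_Icc.exists_isMinOn (nonempty_Icc.2 zero_le_one) (hf.pow 2)
  have h1 : f y ^ 2 ≤ ∫ z in (0 : ℝ)..1, f z ^ 2 := by
    have := intervalIntegral.integral_mono_on zero_le_one (f := fun _ => f y ^ 2) (by simp)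
      (hii (hf.pow 2)) (fun z hz => hmin hz)
    simpa using this
  have h2 := abs_sub_le_integral_abs (f := fun z => f z ^ 2) (f1 := fun z => 2 * f z * f1 z)
    (fun z hz => ((hd z hz).pow 2).congr_deriv (by norm_num)) (by fun_prop) hx hy
  have h3 : ∫ z in (0 : ℝ)..1, |2 * f z * f1 z|
      ≤ ∫ z in (0 : ℝ)..1, (1 / η * f z ^ 2 + η * f1 z ^ 2) := by
    refine intervalIntegral.integral_mono_on zero_le_one
      (hii (ContinuousOn.abs (by fun_prop))) (hii (by fun_prop)) fun z _ => ?_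
    have e1 : 1 / η * f z ^ 2 + η * f1 z ^ 2 - 2 * f z * f1 z = (f z - η * f1 z) ^ 2 / η := by
      field_simp; ring
    have e2 : 1 / η * f z ^ 2 + η * f1 z ^ 2 + 2 * f z * f1 z = (f z + η * f1 z) ^ 2 / η := by
      field_simp; ring
    have p1 : 0 ≤ (f z - η * f1 z) ^ 2 / η := by positivity
    have p2 : 0 ≤ (f z + η * f1 z) ^ 2 / η := by positivity
    exact abs_le.2 ⟨by linarith, by linarith⟩
  rw [intervalIntegral.integral_add (hii (by fun_prop)) (hii (by fun_prop)),
    intervalIntegral.integral_const_mul, intervalIntegral.integral_const_mul] at h3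
  have h4 := (le_abs_self _).trans h2
  linarith

/-! ### `H²` profiles -/

/-- `f ∈ H²(0,1)` with derivative `f1` and weak second derivative `f2`. -/
structure HasH2 (f f1 f2 : ℝ → ℝ) : Prop where
  deriv : ∀ x ∈ Icc (0 : ℝ) 1, HasDerivWithinAt f (f1 x) (Icc 0 1) x
  memLp : L2I f2
  eq_integral : ∀ x ∈ Icc (0 : ℝ) 1, f1 x = f1 0 + ∫ z in (0 : ℝ)..x, f2 z

theorem L2I.integrable_sub {f : ℝ → ℝ} (hf : L2I f) {x : ℝ} (hx : x ∈ Icc (0 : ℝ) 1) :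
    IntervalIntegrable f volume 0 x :=
  hf.integrable.mono_set (by
    rw [uIcc_of_le hx.1, uIcc_of_le zero_le_one]; exact Icc_subset_Icc_right hx.2)

theorem HasH2.absolutelyContinuous {f f1 f2 : ℝ → ℝ} (h : HasH2 f f1 f2) :
    AbsolutelyContinuousOnInterval (fun x => f1 0 + ∫ z in (0 : ℝ)..x, f2 z) 0 1 := by
  have h1 := h.memLp.integrable.absolutelyContinuousOnInterval_intervalIntegral (c := 0) (by simp)
  have h2 : AbsolutelyContinuousOnInterval (fun _ : ℝ => f1 0) 0 1 :=
    (LipschitzWith.const (f1 0)).lipschitzOnWith.absolutelyContinuousOnInterval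
  exact h2.add h1

theorem AbsolutelyContinuousOnInterval.congr_Icc {f g : ℝ → ℝ}
    (hf : AbsolutelyContinuousOnInterval f 0 1) (h : ∀ x ∈ Icc (0 : ℝ) 1, f x = g x) :
    AbsolutelyContinuousOnInterval g 0 1 := by
  rw [absolutelyContinuousOnInterval_iff] at hf ⊢
  intro r hr
  obtain ⟨δ, hδ, H⟩ := hf r hr
  refine ⟨δ, hδ, fun E hE hlt => ?_⟩
  refine lt_of_eq_of_lt (Finset.sum_congr rfl fun i hi => ?_) (H E hE hlt)
  have := hE.1 i hi
  rw [uIcc_of_le zero_le_one] at this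
  rw [h _ this.1, h _ this.2]

theorem HasH2.continuousOn_deriv {f f1 f2 : ℝ → ℝ} (h : HasH2 f f1 f2) :
    ContinuousOn f1 (Icc 0 1) := by
  have := h.absolutelyContinuous.continuousOn
  rw [uIcc_of_le zero_le_one] at this
  exact this.congr h.eq_integral

theorem HasH2.continuousOn {f f1 f2 : ℝ → ℝ} (h : HasH2 f f1 f2) :
    ContinuousOn f (Icc 0 1) := fun x hx => (h.deriv x hx).continuousWithinAt

theorem HasH2.D_eq {f f1 f2 : ℝ → ℝ} (h : HasH2 f f1 f2) {x : ℝ} (hx : x ∈ Icc (0 : ℝ) 1) :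
    D f x = f1 x := ViscousHJ.D_eq hx (h.deriv x hx)

/-- Lebesgue differentiation of the primitive of `f2`. It allows `H2norm`, defined through `D (D
f)`, to be computed with any representative of the weak second derivative. -/
theorem HasH2.ae_deriv {f f1 f2 : ℝ → ℝ} (h : HasH2 f f1 f2) :
    ∀ᵐ x, x ∈ Icc (0 : ℝ) 1 → D (D f) x = f2 x := by
  filter_upwards [h.memLp.integrable.ae_hasDerivAt_integral] with x hx hxI
  have h1 : HasDerivAt (fun y => ∫ z in (0 : ℝ)..y, f2 z) (f2 x) x :=
    hx (by rwa [uIcc_of_le zero_le_one]) 0 (by simp)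
  refine ViscousHJ.D_eq hxI ?_
  refine (h1.const_add (f1 0)).hasDerivWithinAt.congr (fun y hy => ?_) ?_
  · rw [h.D_eq hy, h.eq_integral y hy]
  · rw [h.D_eq hxI, h.eq_integral x hxI]

theorem HasH2.memH2 {f f1 f2 : ℝ → ℝ} (h : HasH2 f f1 f2) : MemH2 f where
  diff := fun x hx => (h.deriv x hx).differentiableWithinAt
  ac := AbsolutelyContinuousOnInterval.congr_Icc h.absolutelyContinuous fun x hx => by
    rw [h.D_eq hx, h.eq_integral x hx]
  memLp := by
    refine (memLp_congr_ae ?_).1 h.memLp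
    rw [EventuallyEq, ae_restrict_iff' measurableSet_Icc]
    filter_upwards [h.ae_deriv] with x hx hxI
    exact (hx hxI).symm

theorem MemH2.hasH2 {f : ℝ → ℝ} (h : MemH2 f) : HasH2 f (D f) (D (D f)) where
  deriv := fun x hx => (h.diff x hx).hasDerivWithinAt
  memLp := h.memLp
  eq_integral := fun x hx => by
    have hac : AbsolutelyContinuousOnInterval (D f) 0 x := h.ac.mono (by
      rw [uIcc_of_le hx.1, uIcc_of_le zero_le_one]; exact Icc_subset_Icc_right hx.2)
    have h1 := hac.integral_deriv_eq_sub
    have h2 : ∫ z in (0 : ℝ)..x, D (D f) z = ∫ z in (0 : ℝ)..x, deriv (D f) z := by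
      refine intervalIntegral.integral_congr_ae ?_
      -- `D` is one-sided at 1 and agrees with `deriv` only in the interior, so this point is
      -- discarded.
      have hne : ∀ᵐ z : ℝ, z ≠ 1 := by simp [ae_iff, measure_singleton]
      filter_upwards [hne] with z hz1 hz
      rw [uIoc_of_le hx.1] at hz
      exact derivWithin_of_mem_nhds
        (Icc_mem_nhds hz.1 (lt_of_le_of_ne (hz.2.trans hx.2) hz1))
    rw [h2, h1]
    ring

theorem HasH2.H1norm_eq {f f1 f2 : ℝ → ℝ} (h : HasH2 f f1 f2) :
    H1norm f = L2norm f + L2norm f1 := by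
  unfold H1norm
  rw [L2norm_congr (f := D f) fun x hx => h.D_eq hx]

theorem HasH2.H2norm_eq {f f1 f2 : ℝ → ℝ} (h : HasH2 f f1 f2) :
    H2norm f = L2norm f + L2norm f1 + L2norm f2 := by
  unfold H2norm
  rw [L2norm_congr (f := D f) fun x hx => h.D_eq hx, L2norm_congr_ae h.ae_deriv]

theorem HasH2.congr {f f1 f2 g g1 : ℝ → ℝ} (h : HasH2 f f1 f2)
    (h0 : ∀ x ∈ Icc (0 : ℝ) 1, g x = f x) (h1 : ∀ x ∈ Icc (0 : ℝ) 1, g1 x = f1 x) :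
    HasH2 g g1 f2 where
  deriv := fun x hx => by
    rw [h1 x hx]
    exact (h.deriv x hx).congr h0 (h0 x hx)
  memLp := h.memLp
  eq_integral := fun x hx => by
    rw [h1 x hx, h1 0 (left_mem_Icc.2 zero_le_one), h.eq_integral x hx]

theorem HasH2.add {f f1 f2 g g1 g2 : ℝ → ℝ} (hf : HasH2 f f1 f2) (hg : HasH2 g g1 g2) :
    HasH2 (fun x => f x + g x) (fun x => f1 x + g1 x) (fun x => f2 x + g2 x) where
  deriv := fun x hx => (hf.deriv x hx).add (hg.deriv x hx)
  memLp := hf.memLp.add hg.memLp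
  eq_integral := fun x hx => by
    rw [intervalIntegral.integral_add (hf.memLp.integrable_sub hx) (hg.memLp.integrable_sub hx),
      hf.eq_integral x hx, hg.eq_integral x hx]
    ring

theorem HasH2.const_mul {f f1 f2 : ℝ → ℝ} (hf : HasH2 f f1 f2) (c : ℝ) :
    HasH2 (fun x => c * f x) (fun x => c * f1 x) (fun x => c * f2 x) where
  deriv := fun x hx => (hf.deriv x hx).const_mul c
  memLp := hf.memLp.const_mul c
  eq_integral := fun x hx => by
    rw [intervalIntegral.integral_const_mul, hf.eq_integral x hx]
    ring

theorem HasH2.sub {f f1 f2 g g1 g2 : ℝ → ℝ} (hf : HasH2 f f1 f2) (hg : HasH2 g g1 g2) :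
    HasH2 (fun x => f x - g x) (fun x => f1 x - g1 x) (fun x => f2 x - g2 x) := by
  simpa [sub_eq_add_neg] using hf.add (hg.const_mul (-1))

/-- Classical `C²` profiles. -/
theorem HasH2.of_hasDeriv {f f1 f2 : ℝ → ℝ}
    (h1 : ∀ x ∈ Icc (0 : ℝ) 1, HasDerivWithinAt f (f1 x) (Icc 0 1) x)
    (h2 : ∀ x ∈ Icc (0 : ℝ) 1, HasDerivWithinAt f1 (f2 x) (Icc 0 1) x)
    (hc : ContinuousOn f2 (Icc 0 1)) : HasH2 f f1 f2 where
  deriv := h1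
  memLp := L2I.of_continuousOn hc
  eq_integral := fun x hx => by
    have hsub : Icc 0 x ⊆ Icc (0 : ℝ) 1 := Icc_subset_Icc_right hx.2
    have : ∫ z in (0 : ℝ)..x, f2 z = f1 x - f1 0 := by
      refine intervalIntegral.integral_eq_sub_of_hasDerivAt_of_le hx.1 ?_ (fun z hz => ?_) ?_
      · exact fun y hy => ((h2 y (hsub hy)).continuousWithinAt).mono hsub
      · exact (h2 z ⟨hz.1.le, hz.2.le.trans hx.2⟩).hasDerivAt
          (Icc_mem_nhds hz.1 (hz.2.trans_le hx.2))
      · exact (L2I.of_continuousOn hc).integrable_sub hx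
    rw [this]
    ring

theorem absolutelyContinuous_of_hasDeriv {f f1 : ℝ → ℝ}
    (h1 : ∀ x ∈ Icc (0 : ℝ) 1, HasDerivWithinAt f (f1 x) (Icc 0 1) x)
    (hc : ContinuousOn f1 (Icc 0 1)) : AbsolutelyContinuousOnInterval f 0 1 := by
  obtain ⟨C, hC⟩ := isCompact_Icc.exists_bound_of_continuousOn hc
  have hK : LipschitzOnWith C.toNNReal f (Icc 0 1) :=
    (convex_Icc 0 1).lipschitzOnWith_of_nnnorm_hasDerivWithin_le h1 fun x hx => by
      rw [← NNReal.coe_le_coe, coe_nnnorm]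
      exact (hC x hx).trans (Real.le_coe_toNNReal C)
  rw [← uIcc_of_le (zero_le_one' ℝ)] at hK
  exact hK.absolutelyContinuousOnInterval

/-- A function whose derivative is `p f' + q` with `f ∈ H²` and `p, q ∈ C¹` is in `H²`. -/
theorem HasH2.of_deriv_eq_mul_add {f f1 f2 g p p1 q q1 : ℝ → ℝ} (hf : HasH2 f f1 f2)
    (hg : ∀ x ∈ Icc (0 : ℝ) 1, HasDerivWithinAt g (p x * f1 x + q x) (Icc 0 1) x)
    (hp : ∀ x ∈ Icc (0 : ℝ) 1, HasDerivWithinAt p (p1 x) (Icc 0 1) x)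
    (hq : ∀ x ∈ Icc (0 : ℝ) 1, HasDerivWithinAt q (q1 x) (Icc 0 1) x)
    (hp1 : ContinuousOn p1 (Icc 0 1)) (hq1 : ContinuousOn q1 (Icc 0 1)) :
    HasH2 g (fun x => p x * f1 x + q x) (fun x => p1 x * f1 x + p x * f2 x + q1 x) where
  deriv := hg
  memLp := by
    have hpc : ContinuousOn p (Icc 0 1) := fun x hx => (hp x hx).continuousWithinAt
    have a1 : L2I fun x => p1 x * f1 x := L2I.of_continuousOn (hp1.mul hf.continuousOn_deriv)
    exact (a1.add (hf.memLp.mul_continuousOn hpc)).add (L2I.of_continuousOn hq1)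
  eq_integral := fun x hx => by
    have hpc : ContinuousOn p (Icc 0 1) := fun x hx => (hp x hx).continuousWithinAt
    have a1 : L2I fun x => p1 x * f1 x := L2I.of_continuousOn (hp1.mul hf.continuousOn_deriv)
    have a2 := hf.memLp.mul_continuousOn hpc
    have a3 := L2I.of_continuousOn hq1
    have hsub : Icc 0 x ⊆ Icc (0 : ℝ) 1 := Icc_subset_Icc_right hx.2
    have hsub' : uIcc 0 x ⊆ uIcc (0 : ℝ) 1 := by
      rwa [uIcc_of_le hx.1, uIcc_of_le zero_le_one]
    have e1 : ∫ z in (0 : ℝ)..x, q1 z = q x - q 0 := by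
      refine intervalIntegral.integral_eq_sub_of_hasDerivAt_of_le hx.1 ?_ (fun z hz => ?_) ?_
      · exact fun y hy => ((hq y (hsub hy)).continuousWithinAt).mono hsub
      · exact (hq z ⟨hz.1.le, hz.2.le.trans hx.2⟩).hasDerivAt
          (Icc_mem_nhds hz.1 (hz.2.trans_le hx.2))
      · exact a3.integrable_sub hx
    have hpac := (absolutelyContinuous_of_hasDeriv hp hp1).mono hsub'
    have hfac := hf.absolutelyContinuous.mono hsub'
    -- Integration by parts for absolutely continuous functions. The second factor is the integral
    -- representation of `f1`, which is defined and differentiable almost everywhere independently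
    -- of the values of `f1` outside [0,1].
    have e2 := hpac.integral_deriv_mul_eq_sub hfac
    have e3 : ∫ z in (0 : ℝ)..x, (p1 z * f1 z + p z * f2 z) = p x * f1 x - p 0 * f1 0 := by
      rw [hf.eq_integral x hx]
      simp only [intervalIntegral.integral_same, add_zero] at e2
      rw [← e2]
      refine intervalIntegral.integral_congr_ae ?_
      have hne : ∀ᵐ z : ℝ, z ≠ 1 := by simp [ae_iff, measure_singleton]
      filter_upwards [hne, hf.memLp.integrable.ae_hasDerivAt_integral] with z hz1 hz2 hz
      rw [uIoc_of_le hx.1] at hz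
      have hzI : z ∈ Icc (0 : ℝ) 1 := ⟨hz.1.le, hz.2.trans hx.2⟩
      have hzn : Icc (0 : ℝ) 1 ∈ 𝓝 z := Icc_mem_nhds hz.1 (lt_of_le_of_ne hzI.2 hz1)
      rw [((hp z hzI).hasDerivAt hzn).deriv, ← hf.eq_integral z hzI]
      have h1 : HasDerivAt (fun y => ∫ z in (0 : ℝ)..y, f2 z) (f2 z) z :=
        hz2 (by rwa [uIcc_of_le zero_le_one]) 0 (by simp)
      rw [(h1.const_add (f1 0)).deriv]
    rw [intervalIntegral.integral_add ((a1.integrable_sub hx).add (a2.integrable_sub hx))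
      (a3.integrable_sub hx), e1,
      e3]
    ring

/-! ### Derivatives of the Bessel kernel -/

/-- The `j`-th derivative of `besselI1Div`. -/
def besselDer (j : ℕ) (s : ℝ) : ℝ :=
  ∑' k : ℕ, s ^ k / (2 ^ (2 * k + 2 * j + 1) * ((k ! : ℝ) * ((k + 1 + j)! : ℝ)))

theorem besselDer_zero : besselDer 0 = besselI1Div := by
  funext s
  simp [besselDer, besselI1Div]

theorem besselTerm_bound (j k : ℕ) {s R : ℝ} (hs : |s| ≤ R) :
    |s ^ k / (2 ^ (2 * k + 2 * j + 1) * ((k ! : ℝ) * ((k + 1 + j)! : ℝ)))| ≤ R ^ k / k ! := by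
  have hR : 0 ≤ R := (abs_nonneg s).trans hs
  have h1 : (1 : ℝ) ≤ 2 ^ (2 * k + 2 * j + 1) := one_le_pow₀ (by norm_num)
  have h2 : (1 : ℝ) ≤ ((k + 1 + j)! : ℝ) := by exact_mod_cast Nat.one_le_iff_ne_zero.2 (Nat.factorial_ne_zero _)
  have h3 : (0 : ℝ) < (k ! : ℝ) := by positivity
  rw [abs_div, abs_pow, abs_of_pos (a := 2 ^ (2 * k + 2 * j + 1) * _) (by positivity)]
  refine div_le_div₀ (by positivity) (pow_le_pow_left₀ (abs_nonneg _) hs k) h3 ?_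
  have h4 : (k ! : ℝ) ≤ k ! * ((k + 1 + j)! : ℝ) := le_mul_of_one_le_right h3.le h2
  exact h4.trans (le_mul_of_one_le_left (by positivity) h1)

theorem summable_besselTerm (j : ℕ) (s : ℝ) :
    Summable fun k : ℕ => s ^ k / (2 ^ (2 * k + 2 * j + 1) * ((k ! : ℝ) * ((k + 1 + j)! : ℝ))) :=
  Summable.of_norm_bounded (Real.summable_pow_div_factorial |s|)
    fun k => besselTerm_bound j k le_rfl

theorem besselTerm_succ (j k : ℕ) (s : ℝ) :
    ((k + 1 : ℕ) * s ^ k) / (2 ^ (2 * (k + 1) + 2 * j + 1) * (((k + 1)! : ℝ) * ((k + 1 + 1 + j)! : ℝ)))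
      = s ^ k / (2 ^ (2 * k + 2 * (j + 1) + 1) * ((k ! : ℝ) * ((k + 1 + (j + 1))! : ℝ))) := by
  have e1 : 2 * (k + 1) + 2 * j + 1 = 2 * k + 2 * (j + 1) + 1 := by ring
  have e2 : k + 1 + 1 + j = k + 1 + (j + 1) := by ring
  rw [e1, e2, Nat.factorial_succ k]
  push_cast
  have : (k ! : ℝ) ≠ 0 := by positivity
  field_simp

theorem hasDerivAt_besselDer (j : ℕ) (s : ℝ) :
    HasDerivAt (besselDer j) (besselDer (j + 1) s) s := by
  set R := |s| + 1
  -- Differentiation kills the term k = 0 and shifts the others, so the majorant is shifted too; R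
  -- exceeds |s| to put s inside an open ball.
  have hu : Summable fun k : ℕ => (match k with | 0 => 0 | k + 1 => R ^ k / k ! : ℝ) := by
    rw [← summable_nat_add_iff 1]
    exact Real.summable_pow_div_factorial R
  have key := hasDerivAt_tsum_of_isPreconnected (𝕜 := ℝ)
    (g := fun (k : ℕ) (y : ℝ) => y ^ k / (2 ^ (2 * k + 2 * j + 1) * ((k ! : ℝ) * ((k + 1 + j)! : ℝ))))
    (g' := fun (k : ℕ) (y : ℝ) =>
      (k * y ^ (k - 1)) / (2 ^ (2 * k + 2 * j + 1) * ((k ! : ℝ) * ((k + 1 + j)! : ℝ))))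
    hu (t := Metric.ball 0 R) Metric.isOpen_ball (convex_ball _ _).isPreconnected
    (fun k y _ => (hasDerivAt_pow k y).div_const _) (fun k y hy => ?_)
    (y₀ := s) (y := s) (by simp [R]) (summable_besselTerm j s) (by simp [R])
  · have e : (∑' k : ℕ, (k * s ^ (k - 1)) / (2 ^ (2 * k + 2 * j + 1) * ((k ! : ℝ) * ((k + 1 + j)! : ℝ))))
        = besselDer (j + 1) s := by
      rw [tsum_eq_zero_add']
      · simp only [Nat.cast_zero, zero_mul, zero_div, zero_add, Nat.add_sub_cancel, besselDer]
        exact tsum_congr fun k => besselTerm_succ j k s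
      · simp only [Nat.add_sub_cancel]
        exact (summable_besselTerm (j + 1) s).congr fun k => (besselTerm_succ j k s).symm
    rw [← e]
    exact key
  · cases k with
    | zero => simp
    | succ k =>
      simp only [Nat.add_sub_cancel]
      rw [besselTerm_succ]
      exact besselTerm_bound (j + 1) k (by simpa using (mem_ball_zero_iff.1 hy).le)

@[fun_prop]
theorem continuous_besselDer (j : ℕ) : Continuous (besselDer j) :=
  continuous_iff_continuousAt.2 fun s => (hasDerivAt_besselDer j s).continuousAt

/-- Bessel's equation for I₁ written for I₁(√s)/√s in the variable s = z²; it holds coefficient by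
coefficient. It is the reason for the kernel equation `kern_pde`. -/
theorem bessel_ode (s : ℝ) :
    4 * s * besselDer 2 s + 8 * besselDer 1 s = besselDer 0 s := by
  have h0 := (summable_besselTerm 0 s)
  have h1 := (summable_besselTerm 1 s)
  have h2 := (summable_besselTerm 2 s)
  have e2 : 4 * s * besselDer 2 s = ∑' k : ℕ, (4 * k) * (s ^ k /
      (2 ^ (2 * k + 2 * 1 + 1) * ((k ! : ℝ) * ((k + 1 + 1)! : ℝ)))) := by
    have hk : ∀ k : ℕ, (4 * ((k + 1 : ℕ) : ℝ)) * (s ^ (k + 1) /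
      (2 ^ (2 * (k + 1) + 2 * 1 + 1) * (((k + 1)! : ℝ) * ((k + 1 + 1 + 1)! : ℝ))))
      = 4 * s * (s ^ k / (2 ^ (2 * k + 2 * 2 + 1) * ((k ! : ℝ) * ((k + 1 + 2)! : ℝ)))) := by
      intro k
      rw [← besselTerm_succ 1 k s, pow_succ]
      ring
    rw [tsum_eq_zero_add']
    · simp only [Nat.cast_zero, mul_zero, zero_mul, zero_add]
      simp_rw [hk]
      rw [tsum_mul_left, besselDer]
    · simp_rw [hk]
      exact h2.mul_left _
  have hs2 : Summable fun k : ℕ => (4 * k) * (s ^ k /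
      (2 ^ (2 * k + 2 * 1 + 1) * ((k ! : ℝ) * ((k + 1 + 1)! : ℝ)))) := by
    refine ((h0).sub (h1.mul_left 8)).congr fun k => ?_
    rw [Nat.factorial_succ (k + 1)]
    have : ((k + 1)! : ℝ) ≠ 0 := by positivity
    have : (k ! : ℝ) ≠ 0 := by positivity
    push_cast
    rw [pow_add, pow_add, pow_add]
    field_simp
    ring
  rw [e2, besselDer, besselDer, ← tsum_mul_left, ← hs2.tsum_add (h1.mul_left 8)]
  refine tsum_congr fun k => ?_
  rw [Nat.factorial_succ (k + 1)]
  have : ((k + 1)! : ℝ) ≠ 0 := by positivity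
  have : (k ! : ℝ) ≠ 0 := by positivity
  push_cast
  rw [pow_add, pow_add, pow_add]
  field_simp
  ring

/-! ### The backstepping kernel, its derivatives and its values on the characteristics -/

/-- The argument of the Bessel function in the kernels. -/
def kArg (q x y : ℝ) : ℝ := q * ((x - 1 / 2) ^ 2 - (y - 1 / 2) ^ 2)

/-- The kernel `k(x, y)` with `q = c / ε`. -/
def kern (q x y : ℝ) : ℝ := -(1 / 2) * q * besselDer 0 (kArg q x y) * (x + y - 1)

/-- `∂ₓ kern`. -/
def kernX (q x y : ℝ) : ℝ := -(1 / 2) * q * (besselDer 1 (kArg q x y) * (2 * q * (x - 1 / 2))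
  * (x + y - 1) + besselDer 0 (kArg q x y))

/-- `∂_y kern`. -/
def kernY (q x y : ℝ) : ℝ := -(1 / 2) * q * (besselDer 1 (kArg q x y) * (-(2 * q * (y - 1 / 2)))
  * (x + y - 1) + besselDer 0 (kArg q x y))

/-- `∂ₓ² kern`. -/
def kernXX (q x y : ℝ) : ℝ := -(1 / 2) * q *
  (besselDer 2 (kArg q x y) * (2 * q * (x - 1 / 2)) ^ 2 * (x + y - 1)
    + besselDer 1 (kArg q x y) * (2 * q) * (x + y - 1)
    + 2 * besselDer 1 (kArg q x y) * (2 * q * (x - 1 / 2)))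

/-- `∂_y² kern`. -/
def kernYY (q x y : ℝ) : ℝ := -(1 / 2) * q *
  (besselDer 2 (kArg q x y) * (2 * q * (y - 1 / 2)) ^ 2 * (x + y - 1)
    - besselDer 1 (kArg q x y) * (2 * q) * (x + y - 1)
    - 2 * besselDer 1 (kArg q x y) * (2 * q * (y - 1 / 2)))

/-- `∂ₓ ∂_y kern`. -/
def kernXY (q x y : ℝ) : ℝ := -(1 / 2) * q *
  (besselDer 2 (kArg q x y) * (-(2 * q * (y - 1 / 2))) * (2 * q * (x - 1 / 2)) * (x + y - 1)
    + besselDer 1 (kArg q x y) * (2 * q * (x - 1 / 2))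
    + besselDer 1 (kArg q x y) * (-(2 * q * (y - 1 / 2))))

/-- `∂ₓ ∂_y² kern`. -/
def kernXYY (q x y : ℝ) : ℝ := -(1 / 2) * q *
  (besselDer 3 (kArg q x y) * (2 * q * (y - 1 / 2)) ^ 2 * (2 * q * (x - 1 / 2)) * (x + y - 1)
    - besselDer 2 (kArg q x y) * (2 * q) * (2 * q * (x - 1 / 2)) * (x + y - 1)
    + 2 * (besselDer 2 (kArg q x y) * (-(2 * q * (y - 1 / 2))) * (2 * q * (x - 1 / 2)))
    + besselDer 2 (kArg q x y) * (2 * q * (y - 1 / 2)) ^ 2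
    - besselDer 1 (kArg q x y) * (2 * q))

theorem hasDerivAt_kArg_left (q x y : ℝ) :
    HasDerivAt (fun x => kArg q x y) (2 * q * (x - 1 / 2)) x := by
  unfold kArg
  have h := ((((hasDerivAt_id x).sub_const (1 / 2)).pow 2).sub_const ((y - 1 / 2) ^ 2)).const_mul q
  refine h.congr_deriv ?_
  simp only [id]
  ring

theorem hasDerivAt_kArg_right (q x y : ℝ) :
    HasDerivAt (fun y => kArg q x y) (-(2 * q * (y - 1 / 2))) y := by
  unfold kArg
  have h := ((((hasDerivAt_id y).sub_const (1 / 2)).pow 2).const_sub ((x - 1 / 2) ^ 2)).const_mul q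
  refine h.congr_deriv ?_
  simp only [id]
  ring

theorem hasDerivAt_besselDer_left (j : ℕ) (q x y : ℝ) :
    HasDerivAt (fun x => besselDer j (kArg q x y))
      (besselDer (j + 1) (kArg q x y) * (2 * q * (x - 1 / 2))) x :=
  (hasDerivAt_besselDer j _).comp x (hasDerivAt_kArg_left q x y)

theorem hasDerivAt_besselDer_right (j : ℕ) (q x y : ℝ) :
    HasDerivAt (fun y => besselDer j (kArg q x y))
      (besselDer (j + 1) (kArg q x y) * (-(2 * q * (y - 1 / 2)))) y :=
  (hasDerivAt_besselDer j _).comp y (hasDerivAt_kArg_right q x y)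

theorem hasDerivAt_kern_left (q x y : ℝ) :
    HasDerivAt (fun x => kern q x y) (kernX q x y) x := by
  have h := ((hasDerivAt_besselDer_left 0 q x y).const_mul (-(1 / 2) * q)).mul
    (((hasDerivAt_id x).add_const y).sub_const 1)
  refine h.congr_deriv ?_
  simp only [kernX, id, mul_one, zero_add]
  ring

theorem hasDerivAt_kern_right (q x y : ℝ) :
    HasDerivAt (fun y => kern q x y) (kernY q x y) y := by
  have h := ((hasDerivAt_besselDer_right 0 q x y).const_mul (-(1 / 2) * q)).mul
    (((hasDerivAt_id y).const_add x).sub_const 1)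
  refine h.congr_deriv ?_
  simp only [kernY, id, mul_one, zero_add]
  ring

theorem hasDerivAt_kernX_left (q x y : ℝ) :
    HasDerivAt (fun x => kernX q x y) (kernXX q x y) x := by
  have h := ((((hasDerivAt_besselDer_left 1 q x y).mul
    (((hasDerivAt_id x).sub_const (1 / 2)).const_mul (2 * q))).mul
    (((hasDerivAt_id x).add_const y).sub_const 1)).add
      (hasDerivAt_besselDer_left 0 q x y)).const_mul (-(1 / 2) * q)
  refine h.congr_deriv ?_
  simp only [kernXX, Pi.mul_apply, id, mul_one, Nat.reduceAdd, zero_add]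
  ring

theorem hasDerivAt_kernY_right (q x y : ℝ) :
    HasDerivAt (fun y => kernY q x y) (kernYY q x y) y := by
  have h := ((((hasDerivAt_besselDer_right 1 q x y).mul
    (((hasDerivAt_id y).sub_const (1 / 2)).const_mul (2 * q)).neg).mul
    (((hasDerivAt_id y).const_add x).sub_const 1)).add
      (hasDerivAt_besselDer_right 0 q x y)).const_mul (-(1 / 2) * q)
  refine h.congr_deriv ?_
  simp only [kernYY, Pi.mul_apply, Pi.neg_apply, id, mul_one, Nat.reduceAdd, zero_add]
  ring

theorem hasDerivAt_kernX_right (q x y : ℝ) :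
    HasDerivAt (fun y => kernX q x y) (kernXY q x y) y := by
  have h := ((((hasDerivAt_besselDer_right 1 q x y).mul_const (2 * q * (x - 1 / 2))).mul
    (((hasDerivAt_id y).const_add x).sub_const 1)).add
      (hasDerivAt_besselDer_right 0 q x y)).const_mul (-(1 / 2) * q)
  refine h.congr_deriv ?_
  simp only [kernXY, id, mul_one, Nat.reduceAdd, zero_add]

theorem hasDerivAt_kernXY_right (q x y : ℝ) :
    HasDerivAt (fun y => kernXY q x y) (kernXYY q x y) y := by
  have hY : HasDerivAt (fun y : ℝ => -(2 * q * (y - 1 / 2))) (-(2 * q * 1)) y :=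
    (((hasDerivAt_id y).sub_const (1 / 2)).const_mul (2 * q)).neg
  have h := (((((((hasDerivAt_besselDer_right 2 q x y).mul hY).mul_const (2 * q * (x - 1 / 2))).mul
    (((hasDerivAt_id y).const_add x).sub_const 1))).add
      ((hasDerivAt_besselDer_right 1 q x y).mul_const (2 * q * (x - 1 / 2)))).add
      ((hasDerivAt_besselDer_right 1 q x y).mul hY)).const_mul (-(1 / 2) * q)
  refine h.congr_deriv ?_
  simp only [kernXYY, Pi.mul_apply, id, mul_one, Nat.reduceAdd]
  ring

@[fun_prop]
theorem continuous_kArg (q : ℝ) : Continuous fun p : ℝ × ℝ => kArg q p.1 p.2 := by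
  unfold kArg; fun_prop

theorem continuous_kern (q : ℝ) : Continuous fun p : ℝ × ℝ => kern q p.1 p.2 := by
  unfold kern; fun_prop

theorem continuous_kernX (q : ℝ) : Continuous fun p : ℝ × ℝ => kernX q p.1 p.2 := by
  unfold kernX; fun_prop

theorem continuous_kernY (q : ℝ) : Continuous fun p : ℝ × ℝ => kernY q p.1 p.2 := by
  unfold kernY; fun_prop

theorem continuous_kernXX (q : ℝ) : Continuous fun p : ℝ × ℝ => kernXX q p.1 p.2 := by
  unfold kernXX; fun_prop

theorem continuous_kernYY (q : ℝ) : Continuous fun p : ℝ × ℝ => kernYY q p.1 p.2 := by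
  unfold kernYY; fun_prop

theorem continuous_kernXYY (q : ℝ) : Continuous fun p : ℝ × ℝ => kernXYY q p.1 p.2 := by
  unfold kernXYY; fun_prop

/-- The kernel equation. -/
theorem kern_pde (q x y : ℝ) : kernXX q x y - kernYY q x y = q * kern q x y := by
  unfold kernXX kernYY kern
  -- With f the Bessel factor and s its argument, k_xx - k_yy equals q times the prefactor times 4 s
  -- f'' + 8 f', so after Bessel's equation only a polynomial identity is left.
  rw [← bessel_ode (kArg q x y)]
  unfold kArg
  ring

/-- On the antidiagonal the vanishing kernel prevents a reflected term F'(1-x); the nonzero value on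
the diagonal is what creates the additional damping. -/
theorem kern_antidiag (q x : ℝ) : kern q x (1 - x) = 0 := by simp [kern]

theorem besselDer_zero_zero : besselDer 0 0 = 1 / 2 := by
  rw [besselDer, tsum_eq_single 0 (fun k hk => by simp [hk])]
  simp

theorem kern_diag (q x : ℝ) : kern q x x = -(q / 2) * (x - 1 / 2) := by
  simp only [kern, kArg, sub_self, mul_zero, besselDer_zero_zero]
  ring

/-- The derivative of k(x,x) = -(q/2)(x - 1/2) along the diagonal. -/
theorem kernX_add_kernY_diag (q x : ℝ) : kernX q x x + kernY q x x = -(q / 2) := by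
  simp only [kernX, kernY, kArg, sub_self, mul_zero, besselDer_zero_zero]
  ring

/-- The derivative of k(x,1-x) = 0 along the antidiagonal; it cancels the reflected term F(1-x) in
the intertwining relations. -/
theorem kernX_sub_kernY_antidiag (q x : ℝ) : kernX q x (1 - x) - kernY q x (1 - x) = 0 := by
  simp [kernX, kernY]

theorem ctrlKernel_eq_kern (ε c x y : ℝ) : ctrlKernel ε c x y = kern (c / ε) x y := by
  simp only [ctrlKernel, kern, kArg, besselDer_zero]

theorem ctrlKernelX_eq_kernX (ε c x y : ℝ) : ctrlKernelX ε c x y = kernX (c / ε) x y := by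
  simp only [ctrlKernelX, ctrlKernel_eq_kern]
  exact (hasDerivAt_kern_left _ _ _).deriv

theorem obsKernelXi_eq_kernX (ε c x y : ℝ) : obsKernelXi ε c x y = kernX (c / ε) y x := by
  simp only [obsKernelXi, obsKernel_eq_ctrlKernel, ctrlKernel_eq_kern]
  exact (hasDerivAt_kern_left _ _ _).deriv

theorem p1_eq (ε c x : ℝ) : p1 ε c x = -ε * kernX (c / ε) 1 x := by
  rw [p1, obsKernelXi_eq_kernX]

theorem p2_eq (ε c x : ℝ) : p2 ε c x = -ε * kernX (c / ε) 0 x := by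
  rw [p2, obsKernelXi_eq_kernX]

theorem p00_eq (ε c : ℝ) : p00 ε c = -kern (c / ε) 0 0 := by
  rw [p00, obsKernel_eq_ctrlKernel, ctrlKernel_eq_kern]

theorem p11_eq (ε c : ℝ) : p11 ε c = -kern (c / ε) 1 1 := by
  rw [p11, obsKernel_eq_ctrlKernel, ctrlKernel_eq_kern]

/-! ### Differentiation of integrals with parameters -/

theorem hasDerivAt_integral_param {K Kx : ℝ → ℝ → ℝ} {f : ℝ → ℝ}
    (hK : Continuous fun p : ℝ × ℝ => K p.1 p.2) (hKx : Continuous fun p : ℝ × ℝ => Kx p.1 p.2)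
    (hd : ∀ x y, HasDerivAt (fun x => K x y) (Kx x y) x) (hf : Continuous f) (a b x : ℝ) :
    HasDerivAt (fun x => ∫ y in a..b, K x y * f y) (∫ y in a..b, Kx x y * f y) x := by
  have hc : Continuous fun p : ℝ × ℝ => Kx p.1 p.2 * f p.2 := by fun_prop
  obtain ⟨C, hC⟩ := ((isCompact_closedBall x 1).prod (isCompact_uIcc (a := a) (b := b))).exists_bound_of_continuousOn
    hc.continuousOn
  refine (intervalIntegral.hasDerivAt_integral_of_dominated_loc_of_deriv_le
    (F' := fun x y => Kx x y * f y)
    (s := Metric.closedBall x 1) (bound := fun _ => C) (Metric.closedBall_mem_nhds x one_pos)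
    (Eventually.of_forall fun z => ?_) ?_ ?_ (ae_of_all _ fun y hy z hz => ?_) (by simp)
    (ae_of_all _ fun y _ z _ => (hd z y).mul_const _)).2
  · exact Continuous.aestronglyMeasurable (by fun_prop)
  · exact Continuous.intervalIntegrable (by fun_prop) _ _
  · exact Continuous.aestronglyMeasurable (by fun_prop)
  · exact hC (z, y) ⟨hz, uIoc_subset_uIcc hy⟩

/-- Leibniz rule. The parameter and the end point are treated as two independent variables; both
partial derivatives are continuous, so the function is jointly differentiable and the chain rule
applies. -/
theorem hasDerivAt_integral_moving {K Kx : ℝ → ℝ → ℝ} {f β : ℝ → ℝ} {β' x : ℝ}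
    (hK : Continuous fun p : ℝ × ℝ => K p.1 p.2) (hKx : Continuous fun p : ℝ × ℝ => Kx p.1 p.2)
    (hd : ∀ x y, HasDerivAt (fun x => K x y) (Kx x y) x) (hf : Continuous f) (a : ℝ)
    (hβ : HasDerivAt β β' x) :
    HasDerivAt (fun x => ∫ y in a..β x, K x y * f y)
      (β' * (K x (β x) * f (β x)) + ∫ y in a..β x, Kx x y * f y) x := by
  have h := hasStrictFDerivAt_uncurry_coprod (𝕜 := ℝ) (u := (x, β x))
    (f := fun x z => ∫ y in a..z, K x y * f y)
    (f₁ := fun x z => ContinuousLinearMap.toSpanSingleton ℝ (∫ y in a..z, Kx x y * f y))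
    (f₂ := fun x z => ContinuousLinearMap.toSpanSingleton ℝ (K x z * f z))
    (Eventually.of_forall fun v => (hasDerivAt_integral_param hK hKx hd hf a v.2 v.1).hasFDerivAt)
    (Eventually.of_forall fun v => by
      have hc : Continuous fun y => K v.1 y * f y := by fun_prop
      exact (hc.integral_hasStrictDerivAt a v.2).hasDerivAt.hasFDerivAt)
    (by
      have : Continuous fun p : ℝ × ℝ => ∫ y in a..p.2, Kx p.1 y * f y :=
        intervalIntegral.continuous_parametric_intervalIntegral_of_continuous
          (f := fun (p : ℝ × ℝ) y => Kx p.1 y * f y)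
          (by simp only [Function.uncurry_def]; fun_prop) continuous_snd
      exact ((ContinuousLinearMap.toSpanSingletonCLE (𝕜 := ℝ) (E := ℝ)).continuous.comp this).continuousAt)
    (by
      have : Continuous fun p : ℝ × ℝ => K p.1 p.2 * f p.2 := by fun_prop
      exact ((ContinuousLinearMap.toSpanSingletonCLE (𝕜 := ℝ) (E := ℝ)).continuous.comp this).continuousAt)
  have h2 := h.hasFDerivAt.comp_hasDerivAt x ((hasDerivAt_id x).prodMk hβ)
  refine h2.congr_deriv ?_
  simp [Function.HasUncurry.uncurry, ContinuousLinearMap.coprod_apply]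
  ring

/-! ### Integral operators on `C([0,1])` -/

/-- The Banach space `C([0,1])`. -/
abbrev CI : Type := C(Icc (0 : ℝ) 1, ℝ)

/-- Extension of a continuous function on `[0,1]` by constants. -/
def ext (F : CI) : ℝ → ℝ := IccExtend zero_le_one F

@[fun_prop]
theorem continuous_ext (F : CI) : Continuous (ext F) := F.continuous.Icc_extend'

theorem ext_of_mem (F : CI) {x : ℝ} (hx : x ∈ Icc (0 : ℝ) 1) : ext F x = F ⟨x, hx⟩ :=
  IccExtend_of_mem _ _ hx

theorem ext_coe (F : CI) (x : Icc (0 : ℝ) 1) : ext F x = F x := IccExtend_val _ _ _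

theorem abs_ext_le (F : CI) (x : ℝ) : |ext F x| ≤ ‖F‖ := F.norm_coe_le_norm _

theorem ext_add (F G : CI) (x : ℝ) : ext (F + G) x = ext F x + ext G x := rfl

theorem ext_sub (F G : CI) (x : ℝ) : ext (F - G) x = ext F x - ext G x := rfl

theorem ext_smul (c : ℝ) (F : CI) (x : ℝ) : ext (c • F) x = c * ext F x := rfl

/-- Restriction of a function continuous on `[0,1]`. -/
def toCI (f : ℝ → ℝ) (hf : ContinuousOn f (Icc 0 1)) : CI :=
  ⟨fun x => f x, continuousOn_iff_continuous_domRestrict.1 hf⟩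

theorem ext_toCI {f : ℝ → ℝ} (hf : ContinuousOn f (Icc 0 1)) {x : ℝ} (hx : x ∈ Icc (0 : ℝ) 1) :
    ext (toCI f hf) x = f x := ext_of_mem _ hx

theorem CI_ext {F G : CI} (h : ∀ x ∈ Icc (0 : ℝ) 1, ext F x = ext G x) : F = G := by
  ext x
  rw [← ext_coe, ← ext_coe]
  exact h x x.2

theorem CI_norm_le {F : CI} {C : ℝ} (hC : 0 ≤ C) (h : ∀ x ∈ Icc (0 : ℝ) 1, |ext F x| ≤ C) :
    ‖F‖ ≤ C := by
  rw [ContinuousMap.norm_le _ hC]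
  intro x
  have := h x x.2
  rwa [ext_coe] at this

/-- The operator `F ↦ ∫_{α(x)}^{β(x)} K(x,y) F(y) dy`. -/
def intOp (K : ℝ → ℝ → ℝ) (hK : Continuous fun p : ℝ × ℝ => K p.1 p.2) (α β : ℝ → ℝ)
    (hα : Continuous α) (hβ : Continuous β) : CI →L[ℝ] CI :=
  LinearMap.mkContinuousOfExistsBound
    { toFun := fun F => ⟨fun x => ∫ y in α x..β x, K x y * ext F y, by
        have h : ∀ σ : ℝ → ℝ, Continuous σ → Continuous fun x => ∫ y in (0 : ℝ)..σ x, K x y * ext F y :=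
          fun σ hσ => intervalIntegral.continuous_parametric_intervalIntegral_of_continuous
            (f := fun (x : ℝ) y => K x y * ext F y)
            (by simp only [Function.uncurry_def]; fun_prop) hσ
        have h2 := ((h β hβ).sub (h α hα)).comp (continuous_subtype_val (p := (· ∈ Icc (0 : ℝ) 1)))
        refine h2.congr fun x => ?_
        have hi : ∀ a b, IntervalIntegrable (fun y => K x y * ext F y) volume a b := fun a b =>
          Continuous.intervalIntegrable (by fun_prop) _ _
        exact intervalIntegral.integral_interval_sub_left (hi _ _) (hi _ _)⟩
      map_add' := fun F G => by
        ext x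
        have hi : ∀ H : CI, IntervalIntegrable (fun y => K x y * ext H y) volume (α x) (β x) :=
          fun H => Continuous.intervalIntegrable (by fun_prop) _ _
        simp only [ContinuousMap.coe_mk, ContinuousMap.add_apply, ext_add, mul_add]
        exact intervalIntegral.integral_add (hi F) (hi G)
      map_smul' := fun c F => by
        ext x
        simp only [ContinuousMap.coe_mk, ContinuousMap.smul_apply, ext_smul, mul_left_comm _ c]
        exact intervalIntegral.integral_const_mul _ _ }
    (by
      have h : ∀ σ : ℝ → ℝ, Continuous σ → Continuous fun x => ∫ y in (0 : ℝ)..σ x, |K x y| :=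
        fun σ hσ => intervalIntegral.continuous_parametric_intervalIntegral_of_continuous
          (f := fun (x : ℝ) y => |K x y|) (by simp only [Function.uncurry_def]; fun_prop) hσ
      -- The operator bound is a bound over [0,1] of the integral of |K(x,·)|, which is continuous
      -- in x.
      obtain ⟨C, hC⟩ := isCompact_Icc.exists_bound_of_continuousOn
        (((h β hβ).sub (h α hα)).continuousOn (s := Icc (0 : ℝ) 1))
      refine ⟨C, fun F => ?_⟩
      have hC0 : 0 ≤ C := (norm_nonneg _).trans (hC 0 (by simp))
      rw [ContinuousMap.norm_le _ (by positivity)]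
      intro x
      have hKx : ∀ a b, IntervalIntegrable (fun y => |K x y|) volume a b := fun a b =>
        Continuous.intervalIntegrable (by fun_prop) _ _
      have h1 : ‖∫ y in α x..β x, K x y * ext F y‖ ≤ |∫ y in α x..β x, |K x y| * ‖F‖| := by
        refine intervalIntegral.norm_integral_le_abs_of_norm_le (ae_of_all _ fun y => ?_)
          ((hKx _ _).mul_const _)
        rw [norm_mul]
        exact mul_le_mul_of_nonneg_left (abs_ext_le F y) (norm_nonneg _)
      refine h1.trans ?_
      rw [intervalIntegral.integral_mul_const, abs_mul, abs_norm]
      refine mul_le_mul_of_nonneg_right ?_ (norm_nonneg _)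
      have h2 := hC x x.2
      rwa [Pi.sub_apply, intervalIntegral.integral_interval_sub_left (hKx _ _) (hKx _ _)] at h2)

theorem ext_intOp (K : ℝ → ℝ → ℝ) (hK : Continuous fun p : ℝ × ℝ => K p.1 p.2) (α β : ℝ → ℝ)
    (hα : Continuous α) (hβ : Continuous β) (F : CI) {x : ℝ} (hx : x ∈ Icc (0 : ℝ) 1) :
    ext (intOp K hK α β hα hβ F) x = ∫ y in α x..β x, K x y * ext F y := ext_of_mem _ hx

/-- Multiplication by a continuous function. -/
def mulOp (m : ℝ → ℝ) (hm : Continuous m) : CI →L[ℝ] CI :=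
  ContinuousLinearMap.mul ℝ CI ⟨fun x => m x, hm.comp continuous_subtype_val⟩

theorem ext_mulOp (m : ℝ → ℝ) (hm : Continuous m) (F : CI) {x : ℝ} (hx : x ∈ Icc (0 : ℝ) 1) :
    ext (mulOp m hm F) x = m x * ext F x := by
  rw [ext_of_mem _ hx, ext_of_mem _ hx]
  rfl

/-- The reflection of `[0,1]` at its midpoint. -/
def reflOp : CI →L[ℝ] CI :=
  LinearMap.mkContinuous
    { toFun := fun F => ⟨fun x => ext F (1 - x), by fun_prop⟩
      map_add' := fun F G => rfl
      map_smul' := fun c F => rfl } 1 fun F => by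
    rw [one_mul, ContinuousMap.norm_le _ (norm_nonneg F)]
    exact fun x => abs_ext_le F _

theorem ext_reflOp (F : CI) {x : ℝ} (hx : x ∈ Icc (0 : ℝ) 1) :
    ext (reflOp F) x = ext F (1 - x) := ext_of_mem _ hx

/-- If `T` contracts the order interval `[-ρ, ρ]` by a factor two, `1 - T` is invertible. -/
theorem exists_inverse_of_weight (T : CI →L[ℝ] CI) (ρ : CI) (hρ : ∀ x, 0 < ρ x)
    (h : ∀ F : CI, (∀ x, |F x| ≤ ρ x) → ∀ x, |T F x| ≤ ρ x / 2) :
    ∃ R : CI →L[ℝ] CI, (∀ F, R F - T (R F) = F) ∧ ∀ F, R (F - T F) = F := by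
  let σ : CI := ⟨fun x => (ρ x)⁻¹, ρ.continuous.inv₀ fun x => (hρ x).ne'⟩
  have hρσ : ρ * σ = 1 := by
    ext x
    exact mul_inv_cancel₀ (hρ x).ne'
  let m := ContinuousLinearMap.mul ℝ CI ρ
  let m' := ContinuousLinearMap.mul ℝ CI σ
  have hmm' : ∀ F, m (m' F) = F := fun F => by
    change ρ * (σ * F) = F
    rw [← mul_assoc, hρσ, one_mul]
  have hm'm : ∀ F, m' (m F) = F := fun F => by
    change σ * (ρ * F) = F
    rw [← mul_assoc, mul_comm σ, hρσ, one_mul]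
  -- Conjugation by multiplication with ρ turns the hypothesis into ‖S‖ ≤ 1/2 in the sup norm, so 1
  -- - S is invertible; undoing the conjugation inverts 1 - T.
  let S : CI →L[ℝ] CI := m' ∘L T ∘L m
  have hS : ‖S‖ ≤ 1 / 2 := by
    refine S.opNorm_le_of_unit_norm (by norm_num) fun F hF => ?_
    rw [ContinuousMap.norm_le _ (by norm_num)]
    intro x
    have h1 := h (m F) (fun y => by
      change |ρ y * F y| ≤ ρ y
      rw [abs_mul, abs_of_pos (hρ y)]
      have : |F y| ≤ 1 := (F.norm_coe_le_norm y).trans hF.le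
      nlinarith [hρ y]) x
    change |(ρ x)⁻¹ * T (m F) x| ≤ 1 / 2
    rw [abs_mul, abs_of_pos (inv_pos.2 (hρ x)), inv_mul_le_iff₀ (hρ x)]
    linarith
  obtain ⟨U, hU⟩ := isUnit_one_sub_of_norm_lt_one (x := S) (by linarith)
  have hU1 : ∀ F, (↑U⁻¹ : CI →L[ℝ] CI) F - S ((↑U⁻¹ : CI →L[ℝ] CI) F) = F := fun F => by
    have := congrArg (fun V : CI →L[ℝ] CI => V F) U.mul_inv
    rw [hU] at this
    simpa using this
  have hU2 : ∀ F, (↑U⁻¹ : CI →L[ℝ] CI) (F - S F) = F := fun F => by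
    have := congrArg (fun V : CI →L[ℝ] CI => V F) U.inv_mul
    rw [hU] at this
    simpa using this
  have hTm : ∀ F, T (m F) = m (S F) := fun F => (hmm' _).symm
  refine ⟨m ∘L (↑U⁻¹ : CI →L[ℝ] CI) ∘L m', fun F => ?_, fun F => ?_⟩
  · change m ((↑U⁻¹ : CI →L[ℝ] CI) (m' F)) - T (m ((↑U⁻¹ : CI →L[ℝ] CI) (m' F))) = F
    rw [hTm, ← map_sub, hU1, hmm']
  · change m ((↑U⁻¹ : CI →L[ℝ] CI) (m' (F - T F))) = F
    have : m' (F - T F) = m' F - S (m' F) := by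
      rw [map_sub]
      change _ = m' F - m' (T (m (m' F)))
      rw [hmm']
    rw [this, hU2, hmm']

/-! ### The backstepping operators -/

theorem one_sub_mem {x : ℝ} (hx : x ∈ Icc (0 : ℝ) 1) : 1 - x ∈ Icc (0 : ℝ) 1 :=
  ⟨by linarith [hx.2], by linarith [hx.1]⟩

theorem Continuous.comp₂_curried {K : ℝ → ℝ → ℝ} (hK : Continuous fun p : ℝ × ℝ => K p.1 p.2)
    {u v : ℝ → ℝ} (hu : Continuous u) (hv : Continuous v) : Continuous fun x => K (u x) (v x) :=
  hK.comp (hu.prodMk hv)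

theorem continuous_flip {K : ℝ → ℝ → ℝ} (hK : Continuous fun p : ℝ × ℝ => K p.1 p.2) :
    Continuous fun p : ℝ × ℝ => K p.2 p.1 :=
  hK.comp _root_.continuous_swap

/-- `ctrlOp q F x = ∫_{1-x}^x k(x,y) F(y) dy`. -/
def ctrlOp (q : ℝ) : CI →L[ℝ] CI :=
  intOp (kern q) (continuous_kern q) (fun x => 1 - x) (fun x => x) (by fun_prop) (by fun_prop)

/-- The derivative of `ctrlOp q F`. -/
def ctrlOpX (q : ℝ) : CI →L[ℝ] CI :=
  mulOp (fun x => -(q / 2) * (x - 1 / 2)) (by fun_prop) +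
  intOp (kernX q) (continuous_kernX q) (fun x => 1 - x) (fun x => x) (by fun_prop) (by fun_prop)

/-- The part of the second derivative of `ctrlOp q F` that does not involve `F'`. -/
def ctrlOpXX (q : ℝ) : CI →L[ℝ] CI :=
  mulOp (fun x => -(q / 2) + kernX q x x)
      (continuous_const.add (Continuous.comp₂_curried (continuous_kernX q) (by fun_prop) (by fun_prop))) +
  (mulOp (fun x => kernX q x (1 - x))
      (Continuous.comp₂_curried (continuous_kernX q) (by fun_prop) (by fun_prop)) ∘L reflOp +
  intOp (kernXX q) (continuous_kernXX q) (fun x => 1 - x) (fun x => x) (by fun_prop) (by fun_prop))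

/-- `obsOp q F x = ∫_x^1 P(x,y) F(y) dy - ∫_0^{1-x} P(x,y) F(y) dy`, with `P(x,y) = k(y,x)`. -/
def obsOp (q : ℝ) : CI →L[ℝ] CI :=
  intOp (fun x y => kern q y x) (continuous_flip (continuous_kern q)) (fun x => x) (fun _ => 1)
      (by fun_prop) (by fun_prop) -
  intOp (fun x y => kern q y x) (continuous_flip (continuous_kern q)) (fun _ => 0) (fun x => 1 - x)
      (by fun_prop) (by fun_prop)

/-- The derivative of `obsOp q F`. -/
def obsOpX (q : ℝ) : CI →L[ℝ] CI :=
  mulOp (fun x => q / 2 * (x - 1 / 2)) (by fun_prop) +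
  (intOp (fun x y => kernY q y x) (continuous_flip (continuous_kernY q)) (fun x => x) (fun _ => 1)
      (by fun_prop) (by fun_prop) -
  intOp (fun x y => kernY q y x) (continuous_flip (continuous_kernY q)) (fun _ => 0)
      (fun x => 1 - x) (by fun_prop) (by fun_prop))

/-- The part of the second derivative of `obsOp q F` that does not involve `F'`. -/
def obsOpXX (q : ℝ) : CI →L[ℝ] CI :=
  mulOp (fun x => q / 2 - kernY q x x)
      (continuous_const.sub (Continuous.comp₂_curried (continuous_kernY q) (by fun_prop) (by fun_prop))) +
  (mulOp (fun x => kernY q (1 - x) x)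
      (Continuous.comp₂_curried (continuous_kernY q) (by fun_prop) (by fun_prop)) ∘L reflOp +
  (intOp (fun x y => kernYY q y x) (continuous_flip (continuous_kernYY q)) (fun x => x) (fun _ => 1)
      (by fun_prop) (by fun_prop) -
  intOp (fun x y => kernYY q y x) (continuous_flip (continuous_kernYY q)) (fun _ => 0)
      (fun x => 1 - x) (by fun_prop) (by fun_prop)))

section
variable (q : ℝ) (F : CI) {x : ℝ}

theorem ext_ctrlOp (hx : x ∈ Icc (0 : ℝ) 1) : ext (ctrlOp q F) x = ∫ y in (1 - x)..x, kern q x y * ext F y :=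
  ext_intOp _ _ _ _ _ _ _ hx

theorem ext_ctrlOpX (hx : x ∈ Icc (0 : ℝ) 1) : ext (ctrlOpX q F) x =
    -(q / 2) * (x - 1 / 2) * ext F x + ∫ y in (1 - x)..x, kernX q x y * ext F y := by
  simp only [ctrlOpX, add_apply, ext_add]
  rw [ext_mulOp _ _ _ hx, ext_intOp _ _ _ _ _ _ _ hx]

theorem ext_ctrlOpXX (hx : x ∈ Icc (0 : ℝ) 1) : ext (ctrlOpXX q F) x =
    (-(q / 2) + kernX q x x) * ext F x + (kernX q x (1 - x) * ext F (1 - x) +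
      ∫ y in (1 - x)..x, kernXX q x y * ext F y) := by
  simp only [ctrlOpXX, add_apply, ext_add, ContinuousLinearMap.comp_apply]
  rw [ext_mulOp _ _ _ hx, ext_mulOp _ _ _ hx, ext_reflOp _ hx, ext_intOp _ _ _ _ _ _ _ hx]

theorem ext_obsOp (hx : x ∈ Icc (0 : ℝ) 1) : ext (obsOp q F) x =
    (∫ y in x..1, kern q y x * ext F y) - ∫ y in (0 : ℝ)..1 - x, kern q y x * ext F y := by
  simp only [obsOp, sub_apply, ext_sub]
  rw [ext_intOp _ _ _ _ _ _ _ hx, ext_intOp _ _ _ _ _ _ _ hx]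

theorem ext_obsOpX (hx : x ∈ Icc (0 : ℝ) 1) : ext (obsOpX q F) x = q / 2 * (x - 1 / 2) * ext F x +
    ((∫ y in x..1, kernY q y x * ext F y) - ∫ y in (0 : ℝ)..1 - x, kernY q y x * ext F y) := by
  simp only [obsOpX, add_apply, sub_apply, ext_add, ext_sub]
  rw [ext_mulOp _ _ _ hx, ext_intOp _ _ _ _ _ _ _ hx, ext_intOp _ _ _ _ _ _ _ hx]

theorem ext_obsOpXX (hx : x ∈ Icc (0 : ℝ) 1) : ext (obsOpXX q F) x =
    (q / 2 - kernY q x x) * ext F x + (kernY q (1 - x) x * ext F (1 - x) +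
    ((∫ y in x..1, kernYY q y x * ext F y) - ∫ y in (0 : ℝ)..1 - x, kernYY q y x * ext F y)) := by
  simp only [obsOpXX, add_apply, sub_apply, ext_add, ext_sub,
    ContinuousLinearMap.comp_apply]
  rw [ext_mulOp _ _ _ hx, ext_mulOp _ _ _ hx, ext_reflOp _ hx, ext_intOp _ _ _ _ _ _ _ hx,
    ext_intOp _ _ _ _ _ _ _ hx]

/-- Moving-interval version of the differentiation rule, on `[1-x,x]`. -/
theorem hasDerivAt_integral_sym {K Kx : ℝ → ℝ → ℝ}
    (hK : Continuous fun p : ℝ × ℝ => K p.1 p.2) (hKx : Continuous fun p : ℝ × ℝ => Kx p.1 p.2)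
    (hd : ∀ x y, HasDerivAt (fun x => K x y) (Kx x y) x) :
    HasDerivAt (fun x => ∫ y in (1 - x)..x, K x y * ext F y)
      (K x x * ext F x + K x (1 - x) * ext F (1 - x) + ∫ y in (1 - x)..x, Kx x y * ext F y) x := by
  have h1 := hasDerivAt_integral_moving hK hKx hd (continuous_ext F) 0 (hasDerivAt_id x)
  have h2 := hasDerivAt_integral_moving hK hKx hd (continuous_ext F) 0
    ((hasDerivAt_id x).const_sub 1)
  have hi : ∀ {H : ℝ → ℝ → ℝ}, (Continuous fun p : ℝ × ℝ => H p.1 p.2) → ∀ z a b,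
      IntervalIntegrable (fun y => H z y * ext F y) volume a b := fun hH z a b =>
    Continuous.intervalIntegrable (by fun_prop) _ _
  refine ((h1.sub h2).congr_deriv ?_).congr_of_eventuallyEq (Eventually.of_forall fun z => ?_)
  · rw [← intervalIntegral.integral_interval_sub_left (hi hKx x 0 x) (hi hKx x 0 (1 - x))]
    simp only [id]
    ring
  · exact (intervalIntegral.integral_interval_sub_left (hi hK z _ _) (hi hK z _ _)).symm

/-- Moving-interval version of the differentiation rule, outside of `[1-x,x]`. -/
theorem hasDerivAt_integral_compl {K Kx : ℝ → ℝ → ℝ}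
    (hK : Continuous fun p : ℝ × ℝ => K p.1 p.2) (hKx : Continuous fun p : ℝ × ℝ => Kx p.1 p.2)
    (hd : ∀ x y, HasDerivAt (fun x => K x y) (Kx x y) x) :
    HasDerivAt (fun x => (∫ y in x..1, K x y * ext F y) - ∫ y in (0 : ℝ)..1 - x, K x y * ext F y)
      (-(K x x * ext F x) + K x (1 - x) * ext F (1 - x) +
        ((∫ y in x..1, Kx x y * ext F y) - ∫ y in (0 : ℝ)..1 - x, Kx x y * ext F y)) x := by
  have h1 := hasDerivAt_integral_moving hK hKx hd (continuous_ext F) 1 (hasDerivAt_id x)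
  have h2 := hasDerivAt_integral_moving hK hKx hd (continuous_ext F) 0
    ((hasDerivAt_id x).const_sub 1)
  refine ((h1.neg.sub h2).congr_deriv ?_).congr_of_eventuallyEq (Eventually.of_forall fun z => ?_)
  · simp only [id]
    rw [intervalIntegral.integral_symm x 1]
    ring
  · simp only [Pi.sub_apply, Pi.neg_apply, id]
    rw [intervalIntegral.integral_symm z 1, neg_neg]

theorem hasDeriv_ctrlOp (hx : x ∈ Icc (0 : ℝ) 1) :
    HasDerivWithinAt (ext (ctrlOp q F)) (ext (ctrlOpX q F) x) (Icc 0 1) x := by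
  have h := hasDerivAt_integral_sym F (x := x) (continuous_kern q) (continuous_kernX q)
    (hasDerivAt_kern_left q)
  rw [ext_ctrlOpX q F hx]
  refine (h.hasDerivWithinAt.congr (fun y hy => ext_ctrlOp q F hy) (ext_ctrlOp q F hx)).congr_deriv ?_
  rw [kern_antidiag, kern_diag]
  ring

theorem hasDeriv_ctrlOpX (hx : x ∈ Icc (0 : ℝ) 1) {F1 : ℝ} (hF : HasDerivWithinAt (ext F) F1 (Icc 0 1) x) :
    HasDerivWithinAt (ext (ctrlOpX q F))
      (ext (ctrlOpXX q F) x + -(q / 2) * (x - 1 / 2) * F1) (Icc 0 1) x := by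
  have h := (hasDerivAt_integral_sym F (x := x) (continuous_kernX q) (continuous_kernXX q)
    (hasDerivAt_kernX_left q)).hasDerivWithinAt (s := Icc 0 1)
  have h2 : HasDerivWithinAt (fun x : ℝ => -(q / 2) * (x - 1 / 2)) (-(q / 2) * 1) (Icc 0 1) x :=
    (((hasDerivAt_id x).sub_const _).const_mul _).hasDerivWithinAt
  rw [ext_ctrlOpXX q F hx]
  refine (((h2.mul hF).add h).congr (fun y hy => ext_ctrlOpX q F hy)
    (ext_ctrlOpX q F hx)).congr_deriv ?_
  ring

theorem hasDeriv_obsOp (hx : x ∈ Icc (0 : ℝ) 1) :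
    HasDerivWithinAt (ext (obsOp q F)) (ext (obsOpX q F) x) (Icc 0 1) x := by
  have h := hasDerivAt_integral_compl F (x := x) (continuous_flip (continuous_kern q))
    (continuous_flip (continuous_kernY q)) (fun x y => hasDerivAt_kern_right q y x)
  rw [ext_obsOpX q F hx]
  refine (h.hasDerivWithinAt.congr (fun y hy => ext_obsOp q F hy) (ext_obsOp q F hx)).congr_deriv ?_
  have := kern_antidiag q (1 - x)
  rw [sub_sub_cancel] at this
  rw [this, kern_diag]
  ring

theorem hasDeriv_obsOpX (hx : x ∈ Icc (0 : ℝ) 1) {F1 : ℝ} (hF : HasDerivWithinAt (ext F) F1 (Icc 0 1) x) :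
    HasDerivWithinAt (ext (obsOpX q F))
      (ext (obsOpXX q F) x + q / 2 * (x - 1 / 2) * F1) (Icc 0 1) x := by
  have h := (hasDerivAt_integral_compl F (x := x) (continuous_flip (continuous_kernY q))
    (continuous_flip (continuous_kernYY q))
    (fun x y => hasDerivAt_kernY_right q y x)).hasDerivWithinAt (s := Icc 0 1)
  have h2 : HasDerivWithinAt (fun x : ℝ => q / 2 * (x - 1 / 2)) (q / 2 * 1) (Icc 0 1) x :=
    (((hasDerivAt_id x).sub_const _).const_mul _).hasDerivWithinAt
  rw [ext_obsOpXX q F hx]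
  refine (((h2.mul hF).add h).congr (fun y hy => ext_obsOpX q F hy)
    (ext_obsOpX q F hx)).congr_deriv ?_
  ring

end

/-- Two integrations by parts on a subinterval of `[0,1]`. -/
theorem integral_by_parts_twice {K K1 K2 f f1 f2 : ℝ → ℝ} {a b : ℝ}
    (ha : a ∈ Icc (0 : ℝ) 1) (hb : b ∈ Icc (0 : ℝ) 1)
    (hK : ∀ y, HasDerivAt K (K1 y) y) (hK1 : ∀ y, HasDerivAt K1 (K2 y) y) (hK2 : Continuous K2)
    (hf : ∀ y ∈ Icc (0 : ℝ) 1, HasDerivWithinAt f (f1 y) (Icc 0 1) y)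
    (hf1 : ∀ y ∈ Icc (0 : ℝ) 1, HasDerivWithinAt f1 (f2 y) (Icc 0 1) y)
    (hf2 : ContinuousOn f2 (Icc 0 1)) :
    ∫ y in a..b, K y * f2 y = K b * f1 b - K a * f1 a - (K1 b * f b - K1 a * f a)
      + ∫ y in a..b, K2 y * f y := by
  have hsub : uIcc a b ⊆ Icc 0 1 := uIcc_subset_Icc ha hb
  have hKc : Continuous K := continuous_iff_continuousAt.2 fun y => (hK y).continuousAt
  have hK1c : Continuous K1 := continuous_iff_continuousAt.2 fun y => (hK1 y).continuousAt
  have hfc : ContinuousOn f (Icc 0 1) := fun y hy => (hf y hy).continuousWithinAt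
  have hf1c : ContinuousOn f1 (Icc 0 1) := fun y hy => (hf1 y hy).continuousWithinAt
  have hin : ∀ y ∈ Ioo (min a b) (max a b), y ∈ Icc (0 : ℝ) 1 ∧ Icc (0 : ℝ) 1 ∈ 𝓝 y := by
    intro y hy
    have h0 : 0 < y := lt_of_le_of_lt (le_min ha.1 hb.1) hy.1
    have h1 : y < 1 := lt_of_lt_of_le hy.2 (max_le ha.2 hb.2)
    exact ⟨⟨h0.le, h1.le⟩, Icc_mem_nhds h0 h1⟩
  have e1 := intervalIntegral.integral_mul_deriv_eq_deriv_mul_of_hasDeriv_right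
    (u := K) (u' := K1) (v := f1) (v' := f2) (a := a) (b := b)
    hKc.continuousOn (hf1c.mono hsub) (fun y _ => (hK y).hasDerivWithinAt)
    (fun y hy => ((hf1 y (hin y hy).1).hasDerivAt (hin y hy).2).hasDerivWithinAt)
    (hK1c.intervalIntegrable _ _) ((hf2.mono hsub).intervalIntegrable)
  have e2 := intervalIntegral.integral_mul_deriv_eq_deriv_mul_of_hasDeriv_right
    (u := K1) (u' := K2) (v := f) (v' := f1) (a := a) (b := b)
    hK1c.continuousOn (hfc.mono hsub) (fun y _ => (hK1 y).hasDerivWithinAt)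
    (fun y hy => ((hf y (hin y hy).1).hasDerivAt (hin y hy).2).hasDerivWithinAt)
    (hK2.intervalIntegrable _ _) ((hf1c.mono hsub).intervalIntegrable)
  rw [e1, e2]
  ring

/-- `F1` and `F2` are the first two derivatives of `F`. -/
structure IsC2 (F F1 F2 : CI) : Prop where
  d1 : ∀ y ∈ Icc (0 : ℝ) 1, HasDerivWithinAt (ext F) (ext F1 y) (Icc 0 1) y
  d2 : ∀ y ∈ Icc (0 : ℝ) 1, HasDerivWithinAt (ext F1) (ext F2 y) (Icc 0 1) y

/-- The control transformation intertwines `∂ₓ²` and `∂ₓ² - q`. -/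
theorem ctrlOp_intertwine (q : ℝ) {F F1 F2 : CI} (h : IsC2 F F1 F2) {x : ℝ}
    (hx : x ∈ Icc (0 : ℝ) 1) :
    ext (ctrlOpXX q F) x + -(q / 2) * (x - 1 / 2) * ext F1 x - ext (ctrlOp q F2) x
      = -q * ext F x + q * ext (ctrlOp q F) x := by
  -- F'' is moved onto the kernel in its second variable; the kernel equation then trades k_yy for
  -- k_xx - q k, and the integrals cancel up to q `ctrlOp q F`.
  have e := integral_by_parts_twice (K := kern q x) (K1 := kernY q x) (K2 := kernYY q x)
    (one_sub_mem hx) hx (hasDerivAt_kern_right q x) (hasDerivAt_kernY_right q x)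
    (Continuous.comp₂_curried (continuous_kernYY q) (by fun_prop) (by fun_prop))
    h.d1 h.d2 (continuous_ext F2).continuousOn
  have hi : ∀ {H : ℝ → ℝ → ℝ}, (Continuous fun p : ℝ × ℝ => H p.1 p.2) →
      IntervalIntegrable (fun y => H x y * ext F y) volume (1 - x) x := fun hH =>
    Continuous.intervalIntegrable (by fun_prop) _ _
  have e2 : (∫ y in (1 - x)..x, kernXX q x y * ext F y) =
      (∫ y in (1 - x)..x, kernYY q x y * ext F y) + q * ∫ y in (1 - x)..x, kern q x y * ext F y := by
    rw [← intervalIntegral.integral_const_mul, ← intervalIntegral.integral_add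
      (hi (continuous_kernYY q)) ((hi (continuous_kern q)).const_mul q)]
    refine intervalIntegral.integral_congr fun y _ => ?_
    have := kern_pde q x y
    linear_combination ext F y * this
  rw [ext_ctrlOpXX q F hx, ext_ctrlOp q F2 hx, ext_ctrlOp q F hx, e, e2, kern_antidiag, kern_diag]
  -- Only local terms remain: those in F(x) combine to -q F(x) by the diagonal identity, those in
  -- F(1-x) cancel by the antidiagonal one.
  have h1 := kernX_add_kernY_diag q x
  have h2 := kernX_sub_kernY_antidiag q x
  linear_combination ext F x * h1 + ext F (1 - x) * h2

/-- The observer transformation intertwines `∂ₓ²` and `∂ₓ² - q` up to output injection. -/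
theorem obsOp_intertwine (q : ℝ) {F F1 F2 : CI} (h : IsC2 F F1 F2) (h0 : ext F1 0 = 0)
    (h1 : ext F1 1 = 0) {x : ℝ} (hx : x ∈ Icc (0 : ℝ) 1) :
    ext (obsOpXX q F) x + q / 2 * (x - 1 / 2) * ext F1 x - ext (obsOp q F2) x
      = q * ext F x + kernX q 1 x * ext F 1 + kernX q 0 x * ext F 0 - q * ext (obsOp q F) x := by
  have hXX : Continuous fun y : ℝ => kernXX q y x :=
    Continuous.comp₂_curried (continuous_kernXX q) continuous_id continuous_const
  -- Here the integrals reach the ends of [0,1]. Since F' vanishes there, the surviving boundary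
  -- terms are F(0) and F(1) times kernel derivatives, which are the output-injection gains up to a
  -- factor.
  have e := integral_by_parts_twice (K := fun y => kern q y x) (K1 := fun y => kernX q y x)
    (K2 := fun y => kernXX q y x) hx (right_mem_Icc.2 zero_le_one)
    (fun y => hasDerivAt_kern_left q y x) (fun y => hasDerivAt_kernX_left q y x) hXX
    h.d1 h.d2 (continuous_ext F2).continuousOn
  have e' := integral_by_parts_twice (K := fun y => kern q y x) (K1 := fun y => kernX q y x)
    (K2 := fun y => kernXX q y x) (left_mem_Icc.2 zero_le_one) (one_sub_mem hx)
    (fun y => hasDerivAt_kern_left q y x) (fun y => hasDerivAt_kernX_left q y x) hXX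
    h.d1 h.d2 (continuous_ext F2).continuousOn
  have hi : ∀ {H : ℝ → ℝ → ℝ} (a b : ℝ), (Continuous fun p : ℝ × ℝ => H p.1 p.2) →
      IntervalIntegrable (fun y => H y x * ext F y) volume a b := fun a b hH =>
    Continuous.intervalIntegrable (by fun_prop) _ _
  have e2 : ∀ a b, (∫ y in a..b, kernXX q y x * ext F y) =
      (∫ y in a..b, kernYY q y x * ext F y) + q * ∫ y in a..b, kern q y x * ext F y := by
    intro a b
    rw [← intervalIntegral.integral_const_mul, ← intervalIntegral.integral_add
      (hi a b (continuous_kernYY q)) ((hi a b (continuous_kern q)).const_mul q)]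
    refine intervalIntegral.integral_congr fun y _ => ?_
    have := kern_pde q y x
    linear_combination ext F y * this
  have ha := kern_antidiag q (1 - x)
  have h2 := kernX_sub_kernY_antidiag q (1 - x)
  rw [sub_sub_cancel] at ha h2
  rw [ext_obsOpXX q F hx, ext_obsOp q F2 hx, ext_obsOp q F hx, e, e', e2, e2, ha, kern_diag, h0, h1]
  have h3 := kernX_add_kernY_diag q x
  linear_combination -ext F x * h3 - ext F (1 - x) * h2

theorem exists_kern_bound (q : ℝ) :
    ∃ C, 0 < C ∧ ∀ x ∈ Icc (0 : ℝ) 1, ∀ y ∈ Icc (0 : ℝ) 1, |kern q x y| ≤ C := by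
  obtain ⟨C, hC⟩ := (isCompact_Icc.prod isCompact_Icc).exists_bound_of_continuousOn
    ((continuous_kern q).continuousOn (s := Icc (0 : ℝ) 1 ×ˢ Icc (0 : ℝ) 1))
  exact ⟨max C 1, by positivity, fun x hx y hy => (hC (x, y) ⟨hx, hy⟩).trans (le_max_left _ _)⟩

/-- The weight cosh(s(x - 1/2)) grows away from the midpoint, as does the interval [1-x,x]. Its
integral there is 2 sinh(s(x - 1/2))/s, so with s = 4C, C bounding the kernel, the operator halves
the weight. -/
theorem exists_ctrlOp_inverse (q : ℝ) :
    ∃ R : CI →L[ℝ] CI, (∀ F, R F - ctrlOp q (R F) = F) ∧ ∀ F, R (F - ctrlOp q F) = F := by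
  obtain ⟨C, hC0, hC⟩ := exists_kern_bound q
  set s := 4 * C with hs
  have hs0 : 0 < s := by positivity
  let r : ℝ → ℝ := fun x => Real.cosh (s * (x - 1 / 2))
  have hr : Continuous r := by fun_prop
  refine exists_inverse_of_weight (ctrlOp q) (toCI r hr.continuousOn)
    (fun x => Real.cosh_pos _) fun F hF x => ?_
  rw [← ext_coe, ext_ctrlOp q F x.2]
  change _ ≤ r x / 2
  have hder : ∀ y, HasDerivAt (fun y => Real.sinh (s * (y - 1 / 2)) / s) (r y) y := fun y => by
    have h1 : HasDerivAt (fun y : ℝ => s * (y - 1 / 2)) (s * 1) y :=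
      ((hasDerivAt_id y).sub_const _).const_mul s
    refine (h1.sinh.div_const s).congr_deriv ?_
    simp only [r]
    field_simp
  have hint : ∫ y in (1 - x : ℝ)..x, C * r y = C * (2 * Real.sinh (s * (x - 1 / 2)) / s) := by
    rw [intervalIntegral.integral_const_mul,
      intervalIntegral.integral_eq_sub_of_hasDerivAt (fun y _ => hder y) (hr.intervalIntegrable _ _)]
    have : s * (1 - x - 1 / 2 : ℝ) = -(s * (x - 1 / 2)) := by ring
    rw [this, Real.sinh_neg]
    ring
  have h1 : ‖∫ y in (1 - x : ℝ)..x, kern q x y * ext F y‖ ≤ |∫ y in (1 - x : ℝ)..x, C * r y| := by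
    refine intervalIntegral.norm_integral_le_abs_of_norm_le
      ((ae_restrict_iff' measurableSet_uIoc).2 (ae_of_all _ fun y hy => ?_))
      ((hr.intervalIntegrable _ _).const_mul _)
    have hyI : y ∈ Icc (0 : ℝ) 1 :=
      (uIcc_subset_Icc (one_sub_mem x.2) x.2) (uIoc_subset_uIcc hy)
    rw [norm_mul, ext_of_mem F hyI]
    exact mul_le_mul (hC x x.2 y hyI) (hF ⟨y, hyI⟩) (abs_nonneg _) hC0.le
  refine h1.trans ?_
  rw [hint, abs_mul, abs_of_pos hC0, abs_div, abs_of_pos hs0, abs_mul, abs_two]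
  have h2 : |Real.sinh (s * (x - 1 / 2))| ≤ r x := by
    rw [abs_le]
    have := Real.cosh_sub_sinh (s * (x - 1 / 2) : ℝ)
    have := Real.cosh_add_sinh (s * (x - 1 / 2) : ℝ)
    have := Real.exp_pos (s * (x - 1 / 2) : ℝ)
    have := Real.exp_pos (-(s * (x - 1 / 2)) : ℝ)
    constructor <;> simp only [r] <;> linarith
  have h3 : C * (2 * |Real.sinh (s * (x - 1 / 2))| / s) = |Real.sinh (s * (x - 1 / 2))| / 2 := by
    rw [hs]; field_simp; ring
  rw [h3]
  linarith

/-- The integration runs over the points farther from the midpoint than x, so the weight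
e^{-s|x-1/2|} decays outwards. With s = 4C each of the two tails contributes at most a quarter of
the weight at x. -/
theorem exists_obsOp_inverse (q : ℝ) :
    ∃ R : CI →L[ℝ] CI, (∀ F, R F - obsOp q (R F) = F) ∧ ∀ F, R (F - obsOp q F) = F := by
  obtain ⟨C, hC0, hC⟩ := exists_kern_bound q
  set s := 4 * C with hs
  have hs0 : 0 < s := by positivity
  let r : ℝ → ℝ := fun x => Real.exp (-s * |x - 1 / 2|)
  have hr : Continuous r := by fun_prop
  refine exists_inverse_of_weight (obsOp q) (toCI r hr.continuousOn)
    (fun x => Real.exp_pos _) fun F hF x => ?_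
  rw [← ext_coe, ext_obsOp q F x.2]
  change _ ≤ r x / 2
  -- both integrals are estimated for `y ≥ 1/2`
  have key : ∀ y ∈ Icc (1 / 2 : ℝ) 1, |∫ z in y..1, kern q z x * ext F z| ≤ r y / 4 ∧
      |∫ z in (0 : ℝ)..1 - y, kern q z x * ext F z| ≤ r y / 4 := by
    intro y hy
    have hb : ∀ z ∈ Icc (0 : ℝ) 1, ‖kern q z x * ext F z‖ ≤ C * r z := fun z hz => by
      rw [norm_mul, ext_of_mem F hz]
      exact mul_le_mul (hC z hz x x.2) (hF ⟨z, hz⟩) (abs_nonneg _) hC0.le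
    have hry : r y = Real.exp (-s * (y - 1 / 2)) := by
      simp only [r]; rw [abs_of_nonneg (by linarith [hy.1])]
    have hp := Real.exp_pos (-s * (1 / 2))
    constructor
    · have h1 : ‖∫ z in y..1, kern q z x * ext F z‖ ≤ ∫ z in y..1, C * Real.exp (-s * (z - 1 / 2)) := by
        refine intervalIntegral.norm_integral_le_of_norm_le hy.2
          (ae_of_all _ fun z hz => ?_) (Continuous.intervalIntegrable (by fun_prop) _ _)
        have hz0 : 1 / 2 ≤ z := hy.1.trans hz.1.le
        refine (hb z ⟨by linarith, hz.2⟩).trans_eq ?_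
        simp only [r]; rw [abs_of_nonneg (by linarith)]
      refine h1.trans ?_
      have hd : ∀ z, HasDerivAt (fun z => -(C / s) * Real.exp (-s * (z - 1 / 2)))
          (C * Real.exp (-s * (z - 1 / 2))) z := fun z => by
        have h1 : HasDerivAt (fun z : ℝ => -s * (z - 1 / 2)) (-s * 1) z :=
          ((hasDerivAt_id z).sub_const _).const_mul _
        refine (h1.exp.const_mul (-(C / s))).congr_deriv ?_
        field_simp
      rw [intervalIntegral.integral_eq_sub_of_hasDerivAt (fun z _ => hd z)
        (Continuous.intervalIntegrable (by fun_prop) _ _), hry]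
      have hCs : C / s = 1 / 4 := by rw [hs]; field_simp
      rw [hCs]
      have := Real.exp_pos (-s * (1 - 1 / 2))
      linarith
    · have h1 : ‖∫ z in (0 : ℝ)..1 - y, kern q z x * ext F z‖
          ≤ ∫ z in (0 : ℝ)..1 - y, C * Real.exp (s * (z - 1 / 2)) := by
        refine intervalIntegral.norm_integral_le_of_norm_le (by linarith [hy.2])
          (ae_of_all _ fun z hz => ?_) (Continuous.intervalIntegrable (by fun_prop) _ _)
        have hz0 : z ≤ 1 / 2 := hz.2.trans (by linarith [hy.1])
        refine (hb z ⟨hz.1.le, by linarith⟩).trans_eq ?_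
        simp only [r]; rw [abs_of_nonpos (by linarith)]
        ring_nf
      refine h1.trans ?_
      have hd : ∀ z, HasDerivAt (fun z => (C / s) * Real.exp (s * (z - 1 / 2)))
          (C * Real.exp (s * (z - 1 / 2))) z := fun z => by
        have h1 : HasDerivAt (fun z : ℝ => s * (z - 1 / 2)) (s * 1) z :=
          ((hasDerivAt_id z).sub_const _).const_mul _
        refine (h1.exp.const_mul (C / s)).congr_deriv ?_
        field_simp
      rw [intervalIntegral.integral_eq_sub_of_hasDerivAt (fun z _ => hd z)
        (Continuous.intervalIntegrable (by fun_prop) _ _), hry]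
      have hCs : C / s = 1 / 4 := by rw [hs]; field_simp
      rw [hCs, show s * (1 - y - 1 / 2) = -s * (y - 1 / 2) by ring]
      have := Real.exp_pos (s * (0 - 1 / 2))
      linarith
  have hi : ∀ a b, IntervalIntegrable (fun z => kern q z x * ext F z) volume a b := fun a b => by
    have := continuous_kern q
    exact Continuous.intervalIntegrable (by fun_prop) _ _
  rcases le_total (1 / 2) (x : ℝ) with hx | hx
  · obtain ⟨k1, k2⟩ := key x ⟨hx, x.2.2⟩
    refine (abs_sub _ _).trans ?_
    linarith
  · obtain ⟨k1, k2⟩ := key (1 - x) ⟨by linarith, by linarith [x.2.1]⟩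
    have hrr : r (1 - x) = r x := by
      simp only [r]
      rw [show (1 - x - 1 / 2 : ℝ) = -(x - 1 / 2) by ring, abs_neg]
    rw [sub_sub_cancel] at k2
    rw [hrr] at k1 k2
    -- For x ≤ 1/2 the two integrals overlap on [x,1-x], where they cancel; what remains are the
    -- tails belonging to the reflected point 1-x.
    have e : (∫ y in (x : ℝ)..1, kern q y x * ext F y) - ∫ y in (0 : ℝ)..1 - x, kern q y x * ext F y
        = (∫ y in (1 - x : ℝ)..1, kern q y x * ext F y) - ∫ y in (0 : ℝ)..x, kern q y x * ext F y := by
      rw [← intervalIntegral.integral_add_adjacent_intervals (hi x (1 - x)) (hi (1 - x) 1),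
        ← intervalIntegral.integral_add_adjacent_intervals (hi 0 x) (hi x (1 - x))]
      ring
    rw [e]
    refine (abs_sub _ _).trans ?_
    linarith

/-! ### Parseval's identity for cosine and sine series on `[0,1]` -/

/-- Parseval's identity for the extension `G` of `f` to `[-1,1]` of parity `s = ±1`. -/
theorem parseval_symm {f : ℝ → ℝ} (hf : L2I f) (s : ℝ) (hs : s ^ 2 = 1) :
    HasSum (fun n : ℤ => ‖(1 / 2 : ℂ) * ∫ x in (0 : ℝ)..1,
        (Complex.exp (-(n * Real.pi * x * Complex.I)) + s * Complex.exp (n * Real.pi * x * Complex.I))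
          * f x‖ ^ 2) (∫ x in (0 : ℝ)..1, f x ^ 2) := by
  set F : ℝ → ℝ := (Icc (0 : ℝ) 1).indicator f with hF
  have hFm : MemLp F 2 volume := (memLp_indicator_iff_restrict measurableSet_Icc).2 hf
  have hFn : MemLp (fun x => F (-x)) 2 volume :=
    hFm.comp_measurePreserving (Measure.measurePreserving_neg volume)
  -- At x = 0 both summands are present and G may differ from the extension; all identities are
  -- therefore stated on (0,1] and used almost everywhere.
  set G : ℝ → ℝ := fun x => F x + s * F (-x) with hG
  have hGm : MemLp G 2 volume := hFm.add (hFn.const_mul s)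
  have hGc : MemLp (fun x => (G x : ℂ)) 2 (volume.restrict (Ioc (-1 : ℝ) 1)) := by
    have := hGm.ofReal (K := ℂ)
    exact this.restrict _
  have h11 : (-1 : ℝ) < 1 := by norm_num
  have hpos : ∀ x ∈ Ioc (0 : ℝ) 1, G x = f x := fun x hx => by
    simp only [hG, hF]
    rw [indicator_of_mem (Ioc_subset_Icc_self hx), indicator_of_notMem, mul_zero, add_zero]
    simp [hx.1]
  have hneg : ∀ x ∈ Ioc (0 : ℝ) 1, G (-x) = s * f x := fun x hx => by
    simp only [hG, hF, neg_neg]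
    rw [indicator_of_mem (s := Icc (0 : ℝ) 1) (a := x) (Ioc_subset_Icc_self hx),
      indicator_of_notMem, zero_add]
    simp [hx.1]
  have hGi : MemLp (fun x => (G x : ℂ)) 2 volume := hGm.ofReal (K := ℂ)
  have split : ∀ h : ℝ → ℂ, (∀ a b, IntervalIntegrable h volume a b) →
      ∫ x in (-1 : ℝ)..1, h x = ∫ x in (0 : ℝ)..1, (h x + h (-x)) := fun h hh => by
    have hh' : IntervalIntegrable (fun x => h (-x)) volume 0 1 := by
      have := (IntervalIntegrable.iff_comp_neg (by simp)).1 (hh 0 (-1))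
      simpa using this
    rw [intervalIntegral.integral_add (hh 0 1) hh',
      ← intervalIntegral.integral_add_adjacent_intervals (hh (-1) 0) (hh 0 1),
      intervalIntegral.integral_comp_neg (fun x => h x), neg_zero, add_comm]
  have key := hasSum_sq_fourierCoeffOn h11 hGc
  convert key using 1
  · funext n
    congr 2
    rw [fourierCoeffOn_eq_integral, split]
    · rw [Complex.real_smul, show ((1 / (1 - -1) : ℝ) : ℂ) = 1 / 2 by norm_num]
      congr 1
      refine intervalIntegral.integral_congr_ae (ae_of_all _ fun x hx => ?_)
      rw [uIoc_of_le zero_le_one] at hx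
      rw [hpos x hx, hneg x hx, fourier_coe_apply, fourier_coe_apply]
      have e1 : 2 * (Real.pi : ℂ) * Complex.I * ((-n : ℤ) : ℂ) * (x : ℂ) / ((1 - -1 : ℝ) : ℂ)
          = -(n * Real.pi * x * Complex.I) := by push_cast; ring
      have e2 : 2 * (Real.pi : ℂ) * Complex.I * ((-n : ℤ) : ℂ) * ((-x : ℝ) : ℂ) / ((1 - -1 : ℝ) : ℂ)
          = n * Real.pi * x * Complex.I := by push_cast; ring
      rw [e1, e2]
      simp only [smul_eq_mul]
      push_cast
      ring
    · intro a b
      have hGab : IntervalIntegrable (fun x => (G x : ℂ)) volume a b := by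
        rw [intervalIntegrable_iff]
        have : IsFiniteMeasure (volume.restrict (uIoc a b)) :=
          ⟨by rw [Measure.restrict_apply_univ, uIoc]; exact measure_Ioc_lt_top⟩
        exact (hGi.restrict (uIoc a b)).integrable (by norm_num)
      have hc : Continuous fun x : ℝ => fourier (-n) (x : AddCircle (1 - -1 : ℝ)) :=
        (fourier (-n)).continuous.comp (AddCircle.continuous_mk' _)
      exact hGab.continuousOn_smul hc.continuousOn
  · have hsq : ∀ a b, IntervalIntegrable (fun x => ((G x ^ 2 : ℝ) : ℂ)) volume a b := fun a b => by
      rw [intervalIntegrable_iff]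
      exact (hGm.integrable_sq.ofReal).integrableOn
    have h2 := split _ hsq
    have h3 : ∫ x in (-1 : ℝ)..1, G x ^ 2 = 2 * ∫ x in (0 : ℝ)..1, f x ^ 2 := by
      have h4 : ∫ x in (0 : ℝ)..1, (((G x ^ 2 : ℝ) : ℂ) + ((G (-x) ^ 2 : ℝ) : ℂ))
          = ((2 * ∫ x in (0 : ℝ)..1, f x ^ 2 : ℝ) : ℂ) := by
        rw [← intervalIntegral.integral_const_mul, ← intervalIntegral.integral_ofReal]
        refine intervalIntegral.integral_congr_ae (ae_of_all _ fun x hx => ?_)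
        rw [uIoc_of_le zero_le_one] at hx
        rw [hpos x hx, hneg x hx, mul_pow, hs]
        push_cast
        ring
      rw [h4, intervalIntegral.integral_ofReal] at h2
      exact_mod_cast h2
    simp only [Complex.norm_real, Real.norm_eq_abs, sq_abs]
    rw [h3, smul_eq_mul]
    ring

/-- Parseval's identity for cosine series, with frequencies in `ℤ`. -/
theorem parseval_cos {f : ℝ → ℝ} (hf : L2I f) :
    HasSum (fun n : ℤ => (∫ x in (0 : ℝ)..1, f x * Real.cos (n * Real.pi * x)) ^ 2)
      (∫ x in (0 : ℝ)..1, f x ^ 2) := by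
  convert parseval_symm hf 1 (by norm_num) using 1
  funext n
  have : (1 / 2 : ℂ) * ∫ x in (0 : ℝ)..1,
        (Complex.exp (-(n * Real.pi * x * Complex.I)) + (1 : ℝ) * Complex.exp (n * Real.pi * x * Complex.I))
          * f x = ((∫ x in (0 : ℝ)..1, f x * Real.cos (n * Real.pi * x) : ℝ) : ℂ) := by
    rw [← intervalIntegral.integral_const_mul, ← intervalIntegral.integral_ofReal]
    refine intervalIntegral.integral_congr fun x _ => ?_
    push_cast
    rw [Complex.cos]
    ring_nf
  rw [this, Complex.norm_real, Real.norm_eq_abs, sq_abs]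

/-- Parseval's identity for sine series, with frequencies in `ℤ`. -/
theorem parseval_sin {f : ℝ → ℝ} (hf : L2I f) :
    HasSum (fun n : ℤ => (∫ x in (0 : ℝ)..1, f x * Real.sin (n * Real.pi * x)) ^ 2)
      (∫ x in (0 : ℝ)..1, f x ^ 2) := by
  convert parseval_symm hf (-1) (by norm_num) using 1
  funext n
  have : (1 / 2 : ℂ) * ∫ x in (0 : ℝ)..1,
        (Complex.exp (-(n * Real.pi * x * Complex.I)) + (-1 : ℝ) * Complex.exp (n * Real.pi * x * Complex.I))
          * f x = -Complex.I * ((∫ x in (0 : ℝ)..1, f x * Real.sin (n * Real.pi * x) : ℝ) : ℂ) := by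
    rw [← intervalIntegral.integral_ofReal, ← intervalIntegral.integral_const_mul,
      ← intervalIntegral.integral_const_mul]
    refine intervalIntegral.integral_congr fun x _ => ?_
    push_cast
    rw [Complex.sin]
    have := Complex.I_sq
    ring_nf
    rw [this]
    ring
  rw [this, norm_mul, norm_neg, Complex.norm_I, one_mul, Complex.norm_real, Real.norm_eq_abs, sq_abs]

/-! ### The heat equation with Neumann boundary conditions -/

/-- The functional `F ↦ ∫₀¹ g F`. -/
def intFunc (g : ℝ → ℝ) (hg : Continuous g) : CI →L[ℝ] ℝ :=
  ContinuousMap.evalCLM ℝ (⟨0, by simp⟩ : Icc (0 : ℝ) 1) ∘L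
    intOp (fun _ y => g y) (by fun_prop) (fun _ => 0) (fun _ => 1) (by fun_prop) (by fun_prop)

theorem intFunc_apply (g : ℝ → ℝ) (hg : Continuous g) (F : CI) :
    intFunc g hg F = ∫ y in (0 : ℝ)..1, g y * ext F y := rfl

/-- `cos (n π x)`. -/
def cosMode (n : ℤ) : CI := ⟨fun x => Real.cos (n * Real.pi * x), by fun_prop⟩

/-- `sin (n π x)`. -/
def sinMode (n : ℤ) : CI := ⟨fun x => Real.sin (n * Real.pi * x), by fun_prop⟩

theorem ext_cosMode (n : ℤ) {x : ℝ} (hx : x ∈ Icc (0 : ℝ) 1) :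
    ext (cosMode n) x = Real.cos (n * Real.pi * x) := ext_of_mem _ hx

theorem ext_sinMode (n : ℤ) {x : ℝ} (hx : x ∈ Icc (0 : ℝ) 1) :
    ext (sinMode n) x = Real.sin (n * Real.pi * x) := ext_of_mem _ hx

theorem norm_cosMode_le (n : ℤ) : ‖cosMode n‖ ≤ 1 :=
  (ContinuousMap.norm_le _ zero_le_one).2 fun _ => Real.abs_cos_le_one _

theorem norm_sinMode_le (n : ℤ) : ‖sinMode n‖ ≤ 1 :=
  (ContinuousMap.norm_le _ zero_le_one).2 fun _ => Real.abs_sin_le_one _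

theorem norm_smul_mode_le {F : CI} (hF : ‖F‖ ≤ 1) {c C : ℝ} (hc : |c| ≤ C) : ‖c • F‖ ≤ C := by
  rw [norm_smul]
  exact (mul_le_of_le_one_right (norm_nonneg _) hF).trans hc

theorem ext_tsum_smul {c : ℤ → ℝ} {F : ℤ → CI} (hF : ∀ n, ‖F n‖ ≤ 1)
    (hc : Summable fun n => |c n|) (x : ℝ) :
    ext (∑' n, c n • F n) x = ∑' n, c n * ext (F n) x := by
  have hs : Summable fun n => c n • F n :=
    Summable.of_norm_bounded hc fun n => norm_smul_mode_le (hF n) le_rfl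
  exact (ContinuousMap.tsum_apply hs _).symm

theorem one_le_w (n : ℤ) : (1 : ℝ) ≤ 1 + (n : ℝ) ^ 2 := by nlinarith [sq_nonneg (n : ℝ)]

theorem summable_inv_w : Summable fun n : ℤ => 1 / (1 + (n : ℝ) ^ 2) := by
  have h1 : Summable fun n : ℤ => 1 / (n : ℝ) ^ 2 :=
    Real.summable_one_div_int_pow.2 (by norm_num)
  have h2 : Summable fun n : ℤ => if n = 0 then (1 : ℝ) else 0 :=
    summable_of_ne_finset_zero (s := {0}) fun n hn => by simp_all
  refine Summable.of_nonneg_of_le (fun n => by positivity) (fun n => ?_) (h1.add h2)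
  by_cases hn : n = 0
  · simp [hn]
  · have : (0 : ℝ) < (n : ℝ) ^ 2 := by positivity
    simp only [hn, if_false, add_zero]
    exact one_div_le_one_div_of_le this (by linarith)

/-- Cauchy–Schwarz: (1+|n|)|bₙ| is the product of (1+n²)|bₙ| and (1+|n|)/(1+n²), both square
summable. Thus H² cosine coefficients give an absolutely convergent series for the function and its
first derivative. -/
theorem summable_weighted {b : ℤ → ℝ} (hb : Summable fun n : ℤ => ((1 + (n : ℝ) ^ 2) * b n) ^ 2) :
    Summable fun n : ℤ => (1 + |(n : ℝ)|) * |b n| := by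
  refine Summable.of_nonneg_of_le (fun n => by positivity) (fun n => ?_)
    (hb.add (summable_inv_w.mul_left 2))
  have hw : 0 < 1 + (n : ℝ) ^ 2 := by positivity
  set w := 1 + (n : ℝ) ^ 2 with hwd
  have h1 : (1 + |(n : ℝ)|) ^ 2 ≤ 2 * w := by nlinarith [sq_nonneg (1 - |(n : ℝ)|), sq_abs (n : ℝ)]
  have h2 : (1 + |(n : ℝ)|) * |b n| = (w * |b n|) * ((1 + |(n : ℝ)|) / w) := by field_simp
  have h3 : ((1 + |(n : ℝ)|) / w) ^ 2 ≤ 2 * (1 / w) := by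
    rw [div_pow, div_le_iff₀ (by positivity)]
    calc _ ≤ 2 * w := h1
      _ = _ := by field_simp
  have h4 : (w * b n) ^ 2 = (w * |b n|) ^ 2 := by rw [mul_pow, mul_pow, sq_abs]
  rw [h2, h4]
  nlinarith [sq_nonneg (w * |b n| - (1 + |(n : ℝ)|) / w), sq_nonneg ((1 + |(n : ℝ)|) / w),
    sq_nonneg (w * |b n|)]

/-! ### Modal coefficients given by Duhamel's formula, and their bounds -/

/-- The decay rate of the `n`-th mode. -/
def rate (ε κ : ℝ) (n : ℤ) : ℝ := ε * (n * Real.pi) ^ 2 + κ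

/-- The `n`-th coefficient of the solution. -/
def heatCoef (ε κ : ℝ) (a : ℤ → ℝ) (f : ℤ → ℝ → ℝ) (n : ℤ) (t : ℝ) : ℝ :=
  Real.exp (-rate ε κ n * t) * (a n + ∫ s in (0 : ℝ)..t, Real.exp (rate ε κ n * s) * f n s)

theorem hasDerivAt_heatCoef (ε κ : ℝ) (a : ℤ → ℝ) {f : ℤ → ℝ → ℝ} (n : ℤ) (hf : Continuous (f n))
    (t : ℝ) : HasDerivAt (heatCoef ε κ a f n) (-rate ε κ n * heatCoef ε κ a f n t + f n t) t := by
  have h1 : HasDerivAt (fun t => Real.exp (-rate ε κ n * t))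
      (Real.exp (-rate ε κ n * t) * (-rate ε κ n * 1)) t :=
    ((hasDerivAt_id t).const_mul (-rate ε κ n)).exp
  have hc : Continuous fun s => Real.exp (rate ε κ n * s) * f n s := by fun_prop
  have h2 := (hc.integral_hasStrictDerivAt 0 t).hasDerivAt.const_add (a n)
  refine (h1.mul h2).congr_deriv ?_
  have : Real.exp (-rate ε κ n * t) * Real.exp (rate ε κ n * t) = 1 := by
    rw [← Real.exp_add]; simp
  unfold heatCoef
  linear_combination f n t * this

theorem continuous_heatCoef (ε κ : ℝ) (a : ℤ → ℝ) {f : ℤ → ℝ → ℝ} (n : ℤ) (hf : Continuous (f n)) :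
    Continuous (heatCoef ε κ a f n) :=
  continuous_iff_continuousAt.2 fun t => (hasDerivAt_heatCoef ε κ a n hf t).continuousAt

theorem heatCoef_zero (ε κ : ℝ) (a : ℤ → ℝ) (f : ℤ → ℝ → ℝ) (n : ℤ) :
    heatCoef ε κ a f n 0 = a n := by simp [heatCoef]

/-- Admissible data: `H²` initial coefficients and an exponentially decaying forcing. -/
structure HeatData (ε κ δ A : ℝ) (a : ℤ → ℝ) (f : ℤ → ℝ → ℝ) : Prop where
  hε : 0 < ε
  hδ : 0 < δ
  hδκ : δ < κ
  hA : 0 ≤ A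
  ha : Summable fun n : ℤ => ((1 + (n : ℝ) ^ 2) * a n) ^ 2
  a_even : ∀ n, a (-n) = a n
  hf : ∀ n, Continuous (f n)
  f_even : ∀ n t, f (-n) t = f n t
  f_bound : ∀ n t, 0 ≤ t → |f n t| ≤ A * Real.exp (-δ * t) / (1 + (n : ℝ) ^ 2)

/-- The ellipticity constant in `rate n - δ ≥ ellip * (1 + n²)`. -/
def ellip (ε κ δ : ℝ) : ℝ := min ε (κ - δ)

theorem ellip_pos {ε κ δ : ℝ} (hε : 0 < ε) (hδκ : δ < κ) : 0 < ellip ε κ δ :=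
  lt_min hε (sub_pos.2 hδκ)

/-- The diffusion carries the n² part, and κ - δ > 0 carries the mode n = 0, on which diffusion
gives nothing. -/
theorem ellip_mul_le {ε κ δ : ℝ} (hε : 0 < ε) (n : ℤ) :
    ellip ε κ δ * (1 + (n : ℝ) ^ 2) ≤ rate ε κ n - δ := by
  have h1 : ellip ε κ δ ≤ ε := min_le_left _ _
  have h2 : ellip ε κ δ ≤ κ - δ := min_le_right _ _
  have h3 : (n : ℝ) ^ 2 ≤ (n * Real.pi) ^ 2 := by
    rw [mul_pow]
    have : (1 : ℝ) ≤ Real.pi ^ 2 := by nlinarith [Real.pi_gt_three]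
    nlinarith [sq_nonneg (n : ℝ)]
  unfold rate
  nlinarith [sq_nonneg (n : ℝ)]

namespace HeatData

variable {ε κ δ A : ℝ} {a : ℤ → ℝ} {f : ℤ → ℝ → ℝ}

/-- In Duhamel's integral one power of 1 + n² comes from the forcing and a second one from
integrating e^{(rate-δ)s}. The initial coefficient keeps its own fast exponential, which is the
source of smoothing for t > 0. -/
theorem coef_bound_sharp (h : HeatData ε κ δ A a f) (n : ℤ) {t : ℝ} (ht : 0 ≤ t) :
    |heatCoef ε κ a f n t| ≤ Real.exp (-rate ε κ n * t) * |a n|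
      + Real.exp (-δ * t) * (A / (ellip ε κ δ * (1 + (n : ℝ) ^ 2) ^ 2)) := by
  have hr0 := ellip_pos h.hε h.hδκ
  have hrn := ellip_mul_le (κ := κ) (δ := δ) h.hε n
  have hw : 0 < 1 + (n : ℝ) ^ 2 := by positivity
  set r := rate ε κ n
  set w := 1 + (n : ℝ) ^ 2
  have hrd : 0 < r - δ := lt_of_lt_of_le (by positivity) hrn
  have h1 : ‖∫ s in (0 : ℝ)..t, Real.exp (r * s) * f n s‖
      ≤ ∫ s in (0 : ℝ)..t, A / w * Real.exp ((r - δ) * s) := by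
    refine intervalIntegral.norm_integral_le_of_norm_le ht (ae_of_all _ fun s hs => ?_)
      (Continuous.intervalIntegrable (μ := volume) (u := fun s => A / w * Real.exp ((r - δ) * s))
        (by fun_prop) _ _)
    rw [norm_mul, Real.norm_eq_abs, abs_of_pos (Real.exp_pos _)]
    refine (mul_le_mul_of_nonneg_left (h.f_bound n s hs.1.le) (Real.exp_pos _).le).trans_eq ?_
    rw [show (r - δ) * s = r * s + -δ * s by ring, Real.exp_add]
    ring
  have hd : ∀ s, HasDerivAt (fun s => A / w / (r - δ) * Real.exp ((r - δ) * s))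
      (A / w * Real.exp ((r - δ) * s)) s := fun s => by
    refine ((((hasDerivAt_id s).const_mul (r - δ)).exp).const_mul (A / w / (r - δ))).congr_deriv ?_
    simp only [id]
    field_simp
  rw [intervalIntegral.integral_eq_sub_of_hasDerivAt (fun s _ => hd s)
    (Continuous.intervalIntegrable (by fun_prop) _ _), Real.norm_eq_abs] at h1
  have hAw : 0 ≤ A / w / (r - δ) := div_nonneg (div_nonneg h.hA hw.le) hrd.le
  have h2 : A / w / (r - δ) ≤ A / (ellip ε κ δ * w ^ 2) := by
    rw [div_div]
    refine div_le_div_of_nonneg_left h.hA (by positivity) ?_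
    nlinarith
  unfold heatCoef
  rw [abs_mul, abs_of_pos (Real.exp_pos _)]
  have h3 : Real.exp (-r * t) * Real.exp ((r - δ) * t) = Real.exp (-δ * t) := by
    rw [← Real.exp_add]; ring_nf
  have h4 : |a n + ∫ s in (0 : ℝ)..t, Real.exp (r * s) * f n s|
      ≤ |a n| + A / w / (r - δ) * Real.exp ((r - δ) * t) := by
    refine (abs_add_le _ _).trans ?_
    have := Real.exp_pos ((r - δ) * 0)
    nlinarith
  have hE := Real.exp_pos (-r * t)
  calc _ ≤ Real.exp (-r * t) * (|a n| + A / w / (r - δ) * Real.exp ((r - δ) * t)) :=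
        mul_le_mul_of_nonneg_left h4 hE.le
    _ = Real.exp (-r * t) * |a n| + Real.exp (-δ * t) * (A / w / (r - δ)) := by
        rw [← h3]; ring
    _ ≤ _ := by
        have := mul_le_mul_of_nonneg_left h2 (Real.exp_pos (-δ * t)).le
        linarith

/-- A bound of the coefficients, uniform in time. -/
def maj (ε κ δ A : ℝ) (a : ℤ → ℝ) (n : ℤ) : ℝ :=
  |a n| + A / (ellip ε κ δ * (1 + (n : ℝ) ^ 2) ^ 2)

theorem maj_nonneg (h : HeatData ε κ δ A a f) (n : ℤ) : 0 ≤ maj ε κ δ A a n :=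
  add_nonneg (abs_nonneg _)
    (div_nonneg h.hA (mul_nonneg (ellip_pos h.hε h.hδκ).le (sq_nonneg _)))

theorem coef_bound (h : HeatData ε κ δ A a f) (n : ℤ) {t : ℝ} (ht : 0 ≤ t) :
    |heatCoef ε κ a f n t| ≤ Real.exp (-δ * t) * maj ε κ δ A a n := by
  refine (h.coef_bound_sharp n ht).trans ?_
  have h1 : Real.exp (-rate ε κ n * t) ≤ Real.exp (-δ * t) := by
    refine Real.exp_le_exp.2 ?_
    have hrn := ellip_mul_le (κ := κ) (δ := δ) h.hε n
    have := ellip_pos h.hε h.hδκ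
    have : 0 ≤ ellip ε κ δ * (1 + (n : ℝ) ^ 2) := by positivity
    nlinarith
  rw [maj, mul_add]
  have := mul_le_mul_of_nonneg_right h1 (abs_nonneg (a n))
  linarith

theorem coef_bound' (h : HeatData ε κ δ A a f) (n : ℤ) {t : ℝ} (ht : 0 ≤ t) :
    |heatCoef ε κ a f n t| ≤ maj ε κ δ A a n := by
  refine (h.coef_bound n ht).trans (mul_le_of_le_one_left (h.maj_nonneg n) ?_)
  exact Real.exp_le_one_iff.2 (by nlinarith [h.hδ])

theorem summable_maj_sq (h : HeatData ε κ δ A a f) :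
    Summable fun n : ℤ => ((1 + (n : ℝ) ^ 2) * maj ε κ δ A a n) ^ 2 := by
  have hr0 := ellip_pos h.hε h.hδκ
  refine Summable.of_nonneg_of_le (fun n => sq_nonneg _) (fun n => ?_)
    ((h.ha.mul_left 2).add (summable_inv_w.mul_left (2 * (A / ellip ε κ δ) ^ 2)))
  have hw : 1 ≤ 1 + (n : ℝ) ^ 2 := one_le_w n
  set w := 1 + (n : ℝ) ^ 2
  have e1 : w * maj ε κ δ A a n = w * |a n| + A / ellip ε κ δ / w := by
    unfold maj
    have : 0 < w := by linarith
    change w * (|a n| + A / (ellip ε κ δ * w ^ 2)) = _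
    field_simp
  have e2 : (w * a n) ^ 2 = (w * |a n|) ^ 2 := by rw [mul_pow, mul_pow, sq_abs]
  have e3 : (A / ellip ε κ δ / w) ^ 2 ≤ (A / ellip ε κ δ) ^ 2 * (1 / w) := by
    rw [div_pow, div_eq_mul_one_div]
    refine mul_le_mul_of_nonneg_left ?_ (sq_nonneg _)
    exact one_div_le_one_div_of_le (by linarith) (by nlinarith)
  rw [e1, e2]
  nlinarith [sq_nonneg (w * |a n| - A / ellip ε κ δ / w)]

theorem summable_maj (h : HeatData ε κ δ A a f) :
    Summable fun n : ℤ => (1 + |(n : ℝ)|) * maj ε κ δ A a n :=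
  (summable_weighted h.summable_maj_sq).congr fun n => by rw [abs_of_nonneg (h.maj_nonneg n)]

/-- A bound of `(1 + n²) |q_n(t)|` for `t ≥ τ > 0`. -/
def maj2 (ε κ δ A τ : ℝ) (a : ℤ → ℝ) (n : ℤ) : ℝ :=
  (1 + (n : ℝ) ^ 2) * |a n| * Real.exp (-rate ε κ n * τ) + A / (ellip ε κ δ * (1 + (n : ℝ) ^ 2))

theorem coef_bound2 (h : HeatData ε κ δ A a f) (n : ℤ) {τ t : ℝ} (hτ : 0 < τ) (ht : τ ≤ t) :
    (1 + (n : ℝ) ^ 2) * |heatCoef ε κ a f n t| ≤ maj2 ε κ δ A τ a n := by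
  have hw : 0 < 1 + (n : ℝ) ^ 2 := by positivity
  have hr0 := ellip_pos h.hε h.hδκ
  have h1 := mul_le_mul_of_nonneg_left (h.coef_bound_sharp n (hτ.le.trans ht)) hw.le
  refine h1.trans ?_
  have hr : 0 ≤ rate ε κ n := by
    have hrn := ellip_mul_le (κ := κ) (δ := δ) h.hε n
    have : 0 ≤ ellip ε κ δ * (1 + (n : ℝ) ^ 2) := by positivity
    linarith [h.hδ]
  have h2 : Real.exp (-rate ε κ n * t) ≤ Real.exp (-rate ε κ n * τ) :=
    Real.exp_le_exp.2 (by nlinarith)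
  have h3 : Real.exp (-δ * t) ≤ 1 := Real.exp_le_one_iff.2 (by nlinarith [h.hδ])
  have hq : 0 ≤ A / (ellip ε κ δ * (1 + (n : ℝ) ^ 2) ^ 2) :=
    div_nonneg h.hA (by positivity)
  have e : A / (ellip ε κ δ * (1 + (n : ℝ) ^ 2))
      = (1 + (n : ℝ) ^ 2) * (A / (ellip ε κ δ * (1 + (n : ℝ) ^ 2) ^ 2)) := by field_simp
  rw [maj2, mul_add, e]
  refine add_le_add ?_ (mul_le_mul_of_nonneg_left (mul_le_of_le_one_left hq h3) hw.le)
  have := mul_le_mul_of_nonneg_left h2 (mul_nonneg hw.le (abs_nonneg (a n)))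
  linarith

/-- Parabolic smoothing: at times t ≥ τ > 0 the coefficients of the second derivative are absolutely
summable, whereas H² initial data make them only square summable. -/
theorem summable_maj2 (h : HeatData ε κ δ A a f) {τ : ℝ} (hτ : 0 < τ) :
    Summable (maj2 ε κ δ A τ a) := by
  have hr0 := ellip_pos h.hε h.hδκ
  refine Summable.of_nonneg_of_le (fun n => ?_) (fun n => ?_)
    (h.ha.add (summable_inv_w.mul_left (1 / (2 * ellip ε κ δ * τ) + A / ellip ε κ δ)))
  · exact add_nonneg (by positivity) (div_nonneg h.hA (by positivity))
  · have hw : 0 < 1 + (n : ℝ) ^ 2 := by positivity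
    have hrn := ellip_mul_le (κ := κ) (δ := δ) h.hε n
    unfold maj2
    set w := 1 + (n : ℝ) ^ 2
    set E := Real.exp (-rate ε κ n * τ)
    -- From e^y ≥ 1 + y. The square of the exponential is thus summable, and AM–GM pairs it with the
    -- square summable initial coefficients.
    have hE2 : E ^ 2 ≤ 1 / (2 * ellip ε κ δ * τ) * (1 / w) := by
      have h1 : E ^ 2 = Real.exp (-(2 * (rate ε κ n * τ))) := by
        rw [← Real.exp_nat_mul]; congr 1; push_cast; ring
      have hx : 0 < 2 * ellip ε κ δ * τ * w := by positivity
      have h2 : 2 * ellip ε κ δ * τ * w ≤ 2 * (rate ε κ n * τ) := by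
        nlinarith [h.hδ]
      rw [h1, Real.exp_neg, ← one_div, one_div_mul_one_div]
      refine one_div_le_one_div_of_le hx ?_
      linarith [Real.add_one_le_exp (2 * (rate ε κ n * τ))]
    have e2 : (w * a n) ^ 2 = (w * |a n|) ^ 2 := by rw [mul_pow, mul_pow, sq_abs]
    have e3 : A / (ellip ε κ δ * w) = A / ellip ε κ δ * (1 / w) := by field_simp
    rw [e2, e3]
    nlinarith [sq_nonneg (w * |a n| - E), sq_nonneg E, sq_nonneg (w * |a n|)]

end HeatData

/-- Regularity of a curve in `C([0,1])` with space derivatives `Z1`, `Z2` and time derivative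
`Zt`: the curve and `Z1` are continuous for `t ≥ 0`, the other derivatives for `t > 0`. -/
structure ParaCurve (Z Z1 Z2 Zt : ℝ → CI) : Prop where
  cont : ContinuousOn Z (Ici 0)
  cont1 : ContinuousOn Z1 (Ici 0)
  cont2 : ContinuousOn Z2 (Ioi 0)
  contt : ContinuousOn Zt (Ioi 0)
  d1 : ∀ t, 0 ≤ t → ∀ x ∈ Icc (0 : ℝ) 1,
    HasDerivWithinAt (ext (Z t)) (ext (Z1 t) x) (Icc 0 1) x
  d2 : ∀ t, 0 < t → ∀ x ∈ Icc (0 : ℝ) 1,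
    HasDerivWithinAt (ext (Z1 t)) (ext (Z2 t) x) (Icc 0 1) x
  dt : ∀ t, 0 < t → HasDerivAt Z (Zt t) t

theorem ParaCurve.isC2 {Z Z1 Z2 Zt : ℝ → CI} (h : ParaCurve Z Z1 Z2 Zt) {t : ℝ} (ht : 0 < t) :
    IsC2 (Z t) (Z1 t) (Z2 t) := ⟨h.d1 t ht.le, h.d2 t ht⟩

theorem continuousOn_Ioi_of_Ici {E : Type*} [TopologicalSpace E] {g : ℝ → E}
    (h : ∀ τ, 0 < τ → ContinuousOn g (Ici τ)) : ContinuousOn g (Ioi 0) := fun t ht => by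
  have ht' : 0 < t := ht
  exact ((h (t / 2) (by positivity)).continuousAt (Ici_mem_nhds (by linarith))).continuousWithinAt

/-- Termwise differentiation of a cosine series. -/
theorem hasDeriv_cos_series {c : ℤ → ℝ} (hc : Summable fun n : ℤ => (1 + |(n : ℝ)|) * |c n|) {x : ℝ}
    (hx : x ∈ Icc (0 : ℝ) 1) :
    HasDerivWithinAt (ext (∑' n, c n • cosMode n))
      (ext (∑' n : ℤ, (-(n * Real.pi) * c n) • sinMode n) x) (Icc 0 1) x := by
  have hc0 : Summable fun n => |c n| := Summable.of_nonneg_of_le (fun n => abs_nonneg _)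
    (fun n => le_mul_of_one_le_left (abs_nonneg _) (by simp)) hc
  have hc1 : Summable fun n : ℤ => |-(n * Real.pi) * c n| := by
    refine Summable.of_nonneg_of_le (fun n => abs_nonneg _) (fun n => ?_) (hc.mul_left Real.pi)
    rw [abs_mul, abs_neg, abs_mul, abs_of_pos Real.pi_pos]
    have := mul_nonneg Real.pi_pos.le (abs_nonneg (c n))
    nlinarith
  have h : HasDerivAt (fun x => ∑' n : ℤ, c n * Real.cos (n * Real.pi * x))
      (∑' n : ℤ, -(n * Real.pi) * c n * Real.sin (n * Real.pi * x)) x := by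
    refine hasDerivAt_tsum (𝕜 := ℝ) (F := ℝ) (y₀ := x)
      (g := fun (n : ℤ) x => c n * Real.cos (n * Real.pi * x))
      (g' := fun (n : ℤ) x => -(n * Real.pi) * c n * Real.sin (n * Real.pi * x)) hc1 (fun n y => ?_) (fun n y => ?_) ?_ x
    · have := (((hasDerivAt_id y).const_mul (n * Real.pi)).cos).const_mul (c n)
      refine this.congr_deriv ?_
      simp only [id]
      ring
    · rw [norm_mul]
      exact mul_le_of_le_one_right (norm_nonneg _) (Real.abs_sin_le_one _)
    · refine Summable.of_norm_bounded hc0 fun n => ?_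
      rw [norm_mul]
      exact mul_le_of_le_one_right (norm_nonneg _) (Real.abs_cos_le_one _)
  have e : ∀ y ∈ Icc (0 : ℝ) 1, ext (∑' n, c n • cosMode n) y
      = ∑' n : ℤ, c n * Real.cos (n * Real.pi * y) := fun y hy => by
    rw [ext_tsum_smul norm_cosMode_le hc0]
    simp_rw [ext_cosMode _ hy]
  rw [ext_tsum_smul norm_sinMode_le hc1]
  simp_rw [ext_sinMode _ hx]
  exact h.hasDerivWithinAt.congr e (e x hx)

/-- Termwise differentiation of a sine series. -/
theorem hasDeriv_sin_series {c : ℤ → ℝ} (hc : Summable fun n : ℤ => (1 + (n : ℝ) ^ 2) * |c n|) {x : ℝ}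
    (hx : x ∈ Icc (0 : ℝ) 1) :
    HasDerivWithinAt (ext (∑' n : ℤ, (-(n * Real.pi) * c n) • sinMode n))
      (ext (∑' n : ℤ, (-(n * Real.pi) ^ 2 * c n) • cosMode n) x) (Icc 0 1) x := by
  have hc0 : Summable fun n : ℤ => |-(n * Real.pi) * c n| := by
    refine Summable.of_nonneg_of_le (fun n => abs_nonneg _) (fun n => ?_) (hc.mul_left Real.pi)
    rw [abs_mul, abs_neg, abs_mul, abs_of_pos Real.pi_pos]
    have h1 := mul_nonneg Real.pi_pos.le (abs_nonneg (c n))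
    have h2 : |(n : ℝ)| ≤ 1 + (n : ℝ) ^ 2 := by nlinarith [sq_nonneg (1 - |(n : ℝ)|), sq_abs (n : ℝ)]
    nlinarith
  have hc1 : Summable fun n : ℤ => |-(n * Real.pi) ^ 2 * c n| := by
    refine Summable.of_nonneg_of_le (fun n => abs_nonneg _) (fun n => ?_) (hc.mul_left (Real.pi ^ 2))
    rw [abs_mul, abs_neg, abs_of_nonneg (sq_nonneg _), mul_pow]
    have := mul_nonneg (sq_nonneg Real.pi) (abs_nonneg (c n))
    nlinarith
  have h : HasDerivAt (fun x => ∑' n : ℤ, -(n * Real.pi) * c n * Real.sin (n * Real.pi * x))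
      (∑' n : ℤ, -(n * Real.pi) ^ 2 * c n * Real.cos (n * Real.pi * x)) x := by
    refine hasDerivAt_tsum (𝕜 := ℝ) (F := ℝ) (y₀ := x)
      (g := fun (n : ℤ) x => -(n * Real.pi) * c n * Real.sin (n * Real.pi * x))
      (g' := fun (n : ℤ) x => -(n * Real.pi) ^ 2 * c n * Real.cos (n * Real.pi * x)) hc1 (fun n y => ?_) (fun n y => ?_) ?_ x
    · have := (((hasDerivAt_id y).const_mul (n * Real.pi)).sin).const_mul (-(n * Real.pi) * c n)
      refine this.congr_deriv ?_
      simp only [id]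
      ring
    · rw [norm_mul]
      exact mul_le_of_le_one_right (norm_nonneg _) (Real.abs_cos_le_one _)
    · refine Summable.of_norm_bounded hc0 fun n => ?_
      rw [norm_mul]
      exact mul_le_of_le_one_right (norm_nonneg _) (Real.abs_sin_le_one _)
  have e : ∀ y ∈ Icc (0 : ℝ) 1, ext (∑' n : ℤ, (-(n * Real.pi) * c n) • sinMode n) y
      = ∑' n : ℤ, -(n * Real.pi) * c n * Real.sin (n * Real.pi * y) := fun y hy => by
    rw [ext_tsum_smul norm_sinMode_le hc0]
    simp_rw [ext_sinMode _ hy]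
  rw [ext_tsum_smul norm_cosMode_le hc1]
  simp_rw [ext_cosMode _ hx]
  exact h.hasDerivWithinAt.congr e (e x hx)

/-! ### Orthogonality of the cosine modes and coefficients of derivatives -/

/-- The `m`-th cosine coefficient. -/
def cosFunc (m : ℤ) : CI →L[ℝ] ℝ := intFunc (fun x => Real.cos (m * Real.pi * x)) (by fun_prop)

theorem cosFunc_apply (m : ℤ) (F : CI) :
    cosFunc m F = ∫ x in (0 : ℝ)..1, ext F x * Real.cos (m * Real.pi * x) := by
  simp only [cosFunc, intFunc_apply, mul_comm]

theorem integral_cos_int (k : ℤ) :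
    ∫ x in (0 : ℝ)..1, Real.cos (k * Real.pi * x) = if k = 0 then 1 else 0 := by
  by_cases hk : k = 0
  · simp [hk]
  · have hkp : (k * Real.pi : ℝ) ≠ 0 := mul_ne_zero (by exact_mod_cast hk) Real.pi_ne_zero
    have hd : ∀ x : ℝ, HasDerivAt (fun x => Real.sin (k * Real.pi * x) / (k * Real.pi))
        (Real.cos (k * Real.pi * x)) x := fun x => by
      refine ((((hasDerivAt_id x).const_mul (k * Real.pi)).sin).div_const (k * Real.pi)).congr_deriv ?_
      simp only [id]
      field_simp
    rw [intervalIntegral.integral_eq_sub_of_hasDerivAt (fun x _ => hd x)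
      (Continuous.intervalIntegrable (by fun_prop) _ _)]
    simp [hk, Real.sin_int_mul_pi]

/-- The modes n and -n are the same function, so a coefficient is shared between two indices; for m
= n = 0 both indicators are 1, giving the correct integral 1. An even coefficient sequence is
recovered exactly, see `cosFunc_series`. -/
theorem cosFunc_cosMode (m n : ℤ) :
    cosFunc m (cosMode n) = 1 / 2 * ((if n = m then 1 else 0) + if n = -m then 1 else 0) := by
  have e : ∀ x ∈ uIcc (0 : ℝ) 1, ext (cosMode n) x * Real.cos (m * Real.pi * x)
      = 1 / 2 * (Real.cos ((n - m : ℤ) * Real.pi * x) + Real.cos ((n + m : ℤ) * Real.pi * x)) := by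
    intro x hx
    rw [uIcc_of_le zero_le_one] at hx
    rw [ext_cosMode _ hx]
    have h1 : ((n - m : ℤ) : ℝ) * Real.pi * x = n * Real.pi * x - m * Real.pi * x := by push_cast; ring
    have h2 : ((n + m : ℤ) : ℝ) * Real.pi * x = n * Real.pi * x + m * Real.pi * x := by push_cast; ring
    rw [h1, h2, Real.cos_sub, Real.cos_add]
    ring
  rw [cosFunc_apply, intervalIntegral.integral_congr e, intervalIntegral.integral_const_mul,
    intervalIntegral.integral_add (Continuous.intervalIntegrable (by fun_prop) _ _)
      (Continuous.intervalIntegrable (by fun_prop) _ _), integral_cos_int, integral_cos_int]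
  simp only [sub_eq_zero, add_eq_zero_iff_eq_neg]

theorem cosFunc_series {c : ℤ → ℝ} (hc : Summable fun n => |c n|) (heven : ∀ n, c (-n) = c n) (m : ℤ) :
    cosFunc m (∑' n, c n • cosMode n) = c m := by
  have hs : Summable fun n => c n • cosMode n :=
    Summable.of_norm_bounded hc fun n => norm_smul_mode_le (norm_cosMode_le n) le_rfl
  rw [(cosFunc m).map_tsum hs]
  simp only [map_smul, cosFunc_cosMode, smul_eq_mul]
  have e : ∀ n, c n * (1 / 2 * ((if n = m then (1 : ℝ) else 0) + if n = -m then 1 else 0))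
      = 1 / 2 * (if n = m then c n else 0) + 1 / 2 * (if n = -m then c n else 0) := fun n => by
    split_ifs <;> ring
  simp_rw [e]
  have s1 : ∀ k : ℤ, HasSum (fun n => 1 / 2 * (if n = k then c n else 0)) (1 / 2 * c k) := fun k =>
    by
    have h : (fun n => if n = k then c n else 0) = fun n => if n = k then c k else 0 := by
      funext n; split_ifs with h <;> simp [h]
    refine HasSum.mul_left _ ?_
    rw [h]
    exact hasSum_ite_eq k (c k)
  rw [((s1 m).add (s1 (-m))).tsum_eq, heven]
  ring

/-- Neumann profiles in `H²`: cosine coefficients of the second derivative. -/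
theorem HasH2.cos_coef {f f1 f2 : ℝ → ℝ} (h : HasH2 f f1 f2) (h0 : f1 0 = 0) (h1 : f1 1 = 0)
    (n : ℤ) : ∫ x in (0 : ℝ)..1, f2 x * Real.cos (n * Real.pi * x)
      = -(n * Real.pi) ^ 2 * ∫ x in (0 : ℝ)..1, f x * Real.cos (n * Real.pi * x) := by
  have hcos : ∀ x : ℝ, HasDerivAt (fun x => Real.cos (n * Real.pi * x))
      (-(n * Real.pi) * Real.sin (n * Real.pi * x)) x := fun x => by
    refine (((hasDerivAt_id x).const_mul (n * Real.pi)).cos).congr_deriv ?_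
    simp only [id]; ring
  have hsin : ∀ x : ℝ, HasDerivAt (fun x => Real.sin (n * Real.pi * x))
      ((n * Real.pi) * Real.cos (n * Real.pi * x)) x := fun x => by
    refine (((hasDerivAt_id x).const_mul (n * Real.pi)).sin).congr_deriv ?_
    simp only [id]; ring
  -- The product cos(nπx) f is in H² and its derivative vanishes at both ends, by the Neumann
  -- conditions and sin(nπ) = 0. Integrating its weak second derivative over [0,1] gives the
  -- relation between coefficients.
  have hA := h.of_deriv_eq_mul_add (g := fun x => Real.cos (n * Real.pi * x) * f x)
    (p := fun x => Real.cos (n * Real.pi * x)) (p1 := fun x => -(n * Real.pi) * Real.sin (n * Real.pi * x))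
    (q := fun x => -(n * Real.pi) * Real.sin (n * Real.pi * x) * f x)
    (q1 := fun x => -(n * Real.pi) * ((n * Real.pi) * Real.cos (n * Real.pi * x)) * f x
      + -(n * Real.pi) * Real.sin (n * Real.pi * x) * f1 x)
    (fun x hx => ((hcos x).hasDerivWithinAt.mul (h.deriv x hx)).congr_deriv (by ring))
    (fun x _ => (hcos x).hasDerivWithinAt)
    (fun x hx => ((hsin x).const_mul _).hasDerivWithinAt.mul (h.deriv x hx))
    (by fun_prop) (by
      have := h.continuousOn
      have := h.continuousOn_deriv
      fun_prop)
  have hB := hA.eq_integral 1 (by simp)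
  simp only [h0, h1, mul_zero, Real.sin_zero, zero_mul, zero_add, mul_one, Real.sin_int_mul_pi] at hB
  have hC : ∫ x in (0 : ℝ)..1, ((n * Real.pi) * Real.cos (n * Real.pi * x) * f x
      + Real.sin (n * Real.pi * x) * f1 x) = 0 := by
    have hcf := h.continuousOn
    have hcf1 := h.continuousOn_deriv
    have := intervalIntegral.integral_eq_sub_of_hasDerivAt_of_le (a := 0) (b := 1) zero_le_one
      (f := fun x => Real.sin (n * Real.pi * x) * f x)
      (f' := fun x => (n * Real.pi) * Real.cos (n * Real.pi * x) * f x
      + Real.sin (n * Real.pi * x) * f1 x) (by fun_prop)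
      (fun x hx => (hsin x).mul ((h.deriv x (Ioo_subset_Icc_self hx)).hasDerivAt
        (Icc_mem_nhds hx.1 hx.2)))
      (L2I.of_continuousOn (by fun_prop)).integrable
    simpa [Real.sin_int_mul_pi] using this
  have i1 : IntervalIntegrable (fun x => f2 x * Real.cos (n * Real.pi * x)) volume 0 1 :=
    h.memLp.integrable.mul_continuousOn (by fun_prop)
  have i2 : IntervalIntegrable (fun x => f x * Real.cos (n * Real.pi * x)) volume 0 1 :=
    (L2I.of_continuousOn h.continuousOn).integrable.mul_continuousOn (by fun_prop)
  have i3 : IntervalIntegrable (fun x => Real.sin (n * Real.pi * x) * f1 x) volume 0 1 :=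
    (L2I.of_continuousOn h.continuousOn_deriv).integrable.continuousOn_mul (by fun_prop)
  have eC : ∫ x in (0 : ℝ)..1, Real.sin (n * Real.pi * x) * f1 x
      = -(n * Real.pi) * ∫ x in (0 : ℝ)..1, f x * Real.cos (n * Real.pi * x) := by
    have e : ∀ x, (n * Real.pi) * Real.cos (n * Real.pi * x) * f x + Real.sin (n * Real.pi * x) * f1 x
      = (n * Real.pi) * (f x * Real.cos (n * Real.pi * x)) + Real.sin (n * Real.pi * x) * f1 x :=
      fun x => by ring
    simp_rw [e] at hC
    rw [intervalIntegral.integral_add (i2.const_mul _) i3, intervalIntegral.integral_const_mul] at hC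
    linarith
  have e : ∀ x, -(n * Real.pi) * Real.sin (n * Real.pi * x) * f1 x + Real.cos (n * Real.pi * x) * f2 x
      + (-(n * Real.pi) * ((n * Real.pi) * Real.cos (n * Real.pi * x)) * f x
      + -(n * Real.pi) * Real.sin (n * Real.pi * x) * f1 x)
      = f2 x * Real.cos (n * Real.pi * x) + (-(2 * (n * Real.pi)) * (Real.sin (n * Real.pi * x) * f1 x)
      + -(n * Real.pi) ^ 2 * (f x * Real.cos (n * Real.pi * x))) := fun x => by ring
  simp_rw [e] at hB
  rw [intervalIntegral.integral_add i1 ((i3.const_mul _).add (i2.const_mul _)),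
    intervalIntegral.integral_add (i3.const_mul _) (i2.const_mul _),
    intervalIntegral.integral_const_mul, intervalIntegral.integral_const_mul, eC] at hB
  linarith

/-- Sine coefficients of a derivative. -/
theorem sin_coef_deriv {f f1 : ℝ → ℝ}
    (hd : ∀ x ∈ Icc (0 : ℝ) 1, HasDerivWithinAt f (f1 x) (Icc 0 1) x)
    (hc : ContinuousOn f1 (Icc 0 1)) (n : ℤ) :
    ∫ x in (0 : ℝ)..1, f1 x * Real.sin (n * Real.pi * x)
      = -(n * Real.pi) * ∫ x in (0 : ℝ)..1, f x * Real.cos (n * Real.pi * x) := by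
  have hcf : ContinuousOn f (Icc 0 1) := fun x hx => (hd x hx).continuousWithinAt
  have hsin : ∀ x : ℝ, HasDerivAt (fun x => Real.sin (n * Real.pi * x))
      ((n * Real.pi) * Real.cos (n * Real.pi * x)) x := fun x => by
    refine (((hasDerivAt_id x).const_mul (n * Real.pi)).sin).congr_deriv ?_
    simp only [id]; ring
  have := intervalIntegral.integral_eq_sub_of_hasDerivAt_of_le (a := 0) (b := 1) zero_le_one
    (f := fun x => f x * Real.sin (n * Real.pi * x))
    (f' := fun x => f1 x * Real.sin (n * Real.pi * x)
      + f x * ((n * Real.pi) * Real.cos (n * Real.pi * x))) (by fun_prop)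
    (fun x hx => ((hd x (Ioo_subset_Icc_self hx)).hasDerivAt (Icc_mem_nhds hx.1 hx.2)).mul (hsin x))
    (L2I.of_continuousOn (by fun_prop)).integrable
  rw [intervalIntegral.integral_add (L2I.of_continuousOn (by fun_prop)).integrable
    (L2I.of_continuousOn (by fun_prop)).integrable] at this
  simp only [mul_left_comm _ (n * Real.pi : ℝ), intervalIntegral.integral_const_mul] at this
  simp [Real.sin_int_mul_pi] at this
  linarith

/-- The solution of the Neumann heat equation. -/
def heatSol (ε κ : ℝ) (a : ℤ → ℝ) (f : ℤ → ℝ → ℝ) (t : ℝ) : CI :=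
  ∑' n, heatCoef ε κ a f n t • cosMode n

/-- Its first space derivative. -/
def heatSolX (ε κ : ℝ) (a : ℤ → ℝ) (f : ℤ → ℝ → ℝ) (t : ℝ) : CI :=
  ∑' n : ℤ, (-(n * Real.pi) * heatCoef ε κ a f n t) • sinMode n

/-- Its second space derivative. -/
def heatSolXX (ε κ : ℝ) (a : ℤ → ℝ) (f : ℤ → ℝ → ℝ) (t : ℝ) : CI :=
  ∑' n : ℤ, (-(n * Real.pi) ^ 2 * heatCoef ε κ a f n t) • cosMode n

/-- Its time derivative. -/
def heatSolT (ε κ : ℝ) (a : ℤ → ℝ) (f : ℤ → ℝ → ℝ) (t : ℝ) : CI :=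
  ∑' n : ℤ, (-rate ε κ n * heatCoef ε κ a f n t + f n t) • cosMode n

namespace HeatData

variable {ε κ δ A : ℝ} {a : ℤ → ℝ} {f : ℤ → ℝ → ℝ}

theorem summable_maj0 (h : HeatData ε κ δ A a f) : Summable (maj ε κ δ A a) :=
  Summable.of_nonneg_of_le h.maj_nonneg
    (fun n => le_mul_of_one_le_left (h.maj_nonneg n) (by simp)) h.summable_maj

theorem summable_coef (h : HeatData ε κ δ A a f) {t : ℝ} (ht : 0 ≤ t) :
    Summable fun n : ℤ => (1 + |(n : ℝ)|) * |heatCoef ε κ a f n t| :=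
  Summable.of_nonneg_of_le (fun n => by positivity)
    (fun n => mul_le_mul_of_nonneg_left (h.coef_bound' n ht) (by positivity)) h.summable_maj

theorem summable_coef0 (h : HeatData ε κ δ A a f) {t : ℝ} (ht : 0 ≤ t) :
    Summable fun n : ℤ => |heatCoef ε κ a f n t| :=
  Summable.of_nonneg_of_le (fun _ => abs_nonneg _) (fun n => h.coef_bound' n ht) h.summable_maj0

theorem summable_coef2 (h : HeatData ε κ δ A a f) {t : ℝ} (ht : 0 < t) :
    Summable fun n : ℤ => (1 + (n : ℝ) ^ 2) * |heatCoef ε κ a f n t| :=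
  Summable.of_nonneg_of_le (fun n => by positivity) (fun n => h.coef_bound2 n ht le_rfl)
    (h.summable_maj2 ht)

theorem abs_xx_le (n : ℤ) (c : ℝ) :
    |-(n * Real.pi) ^ 2 * c| ≤ Real.pi ^ 2 * ((1 + (n : ℝ) ^ 2) * |c|) := by
  rw [abs_mul, abs_neg, abs_of_nonneg (sq_nonneg _), mul_pow]
  have := mul_nonneg (sq_nonneg Real.pi) (abs_nonneg c)
  nlinarith

theorem abs_x_le (n : ℤ) (c : ℝ) :
    |-(n * Real.pi) * c| ≤ Real.pi * ((1 + |(n : ℝ)|) * |c|) := by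
  rw [abs_mul, abs_neg, abs_mul, abs_of_pos Real.pi_pos]
  have := mul_nonneg Real.pi_pos.le (abs_nonneg c)
  nlinarith

theorem abs_t_le (h : HeatData ε κ δ A a f) (n : ℤ) {τ t : ℝ} (hτ : 0 < τ) (ht : τ ≤ t) :
    |-rate ε κ n * heatCoef ε κ a f n t + f n t|
      ≤ (ε * Real.pi ^ 2 + κ) * maj2 ε κ δ A τ a n + A * (1 / (1 + (n : ℝ) ^ 2)) := by
  have hκ : 0 < κ := h.hδ.trans h.hδκ
  have h1 : |rate ε κ n| ≤ (ε * Real.pi ^ 2 + κ) * (1 + (n : ℝ) ^ 2) := by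
    have hε := h.hε
    rw [rate, abs_of_nonneg (by positivity), mul_pow]
    have : 0 < ε * Real.pi ^ 2 := by positivity
    nlinarith [sq_nonneg (n : ℝ)]
  have h2 := h.coef_bound2 n hτ ht
  have h3 := h.f_bound n t (hτ.le.trans ht)
  have h4 : A * Real.exp (-δ * t) / (1 + (n : ℝ) ^ 2) ≤ A * (1 / (1 + (n : ℝ) ^ 2)) := by
    rw [mul_one_div]
    have : Real.exp (-δ * t) ≤ 1 := Real.exp_le_one_iff.2 (by nlinarith [h.hδ])
    exact div_le_div_of_nonneg_right (mul_le_of_le_one_right h.hA this) (by positivity)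
  refine (abs_add_le _ _).trans (add_le_add ?_ (h3.trans h4))
  rw [abs_mul, abs_neg]
  have hε := h.hε
  calc |rate ε κ n| * |heatCoef ε κ a f n t|
      ≤ (ε * Real.pi ^ 2 + κ) * (1 + (n : ℝ) ^ 2) * |heatCoef ε κ a f n t| :=
        mul_le_mul_of_nonneg_right h1 (abs_nonneg _)
    _ = (ε * Real.pi ^ 2 + κ) * ((1 + (n : ℝ) ^ 2) * |heatCoef ε κ a f n t|) := by ring
    _ ≤ _ := mul_le_mul_of_nonneg_left h2 (by positivity)

theorem summable_t (h : HeatData ε κ δ A a f) {τ : ℝ} (hτ : 0 < τ) : Summable fun n : ℤ =>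
    (ε * Real.pi ^ 2 + κ) * maj2 ε κ δ A τ a n + A * (1 / (1 + (n : ℝ) ^ 2)) :=
  ((h.summable_maj2 hτ).mul_left _).add (summable_inv_w.mul_left _)

/-- Every series converges in C([0,1]) uniformly in time: `maj` serves all t ≥ 0 for the function
and its first derivative, `maj2` serves t ≥ τ for the second and the time derivative, and τ > 0 is
arbitrary. -/
theorem paraCurve (h : HeatData ε κ δ A a f) :
    ParaCurve (heatSol ε κ a f) (heatSolX ε κ a f) (heatSolXX ε κ a f) (heatSolT ε κ a f) where
  cont := continuousOn_tsum
    (fun n => ((continuous_heatCoef ε κ a n (h.hf n)).smul continuous_const).continuousOn)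
    h.summable_maj0 fun n t ht => norm_smul_mode_le (norm_cosMode_le n) (h.coef_bound' n ht)
  cont1 := continuousOn_tsum
    (fun n => (((continuous_heatCoef ε κ a n (h.hf n)).const_smul (-(n * Real.pi))).smul
      continuous_const).continuousOn)
    (h.summable_maj.mul_left Real.pi) fun n t ht => norm_smul_mode_le (norm_sinMode_le n)
      ((abs_x_le n _).trans (mul_le_mul_of_nonneg_left (mul_le_mul_of_nonneg_left
        (h.coef_bound' n ht) (by positivity)) Real.pi_pos.le))
  cont2 := continuousOn_Ioi_of_Ici fun τ hτ => continuousOn_tsum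
    (fun n => (((continuous_heatCoef ε κ a n (h.hf n)).const_smul (-(n * Real.pi) ^ 2)).smul
      continuous_const).continuousOn)
    ((h.summable_maj2 hτ).mul_left (Real.pi ^ 2)) fun n t ht => norm_smul_mode_le
      (norm_cosMode_le n) ((abs_xx_le n _).trans
        (mul_le_mul_of_nonneg_left (h.coef_bound2 n hτ ht) (sq_nonneg _)))
  contt := continuousOn_Ioi_of_Ici fun τ hτ => continuousOn_tsum
    (fun n => ((((continuous_heatCoef ε κ a n (h.hf n)).const_smul (-rate ε κ n)).add (h.hf n)).smul
      continuous_const).continuousOn)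
    (h.summable_t hτ) fun n t ht => norm_smul_mode_le (norm_cosMode_le n) (h.abs_t_le n hτ ht)
  d1 := fun t ht x hx => hasDeriv_cos_series (h.summable_coef ht) hx
  d2 := fun t ht x hx => hasDeriv_sin_series (h.summable_coef2 ht) hx
  dt := fun t ht => by
    have ht2 : 0 < t / 2 := by positivity
    have hs : Summable fun n => heatCoef ε κ a f n t • cosMode n :=
      Summable.of_norm_bounded (h.summable_coef0 ht.le)
        fun n => norm_smul_mode_le (norm_cosMode_le n) le_rfl
    exact hasDerivAt_tsum_of_isPreconnected (𝕜 := ℝ) (F := CI) (y₀ := t) (t := Ioi (t / 2))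
      (g := fun n t => heatCoef ε κ a f n t • cosMode n)
      (g' := fun n t => (-rate ε κ n * heatCoef ε κ a f n t + f n t) • cosMode n)
      (h.summable_t ht2) isOpen_Ioi isPreconnected_Ioi
      (fun n y _ => HasDerivAt.smul_const (F := CI) (hasDerivAt_heatCoef ε κ a n (h.hf n) y) (cosMode n))
      (fun n y hy => norm_smul_mode_le (norm_cosMode_le n) (h.abs_t_le n ht2 (le_of_lt hy)))
      (show t ∈ Ioi (t / 2) by simp [ht]) hs (show t ∈ Ioi (t / 2) by simp [ht])

theorem pde (h : HeatData ε κ δ A a f) {t : ℝ} (ht : 0 < t) :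
    heatSolT ε κ a f t = ε • heatSolXX ε κ a f t - κ • heatSol ε κ a f t
      + ∑' n, f n t • cosMode n := by
  have s0 : Summable fun n => heatCoef ε κ a f n t • cosMode n :=
    Summable.of_norm_bounded (h.summable_coef0 ht.le)
      fun n => norm_smul_mode_le (norm_cosMode_le n) le_rfl
  have s2 : Summable fun n : ℤ => (-(n * Real.pi) ^ 2 * heatCoef ε κ a f n t) • cosMode n :=
    Summable.of_norm_bounded ((h.summable_coef2 ht).mul_left (Real.pi ^ 2))
      fun n => norm_smul_mode_le (norm_cosMode_le n) (abs_xx_le n _)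
  have hsf : Summable fun n => f n t • cosMode n := by
    refine Summable.of_norm_bounded (summable_inv_w.mul_left (A * Real.exp (-δ * t)))
      fun n => norm_smul_mode_le (norm_cosMode_le n) ?_
    rw [mul_one_div]
    exact h.f_bound n t ht.le
  rw [heatSolXX, heatSol, ← s2.tsum_const_smul, ← s0.tsum_const_smul,
    ← (s2.const_smul ε).tsum_sub (s0.const_smul κ),
    ← ((s2.const_smul ε).sub (s0.const_smul κ)).tsum_add hsf, heatSolT]
  refine tsum_congr fun n => ?_
  rw [smul_smul, smul_smul, ← sub_smul, ← add_smul, rate]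
  congr 1
  ring

theorem coef_even (h : HeatData ε κ δ A a f) (n : ℤ) (t : ℝ) :
    heatCoef ε κ a f (-n) t = heatCoef ε κ a f n t := by
  have : rate ε κ (-n) = rate ε κ n := by simp [rate]
  unfold heatCoef
  simp only [this, h.a_even, h.f_even]

theorem neumann0 (h : HeatData ε κ δ A a f) {t : ℝ} (ht : 0 ≤ t) : ext (heatSolX ε κ a f t) 0 = 0 := by
  rw [heatSolX, ext_tsum_smul norm_sinMode_le (Summable.of_nonneg_of_le (fun _ => abs_nonneg _)
    (fun n => abs_x_le n _) ((h.summable_coef ht).mul_left Real.pi))]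
  simp [ext_sinMode]

theorem neumann1 (h : HeatData ε κ δ A a f) {t : ℝ} (ht : 0 ≤ t) : ext (heatSolX ε κ a f t) 1 = 0 := by
  rw [heatSolX, ext_tsum_smul norm_sinMode_le (Summable.of_nonneg_of_le (fun _ => abs_nonneg _)
    (fun n => abs_x_le n _) ((h.summable_coef ht).mul_left Real.pi))]
  simp [ext_sinMode, Real.sin_int_mul_pi]

theorem cosFunc_sol (h : HeatData ε κ δ A a f) {t : ℝ} (ht : 0 ≤ t) (m : ℤ) :
    cosFunc m (heatSol ε κ a f t) = heatCoef ε κ a f m t :=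
  cosFunc_series (h.summable_coef0 ht) (fun n => h.coef_even n t) m

theorem cosFunc_solXX (h : HeatData ε κ δ A a f) {t : ℝ} (ht : 0 < t) (m : ℤ) :
    cosFunc m (heatSolXX ε κ a f t) = -(m * Real.pi) ^ 2 * heatCoef ε κ a f m t := by
  refine cosFunc_series (c := fun m : ℤ => -(m * Real.pi) ^ 2 * heatCoef ε κ a f m t)
    (Summable.of_nonneg_of_le (fun _ => abs_nonneg _)
    (fun n => abs_xx_le n _) ((h.summable_coef2 ht).mul_left (Real.pi ^ 2))) (fun n => ?_) m
  rw [h.coef_even]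
  push_cast
  ring

end HeatData

/-- Cosine coefficients of a profile. -/
def cosCoef (f : ℝ → ℝ) (n : ℤ) : ℝ := ∫ x in (0 : ℝ)..1, f x * Real.cos (n * Real.pi * x)

theorem cosCoef_even (f : ℝ → ℝ) (n : ℤ) : cosCoef f (-n) = cosCoef f n := by
  unfold cosCoef
  refine intervalIntegral.integral_congr fun x _ => ?_
  simp only [Int.cast_neg, neg_mul, Real.cos_neg]

theorem HasH2.cosCoef_snd {f f1 f2 : ℝ → ℝ} (h : HasH2 f f1 f2) (h0 : f1 0 = 0) (h1 : f1 1 = 0)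
    (n : ℤ) : cosCoef f2 n = -(n * Real.pi) ^ 2 * cosCoef f n := h.cos_coef h0 h1 n

/-- Parseval for f and for its weak second derivative, whose coefficients are -(nπ)² times those of
f because of the Neumann conditions. -/
theorem HasH2.summable_cosCoef {f f1 f2 : ℝ → ℝ} (h : HasH2 f f1 f2) (h0 : f1 0 = 0)
    (h1 : f1 1 = 0) : Summable fun n : ℤ => ((1 + (n : ℝ) ^ 2) * cosCoef f n) ^ 2 := by
  have s0 := (parseval_cos (L2I.of_continuousOn h.continuousOn)).summable
  have s2 := (parseval_cos h.memLp).summable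
  refine Summable.of_nonneg_of_le (fun n => sq_nonneg _) (fun n => ?_)
    ((s0.mul_left 2).add (s2.mul_left 2))
  change ((1 + (n : ℝ) ^ 2) * cosCoef f n) ^ 2 ≤ 2 * cosCoef f n ^ 2 + 2 * cosCoef f2 n ^ 2
  rw [h.cosCoef_snd h0 h1]
  have hp : (1 : ℝ) ≤ Real.pi ^ 4 := one_le_pow₀ (by linarith [Real.pi_gt_three])
  have e : (-(n * Real.pi) ^ 2 * cosCoef f n) ^ 2 = Real.pi ^ 4 * ((n : ℝ) ^ 2 * cosCoef f n) ^ 2 := by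
    ring
  rw [e]
  nlinarith [sq_nonneg (cosCoef f n - (n : ℝ) ^ 2 * cosCoef f n), sq_nonneg ((n : ℝ) ^ 2 * cosCoef f n)]

/-- A continuous function with vanishing cosine coefficients vanishes. -/
theorem eq_zero_of_cosCoef {f : ℝ → ℝ} (hf : ContinuousOn f (Icc 0 1)) (h : ∀ n, cosCoef f n = 0)
    {x : ℝ} (hx : x ∈ Icc (0 : ℝ) 1) : f x = 0 := by
  have hs := parseval_cos (L2I.of_continuousOn hf)
  have h0 : ∫ x in (0 : ℝ)..1, f x ^ 2 = 0 := by
    refine hs.unique ?_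
    convert hasSum_zero using 2 with n
    exact pow_eq_zero_iff two_ne_zero |>.2 (h n)
  by_contra hne
  have hpos : 0 < ∫ x in (0 : ℝ)..1, f x ^ 2 :=
    intervalIntegral.integral_pos zero_lt_one (hf.pow 2) (fun _ _ => sq_nonneg _)
      ⟨x, hx, by positivity⟩
  linarith

/-- Well-posedness, regularity and decay for the heat equation with Neumann conditions. -/
theorem exists_neumann_heat {ε κ δ : ℝ} (hε : 0 < ε) (hδ : 0 < δ) (hδκ : δ < κ) :
    ∃ C, 0 < C ∧ ∀ z z1 z2 : ℝ → ℝ, HasH2 z z1 z2 → z1 0 = 0 → z1 1 = 0 →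
      ∀ (A : ℝ) (f : ℤ → ℝ → ℝ), 0 ≤ A → (∀ n, Continuous (f n)) → (∀ n t, f (-n) t = f n t) →
      (∀ n t, 0 ≤ t → |f n t| ≤ A * Real.exp (-δ * t) / (1 + (n : ℝ) ^ 2)) →
      ∃ Z Z1 Z2 Zt : ℝ → CI, ParaCurve Z Z1 Z2 Zt ∧
        (∀ t, 0 < t → Zt t = ε • Z2 t - κ • Z t + ∑' n, f n t • cosMode n) ∧
        (∀ t, 0 ≤ t → ext (Z1 t) 0 = 0 ∧ ext (Z1 t) 1 = 0) ∧
        (∀ x ∈ Icc (0 : ℝ) 1, ext (Z 0) x = z x ∧ ext (Z1 0) x = z1 x) ∧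
        Tendsto (fun t => ∫ x in (0 : ℝ)..1, (ext (Z2 t) x - z2 x) ^ 2) (𝓝[>] 0) (𝓝 0) ∧
        ∀ t, 0 ≤ t → L2norm (ext (Z t)) + L2norm (ext (Z1 t))
          ≤ C * Real.exp (-δ * t) * (L2norm z + L2norm z1 + A) := by
  have hr0 := ellip_pos hε hδκ
  set S := ∑' n : ℤ, 1 / (1 + (n : ℝ) ^ 2) with hS
  have hS0 : 0 ≤ S := tsum_nonneg fun n => by positivity
  -- B dominates the two constants produced by (x+y)² ≤ 2x² + 2y², one for the initial data and one
  -- for the forcing; B ≥ 2 allows B to be replaced by B² under the square root.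
  set B := 2 * (Real.pi ^ 2 / ellip ε κ δ ^ 2 * S) + 2 with hB
  have hB2 : 2 ≤ B := by rw [hB]; have : 0 ≤ Real.pi ^ 2 / ellip ε κ δ ^ 2 * S := by positivity
                         linarith
  refine ⟨4 * B, by positivity, fun z z1 z2 hz h0 h1 A f hA hfc hfe hfb => ?_⟩
  have hD : HeatData ε κ δ A (cosCoef z) f := ⟨hε, hδ, hδκ, hA, hz.summable_cosCoef h0 h1,
    cosCoef_even z, hfc, hfe, hfb⟩
  have hP := hD.paraCurve
  set a := cosCoef z with ha
  have hz0 : ∀ x ∈ Icc (0 : ℝ) 1, ext (heatSol ε κ a f 0) x = z x := fun x hx => by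
    have := eq_zero_of_cosCoef (f := fun x => ext (heatSol ε κ a f 0) x - z x)
      ((continuous_ext _).continuousOn.sub hz.continuousOn) (fun n => ?_) hx
    · linarith
    · have e1 := hD.cosFunc_sol le_rfl n
      rw [cosFunc_apply, heatCoef_zero] at e1
      unfold cosCoef
      simp only [sub_mul]
      rw [intervalIntegral.integral_sub (Continuous.intervalIntegrable (by fun_prop) _ _)
        ((L2I.of_continuousOn hz.continuousOn).integrable.mul_continuousOn (by fun_prop)), e1, ha]
      exact sub_self _
  refine ⟨heatSol ε κ a f, heatSolX ε κ a f, heatSolXX ε κ a f, heatSolT ε κ a f, hP,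
    fun t ht => hD.pde ht, fun t ht => ⟨hD.neumann0 ht, hD.neumann1 ht⟩,
    fun x hx => ⟨hz0 x hx, ?_⟩, ?_, fun t ht => ?_⟩
  · have e1 := hP.d1 0 le_rfl x hx
    have e2 := (hz.deriv x hx).congr hz0 (hz0 x hx)
    rw [← D_eq hx e1, D_eq hx e2]
  -- L² continuity of the second derivative at t = 0: Parseval turns it into a statement on series,
  -- and dominated convergence applies with the square summable majorant `maj`.
  · have e : ∀ᶠ t in 𝓝[>] (0 : ℝ), ∑' n : ℤ, ((n * Real.pi) ^ 2 * (heatCoef ε κ a f n t - a n)) ^ 2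
        = ∫ x in (0 : ℝ)..1, (ext (heatSolXX ε κ a f t) x - z2 x) ^ 2 := by
      filter_upwards [self_mem_nhdsWithin] with t ht
      have hm : L2I fun x => ext (heatSolXX ε κ a f t) x - z2 x :=
        (L2I.of_continuousOn (continuous_ext _).continuousOn).sub hz.memLp
      rw [← (parseval_cos hm).tsum_eq]
      refine tsum_congr fun n => ?_
      have e1 := hD.cosFunc_solXX ht n
      rw [cosFunc_apply] at e1
      have e2 := hz.cosCoef_snd h0 h1 n
      simp only [sub_mul]
      rw [intervalIntegral.integral_sub (Continuous.intervalIntegrable (by fun_prop) _ _)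
        (hz.memLp.integrable.mul_continuousOn (by fun_prop)), e1]
      change _ = (_ - cosCoef z2 n) ^ 2
      rw [e2, ← ha]
      ring
    refine Tendsto.congr' e ?_
    have hlim : Tendsto (fun t => ∑' n : ℤ, ((n * Real.pi) ^ 2 * (heatCoef ε κ a f n t - a n)) ^ 2)
        (𝓝[>] 0) (𝓝 (∑' _ : ℤ, (0 : ℝ))) := by
      refine tendsto_tsum_of_dominated_convergence
        (bound := fun n : ℤ => 4 * Real.pi ^ 4 * ((1 + (n : ℝ) ^ 2) * HeatData.maj ε κ δ A a n) ^ 2)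
        (hD.summable_maj_sq.mul_left _) (fun n => ?_) ?_
      · have hc := (continuous_heatCoef ε κ a n (hfc n)).tendsto 0
        rw [heatCoef_zero] at hc
        have := (((hc.sub_const (a n)).const_mul ((n * Real.pi) ^ 2)).pow 2).mono_left
          (nhdsWithin_le_nhds (s := Ioi 0))
        simpa using this
      · filter_upwards [self_mem_nhdsWithin] with t ht n
        have b1 := hD.coef_bound' n (le_of_lt ht)
        have b2 : |a n| ≤ HeatData.maj ε κ δ A a n := by
          have := hD.coef_bound' n (le_refl (0 : ℝ))
          rwa [heatCoef_zero] at this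
        have b3 : |heatCoef ε κ a f n t - a n| ≤ 2 * HeatData.maj ε κ δ A a n :=
          (abs_sub _ _).trans (by linarith)
        have b4 := hD.maj_nonneg n
        rw [norm_pow, norm_mul, Real.norm_eq_abs, Real.norm_eq_abs, abs_of_nonneg (sq_nonneg _)]
        have b5 : (n * Real.pi) ^ 2 * |heatCoef ε κ a f n t - a n|
            ≤ 2 * Real.pi ^ 2 * ((1 + (n : ℝ) ^ 2) * HeatData.maj ε κ δ A a n) := by
          have c1 : (n * Real.pi) ^ 2 ≤ Real.pi ^ 2 * (1 + (n : ℝ) ^ 2) := by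
            nlinarith [sq_nonneg Real.pi]
          calc _ ≤ Real.pi ^ 2 * (1 + (n : ℝ) ^ 2) * (2 * HeatData.maj ε κ δ A a n) :=
                mul_le_mul c1 b3 (abs_nonneg _) (by positivity)
            _ = _ := by ring
        calc _ ≤ (2 * Real.pi ^ 2 * ((1 + (n : ℝ) ^ 2) * HeatData.maj ε κ δ A a n)) ^ 2 :=
              pow_le_pow_left₀ (by positivity) b5 2
          _ = _ := by ring
    simpa using hlim
  · -- decay
    have hdec : ∀ (g g0 : ℝ → ℝ) (p : ℤ → ℝ),
        (∀ n, (p n) ^ 2 ≤ Real.pi ^ 2 * (1 + (n : ℝ) ^ 2)) →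
        HasSum (fun n => (p n * heatCoef ε κ a f n t) ^ 2) (∫ x in (0 : ℝ)..1, g x ^ 2) →
        HasSum (fun n => (p n * a n) ^ 2) (∫ x in (0 : ℝ)..1, g0 x ^ 2) →
        L2norm g ≤ B * Real.exp (-δ * t) * (L2norm g0 + A) := by
      intro g g0 p hp hg hg0
      set E := Real.exp (-δ * t)
      have hE : 0 < E := Real.exp_pos _
      have hle : ∫ x in (0 : ℝ)..1, g x ^ 2 ≤ 2 * E ^ 2 * (∫ x in (0 : ℝ)..1, g0 x ^ 2)
          + 2 * E ^ 2 * (A ^ 2 * (Real.pi ^ 2 / ellip ε κ δ ^ 2)) * S := by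
        refine hasSum_le (fun n => ?_) hg ((hg0.mul_left (2 * E ^ 2)).add
          (summable_inv_w.hasSum.mul_left (2 * E ^ 2 * (A ^ 2 * (Real.pi ^ 2 / ellip ε κ δ ^ 2)))))
        have b1 := hD.coef_bound n ht
        have hw := one_le_w n
        have hpn := hp n
        set w := 1 + (n : ℝ) ^ 2
        set y := A / (ellip ε κ δ * w ^ 2) with hy
        have b1' : |heatCoef ε κ a f n t| ≤ E * (|a n| + y) := b1
        have b2 : heatCoef ε κ a f n t ^ 2 ≤ E ^ 2 * (2 * a n ^ 2 + 2 * y ^ 2) := by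
          rw [← sq_abs (heatCoef ε κ a f n t), ← sq_abs (a n)]
          calc _ ≤ (E * (|a n| + y)) ^ 2 := pow_le_pow_left₀ (abs_nonneg _) b1' 2
            _ = E ^ 2 * (|a n| + y) ^ 2 := by ring
            _ ≤ _ := mul_le_mul_of_nonneg_left (by nlinarith [sq_nonneg (|a n| - y)]) (sq_nonneg _)
        have b3 : p n ^ 2 * y ^ 2 ≤ A ^ 2 * (Real.pi ^ 2 / ellip ε κ δ ^ 2) * (1 / w) := by
          have c1 : y ^ 2 = A ^ 2 / ellip ε κ δ ^ 2 / w ^ 4 := by rw [hy]; field_simp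
          have hw0 : 0 < w := by linarith
          have c2 : A ^ 2 * (Real.pi ^ 2 / ellip ε κ δ ^ 2) * (1 / w)
              = (Real.pi ^ 2 * w) * (A ^ 2 / ellip ε κ δ ^ 2 / w ^ 2) := by field_simp
          rw [c1, c2]
          refine mul_le_mul hpn ?_ (by positivity) (by positivity)
          refine div_le_div_of_nonneg_left (by positivity) (by positivity) ?_
          exact pow_le_pow_right₀ hw (by norm_num)
        rw [mul_pow, mul_pow]
        have := mul_le_mul_of_nonneg_left b2 (sq_nonneg (p n))
        nlinarith [sq_nonneg E]
      have hBS : 2 * (Real.pi ^ 2 / ellip ε κ δ ^ 2 * S) ≤ B := by linarith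
      refine Real.sqrt_le_iff.2 ⟨by have := L2norm_nonneg g0; positivity, ?_⟩
      have hn := L2norm_nonneg g0
      rw [← L2norm_sq g0] at hle
      have c1 : 2 * L2norm g0 ^ 2 + 2 * (Real.pi ^ 2 / ellip ε κ δ ^ 2 * S) * A ^ 2
          ≤ B ^ 2 * (L2norm g0 + A) ^ 2 := by
        have d1 : 2 * L2norm g0 ^ 2 + 2 * (Real.pi ^ 2 / ellip ε κ δ ^ 2 * S) * A ^ 2
            ≤ B * (L2norm g0 ^ 2 + A ^ 2) := by
          nlinarith [sq_nonneg A, sq_nonneg (L2norm g0)]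
        have d2 : L2norm g0 ^ 2 + A ^ 2 ≤ (L2norm g0 + A) ^ 2 := by nlinarith
        have d3 : B * (L2norm g0 + A) ^ 2 ≤ B ^ 2 * (L2norm g0 + A) ^ 2 :=
          mul_le_mul_of_nonneg_right (by nlinarith) (sq_nonneg _)
        have d4 := mul_le_mul_of_nonneg_left d2 (by linarith : 0 ≤ B)
        linarith
      calc _ ≤ E ^ 2 * (2 * L2norm g0 ^ 2 + 2 * (Real.pi ^ 2 / ellip ε κ δ ^ 2 * S) * A ^ 2) := by
            refine hle.trans_eq (by ring)
        _ ≤ E ^ 2 * (B ^ 2 * (L2norm g0 + A) ^ 2) := mul_le_mul_of_nonneg_left c1 (sq_nonneg _)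
        _ = _ := by ring
    have hcoef : ∀ n : ℤ, ∫ x in (0 : ℝ)..1, ext (heatSol ε κ a f t) x * Real.cos (n * Real.pi * x)
        = heatCoef ε κ a f n t := fun n => by rw [← cosFunc_apply, hD.cosFunc_sol ht]
    -- One coefficient estimate gives both halves of the H¹ norm: with weight 1 and the cosine
    -- Parseval identity for the function, with weight -nπ and the sine identity for the derivative.
    have k0 := hdec (ext (heatSol ε κ a f t)) z (fun _ => 1)
      (fun n => by nlinarith [one_le_w n, Real.pi_gt_three])
      (by
        convert parseval_cos (L2I.of_continuousOn (continuous_ext (heatSol ε κ a f t)).continuousOn)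
          using 2 with n
        rw [hcoef, one_mul])
      (by
        convert parseval_cos (L2I.of_continuousOn hz.continuousOn) using 2 with n
        rw [one_mul, ha, cosCoef])
    have k1 := hdec (ext (heatSolX ε κ a f t)) z1 (fun n => -(n * Real.pi))
      (fun n => by nlinarith [sq_nonneg Real.pi])
      (by
        convert parseval_sin (L2I.of_continuousOn (continuous_ext (heatSolX ε κ a f t)).continuousOn)
          using 2 with n
        rw [sin_coef_deriv (hP.d1 t ht) (continuous_ext _).continuousOn, hcoef])
      (by
        convert parseval_sin (L2I.of_continuousOn hz.continuousOn_deriv) using 2 with n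
        rw [sin_coef_deriv hz.deriv hz.continuousOn_deriv, ha, cosCoef])
    have hn := L2norm_nonneg z
    have hn1 := L2norm_nonneg z1
    have hE := Real.exp_pos (-δ * t)
    have hBE : 0 ≤ B * Real.exp (-δ * t) := by positivity
    nlinarith [mul_nonneg hBE hn, mul_nonneg hBE hn1, mul_nonneg hBE hA]

/-! ### Curves in `H²` and transformations of Volterra type -/

/-- A `ParaCurve` that is moreover continuous at `t = 0` as a curve in `H²(0,1)`. -/
structure H2Curve (Z Z1 Z2 Zt : ℝ → CI) : Prop extends ParaCurve Z Z1 Z2 Zt where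
  h2 : ∃ z2, HasH2 (ext (Z 0)) (ext (Z1 0)) z2 ∧
    Tendsto (fun t => L2norm fun x => ext (Z2 t) x - z2 x) (𝓝[>] 0) (𝓝 0)

/-- The `H¹` norm of a profile `F` with derivative `F1`. -/
def normH1 (F F1 : CI) : ℝ := L2norm (ext F) + L2norm (ext F1)

theorem normH1_nonneg (F F1 : CI) : 0 ≤ normH1 F F1 :=
  add_nonneg (L2norm_nonneg _) (L2norm_nonneg _)

theorem L2I_ext (F : CI) : L2I (ext F) := L2I.of_continuousOn (continuous_ext F).continuousOn

theorem L2norm_ext_le (F : CI) : L2norm (ext F) ≤ ‖F‖ :=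
  L2norm_le_of_bound (norm_nonneg F) fun x _ => abs_ext_le F x

theorem norm_le_normH1 {F F1 : CI}
    (h : ∀ x ∈ Icc (0 : ℝ) 1, HasDerivWithinAt (ext F) (ext F1 x) (Icc 0 1) x) :
    ‖F‖ ≤ normH1 F F1 :=
  CI_norm_le (normH1_nonneg F F1) fun _ hx =>
    abs_le_L2norm_add h (continuous_ext F1).continuousOn hx

theorem L2norm_ext_add_le (F G : CI) : L2norm (ext (F + G)) ≤ L2norm (ext F) + L2norm (ext G) :=
  L2norm_add_le (L2I_ext F) (L2I_ext G)

theorem ext_neg (F : CI) (x : ℝ) : ext (-F) x = -ext F x := rfl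

theorem L2norm_ext_sub_le (F G : CI) : L2norm (ext (F - G)) ≤ L2norm (ext F) + L2norm (ext G) := by
  have h := L2norm_ext_add_le F (-G)
  have e : L2norm (ext (-G)) = L2norm (ext G) := by
    have := L2norm_const_mul (-1) (ext G)
    simp only [neg_mul, one_mul, abs_neg, abs_one] at this
    exact this
  rwa [e, ← sub_eq_add_neg] at h

theorem normH1_sub_le (F F1 G G1 : CI) : normH1 (F - G) (F1 - G1) ≤ normH1 F F1 + normH1 G G1 := by
  have h1 := L2norm_ext_sub_le F G
  have h2 := L2norm_ext_sub_le F1 G1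
  unfold normH1
  linarith

theorem normH1_smul (c : ℝ) (F F1 : CI) : normH1 (c • F) (c • F1) = |c| * normH1 F F1 := by
  have h : ∀ G : CI, L2norm (ext (c • G)) = |c| * L2norm (ext G) :=
    fun G => L2norm_const_mul c (ext G)
  rw [normH1, h, h, normH1, mul_add]

theorem H2Curve.sub {Z Z1 Z2 Zt W W1 W2 Wt : ℝ → CI} (hZ : H2Curve Z Z1 Z2 Zt)
    (hW : H2Curve W W1 W2 Wt) :
    H2Curve (fun t => Z t - W t) (fun t => Z1 t - W1 t) (fun t => Z2 t - W2 t)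
      (fun t => Zt t - Wt t) where
  cont := hZ.cont.sub hW.cont
  cont1 := hZ.cont1.sub hW.cont1
  cont2 := hZ.cont2.sub hW.cont2
  contt := hZ.contt.sub hW.contt
  d1 := fun t ht x hx => (hZ.d1 t ht x hx).sub (hW.d1 t ht x hx)
  d2 := fun t ht x hx => (hZ.d2 t ht x hx).sub (hW.d2 t ht x hx)
  dt := fun t ht => (hZ.dt t ht).sub (hW.dt t ht)
  h2 := by
    obtain ⟨z2, hz, tz⟩ := hZ.h2
    obtain ⟨w2, hw, tw⟩ := hW.h2
    refine ⟨fun x => z2 x - w2 x, hz.sub hw, ?_⟩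
    refine squeeze_zero (fun t => L2norm_nonneg _) (fun t => ?_) (by simpa using tz.add tw)
    have h1 : L2I fun x => ext (Z2 t) x - z2 x := (L2I_ext _).sub hz.memLp
    have h2 : L2I fun x => w2 x - ext (W2 t) x := hw.memLp.sub (L2I_ext _)
    have h3 := L2norm_add_le h1 h2
    have e : L2norm (fun x => w2 x - ext (W2 t) x) = L2norm fun x => ext (W2 t) x - w2 x := by
      rw [← L2norm_abs, ← L2norm_abs (fun x => ext (W2 t) x - w2 x)]
      simp only [abs_sub_comm]
    rw [e] at h3
    refine (le_of_eq ?_).trans h3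
    congr 1
    funext x
    simp only [ext_sub]
    ring

theorem H2Curve.smul_profile {g g' : ℝ → ℝ} {F F1 F2 : CI} (hg : ContinuousOn g (Ici 0))
    (hg' : ContinuousOn g' (Ioi 0)) (hd : ∀ t, 0 < t → HasDerivAt g (g' t) t) (hF : IsC2 F F1 F2) :
    H2Curve (fun t => g t • F) (fun t => g t • F1) (fun t => g t • F2) (fun t => g' t • F) where
  cont := hg.smul continuousOn_const
  cont1 := hg.smul continuousOn_const
  cont2 := (hg.mono Ioi_subset_Ici_self).smul continuousOn_const
  contt := hg'.smul continuousOn_const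
  d1 := fun t _ x hx => (hF.d1 x hx).const_mul (g t)
  d2 := fun t _ x hx => (hF.d2 x hx).const_mul (g t)
  dt := fun t ht => HasDerivAt.smul_const (F := CI) (hd t ht) F
  h2 := by
    refine ⟨fun x => g 0 * ext F2 x, HasH2.of_hasDeriv (fun x hx => (hF.d1 x hx).const_mul (g 0))
      (fun x hx => (hF.d2 x hx).const_mul (g 0)) (by fun_prop), ?_⟩
    have h0 : Tendsto g (𝓝[>] 0) (𝓝 (g 0)) :=
      (hg 0 self_mem_Ici).mono_left (nhdsWithin_mono _ Ioi_subset_Ici_self)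
    have h1 := ((h0.sub_const (g 0)).abs).mul_const (L2norm (ext F2))
    simp only [sub_self, abs_zero, zero_mul] at h1
    refine h1.congr fun t => ?_
    rw [← L2norm_const_mul]
    simp only [ext_smul, sub_mul]

/-- `A` maps a profile with derivative `F1` to one with derivative `F1 + B F`, and `B F` has
derivative `C0 F + C1 F1`. -/
structure Transform (A B C0 C1 : CI →L[ℝ] CI) : Prop where
  d1 : ∀ F F1 : CI, (∀ x ∈ Icc (0 : ℝ) 1, HasDerivWithinAt (ext F) (ext F1 x) (Icc 0 1) x) →
    ∀ x ∈ Icc (0 : ℝ) 1, HasDerivWithinAt (ext (A F)) (ext (F1 + B F) x) (Icc 0 1) x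
  d2 : ∀ F F1 : CI, (∀ x ∈ Icc (0 : ℝ) 1, HasDerivWithinAt (ext F) (ext F1 x) (Icc 0 1) x) →
    ∀ x ∈ Icc (0 : ℝ) 1, HasDerivWithinAt (ext (B F)) (ext (C0 F + C1 F1) x) (Icc 0 1) x

namespace Transform

variable {A B C0 C1 : CI →L[ℝ] CI}

theorem hasH2 (h : Transform A B C0 C1) {F F1 : CI} {f2 : ℝ → ℝ}
    (hF : HasH2 (ext F) (ext F1) f2) :
    HasH2 (ext (A F)) (ext (F1 + B F)) (fun x => f2 x + ext (C0 F + C1 F1) x) where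
  deriv := h.d1 F F1 hF.deriv
  memLp := hF.memLp.add (L2I_ext _)
  eq_integral := fun x hx => by
    -- The primitive of B F is introduced only to obtain the fundamental theorem of calculus for the
    -- C¹ function B F.
    have hB : HasH2 (fun x => ∫ y in (0 : ℝ)..x, ext (B F) y) (ext (B F)) (ext (C0 F + C1 F1)) :=
      HasH2.of_hasDeriv (fun y _ => (((continuous_ext (B F)).integral_hasStrictDerivAt
        0 y).hasDerivAt).hasDerivWithinAt) (h.d2 F F1 hF.deriv) (continuous_ext _).continuousOn
    have e1 := hF.eq_integral x hx
    have e2 := hB.eq_integral x hx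
    rw [intervalIntegral.integral_add (hF.memLp.integrable_sub hx)
      ((L2I_ext _).integrable_sub hx)]
    simp only [ext_add] at *
    linarith

/-- The second derivative of the image is the old one plus terms of lower order, and those are
continuous in C([0,1]) up to t = 0; only the old one has to be followed in L². -/
theorem h2Curve (h : Transform A B C0 C1) {W W1 W2 Wt : ℝ → CI} (hW : H2Curve W W1 W2 Wt) :
    H2Curve (fun t => A (W t)) (fun t => W1 t + B (W t))
      (fun t => W2 t + (C0 (W t) + C1 (W1 t))) (fun t => A (Wt t)) where
  cont := A.continuous.comp_continuousOn hW.cont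
  cont1 := hW.cont1.add (B.continuous.comp_continuousOn hW.cont)
  cont2 := hW.cont2.add ((C0.continuous.comp_continuousOn (hW.cont.mono Ioi_subset_Ici_self)).add
    (C1.continuous.comp_continuousOn (hW.cont1.mono Ioi_subset_Ici_self)))
  contt := A.continuous.comp_continuousOn hW.contt
  d1 := fun t ht => h.d1 _ _ (hW.d1 t ht)
  d2 := fun t ht x hx => (hW.d2 t ht x hx).add (h.d2 _ _ (hW.d1 t ht.le) x hx)
  dt := fun t ht => A.hasFDerivAt.comp_hasDerivAt t (hW.dt t ht)
  h2 := by
    obtain ⟨w2, hw, tw⟩ := hW.h2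
    refine ⟨_, h.hasH2 hw, ?_⟩
    have hc : ContinuousOn (fun t => C0 (W t) + C1 (W1 t)) (Ici 0) :=
      (C0.continuous.comp_continuousOn hW.cont).add (C1.continuous.comp_continuousOn hW.cont1)
    have h0 := ((hc 0 self_mem_Ici).mono_left (nhdsWithin_mono _ Ioi_subset_Ici_self)).sub_const
      (C0 (W 0) + C1 (W1 0))
    have h1 := h0.norm
    rw [sub_self, norm_zero] at h1
    refine squeeze_zero (fun t => L2norm_nonneg _) (fun t => ?_) (by simpa using tw.add h1)
    have h2 : L2I fun x => ext (W2 t) x - w2 x := (L2I_ext _).sub hw.memLp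
    have h3 := L2norm_add_le h2 (L2I_ext (C0 (W t) + C1 (W1 t) - (C0 (W 0) + C1 (W1 0))))
    refine (le_of_eq ?_).trans (h3.trans (add_le_add_right (L2norm_ext_le _) _))
    congr 1
    funext x
    simp only [ext_sub, ext_add]
    ring

/-- Operators bounded in the sup norm are controlled by the H¹ norm through the Sobolev embedding.
-/
theorem normH1_le (_h : Transform A B C0 C1) {F F1 : CI}
    (hF : ∀ x ∈ Icc (0 : ℝ) 1, HasDerivWithinAt (ext F) (ext F1 x) (Icc 0 1) x) :
    normH1 (A F) (F1 + B F) ≤ (‖A‖ + ‖B‖ + 1) * normH1 F F1 := by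
  have h1 := L2norm_ext_add_le F1 (B F)
  have h2 := (L2norm_ext_le (B F)).trans (B.le_opNorm F)
  have h3 := (L2norm_ext_le (A F)).trans (A.le_opNorm F)
  have h4 := norm_le_normH1 hF
  have h5 := L2norm_nonneg (ext F)
  have h6 := mul_le_mul_of_nonneg_left h4 (norm_nonneg A)
  have h7 := mul_le_mul_of_nonneg_left h4 (norm_nonneg B)
  have h8 : L2norm (ext F1) ≤ normH1 F F1 := le_add_of_nonneg_left h5
  have e : normH1 (A F) (F1 + B F) = L2norm (ext (A F)) + L2norm (ext (F1 + B F)) := rfl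
  rw [e]
  nlinarith

variable {T TX TXX m R : CI →L[ℝ] CI}

theorem one_sub
    (hT : ∀ (F : CI), ∀ x ∈ Icc (0 : ℝ) 1, HasDerivWithinAt (ext (T F)) (ext (TX F) x) (Icc 0 1) x)
    (hTX : ∀ F F1 : CI, (∀ x ∈ Icc (0 : ℝ) 1, HasDerivWithinAt (ext F) (ext F1 x) (Icc 0 1) x) →
      ∀ x ∈ Icc (0 : ℝ) 1, HasDerivWithinAt (ext (TX F)) (ext (TXX F + m F1) x) (Icc 0 1) x) :
    Transform (1 - T) (-TX) (-TXX) (-m) where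
  d1 := fun F F1 hF x hx => ((hF x hx).sub (hT F x hx)).congr_deriv (by
    simp only [neg_apply, ext_add, ext_neg]; ring)
  d2 := fun F F1 hF x hx => ((hTX F F1 hF x hx).neg).congr_deriv (by
    simp only [neg_apply, ext_add, ext_neg]; ring)

/-- Since R F = F + T(R F), the inverse has the same structure as 1 - T, with T applied to R F.
Nothing about an inverse kernel is needed. -/
theorem inverse
    (hT : ∀ (F : CI), ∀ x ∈ Icc (0 : ℝ) 1, HasDerivWithinAt (ext (T F)) (ext (TX F) x) (Icc 0 1) x)
    (hTX : ∀ F F1 : CI, (∀ x ∈ Icc (0 : ℝ) 1, HasDerivWithinAt (ext F) (ext F1 x) (Icc 0 1) x) →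
      ∀ x ∈ Icc (0 : ℝ) 1, HasDerivWithinAt (ext (TX F)) (ext (TXX F + m F1) x) (Icc 0 1) x)
    (hR : ∀ F, R F - T (R F) = F) :
    Transform R (TX ∘L R) (TXX ∘L R + m ∘L TX ∘L R) m := by
  have hd : ∀ F F1 : CI, (∀ x ∈ Icc (0 : ℝ) 1, HasDerivWithinAt (ext F) (ext F1 x) (Icc 0 1) x) →
      ∀ x ∈ Icc (0 : ℝ) 1, HasDerivWithinAt (ext (R F)) (ext (F1 + (TX ∘L R) F) x) (Icc 0 1) x :=
    fun F F1 hF x hx => by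
      have e : ∀ y, ext (R F) y = ext F y + ext (T (R F)) y := fun y => by
        rw [← ext_add]
        congr 1
        rw [← sub_eq_iff_eq_add]
        exact hR F
      exact ((hF x hx).add (hT (R F) x hx)).congr (fun y _ => e y) (e x)
  refine ⟨hd, fun F F1 hF x hx => (hTX (R F) _ (hd F F1 hF) x hx).congr_deriv ?_⟩
  simp only [add_apply, ContinuousLinearMap.comp_apply, map_add, ext_add]
  ring

end Transform

/-- The first order part of the second derivative of `ctrlOp q F`. -/
def ctrlOpM (q : ℝ) : CI →L[ℝ] CI := mulOp (fun x => -(q / 2) * (x - 1 / 2)) (by fun_prop)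

/-- The first order part of the second derivative of `obsOp q F`. -/
def obsOpM (q : ℝ) : CI →L[ℝ] CI := mulOp (fun x => q / 2 * (x - 1 / 2)) (by fun_prop)

theorem hasDeriv_ctrlOpX_profile (q : ℝ) (F F1 : CI)
    (hF : ∀ x ∈ Icc (0 : ℝ) 1, HasDerivWithinAt (ext F) (ext F1 x) (Icc 0 1) x) :
    ∀ x ∈ Icc (0 : ℝ) 1, HasDerivWithinAt (ext (ctrlOpX q F))
      (ext (ctrlOpXX q F + ctrlOpM q F1) x) (Icc 0 1) x := fun x hx => by
  rw [ext_add, ctrlOpM, ext_mulOp _ _ _ hx]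
  exact hasDeriv_ctrlOpX q F hx (hF x hx)

theorem hasDeriv_obsOpX_profile (q : ℝ) (F F1 : CI)
    (hF : ∀ x ∈ Icc (0 : ℝ) 1, HasDerivWithinAt (ext F) (ext F1 x) (Icc 0 1) x) :
    ∀ x ∈ Icc (0 : ℝ) 1, HasDerivWithinAt (ext (obsOpX q F))
      (ext (obsOpXX q F + obsOpM q F1) x) (Icc 0 1) x := fun x hx => by
  rw [ext_add, obsOpM, ext_mulOp _ _ _ hx]
  exact hasDeriv_obsOpX q F hx (hF x hx)

theorem transform_ctrl (q : ℝ) :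
    Transform (1 - ctrlOp q) (-ctrlOpX q) (-ctrlOpXX q) (-ctrlOpM q) :=
  Transform.one_sub (fun F _ hx => hasDeriv_ctrlOp q F hx) (hasDeriv_ctrlOpX_profile q)

theorem transform_obs (q : ℝ) :
    Transform (1 - obsOp q) (-obsOpX q) (-obsOpXX q) (-obsOpM q) :=
  Transform.one_sub (fun F _ hx => hasDeriv_obsOp q F hx) (hasDeriv_obsOpX_profile q)

theorem transform_ctrl_inverse {q : ℝ} {R : CI →L[ℝ] CI} (hR : ∀ F, R F - ctrlOp q (R F) = F) :
    Transform R (ctrlOpX q ∘L R) (ctrlOpXX q ∘L R + ctrlOpM q ∘L ctrlOpX q ∘L R) (ctrlOpM q) :=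
  Transform.inverse (fun F _ hx => hasDeriv_ctrlOp q F hx) (hasDeriv_ctrlOpX_profile q) hR

theorem transform_obs_inverse {q : ℝ} {R : CI →L[ℝ] CI} (hR : ∀ F, R F - obsOp q (R F) = F) :
    Transform R (obsOpX q ∘L R) (obsOpXX q ∘L R + obsOpM q ∘L obsOpX q ∘L R) (obsOpM q) :=
  Transform.inverse (fun F _ hx => hasDeriv_obsOp q F hx) (hasDeriv_obsOpX_profile q) hR

/-! ### Heat equation with forcing and with prescribed flux -/

/-- Two integrations by parts. The end values of F' cost 2‖F1‖ but do not spoil the quadratic decay,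
so forcing profiles need not satisfy the Neumann conditions. -/
theorem IsC2.abs_cosCoef_le {F F1 F2 : CI} (h : IsC2 F F1 F2) (n : ℤ) :
    |cosCoef (ext F) n| ≤ (‖F‖ + 2 * ‖F1‖ + ‖F2‖) / (1 + (n : ℝ) ^ 2) := by
  have hcos : ∀ x : ℝ, HasDerivAt (fun x => Real.cos (n * Real.pi * x))
      (-(n * Real.pi) * Real.sin (n * Real.pi * x)) x := fun x => by
    refine (((hasDerivAt_id x).const_mul (n * Real.pi)).cos).congr_deriv ?_
    simp only [id]; ring
  have hsin : ∀ x : ℝ, HasDerivAt (fun x => -(n * Real.pi) * Real.sin (n * Real.pi * x))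
      (-(n * Real.pi) ^ 2 * Real.cos (n * Real.pi * x)) x := fun x => by
    refine ((((hasDerivAt_id x).const_mul (n * Real.pi)).sin).const_mul _).congr_deriv ?_
    simp only [id]; ring
  have e := integral_by_parts_twice (left_mem_Icc.2 zero_le_one) (right_mem_Icc.2 zero_le_one)
    hcos hsin (by fun_prop) h.d1 h.d2 (continuous_ext F2).continuousOn
  have hb : ∀ G : CI, |∫ y in (0 : ℝ)..1, Real.cos (n * Real.pi * y) * ext G y| ≤ ‖G‖ := fun G => by
    have := intervalIntegral.norm_integral_le_of_norm_le_const (a := 0) (b := 1) (C := ‖G‖)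
      (f := fun y => Real.cos (n * Real.pi * y) * ext G y) fun y _ => by
        rw [norm_mul]
        exact (mul_le_of_le_one_left (abs_nonneg _) (Real.abs_cos_le_one _)).trans (abs_ext_le G y)
    simpa using this
  have ec : cosCoef (ext F) n = ∫ y in (0 : ℝ)..1, Real.cos (n * Real.pi * y) * ext F y := by
    unfold cosCoef; simp only [mul_comm]
  have e2 : ∫ y in (0 : ℝ)..1, -(n * Real.pi) ^ 2 * Real.cos (n * Real.pi * y) * ext F y
      = -(n * Real.pi) ^ 2 * cosCoef (ext F) n := by
    rw [ec, ← intervalIntegral.integral_const_mul]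
    simp only [mul_assoc]
  rw [e2] at e
  simp only [mul_one, mul_zero, Real.sin_int_mul_pi, Real.sin_zero, zero_mul, sub_zero,
    Real.cos_zero, one_mul] at e
  have b0 := hb F
  rw [← ec] at b0
  have b2 := hb F2
  have b1 : |Real.cos (n * Real.pi) * ext F1 1| ≤ ‖F1‖ := by
    rw [abs_mul]
    exact (mul_le_of_le_one_left (abs_nonneg _) (Real.abs_cos_le_one _)).trans (abs_ext_le F1 1)
  have b3 := abs_ext_le F1 0
  have k : (n * Real.pi) ^ 2 * |cosCoef (ext F) n| ≤ 2 * ‖F1‖ + ‖F2‖ := by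
    rw [← abs_of_nonneg (sq_nonneg (n * Real.pi : ℝ)), ← abs_mul, abs_le]
    rw [abs_le] at b1 b2 b3
    constructor <;> linarith
  rw [le_div_iff₀ (by positivity)]
  have hp : (1 : ℝ) ≤ Real.pi ^ 2 := by nlinarith [Real.pi_gt_three]
  have : (n : ℝ) ^ 2 * |cosCoef (ext F) n| ≤ (n * Real.pi) ^ 2 * |cosCoef (ext F) n| := by
    rw [mul_pow]
    have := mul_nonneg (sq_nonneg (n : ℝ)) (abs_nonneg (cosCoef (ext F) n))
    nlinarith
  linarith

theorem IsC2.summable_cosCoef {F F1 F2 : CI} (h : IsC2 F F1 F2) :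
    Summable fun n => |cosCoef (ext F) n| := by
  refine Summable.of_nonneg_of_le (fun n => abs_nonneg _) (fun n => ?_)
    (summable_inv_w.mul_left (‖F‖ + 2 * ‖F1‖ + ‖F2‖))
  rw [mul_one_div]
  exact h.abs_cosCoef_le n

theorem IsC2.tsum_cosCoef {F F1 F2 : CI} (h : IsC2 F F1 F2) :
    ∑' n, cosCoef (ext F) n • cosMode n = F := by
  refine CI_ext fun x hx => ?_
  have := eq_zero_of_cosCoef (f := fun x => ext (∑' n, cosCoef (ext F) n • cosMode n) x - ext F x)
    (by fun_prop) (fun m => ?_) hx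
  · linarith
  · have e1 := cosFunc_series h.summable_cosCoef (cosCoef_even _) m
    rw [cosFunc_apply] at e1
    unfold cosCoef
    simp only [sub_mul]
    rw [intervalIntegral.integral_sub (Continuous.intervalIntegrable (by fun_prop) _ _)
      (Continuous.intervalIntegrable (by fun_prop) _ _)]
    exact sub_eq_zero.2 e1

/-- The Neumann heat equation with forcing `∑ i, h i t • Ψ i`. -/
theorem exists_neumann_heat_forced {ε κ δ : ℝ} (hε : 0 < ε) (hδ : 0 < δ) (hδκ : δ < κ)
    {ι : Type*} [Fintype ι] {Ψ Ψ1 Ψ2 : ι → CI} (hΨ : ∀ i, IsC2 (Ψ i) (Ψ1 i) (Ψ2 i)) :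
    ∃ C, 0 < C ∧ ∀ (Z0 Z10 : CI) (z2 : ℝ → ℝ), HasH2 (ext Z0) (ext Z10) z2 → ext Z10 0 = 0 →
      ext Z10 1 = 0 → ∀ (A : ℝ) (h : ι → ℝ → ℝ), 0 ≤ A → (∀ i, ContinuousOn (h i) (Ici 0)) →
      (∀ i t, 0 ≤ t → |h i t| ≤ A * Real.exp (-δ * t)) →
      ∃ Z Z1 Z2 Zt : ℝ → CI, H2Curve Z Z1 Z2 Zt ∧ Z 0 = Z0 ∧ Z1 0 = Z10 ∧
        (∀ t, 0 < t → Zt t = ε • Z2 t - κ • Z t + ∑ i, h i t • Ψ i) ∧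
        (∀ t, 0 ≤ t → ext (Z1 t) 0 = 0 ∧ ext (Z1 t) 1 = 0) ∧
        ∀ t, 0 ≤ t → normH1 (Z t) (Z1 t) ≤ C * Real.exp (-δ * t) * (normH1 Z0 Z10 + A) := by
  obtain ⟨C, hC, H⟩ := exists_neumann_heat hε hδ hδκ
  set K : ι → ℝ := fun i => ‖Ψ i‖ + 2 * ‖Ψ1 i‖ + ‖Ψ2 i‖ with hK
  have hK0 : 0 ≤ ∑ i, K i := Finset.sum_nonneg fun i _ => by rw [hK]; positivity
  refine ⟨C * (1 + ∑ i, K i), by positivity, fun Z0 Z10 z2 hz h0 h1 A h hA hc hb => ?_⟩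
  -- The forcing is frozen at its value at 0 for negative times, because `exists_neumann_heat` asks
  -- for continuity on the whole line.
  let f : ℤ → ℝ → ℝ := fun n t => ∑ i, h i (max t 0) * cosCoef (ext (Ψ i)) n
  obtain ⟨Z, Z1, Z2, Zt, hP, hpde, hN, hinit, htend, hbound⟩ :=
    H _ _ z2 hz h0 h1 (A * ∑ i, K i) f (by positivity)
      (fun n => continuous_finsetSum _ fun i _ =>
        ((hc i).comp_continuous (by fun_prop) fun t => mem_Ici.2 (le_max_right _ _)).mul continuous_const)
      (fun n t => by simp only [f, cosCoef_even]) (fun n t ht => by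
        simp only [f, max_eq_left ht]
        refine (Finset.abs_sum_le_sum_abs _ _).trans ?_
        rw [Finset.mul_sum, Finset.sum_mul, Finset.sum_div]
        refine Finset.sum_le_sum fun i _ => ?_
        rw [abs_mul]
        refine (mul_le_mul (hb i t ht) ((hΨ i).abs_cosCoef_le n) (abs_nonneg _)
          (by positivity)).trans_eq ?_
        rw [hK]
        ring)
  have e0 : Z 0 = Z0 := CI_ext fun x hx => (hinit x hx).1
  have e1 : Z1 0 = Z10 := CI_ext fun x hx => (hinit x hx).2
  refine ⟨Z, Z1, Z2, Zt, ⟨hP, z2, ?_, ?_⟩, e0, e1, fun t ht => ?_, hN, fun t ht => ?_⟩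
  · rwa [e0, e1]
  · have := (Real.continuous_sqrt.tendsto 0).comp htend
    rwa [Real.sqrt_zero] at this
  · rw [hpde t ht]
    congr 1
    have hs : ∀ i, Summable fun n => (h i t * cosCoef (ext (Ψ i)) n) • cosMode n := fun i =>
      Summable.of_norm_bounded ((hΨ i).summable_cosCoef.mul_left |h i t|)
        fun n => norm_smul_mode_le (norm_cosMode_le n) (abs_mul _ _).le
    simp only [f, max_eq_left ht.le, Finset.sum_smul]
    rw [Summable.tsum_finsetSum fun i _ => hs i]
    refine Finset.sum_congr rfl fun i _ => ?_
    simp only [mul_smul]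
    rw [tsum_const_smul'', (hΨ i).tsum_cosCoef]
  · refine (hbound t ht).trans ?_
    have hE := mul_pos hC (Real.exp_pos (-δ * t))
    have hn := normH1_nonneg Z0 Z10
    calc C * Real.exp (-δ * t) * (normH1 Z0 Z10 + A * ∑ i, K i)
        ≤ C * Real.exp (-δ * t) * ((1 + ∑ i, K i) * (normH1 Z0 Z10 + A)) := by
          refine mul_le_mul_of_nonneg_left ?_ hE.le
          nlinarith [mul_nonneg hK0 hn]
      _ = _ := by ring

/-- A decaying solution of the heat equation with fluxes `-h 0` at `x = 0` and `-h 1` at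
`x = 1`. -/
theorem exists_heat_flux {ε κ δ : ℝ} (hε : 0 < ε) (hδ : 0 < δ) (hδκ : δ < κ) :
    ∃ C, 0 < C ∧ ∀ (W0 W10 : CI) (w2 : ℝ → ℝ), HasH2 (ext W0) (ext W10) w2 →
      ∀ (A : ℝ) (h0 h1 k0 k1 : ℝ → ℝ), 0 ≤ A → ContinuousOn h0 (Ici 0) → ContinuousOn h1 (Ici 0) →
      ContinuousOn k0 (Ici 0) → ContinuousOn k1 (Ici 0) →
      (∀ t, 0 < t → HasDerivAt h0 (k0 t) t) → (∀ t, 0 < t → HasDerivAt h1 (k1 t) t) →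
      (∀ t, 0 ≤ t → |h0 t| ≤ A * Real.exp (-δ * t)) →
      (∀ t, 0 ≤ t → |h1 t| ≤ A * Real.exp (-δ * t)) →
      (∀ t, 0 ≤ t → |k0 t| ≤ A * Real.exp (-δ * t)) →
      (∀ t, 0 ≤ t → |k1 t| ≤ A * Real.exp (-δ * t)) →
      ext W10 0 = -h0 0 → ext W10 1 = -h1 0 →
      ∃ W W1 W2 Wt : ℝ → CI, H2Curve W W1 W2 Wt ∧ W 0 = W0 ∧ W1 0 = W10 ∧
        (∀ t, 0 < t → Wt t = ε • W2 t - κ • W t) ∧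
        (∀ t, 0 ≤ t → ext (W1 t) 0 = -h0 t ∧ ext (W1 t) 1 = -h1 t) ∧
        ∀ t, 0 ≤ t → normH1 (W t) (W1 t) ≤ C * Real.exp (-δ * t) * (normH1 W0 W10 + A) := by
  -- The profiles x - x²/2 and x²/2 have derivative 1 at one end and 0 at the other, and constant
  -- second derivatives -1 and 1; together with the constant profile they span all forcing terms
  -- below.
  have hc0 : Continuous fun x : ℝ => x - x ^ 2 / 2 := by fun_prop
  have hc1 : Continuous fun x : ℝ => x ^ 2 / 2 := by fun_prop
  have hc01 : Continuous fun x : ℝ => 1 - x := by fun_prop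
  let P0 := toCI _ hc0.continuousOn
  let P01 := toCI _ hc01.continuousOn
  let P02 := toCI (fun _ => -1) continuousOn_const
  let P1 := toCI _ hc1.continuousOn
  let P11 := toCI _ (continuous_id (X := ℝ)).continuousOn
  let P12 := toCI (fun _ => 1) continuousOn_const
  let O := toCI (fun _ => 0) continuousOn_const
  have hP0 : IsC2 P0 P01 P02 := by
    refine ⟨fun x hx => ?_, fun x hx => ?_⟩
    · rw [ext_toCI _ hx]
      refine HasDerivWithinAt.congr ?_ (fun y hy => ext_toCI _ hy) (ext_toCI _ hx)
      have := ((hasDerivAt_id x).sub (((hasDerivAt_id x).pow 2).div_const 2)).hasDerivWithinAt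
        (s := Icc 0 1)
      refine this.congr_deriv ?_
      simp
    · rw [ext_toCI _ hx]
      exact HasDerivWithinAt.congr ((hasDerivAt_id x).const_sub 1).hasDerivWithinAt
        (fun y hy => ext_toCI _ hy) (ext_toCI _ hx)
  have hP1 : IsC2 P1 P11 P12 := by
    refine ⟨fun x hx => ?_, fun x hx => ?_⟩
    · rw [ext_toCI _ hx]
      refine HasDerivWithinAt.congr ?_ (fun y hy => ext_toCI _ hy) (ext_toCI _ hx)
      have := (((hasDerivAt_id x).pow 2).div_const 2).hasDerivWithinAt (s := Icc 0 1)
      refine this.congr_deriv ?_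
      simp
    · rw [ext_toCI _ hx]
      exact HasDerivWithinAt.congr (hasDerivAt_id x).hasDerivWithinAt
        (fun y hy => ext_toCI _ hy) (ext_toCI _ hx)
  have hO : IsC2 P12 O O := by
    refine ⟨fun x hx => ?_, fun x hx => ?_⟩ <;> rw [ext_toCI _ hx] <;>
      exact HasDerivWithinAt.congr (hasDerivWithinAt_const _ _ _)
        (fun y hy => ext_toCI _ hy) (ext_toCI _ hx)
  have i0 : (0 : ℝ) ∈ Icc (0 : ℝ) 1 := by simp
  have i1 : (1 : ℝ) ∈ Icc (0 : ℝ) 1 := by simp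
  obtain ⟨C, hC, H⟩ := exists_neumann_heat_forced hε hδ hδκ (ι := Fin 3) (Ψ := ![P12, P0, P1])
    (Ψ1 := ![O, P01, P11]) (Ψ2 := ![O, P02, P12]) (fun i => by
      fin_cases i
      · exact hO
      · exact hP0
      · exact hP1)
  have hκ : 0 < κ := hδ.trans hδκ
  set N := normH1 P0 P01 + normH1 P1 P11 with hN
  have hN0 : 0 ≤ N := add_nonneg (normH1_nonneg _ _) (normH1_nonneg _ _)
  -- Common bound for the three forcing coefficients ε(h0 - h1), κ h0 + k0 and κ h1 + k1 in units of
  -- A e^{-δt}.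
  set B := 2 * ε + κ + 1 with hB
  refine ⟨C * (1 + N + B) + N, by positivity,
    fun W0 W10 w2 hW A h0 h1 k0 k1 hA ch0 ch1 ck0 ck1 d0 d1 bh0 bh1 bk0 bk1 f0 f1 => ?_⟩
  have cu0 := H2Curve.smul_profile ch0 (ck0.mono Ioi_subset_Ici_self) d0 hP0
  have cu1 := H2Curve.smul_profile ch1 (ck1.mono Ioi_subset_Ici_self) d1 hP1
  have hz : HasH2 (ext (W0 + h0 0 • P0 + h1 0 • P1)) (ext (W10 + h0 0 • P01 + h1 0 • P11))
      (fun x => w2 x + h0 0 * ext P02 x + h1 0 * ext P12 x) :=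
    (hW.add ((HasH2.of_hasDeriv hP0.d1 hP0.d2 (continuous_ext _).continuousOn).const_mul (h0 0))).add
      ((HasH2.of_hasDeriv hP1.d1 hP1.d2 (continuous_ext _).continuousOn).const_mul (h1 0))
  have v00 : ext P01 0 = 1 := by rw [ext_toCI _ i0]; norm_num
  have v01 : ext P01 1 = 0 := by rw [ext_toCI _ i1]; norm_num
  have v10 : ext P11 0 = 0 := ext_toCI _ i0
  have v11 : ext P11 1 = 1 := ext_toCI _ i1
  -- Z = W + h0 P0 + h1 P1 has zero flux. The time derivatives k0, k1 of the fluxes enter the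
  -- forcing here, and this is why their decay is required.
  obtain ⟨Z, Z1, Z2, Zt, hZ, e0, e1, hpde, hBC, hbd⟩ := H _ _ _ hz
    (by simp only [ext_add, ext_smul, v00, v10, f0]; ring)
    (by simp only [ext_add, ext_smul, v01, v11, f1]; ring) (B * A)
    ![fun t => ε * (h0 t - h1 t), fun t => κ * h0 t + k0 t, fun t => κ * h1 t + k1 t]
    (by positivity) (fun i => by
      fin_cases i
      · exact (ch0.sub ch1).const_mul ε
      · exact (ch0.const_mul κ).add ck0
      · exact (ch1.const_mul κ).add ck1) (fun i t ht => by
      have q0 := abs_le.1 (bh0 t ht)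
      have q1 := abs_le.1 (bh1 t ht)
      have q2 := abs_le.1 (bk0 t ht)
      have q3 := abs_le.1 (bk1 t ht)
      have hAE : 0 ≤ A * Real.exp (-δ * t) := by positivity
      rw [mul_assoc]
      generalize A * Real.exp (-δ * t) = Y at *
      have y1 := mul_nonneg hκ.le hAE
      have y2 := mul_nonneg hε.le hAE
      have z0 := mul_le_mul_of_nonneg_left q0.1 hκ.le
      have z1 := mul_le_mul_of_nonneg_left q0.2 hκ.le
      have z2 := mul_le_mul_of_nonneg_left q1.1 hκ.le
      have z3 := mul_le_mul_of_nonneg_left q1.2 hκ.le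
      have z4 := mul_le_mul_of_nonneg_left q0.1 hε.le
      have z5 := mul_le_mul_of_nonneg_left q0.2 hε.le
      have z6 := mul_le_mul_of_nonneg_left q1.1 hε.le
      have z7 := mul_le_mul_of_nonneg_left q1.2 hε.le
      rw [hB]
      fin_cases i
      · change |ε * (h0 t - h1 t)| ≤ _
        rw [abs_le]
        constructor <;> linarith
      · change |κ * h0 t + k0 t| ≤ _
        rw [abs_le]
        constructor <;> linarith
      · change |κ * h1 t + k1 t| ≤ _
        rw [abs_le]
        constructor <;> linarith)
  refine ⟨_, _, _, _, (hZ.sub cu0).sub cu1, ?_, ?_, fun t ht => ?_, fun t ht => ?_, fun t ht => ?_⟩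
  · simp only [e0]; abel
  · simp only [e1]; abel
  · simp only [hpde t ht, Fin.sum_univ_three]
    have e : P02 = -P12 := CI_ext fun x hx => by rw [ext_neg, ext_toCI _ hx, ext_toCI _ hx]
    simp only [Matrix.cons_val, e]
    module
  · simp only [ext_sub, ext_smul, v00, v01, v10, v11, (hBC t ht).1, (hBC t ht).2]
    constructor <;> ring
  · have s1 := normH1_sub_le (Z t - h0 t • P0) (Z1 t - h0 t • P01) (h1 t • P1) (h1 t • P11)
    have s2 := normH1_sub_le (Z t) (Z1 t) (h0 t • P0) (h0 t • P01)
    rw [normH1_smul] at s1 s2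
    have s3 : normH1 (W0 + h0 0 • P0 + h1 0 • P1) (W10 + h0 0 • P01 + h1 0 • P11)
        ≤ normH1 W0 W10 + A * N := by
      have r1 := normH1_sub_le (W0 - (-h0 0) • P0) (W10 - (-h0 0) • P01) ((-h1 0) • P1)
        ((-h1 0) • P11)
      have r2 := normH1_sub_le W0 W10 ((-h0 0) • P0) ((-h0 0) • P01)
      rw [normH1_smul, abs_neg] at r1 r2
      simp only [neg_smul, sub_neg_eq_add] at r1 r2
      have b0 := bh0 0 le_rfl
      have b1 := bh1 0 le_rfl
      simp only [mul_zero, Real.exp_zero, mul_one] at b0 b1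
      have := mul_le_mul_of_nonneg_right b0 (normH1_nonneg P0 P01)
      have := mul_le_mul_of_nonneg_right b1 (normH1_nonneg P1 P11)
      rw [hN]
      linarith
    have s4 := mul_le_mul_of_nonneg_right (bh0 t ht) (normH1_nonneg P0 P01)
    have s5 := mul_le_mul_of_nonneg_right (bh1 t ht) (normH1_nonneg P1 P11)
    have s6 := hbd t ht
    set E := Real.exp (-δ * t) with hE
    have hE0 : 0 < E := Real.exp_pos _
    have hn := normH1_nonneg W0 W10
    have s7 : C * E * (normH1 (W0 + h0 0 • P0 + h1 0 • P1) (W10 + h0 0 • P01 + h1 0 • P11) + B * A)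
        ≤ C * E * ((1 + N + B) * (normH1 W0 W10 + A)) := by
      refine mul_le_mul_of_nonneg_left ?_ (by positivity)
      have : 0 ≤ (N + B) * normH1 W0 W10 := by positivity
      nlinarith
    calc _ ≤ C * E * ((1 + N + B) * (normH1 W0 W10 + A)) + A * E * N := by rw [hN]; linarith
      _ ≤ _ := by
        have : 0 ≤ N * E * normH1 W0 W10 := by positivity
        linarith

/-! ### The linear closed loop -/

theorem zero_mem_Icc : (0 : ℝ) ∈ Icc (0 : ℝ) 1 := by simp

theorem one_mem_Icc : (1 : ℝ) ∈ Icc (0 : ℝ) 1 := by simp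

theorem ext_zero_eq_evalCLM (F : CI) :
    ext F 0 = ContinuousMap.evalCLM ℝ (⟨0, zero_mem_Icc⟩ : Icc (0 : ℝ) 1) F := ext_of_mem _ _

theorem ext_one_eq_evalCLM (F : CI) :
    ext F 1 = ContinuousMap.evalCLM ℝ (⟨1, one_mem_Icc⟩ : Icc (0 : ℝ) 1) F := ext_of_mem _ _

/-- The profile `x ↦ k_x(y,x)`. -/
def kernXProfile (q y : ℝ) : CI := toCI (fun x => kernX q y x)
  (Continuous.comp₂_curried (continuous_kernX q) continuous_const continuous_id).continuousOn

theorem ext_kernXProfile (q y : ℝ) {x : ℝ} (hx : x ∈ Icc (0 : ℝ) 1) :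
    ext (kernXProfile q y) x = kernX q y x := ext_toCI _ hx

/-- Boundary conditions of the linear closed loop for profiles with derivatives `v1`, `m1`. -/
structure LinBC (q₁ q₂ : ℝ) (v v1 m m1 : ℝ → ℝ) : Prop where
  plant0 : v1 0 = kern q₁ 0 0 * v 0 - ∫ y in (0 : ℝ)..1, kernX q₁ 0 y * m y
  plant1 : v1 1 = kern q₁ 1 1 * v 1 + ∫ y in (0 : ℝ)..1, kernX q₁ 1 y * m y
  obs0 : m1 0 = v1 0 - kern q₂ 0 0 * (v 0 - m 0)
  obs1 : m1 1 = v1 1 - kern q₂ 1 1 * (v 1 - m 1)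

/-- Testing the error equation with a smooth function gives a bounded functional. -/
theorem exists_test_functional {K K1 K2 : ℝ → ℝ} (hK : ∀ y, HasDerivAt K (K1 y) y)
    (hK1 : ∀ y, HasDerivAt K1 (K2 y) y) (hc : Continuous K) (hK2 : Continuous K2)
    (ε l k0 k1 : ℝ) (P0 P1 : CI) :
    ∃ G : CI →L[ℝ] ℝ, ∀ E E1 E2 : CI, IsC2 E E1 E2 → ext E1 0 = k0 * ext E 0 →
      ext E1 1 = k1 * ext E 1 →
      intFunc K hc (ε • E2 - l • E + ε • (ext E 1 • P1 + ext E 0 • P0)) = G E := by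
  let e0 : CI →L[ℝ] ℝ := ContinuousMap.evalCLM ℝ (⟨0, zero_mem_Icc⟩ : Icc (0 : ℝ) 1)
  let e1 : CI →L[ℝ] ℝ := ContinuousMap.evalCLM ℝ (⟨1, one_mem_Icc⟩ : Icc (0 : ℝ) 1)
  refine ⟨ε • ((K 1 * k1 - K1 1) • e1 - (K 0 * k0 - K1 0) • e0 + intFunc K2 hK2) - l • intFunc K hc
    + ε • (intFunc K hc P1 • e1 + intFunc K hc P0 • e0), fun E E1 E2 h h0 h1 => ?_⟩
  -- Both derivatives of E move onto K, and the Robin conditions replace the end values of E1 by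
  -- those of E; everything left is continuous in the sup norm.
  have e := integral_by_parts_twice zero_mem_Icc one_mem_Icc hK hK1 hK2 h.d1 h.d2
    (continuous_ext E2).continuousOn
  rw [← intFunc_apply K hc, ← intFunc_apply K2 hK2, h0, h1] at e
  simp only [map_add, map_sub, map_smul, smul_eq_mul, add_apply, sub_apply, smul_apply, e]
  rw [← ext_zero_eq_evalCLM, ← ext_one_eq_evalCLM]
  ring

section transformation

variable (q : ℝ) (F F1 : CI)

theorem ext_one_sub_apply (T : CI →L[ℝ] CI) (x : ℝ) :
    ext ((1 - T) F) x = ext F x - ext (T F) x := rfl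

/-- At x = 0 the two integrals coincide, and at x = 1 both are empty. Hence 1 - `obsOp` keeps the
boundary values, so the injected measurement errors are the same before and after the
transformation. -/
theorem ext_obsOp_zero : ext (obsOp q F) 0 = 0 := by
  rw [ext_obsOp q F zero_mem_Icc]; simp

theorem ext_obsOp_one : ext (obsOp q F) 1 = 0 := by
  rw [ext_obsOp q F one_mem_Icc]; simp

theorem ext_obsOpX_zero : ext (obsOpX q F) 0 = -(kern q 0 0 * ext F 0) := by
  rw [ext_obsOpX q F zero_mem_Icc, kern_diag]; simp

theorem ext_obsOpX_one : ext (obsOpX q F) 1 = -(kern q 1 1 * ext F 1) := by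
  rw [ext_obsOpX q F one_mem_Icc, kern_diag]; simp

theorem ext_ctrlOpX_zero : ext (ctrlOpX q F) 0
    = kern q 0 0 * ext F 0 - ∫ y in (0 : ℝ)..1, kernX q 0 y * ext F y := by
  rw [ext_ctrlOpX q F zero_mem_Icc, kern_diag, sub_zero, intervalIntegral.integral_symm]; ring

theorem ext_ctrlOpX_one : ext (ctrlOpX q F) 1
    = kern q 1 1 * ext F 1 + ∫ y in (0 : ℝ)..1, kernX q 1 y * ext F y := by
  rw [ext_ctrlOpX q F one_mem_Icc, kern_diag, sub_self]

end transformation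

theorem continuous_kernX_right (q y : ℝ) : Continuous fun x => kernX q y x :=
  Continuous.comp₂_curried (continuous_kernX q) continuous_const continuous_id

/-- The observer error system is stable. -/
theorem exists_error_system {ε l q δ : ℝ} (hε : 0 < ε) (hδ : 0 < δ) (hδl : δ < l + ε * q) :
    ∃ C, 0 < C ∧ ∀ (E0 E10 : CI) (e2 : ℝ → ℝ), HasH2 (ext E0) (ext E10) e2 →
      ext E10 0 = kern q 0 0 * ext E0 0 → ext E10 1 = kern q 1 1 * ext E0 1 →
      ∃ E E1 E2 Et : ℝ → CI, H2Curve E E1 E2 Et ∧ E 0 = E0 ∧ E1 0 = E10 ∧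
        (∀ t, 0 < t → Et t = ε • E2 t - l • E t
          + ε • (ext (E t) 1 • kernXProfile q 1 + ext (E t) 0 • kernXProfile q 0)) ∧
        (∀ t, 0 ≤ t → ext (E1 t) 0 = kern q 0 0 * ext (E t) 0 ∧
          ext (E1 t) 1 = kern q 1 1 * ext (E t) 1) ∧
        ∀ t, 0 ≤ t → normH1 (E t) (E1 t) ≤ C * Real.exp (-δ * t) * normH1 E0 E10 := by
  obtain ⟨R, hR1, hR2⟩ := exists_obsOp_inverse q
  have hTi := transform_obs_inverse hR1
  have hT := transform_obs q
  obtain ⟨C, hC, H⟩ := exists_neumann_heat_forced hε hδ hδl (ι := Fin 0) (Ψ := fun _ => 0)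
    (Ψ1 := fun _ => 0) (Ψ2 := fun _ => 0) (fun i => i.elim0)
  refine ⟨(‖1 - obsOp q‖ + ‖-obsOpX q‖ + 1) * C * (‖R‖ + ‖obsOpX q ∘L R‖ + 1), by positivity,
    fun E0 E10 e2 hE b0 b1 => ?_⟩
  have hval : ∀ x, ext (obsOp q (R E0)) x = 0 → ext (R E0) x = ext E0 x := fun x hx => by
    have := congrArg (fun F => ext F x) (hR1 E0)
    simp only [ext_sub, hx, sub_zero] at this
    exact this
  -- The derivative of the transformation at the ends is local, and the Robin conditions of the
  -- error become exact Neumann conditions; so the cosine theory applies without forcing, with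
  -- damping l + εq.
  obtain ⟨W, W1, W2, Wt, hW, w0, w10, wpde, wbc, wb⟩ := H _ _ _ (hTi.hasH2 hE)
    (by
      rw [ext_add, ContinuousLinearMap.comp_apply, ext_obsOpX_zero, hval 0 (ext_obsOp_zero _ _), b0]
      ring)
    (by
      rw [ext_add, ContinuousLinearMap.comp_apply, ext_obsOpX_one, hval 1 (ext_obsOp_one _ _), b1]
      ring) 0 (fun i => i.elim0) le_rfl (fun i => i.elim0) (fun i => i.elim0)
  have hv0 : ∀ F : CI, ext ((1 - obsOp q) F) 0 = ext F 0 := fun F => by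
    rw [ext_one_sub_apply, ext_obsOp_zero, sub_zero]
  have hv1 : ∀ F : CI, ext ((1 - obsOp q) F) 1 = ext F 1 := fun F => by
    rw [ext_one_sub_apply, ext_obsOp_one, sub_zero]
  have hE0 : (1 - obsOp q) (W 0) = E0 := by
    rw [w0]
    exact hR1 E0
  refine ⟨_, _, _, _, hT.h2Curve hW, hE0, ?_, fun t ht => ?_, fun t ht => ?_, fun t ht => ?_⟩
  · simp only [w0, w10, neg_apply, ContinuousLinearMap.comp_apply]
    abel
  -- The boundary terms of the intertwining relation reproduce the output injection, while its
  -- zeroth-order part cancels the extra damping εq.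
  · have hi := fun x hx => obsOp_intertwine q (hW.isC2 ht) (wbc t ht.le).1 (wbc t ht.le).2 (x := x) hx
    have hpde := wpde t ht
    simp only [Finset.univ_eq_empty, Finset.sum_empty, add_zero] at hpde
    refine CI_ext fun x hx => ?_
    simp only [hpde, map_sub, map_smul, hv0, hv1]
    simp only [ext_add, ext_sub, ext_smul, ext_one_sub_apply, neg_apply, ext_neg, obsOpM,
      ext_mulOp _ _ _ hx, ext_kernXProfile q _ hx]
    have := hi x hx
    linear_combination ε * this
  · simp only [hv0, hv1, ext_add, neg_apply, ext_neg, ext_obsOpX_zero, ext_obsOpX_one,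
      (wbc t ht).1, (wbc t ht).2]
    constructor <;> ring
  · have h1 := hT.normH1_le (hW.d1 t ht)
    have h2 := wb t ht
    have h3 := hTi.normH1_le hE.deriv
    rw [add_zero] at h2
    set N1 := ‖1 - obsOp q‖ + ‖-obsOpX q‖ + 1 with hN1
    set N2 := ‖R‖ + ‖obsOpX q ∘L R‖ + 1 with hN2
    have hN1' : 0 ≤ N1 := by positivity
    have hCE : 0 ≤ C * Real.exp (-δ * t) := by positivity
    calc _ ≤ N1 * normH1 (W t) (W1 t) := h1
      _ ≤ N1 * (C * Real.exp (-δ * t) * (N2 * normH1 E0 E10)) :=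
        mul_le_mul_of_nonneg_left (h2.trans (mul_le_mul_of_nonneg_left h3 hCE)) hN1'
      _ = _ := by ring

/-- Well-posedness and exponential stability of the linear closed loop. -/
theorem exists_linear_closed_loop {ε l q₁ q₂ : ℝ} (hε : 0 < ε) (hl : 0 ≤ l) (hq₁ : 0 < q₁)
    (hq₂ : 0 < q₂) :
    ∃ C δ, 0 < C ∧ 0 < δ ∧ ∀ (V0 V10 M0 M10 : CI) (v2 m2 : ℝ → ℝ),
      HasH2 (ext V0) (ext V10) v2 → HasH2 (ext M0) (ext M10) m2 →
      LinBC q₁ q₂ (ext V0) (ext V10) (ext M0) (ext M10) →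
      ∃ V V1 V2 Vt M M1 M2 Mt : ℝ → CI, H2Curve V V1 V2 Vt ∧ H2Curve M M1 M2 Mt ∧
        V 0 = V0 ∧ M 0 = M0 ∧
        (∀ t, 0 < t → Vt t = ε • V2 t - l • V t) ∧
        (∀ t, 0 < t → Mt t = ε • M2 t - l • M t - ε • ((ext (V t) 1 - ext (M t) 1) • kernXProfile q₂ 1
          + (ext (V t) 0 - ext (M t) 0) • kernXProfile q₂ 0)) ∧
        (∀ t, 0 ≤ t → LinBC q₁ q₂ (ext (V t)) (ext (V1 t)) (ext (M t)) (ext (M1 t))) ∧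
        ∀ t, 0 ≤ t → normH1 (V t) (V1 t) + normH1 (M t) (M1 t)
          ≤ C * Real.exp (-δ * t) * (normH1 V0 V10 + normH1 M0 M10) := by
  have hκ₁ : 0 < l + ε * q₁ := by positivity
  have hκ₂ : 0 < l + ε * q₂ := by positivity
  -- A single rate strictly below both dampings, so that the error enters the controlled equation as
  -- a forcing decaying more slowly than every mode.
  set δ := min (l + ε * q₁) (l + ε * q₂) / 2 with hδdef
  have hδ : 0 < δ := by positivity
  have hδ₁ : δ < l + ε * q₁ := by
    have := min_le_left (l + ε * q₁) (l + ε * q₂)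
    rw [hδdef]; linarith
  have hδ₂ : δ < l + ε * q₂ := by
    have := min_le_right (l + ε * q₁) (l + ε * q₂)
    rw [hδdef]; linarith
  obtain ⟨CE, hCE, HE⟩ := exists_error_system hε hδ hδ₂
  obtain ⟨CW, hCW, HW⟩ := exists_heat_flux hε hδ hδ₁
  obtain ⟨R, hR1, hR2⟩ := exists_ctrlOp_inverse q₁
  have hTi := transform_ctrl_inverse hR1
  have hT := transform_ctrl q₁
  have cX := continuous_kernX_right q₁
  let L0 : CI →L[ℝ] ℝ := intFunc (fun y => kernX q₁ 0 y) (cX 0)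
  let L1 : CI →L[ℝ] ℝ := intFunc (fun y => kernX q₁ 1 y) (cX 1)
  -- G0 represents the time derivative of the flux integral L0(e), and G1 that of L1(e).
  obtain ⟨G0, hG0⟩ := exists_test_functional (hasDerivAt_kernX_right q₁ 0)
    (hasDerivAt_kernXY_right q₁ 0) (cX 0)
    (Continuous.comp₂_curried (continuous_kernXYY q₁) continuous_const continuous_id)
    ε l (kern q₂ 0 0) (kern q₂ 1 1) (kernXProfile q₂ 0) (kernXProfile q₂ 1)
  obtain ⟨G1, hG1⟩ := exists_test_functional (hasDerivAt_kernX_right q₁ 1)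
    (hasDerivAt_kernXY_right q₁ 1) (cX 1)
    (Continuous.comp₂_curried (continuous_kernXYY q₁) continuous_const continuous_id)
    ε l (kern q₂ 0 0) (kern q₂ 1 1) (kernXProfile q₂ 0) (kernXProfile q₂ 1)
  set S := ‖L0‖ + ‖L1‖ + ‖G0‖ + ‖G1‖ with hS
  have hS0 : 0 ≤ S := by positivity
  set N1 := ‖1 - ctrlOp q₁‖ + ‖-ctrlOpX q₁‖ + 1 with hN1
  set N2 := ‖R‖ + ‖ctrlOpX q₁ ∘L R‖ + 1 with hN2
  have hN1' : 0 < N1 := by positivity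
  have hN2' : 0 < N2 := by positivity
  refine ⟨2 * (N2 * CW * (N1 + S * CE)) + CE, δ, by positivity, hδ,
    fun V0 V10 M0 M10 v2 m2 hV hM hbc => ?_⟩
  -- Subtracting the plant and observer conditions cancels the control terms, so the error starts
  -- with homogeneous Robin conditions.
  obtain ⟨E, E1, E2, Et, hE, e0, e10, epde, ebc, eb⟩ := HE (V0 - M0) (V10 - M10) _ (hV.sub hM)
    (by simp only [ext_sub, hbc.obs0]; ring) (by simp only [ext_sub, hbc.obs1]; ring)
  set n0 := normH1 V0 V10 + normH1 M0 M10 with hn0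
  have hn0' : 0 ≤ n0 := add_nonneg (normH1_nonneg _ _) (normH1_nonneg _ _)
  have hnE : ∀ t, 0 ≤ t → normH1 (E t) (E1 t) ≤ CE * Real.exp (-δ * t) * n0 := fun t ht =>
    (eb t ht).trans (mul_le_mul_of_nonneg_left (normH1_sub_le _ _ _ _) (by positivity))
  have hEn : ∀ t, 0 ≤ t → ‖E t‖ ≤ CE * Real.exp (-δ * t) * n0 := fun t ht =>
    (norm_le_normH1 (hE.d1 t ht)).trans (hnE t ht)
  have hbound : ∀ L : CI →L[ℝ] ℝ, ‖L‖ ≤ S → ∀ t, 0 ≤ t →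
      |L (E t)| ≤ S * CE * n0 * Real.exp (-δ * t) := fun L hL t ht => by
    refine (L.le_opNorm (E t)).trans ((mul_le_mul hL (hEn t ht) (norm_nonneg _) hS0).trans_eq ?_)
    ring
  have hcont : ∀ L : CI →L[ℝ] ℝ, ContinuousOn (fun t => L (E t)) (Ici 0) := fun L =>
    L.continuous.comp_continuousOn hE.cont
  have hder : ∀ L : CI →L[ℝ] ℝ, ∀ t, 0 < t → HasDerivAt (fun t => L (E t)) (L (Et t)) t :=
    fun L t ht => L.hasFDerivAt.comp_hasDerivAt t (hE.dt t ht)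
  have n1 := norm_nonneg L0
  have n2 := norm_nonneg L1
  have n3 := norm_nonneg G0
  have n4 := norm_nonneg G1
  -- The fluxes of W are L0(e) at 0 and -L1(e) at 1. They result from replacing m by ṽ - e in the
  -- control: the part in ṽ is exactly what `ctrlOpX` removes. The opposite signs come from the
  -- orientation of [1-x,x] at the two ends.
  obtain ⟨W, W1, W2, Wt, hW, w0, w10, wpde, wbc, wb⟩ := HW _ _ _ (hT.hasH2 hV) (S * CE * n0)
    (fun t => -L0 (E t)) (fun t => L1 (E t)) (fun t => -G0 (E t)) (fun t => G1 (E t))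
    (by positivity) (hcont L0).neg (hcont L1) (hcont G0).neg (hcont G1)
    (fun t ht => by
      rw [← hG0 _ _ _ (hE.isC2 ht) (ebc t ht.le).1 (ebc t ht.le).2, ← epde t ht]
      exact (hder L0 t ht).neg)
    (fun t ht => by
      rw [← hG1 _ _ _ (hE.isC2 ht) (ebc t ht.le).1 (ebc t ht.le).2, ← epde t ht]
      exact hder L1 t ht)
    (fun t ht => by rw [abs_neg]; exact hbound L0 (by linarith) t ht)
    (fun t ht => hbound L1 (by linarith) t ht)
    (fun t ht => by rw [abs_neg]; exact hbound G0 (by linarith) t ht)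
    (fun t ht => hbound G1 (by linarith) t ht)
    (by
      rw [e0, map_sub]
      simp only [ext_add, neg_apply, ext_neg, ext_ctrlOpX_zero, hbc.plant0]
      rw [← intFunc_apply _ (cX 0), ← intFunc_apply _ (cX 0)]
      ring)
    (by
      rw [e0, map_sub]
      simp only [ext_add, neg_apply, ext_neg, ext_ctrlOpX_one, hbc.plant1]
      rw [← intFunc_apply _ (cX 1), ← intFunc_apply _ (cX 1)]
      ring)
  -- The plant is recovered as R W and the observer as R W - E.
  have hVc := hTi.h2Curve hW
  have hMc := hVc.sub hE
  have hV0 : R (W 0) = V0 := by rw [w0]; exact hR2 V0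
  have hbdV : ∀ t, 0 ≤ t → normH1 (R (W t)) (W1 t + (ctrlOpX q₁ ∘L R) (W t))
      ≤ N2 * CW * (N1 + S * CE) * Real.exp (-δ * t) * n0 := fun t ht => by
    have h1 := hTi.normH1_le (hW.d1 t ht)
    have h2 := wb t ht
    have h3 := hT.normH1_le hV.deriv
    have h4 : normH1 V0 V10 ≤ n0 := le_add_of_nonneg_right (normH1_nonneg _ _)
    calc _ ≤ N2 * normH1 (W t) (W1 t) := h1
      _ ≤ N2 * (CW * Real.exp (-δ * t) * (N1 * n0 + S * CE * n0)) := by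
        refine mul_le_mul_of_nonneg_left (h2.trans (mul_le_mul_of_nonneg_left ?_ (by positivity)))
          hN2'.le
        have := mul_le_mul_of_nonneg_left h4 hN1'.le
        linarith
      _ = _ := by ring
  have hv0 : ∀ t, 0 ≤ t → ext (W1 t + (ctrlOpX q₁ ∘L R) (W t)) 0 = kern q₁ 0 0 * ext (R (W t)) 0
      - ∫ y in (0 : ℝ)..1, kernX q₁ 0 y * ext (R (W t) - E t) y := fun t ht => by
    rw [ext_add, (wbc t ht).1, ContinuousLinearMap.comp_apply, ext_ctrlOpX_zero,
      ← intFunc_apply _ (cX 0), ← intFunc_apply _ (cX 0), map_sub]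
    ring
  have hv1 : ∀ t, 0 ≤ t → ext (W1 t + (ctrlOpX q₁ ∘L R) (W t)) 1 = kern q₁ 1 1 * ext (R (W t)) 1
      + ∫ y in (0 : ℝ)..1, kernX q₁ 1 y * ext (R (W t) - E t) y := fun t ht => by
    rw [ext_add, (wbc t ht).2, ContinuousLinearMap.comp_apply, ext_ctrlOpX_one,
      ← intFunc_apply _ (cX 1), ← intFunc_apply _ (cX 1), map_sub]
    ring
  have hVpde : ∀ t, 0 < t → R (Wt t) = ε • (W2 t + ((ctrlOpXX q₁ ∘L R
      + ctrlOpM q₁ ∘L ctrlOpX q₁ ∘L R) (W t) + ctrlOpM q₁ (W1 t))) - l • R (W t) := fun t ht => by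
    have hi := fun x hx => ctrlOp_intertwine q₁ (hVc.isC2 ht) (x := x) hx
    set V2 := W2 t + ((ctrlOpXX q₁ ∘L R + ctrlOpM q₁ ∘L ctrlOpX q₁ ∘L R) (W t)
      + ctrlOpM q₁ (W1 t)) with hV2
    -- Both sides are written as R applied to something, so that the claim reduces to the
    -- intertwining relation for 1 - `ctrlOp`.
    rw [← hR2 (ε • V2 - l • R (W t))]
    congr 1
    have hw : ∀ x, ext (W t) x = ext (R (W t)) x - ext (ctrlOp q₁ (R (W t))) x := fun x => by
      rw [← ext_sub, hR1]
    refine CI_ext fun x hx => ?_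
    have h := hi x hx
    have hm : ext V2 x = ext (W2 t) x + (ext (ctrlOpXX q₁ (R (W t))) x
        + -(q₁ / 2) * (x - 1 / 2) * ext (W1 t + (ctrlOpX q₁ ∘L R) (W t)) x) := by
      simp only [hV2, ext_add, add_apply, ContinuousLinearMap.comp_apply, ctrlOpM,
        ext_mulOp _ _ _ hx]
      ring
    simp only [wpde t ht, map_sub, map_smul, ext_sub, ext_smul]
    rw [hw x]
    linear_combination (-ε) * hm - ε * h
  refine ⟨_, _, _, _, _, _, _, _, hVc, hMc, hV0, ?_, hVpde, fun t ht => ?_, fun t ht => ?_,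
    fun t ht => ?_⟩
  · simp only [hV0, e0]; abel
  · simp only [hVpde t ht, epde t ht, ext_sub]
    module
  · refine ⟨hv0 t ht, hv1 t ht, ?_, ?_⟩
    · simp only [ext_sub, (ebc t ht).1]; ring
    · simp only [ext_sub, (ebc t ht).2]; ring
  · have h1 := normH1_sub_le (R (W t)) (W1 t + (ctrlOpX q₁ ∘L R) (W t)) (E t) (E1 t)
    have h2 := hbdV t ht
    have h3 := hnE t ht
    calc _ ≤ 2 * (N2 * CW * (N1 + S * CE) * Real.exp (-δ * t) * n0)
          + CE * Real.exp (-δ * t) * n0 := by linarith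
      _ = _ := by ring

/-! ### Gevrey classes -/

theorem choose_le_rpow {γ : ℝ} (hγ : 1 ≤ γ) {n k : ℕ} (hk : k ≤ n) :
    (n.choose k : ℝ) ≤ (n.choose k : ℝ) ^ γ :=
  Real.self_le_rpow_of_one_le (by exact_mod_cast Nat.choose_pos hk) hγ

/-- For γ ≥ 1 a binomial coefficient is at most its γ-th power, so it is absorbed by the powers of
factorials. This is what makes the Leibniz rule compatible with Gevrey bounds. -/
theorem choose_mul_factorial_rpow_le {γ : ℝ} (hγ : 1 ≤ γ) {n k : ℕ} (hk : k ≤ n) :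
    (n.choose k : ℝ) * ((k ! : ℝ) ^ γ * ((n - k)! : ℝ) ^ γ) ≤ (n ! : ℝ) ^ γ := by
  have e : (n ! : ℝ) = n.choose k * (k ! * (n - k)!) := by
    exact_mod_cast (by rw [← Nat.choose_mul_factorial_mul_factorial hk, mul_assoc] :
      n ! = n.choose k * (k ! * (n - k)!))
  rw [e, Real.mul_rpow (by positivity) (by positivity), Real.mul_rpow (by positivity) (by positivity)]
  exact mul_le_mul_of_nonneg_right (choose_le_rpow hγ hk) (by positivity)

theorem succ_le_two_pow (n : ℕ) : (n + 1 : ℝ) ≤ 2 ^ n := by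
  exact_mod_cast Nat.succ_le_of_lt (Nat.lt_two_pow_self (n := n))

namespace IsGevrey

variable {F F' M M' γ : ℝ} {f g : ℝ → ℝ}

theorem contDiffWithinAt (hf : IsGevrey F M γ f) (n : ℕ) {t : ℝ} (ht : 0 ≤ t) :
    ContDiffWithinAt ℝ n f (Ici 0) t := (hf.smooth t ht).of_le (by exact_mod_cast le_top)

theorem mono (hf : IsGevrey F M γ f) (hF : F ≤ F') (hF0 : 0 ≤ F) (hM0 : 0 ≤ M) (hM : M ≤ M') :
    IsGevrey F' M' γ f := ⟨hf.smooth, fun n t ht => (hf.bound n t ht).trans (by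
    have := hF0.trans hF
    gcongr)⟩

theorem const_mul (hf : IsGevrey F M γ f) (c : ℝ) : IsGevrey (|c| * F) M γ fun t => c * f t :=
  ⟨contDiffOn_const.mul hf.smooth, fun n t ht => by
    rw [iteratedDerivWithin_const_mul (mem_Ici.2 ht) (uniqueDiffOn_Ici 0) c (hf.contDiffWithinAt n ht), abs_mul,
      mul_assoc, mul_assoc]
    have := hf.bound n t ht
    rw [mul_assoc] at this
    gcongr⟩

theorem add (hf : IsGevrey F M γ f) (hg : IsGevrey F' M γ g) :
    IsGevrey (F + F') M γ fun t => f t + g t :=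
  ⟨hf.smooth.add hg.smooth, fun n t ht => by
    rw [iteratedDerivWithin_fun_add (mem_Ici.2 ht) (uniqueDiffOn_Ici 0) (hf.contDiffWithinAt n ht)
      (hg.contDiffWithinAt n ht)]
    have h1 := hf.bound n t ht
    have h2 := hg.bound n t ht
    refine (abs_add_le _ _).trans ((add_le_add h1 h2).trans_eq (by ring))⟩

/-- All n + 1 Leibniz terms obey the same bound, and n + 1 ≤ 2^n is paid for by doubling M. -/
theorem mul (hγ : 1 ≤ γ) (hM : 0 ≤ M) (hF : 0 ≤ F) (hF' : 0 ≤ F') (hf : IsGevrey F M γ f)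
    (hg : IsGevrey F' M γ g) : IsGevrey (F * F') (2 * M) γ fun t => f t * g t :=
  ⟨hf.smooth.mul hg.smooth, fun n t ht => by
    have e := iteratedDerivWithin_mul (mem_Ici.2 ht) (uniqueDiffOn_Ici 0) (hf.contDiffWithinAt n ht)
      (hg.contDiffWithinAt n ht)
    change |iteratedDerivWithin n (f * g) (Ici 0) t| ≤ _
    rw [e]
    have hterm : ∀ i ∈ Finset.range (n + 1), |n.choose i * iteratedDerivWithin i f (Ici 0) t
        * iteratedDerivWithin (n - i) g (Ici 0) t| ≤ F * F' * M ^ n * (n ! : ℝ) ^ γ := fun i hi => by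
      have hi' : i ≤ n := Nat.lt_succ_iff.1 (Finset.mem_range.1 hi)
      rw [abs_mul, abs_mul, Nat.abs_cast]
      calc _ ≤ (n.choose i : ℝ) * (F * M ^ i * (i ! : ℝ) ^ γ)
            * (F' * M ^ (n - i) * ((n - i)! : ℝ) ^ γ) := by
            have := hf.bound i t ht
            have := hg.bound (n - i) t ht
            gcongr
        _ = F * F' * M ^ n * (n.choose i * ((i ! : ℝ) ^ γ * ((n - i)! : ℝ) ^ γ)) := by
            rw [← pow_mul_pow_sub M hi']; ring
        _ ≤ _ := mul_le_mul_of_nonneg_left (choose_mul_factorial_rpow_le hγ hi') (by positivity)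
    refine (Finset.abs_sum_le_sum_abs _ _).trans ((Finset.sum_le_sum hterm).trans ?_)
    rw [Finset.sum_const, Finset.card_range, nsmul_eq_mul, mul_pow]
    have h2 := mul_le_mul_of_nonneg_right (succ_le_two_pow n)
      (by positivity : 0 ≤ F * F' * M ^ n * (n ! : ℝ) ^ γ)
    push_cast
    linarith⟩

end IsGevrey

/-! ### Exponentials of Gevrey functions and the transformed outputs -/

theorem sum_two_pow_sub_le (n : ℕ) : ∑ i ∈ Finset.range (n + 1), (2 : ℝ) ^ (n - i) ≤ 2 ^ (n + 1) := by
  have h := Finset.sum_range_reflect (fun i => (2 : ℝ) ^ i) (n + 1)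
  simp only [Nat.add_sub_cancel] at h
  rw [h, geom_sum_eq (by norm_num)]
  norm_num

/-- Derivatives of `exp (α y)` for a Gevrey function `y` with `|α| F ≤ 1`. -/
theorem IsGevrey.exp_bound {F M γ α : ℝ} {y : ℝ → ℝ} (hγ : 1 ≤ γ) (hM : 0 ≤ M) (hF : 0 ≤ F)
    (hα : |α| * F ≤ 1) (hy : IsGevrey F M γ y) :
    ∀ n, (∀ t, 0 ≤ t → |iteratedDerivWithin n (fun t => Real.exp (α * y t)) (Ici 0) t|
      ≤ Real.exp 1 * (2 * M) ^ n * (n ! : ℝ) ^ γ) ∧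
      (0 < n → ∀ t, 0 ≤ t → |iteratedDerivWithin n (fun t => Real.exp (α * y t)) (Ici 0) t|
      ≤ |α| * F * Real.exp 1 * (2 * M) ^ n * (n ! : ℝ) ^ γ) := by
  have hU := uniqueDiffOn_Ici (0 : ℝ)
  set g := fun t => Real.exp (α * y t) with hg
  have hgs : ContDiffOn ℝ ∞ g (Ici 0) := (contDiffOn_const.mul hy.smooth).exp
  have hy0 : ∀ t, 0 ≤ t → |y t| ≤ F := fun t ht => by
    have := hy.bound 0 t ht
    simpa using this
  -- The induction differentiates g' = α y' g. Every derivative of positive order therefore carries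
  -- a factor |α| F, which is kept as the second bound; it is needed for smallness.
  have hd : EqOn (derivWithin g (Ici 0)) ((fun t => α * derivWithin y (Ici 0) t) * g) (Ici 0) :=
    fun t ht => by
      have h1 : DifferentiableWithinAt ℝ y (Ici 0) t :=
        (hy.smooth t ht).differentiableWithinAt (by simp)
      have h2 := ((h1.hasDerivWithinAt.const_mul α).exp).derivWithin (hU t ht)
      rw [hg, h2, Pi.mul_apply]
      ring
  have hys : ContDiffOn ℝ ∞ (derivWithin y (Ici 0)) (Ici 0) :=
    hy.smooth.derivWithin hU (by simp)
  intro n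
  induction n using Nat.strong_induction_on with
  | _ n ih =>
  rcases n with _ | n
  · refine ⟨fun t ht => ?_, fun h => absurd h (lt_irrefl 0)⟩
    simp only [iteratedDerivWithin_zero, pow_zero, mul_one, Nat.factorial_zero, Nat.cast_one,
      Real.one_rpow, hg, Real.abs_exp]
    refine Real.exp_le_exp.2 ((le_abs_self _).trans ?_)
    rw [abs_mul]
    exact (mul_le_mul_of_nonneg_left (hy0 t ht) (abs_nonneg α)).trans hα
  · have key : ∀ t, 0 ≤ t → |iteratedDerivWithin (n + 1) g (Ici 0) t|
        ≤ |α| * F * Real.exp 1 * (2 * M) ^ (n + 1) * ((n + 1)! : ℝ) ^ γ := fun t ht => by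
      rw [iteratedDerivWithin_succ', iteratedDerivWithin_congr hd (mem_Ici.2 ht),
        iteratedDerivWithin_mul (mem_Ici.2 ht) hU (((contDiffOn_const.mul hys) t ht).of_le (by exact_mod_cast le_top))
          ((hgs t ht).of_le (by exact_mod_cast le_top))]
      have hterm : ∀ i ∈ Finset.range (n + 1), |n.choose i
          * iteratedDerivWithin i (fun t => α * derivWithin y (Ici 0) t) (Ici 0) t
          * iteratedDerivWithin (n - i) g (Ici 0) t|
          ≤ |α| * F * Real.exp 1 * M ^ (n + 1) * ((n + 1)! : ℝ) ^ γ * 2 ^ (n - i) := fun i hi => by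
        have hi' : i ≤ n := Nat.lt_succ_iff.1 (Finset.mem_range.1 hi)
        rw [iteratedDerivWithin_const_mul (mem_Ici.2 ht) hU α ((hys t ht).of_le (by exact_mod_cast le_top)),
          ← iteratedDerivWithin_succ', abs_mul, abs_mul, abs_mul, Nat.abs_cast]
        -- The derivative of y has order i + 1, so the binomial coefficient is raised to match the
        -- factorials (i+1)! and (n-i)!.
        have hc : (n.choose i : ℝ) ≤ ((n + 1).choose (i + 1) : ℝ) := by
          exact_mod_cast (by rw [Nat.choose_succ_succ]; omega :
            n.choose i ≤ (n + 1).choose (i + 1))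
        have hf := choose_mul_factorial_rpow_le hγ (n := n + 1) (k := i + 1) (by omega)
        rw [show n + 1 - (i + 1) = n - i by omega] at hf
        calc _ ≤ ((n + 1).choose (i + 1) : ℝ) * (|α| * (F * M ^ (i + 1) * ((i + 1)! : ℝ) ^ γ))
              * (Real.exp 1 * (2 * M) ^ (n - i) * ((n - i)! : ℝ) ^ γ) := by
              have := hy.bound (i + 1) t ht
              have := (ih (n - i) (by omega)).1 t ht
              gcongr
          _ = |α| * F * Real.exp 1 * M ^ (n + 1) * (((n + 1).choose (i + 1) : ℝ)
              * (((i + 1)! : ℝ) ^ γ * ((n - i)! : ℝ) ^ γ)) * 2 ^ (n - i) := by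
              have e : M ^ (n + 1) = M ^ (i + 1) * M ^ (n - i) := by
                rw [← pow_add]
                congr 1
                omega
              rw [e, mul_pow]
              ring
          _ ≤ _ := by gcongr
      refine (Finset.abs_sum_le_sum_abs _ _).trans ((Finset.sum_le_sum hterm).trans ?_)
      rw [← Finset.mul_sum, mul_pow]
      have := mul_le_mul_of_nonneg_left (sum_two_pow_sub_le n)
        (by positivity : 0 ≤ |α| * F * Real.exp 1 * M ^ (n + 1) * ((n + 1)! : ℝ) ^ γ)
      linarith
    refine ⟨fun t ht => (key t ht).trans ?_, fun _ => key⟩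
    rw [mul_assoc, mul_assoc, mul_assoc (Real.exp 1)]
    exact mul_le_of_le_one_left (by positivity) hα

theorem IsGevrey.exp {F M γ α : ℝ} {y : ℝ → ℝ} (hγ : 1 ≤ γ) (hM : 0 ≤ M) (hF : 0 ≤ F)
    (hα : |α| * F ≤ 1) (hy : IsGevrey F M γ y) :
    IsGevrey (Real.exp 1) (2 * M) γ fun t => Real.exp (α * y t) :=
  ⟨(contDiffOn_const.mul hy.smooth).exp, fun n => (hy.exp_bound hγ hM hF hα n).1⟩

theorem abs_exp_sub_one_le_mul (z : ℝ) : |Real.exp z - 1| ≤ |z| * Real.exp |z| := by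
  have hz := Real.add_one_le_exp z
  have hz2 := Real.add_one_le_exp (-z)
  rw [abs_le]
  rcases le_total 0 z with h | h
  · rw [abs_of_nonneg h]
    have e : Real.exp z * Real.exp (-z) = 1 := by rw [← Real.exp_add]; simp
    have hp := Real.exp_pos z
    constructor <;> nlinarith
  · rw [abs_of_nonpos h]
    have h1 : Real.exp z ≤ 1 := Real.exp_le_one_iff.2 h
    have h3 : 1 ≤ Real.exp (-z) := Real.one_le_exp (by linarith)
    constructor <;> nlinarith

/-- Subtracting 1 makes the zeroth derivative proportional to F as well, so that small outputs have
small transformed outputs. -/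
theorem IsGevrey.exp_sub_one {F M γ α : ℝ} {y : ℝ → ℝ} (hγ : 1 ≤ γ) (hM : 0 ≤ M) (hF : 0 ≤ F)
    (hα : |α| * F ≤ 1) (hy : IsGevrey F M γ y) :
    IsGevrey (|α| * F * Real.exp 1) (2 * M) γ fun t => Real.exp (α * y t) - 1 := by
  refine ⟨(contDiffOn_const.mul hy.smooth).exp.sub contDiffOn_const, fun n t ht => ?_⟩
  rcases n with _ | n
  · simp only [iteratedDerivWithin_zero, pow_zero, mul_one, Nat.factorial_zero, Nat.cast_one,
      Real.one_rpow]
    have hy0 : |α * y t| ≤ |α| * F := by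
      have := hy.bound 0 t ht
      simp only [iteratedDerivWithin_zero, pow_zero, mul_one, Nat.factorial_zero, Nat.cast_one,
        Real.one_rpow] at this
      rw [abs_mul]
      exact mul_le_mul_of_nonneg_left this (abs_nonneg α)
    refine (abs_exp_sub_one_le_mul _).trans (mul_le_mul hy0 (Real.exp_le_exp.2 (hy0.trans hα)) (Real.exp_pos _).le
      (by positivity))
  · have e : iteratedDerivWithin (n + 1) (fun t => Real.exp (α * y t) - 1) (Ici 0) t
        = iteratedDerivWithin (n + 1) (fun t => Real.exp (α * y t)) (Ici 0) t := by
      rw [iteratedDerivWithin_succ', iteratedDerivWithin_succ']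
      refine iteratedDerivWithin_congr (fun s _ => ?_) ht
      exact derivWithin_sub_const _
    rw [e]
    exact (hy.exp_bound hγ hM hF hα (n + 1)).2 n.succ_pos t ht

/-- The transformed outputs are Gevrey functions, with a bound proportional to `F`. -/
theorem exists_gevrey_outputs (ε a b x₀ M γ : ℝ) (hM : 0 < M) (hγ : 1 ≤ γ) :
    ∃ C, 0 < C ∧ ∀ F, 0 < F → |a / ε| * F ≤ 1 → ∀ y₁ y₂ : ℝ → ℝ, IsGevrey F M γ y₁ →
      IsGevrey F M γ y₂ → IsGevrey (C * F) (4 * M) γ (y1v ε a b x₀ y₁) ∧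
        IsGevrey (C * F) (4 * M) γ (y2v ε a b x₀ y₁ y₂) := by
  set A := |a / ε| * Real.exp 1 with hA
  set E := |Real.exp (-(a * b / (2 * ε)) * x₀)| with hE
  have hA0 : 0 ≤ A := by positivity
  have hE0 : 0 ≤ E := by positivity
  refine ⟨E * (A + A * |a * b / (2 * ε)|) + E * A + 1, by positivity, fun F hF hFa y₁ y₂ h1 h2 => ?_⟩
  have hFa' : |-(a / ε)| * F ≤ 1 := by rwa [abs_neg]
  have g1 := h1.exp_sub_one hγ hM.le hF.le hFa'
  have g2 := h1.exp hγ hM.le hF.le hFa'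
  rw [abs_neg] at g1
  have g3 : IsGevrey F (2 * M) γ y₂ := h2.mono le_rfl hF.le hM.le (by linarith)
  have g4 := (IsGevrey.mul hγ (by positivity) (Real.exp_pos 1).le hF.le g2 g3)
  have g5 := g1.mono (le_refl _) (by positivity) (by positivity) (by linarith : 2 * M ≤ 4 * M)
  have g6 := ((g4.mono le_rfl (by positivity) (by positivity)
    (by linarith : 2 * (2 * M) ≤ 4 * M)).const_mul (-(a / ε))).add (g5.const_mul (-(a * b / (2 * ε))))
  have g7 := g6.const_mul (Real.exp (-(a * b / (2 * ε)) * x₀))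
  have g8 := g5.const_mul (Real.exp (-(a * b / (2 * ε)) * x₀))
  rw [abs_neg, abs_neg, ← hE] at g7
  rw [← hE] at g8
  constructor
  · refine IsGevrey.mono (f := y1v ε a b x₀ y₁) g8 ?_ (by positivity) (by positivity) le_rfl
    have : 0 ≤ E * (A + A * |a * b / (2 * ε)|) * F := by positivity
    rw [show |a / ε| * F * Real.exp 1 = A * F by rw [hA]; ring]
    nlinarith
  · have e : y2v ε a b x₀ y₁ y₂ = fun t => Real.exp (-(a * b / (2 * ε)) * x₀) *
        (-(a / ε) * (Real.exp (-(a / ε) * y₁ t) * y₂ t)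
          + -(a * b / (2 * ε)) * (Real.exp (-(a / ε) * y₁ t) - 1)) := by
      funext t
      unfold y2v
      ring
    rw [e]
    refine g7.mono ?_ (by positivity) (by positivity) le_rfl
    have : 0 ≤ E * A * F := by positivity
    rw [show |a / ε| * F * Real.exp 1 = A * F by rw [hA]; ring,
      show |a / ε| * (Real.exp 1 * F) = A * F by rw [hA]; ring]
    nlinarith

/-! ### Power series with Gevrey coefficients -/

/-- Majorant of the coefficients of the series for `v^r`. -/
def gevreyMaj (γ Q : ℝ) (n : ℕ) : ℝ := 2 ^ n / (n ! : ℝ) * (((n / 2 + 1)! : ℝ) ^ γ * Q ^ (n / 2 + 1))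

theorem gevreyMaj_nonneg {γ Q : ℝ} (hQ : 1 ≤ Q) (n : ℕ) : 0 ≤ gevreyMaj γ Q n := by
  unfold gevreyMaj; positivity

/-- Ratio test: consecutive terms have ratio Q(k+2)^γ / ((2k+2)(2k+1)), which tends to 0 exactly
because γ < 2. -/
theorem summable_factorial_rpow {γ : ℝ} (hγ : γ < 2) {Q : ℝ} (hQ : 0 ≤ Q) :
    Summable fun k : ℕ => ((k + 1)! : ℝ) ^ γ * Q ^ (k + 1) / ((2 * k)! : ℝ) := by
  have ht : Tendsto (fun k : ℕ => Q * ((k : ℝ) + 2) ^ (-(2 - γ))) atTop (𝓝 (Q * 0)) :=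
    ((tendsto_rpow_neg_atTop (by linarith : 0 < 2 - γ)).comp
      (tendsto_atTop_add_const_right _ 2 tendsto_natCast_atTop_atTop)).const_mul Q
  rw [mul_zero] at ht
  refine summable_of_ratio_norm_eventually_le (r := 1 / 2) (by norm_num) ?_
  filter_upwards [ht.eventually_le_const (by norm_num : (0 : ℝ) < 1 / 2), eventually_ge_atTop 1]
    with k hk hk1
  rw [Real.norm_of_nonneg (by positivity), Real.norm_of_nonneg (by positivity)]
  have e1 : (((k + 1 + 1)! : ℕ) : ℝ) = (k + 2) * ((k + 1)! : ℝ) := by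
    rw [Nat.factorial_succ (k + 1)]; push_cast; ring
  have e2 : (((2 * (k + 1))! : ℕ) : ℝ) = (2 * k + 2) * (2 * k + 1) * ((2 * k)! : ℝ) := by
    rw [show 2 * (k + 1) = 2 * k + 1 + 1 by ring, Nat.factorial_succ, Nat.factorial_succ]
    push_cast; ring
  rw [e1, e2, Real.mul_rpow (by positivity) (by positivity), pow_succ Q (k + 1)]
  have hk1' : (1 : ℝ) ≤ k := by exact_mod_cast hk1
  have hp : ((k : ℝ) + 2) ^ γ ≤ ((k : ℝ) + 2) ^ (-(2 - γ)) * ((2 * k + 2) * (2 * k + 1)) := by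
    have : ((k : ℝ) + 2) ^ γ = ((k : ℝ) + 2) ^ (-(2 - γ)) * ((k : ℝ) + 2) ^ (2 : ℝ) := by
      rw [← Real.rpow_add (by positivity)]; congr 1; ring
    rw [this, Real.rpow_two]
    refine mul_le_mul_of_nonneg_left ?_ (by positivity)
    nlinarith
  have hq : Q * ((k : ℝ) + 2) ^ γ ≤ 1 / 2 * ((2 * k + 2) * (2 * k + 1)) := by
    have h1 := mul_le_mul_of_nonneg_left hp hQ
    have h2 := mul_le_mul_of_nonneg_right hk (by positivity : (0 : ℝ) ≤ (2 * k + 2) * (2 * k + 1))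
    linarith
  rw [div_le_iff₀ (by positivity)]
  have e3 : 1 / 2 * (((k + 1)! : ℝ) ^ γ * Q ^ (k + 1) / ((2 * k)! : ℝ))
      * ((2 * k + 2) * (2 * k + 1) * ((2 * k)! : ℝ))
      = (1 / 2 * ((2 * k + 2) * (2 * k + 1))) * (((k + 1)! : ℝ) ^ γ * Q ^ (k + 1)) := by
    have : ((2 * k)! : ℝ) ≠ 0 := by positivity
    field_simp
  rw [e3]
  have := mul_le_mul_of_nonneg_right hq (by positivity : (0 : ℝ) ≤ ((k + 1)! : ℝ) ^ γ * Q ^ (k + 1))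
  linarith

theorem summable_gevreyMaj {γ : ℝ} (hγ : γ < 2) {Q : ℝ} (hQ : 1 ≤ Q) :
    Summable (gevreyMaj γ Q) := by
  have hs := (summable_factorial_rpow hγ (by positivity : 0 ≤ 4 * Q)).mul_left 2
  -- The indices 2k and 2k+1 share one bound, so the series is compared separately on its even and
  -- odd parts.
  have hb : ∀ k n : ℕ, n / 2 = k → gevreyMaj γ Q n
      ≤ 2 * (((k + 1)! : ℝ) ^ γ * (4 * Q) ^ (k + 1) / ((2 * k)! : ℝ)) := fun k n hk => by
    unfold gevreyMaj
    rw [hk]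
    have h1 : (2 : ℝ) ^ n ≤ 2 * 4 ^ (k + 1) := by
      rw [show (4 : ℝ) = 2 ^ 2 by norm_num, ← pow_mul, ← pow_succ']
      exact pow_le_pow_right₀ (by norm_num) (by omega)
    have h2 : ((2 * k)! : ℝ) ≤ (n ! : ℝ) := by
      exact_mod_cast Nat.factorial_le (by omega)
    calc 2 ^ n / (n ! : ℝ) * (((k + 1)! : ℝ) ^ γ * Q ^ (k + 1))
        ≤ 2 * 4 ^ (k + 1) / ((2 * k)! : ℝ) * (((k + 1)! : ℝ) ^ γ * Q ^ (k + 1)) := by gcongr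
      _ = _ := by rw [mul_pow]; ring
  refine Summable.even_add_odd ?_ ?_
  · exact Summable.of_nonneg_of_le (fun k => gevreyMaj_nonneg hQ _) (fun k => hb k _ (by omega)) hs
  · exact Summable.of_nonneg_of_le (fun k => gevreyMaj_nonneg hQ _) (fun k => hb k _ (by omega)) hs

/-- Termwise differentiation of `∑ Xⁿ/n! aₙ`. -/
theorem hasDerivAt_expSeries {a u0 u1 : ℕ → ℝ} (h0 : Summable u0) (h1 : Summable u1)
    (b0 : ∀ n, 2 ^ n / (n ! : ℝ) * |a n| ≤ u0 n) (b1 : ∀ n, 2 ^ n / (n ! : ℝ) * |a (n + 1)| ≤ u1 n)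
    {X : ℝ} (hX : |X| < 2) :
    HasDerivAt (fun X => ∑' n, X ^ n / (n ! : ℝ) * a n) (∑' n, X ^ n / (n ! : ℝ) * a (n + 1)) X := by
  let g' : ℕ → ℝ → ℝ := fun n X => n * X ^ (n - 1) / (n ! : ℝ) * a n
  have eg : ∀ n X, g' (n + 1) X = X ^ n / (n ! : ℝ) * a (n + 1) := fun n X => by
    simp only [g', Nat.factorial_succ, Nat.add_sub_cancel]
    push_cast
    have : (n : ℝ) + 1 ≠ 0 := by positivity
    field_simp
  have hbd : ∀ (c : ℝ) (n : ℕ) (X : ℝ), |X| < 2 →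
      ‖X ^ n / (n ! : ℝ) * c‖ ≤ 2 ^ n / (n ! : ℝ) * |c| := fun c n X hX => by
    rw [norm_mul, norm_div, norm_pow, Real.norm_eq_abs, Real.norm_of_nonneg (by positivity : (0 : ℝ) ≤ (n ! : ℝ))]
    have := pow_le_pow_left₀ (abs_nonneg X) hX.le n
    rw [Real.norm_eq_abs]
    gcongr
  let u : ℕ → ℝ := fun n => Nat.casesOn n 0 u1
  have hu : Summable u := (summable_nat_add_iff 1).1 h1
  have hmem : ∀ {Y : ℝ}, Y ∈ Ioo (-2 : ℝ) 2 ↔ |Y| < 2 := fun {Y} => abs_lt.symm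
  have key := hasDerivAt_tsum_of_isPreconnected (𝕜 := ℝ) (F := ℝ) (y₀ := X) (y := X)
    (t := Ioo (-2) 2) (g := fun n X => X ^ n / (n ! : ℝ) * a n) (g' := g') hu isOpen_Ioo
    isPreconnected_Ioo (fun n Y _ => ((hasDerivAt_pow n Y).div_const _).mul_const _)
    (fun n Y hY => by
      rcases n with _ | n
      · simp [g', u]
      · rw [eg]
        exact (hbd _ n Y (hmem.1 hY)).trans (b1 n)) (hmem.2 hX)
    (Summable.of_norm_bounded h0 fun n => (hbd _ n X hX).trans (b0 n)) (hmem.2 hX)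
  refine key.congr_deriv ?_
  have hs : Summable fun n => g' n X := by
    refine Summable.of_norm_bounded hu fun n => ?_
    rcases n with _ | n
    · simp [g', u]
    · rw [eg]
      exact (hbd _ n X hX).trans (b1 n)
  rw [hs.tsum_eq_zero_add]
  simp only [eg]
  simp [g']

/-- Termwise differentiation of a series on a half-line. -/
theorem hasDerivWithinAt_tsum_Ici {c d : ℕ → ℝ → ℝ} {u : ℕ → ℝ} (hu : Summable u)
    (hc : ∀ n t, 0 ≤ t → HasDerivWithinAt (c n) (d n t) (Ici 0) t)
    (hd : ∀ n, ContinuousOn (d n) (Ici 0)) (hb : ∀ n t, 0 ≤ t → |d n t| ≤ u n)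
    (hs : Summable fun n => c n 0) {t : ℝ} (ht : 0 ≤ t) :
    HasDerivWithinAt (fun t => ∑' n, c n t) (∑' n, d n t) (Ici 0) t := by
  have hcont : ∀ n, Continuous fun s => d n (max s 0) := fun n =>
    (hd n).comp_continuous (by fun_prop) fun t => mem_Ici.2 (le_max_right _ _)
  -- Each term is extended to negative times as a primitive of its derivative frozen at 0;
  -- differentiation of series is then used on the whole line and restricted back.
  let g : ℕ → ℝ → ℝ := fun n t => c n 0 + ∫ s in (0 : ℝ)..t, d n (max s 0)
  have hg : ∀ n t, HasDerivAt (g n) (d n (max t 0)) t := fun n t =>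
    ((hcont n).integral_hasStrictDerivAt 0 t).hasDerivAt.const_add _
  have e : ∀ t, 0 ≤ t → ∀ n, c n t = g n t := fun t ht n => by
    have h1 := intervalIntegral.integral_eq_sub_of_hasDerivAt_of_le (f := c n)
      (f' := fun s => d n (max s 0)) ht
      (fun s hs => ((hc n s hs.1).continuousWithinAt).mono Icc_subset_Ici_self)
      (fun s hs => by
        rw [max_eq_left hs.1.le]
        exact (hc n s hs.1.le).hasDerivAt (Ici_mem_nhds hs.1))
      ((hcont n).intervalIntegrable _ _)
    simp only [g, h1]
    ring
  have h := hasDerivAt_tsum (𝕜 := ℝ) (F := ℝ) (g := g) (g' := fun n t => d n (max t 0)) (y₀ := 0) hu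
    hg (fun n t => hb n _ (le_max_right _ _)) (by simpa [g] using hs) t
  simp only [max_eq_left ht] at h
  exact h.hasDerivWithinAt.congr (fun s hs => tsum_congr (e s hs)) (tsum_congr (e t ht))

/-! ### The operators `(∂ₜ + a²b²/(4ε))ᵏ` -/

theorem binomDeriv_zero (ε a b : ℝ) (f : ℝ → ℝ) (t : ℝ) : binomDeriv ε a b f 0 t = f t := by
  simp [binomDeriv]

/-- Pascal's rule, that is (∂ₜ + l)^{k+1} = (∂ₜ + l)(∂ₜ + l)^k. -/
theorem binomDeriv_succ (ε a b : ℝ) (f : ℝ → ℝ) (k : ℕ) (t : ℝ) :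
    binomDeriv ε a b f (k + 1) t = (∑ m ∈ Finset.range (k + 1), (k.choose m : ℝ)
      * (a ^ 2 * b ^ 2 / (4 * ε)) ^ (k - m) * iteratedDerivWithin (m + 1) f (Ici 0) t)
      + a ^ 2 * b ^ 2 / (4 * ε) * binomDeriv ε a b f k t := by
  unfold binomDeriv
  set l := a ^ 2 * b ^ 2 / (4 * ε)
  set D := fun m => iteratedDerivWithin m f (Ici 0) t with hD
  change ∑ m ∈ Finset.range (k + 1 + 1), ((k + 1).choose m : ℝ) * l ^ (k + 1 - m) * D m
    = (∑ m ∈ Finset.range (k + 1), (k.choose m : ℝ) * l ^ (k - m) * D (m + 1))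
      + l * ∑ m ∈ Finset.range (k + 1), (k.choose m : ℝ) * l ^ (k - m) * D m
  rw [Finset.sum_range_succ']
  have h1 : ∀ m ∈ Finset.range (k + 1), ((k + 1).choose (m + 1) : ℝ) * l ^ (k + 1 - (m + 1)) * D (m + 1)
      = (k.choose m : ℝ) * l ^ (k - m) * D (m + 1)
        + (k.choose (m + 1) : ℝ) * l ^ (k - m) * D (m + 1) := fun m hm => by
    rw [Nat.choose_succ_succ, show k + 1 - (m + 1) = k - m by omega]
    push_cast
    ring
  rw [Finset.sum_congr rfl h1, Finset.sum_add_distrib, add_assoc]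
  congr 1
  rw [Finset.sum_range_succ, Nat.choose_succ_self, Finset.sum_range_succ' _ k, mul_add,
    Finset.mul_sum]
  simp only [Nat.cast_zero, zero_mul, add_zero, Nat.choose_zero_right, Nat.cast_one, one_mul,
    Nat.sub_zero]
  rw [pow_succ' l k, mul_assoc]
  congr 1
  refine Finset.sum_congr rfl fun m hm => ?_
  have hm' : m < k := Finset.mem_range.1 hm
  rw [show k - m = (k - (m + 1)) + 1 by omega, pow_succ']
  ring

theorem hasDerivWithinAt_binomDeriv {F M γ : ℝ} {f : ℝ → ℝ} (hf : IsGevrey F M γ f) (ε a b : ℝ)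
    (k : ℕ) {t : ℝ} (ht : 0 ≤ t) : HasDerivWithinAt (binomDeriv ε a b f k)
      (binomDeriv ε a b f (k + 1) t - a ^ 2 * b ^ 2 / (4 * ε) * binomDeriv ε a b f k t)
      (Ici 0) t := by
  rw [binomDeriv_succ, add_sub_cancel_right]
  refine HasDerivWithinAt.fun_sum fun m _ => HasDerivWithinAt.const_mul _ ?_
  rw [iteratedDerivWithin_succ]
  exact ((hf.smooth.differentiableOn_iteratedDerivWithin (by exact_mod_cast ENat.natCast_lt_top m)
    (uniqueDiffOn_Ici 0)) t ht).hasDerivWithinAt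

/-- Each (m!)^γ is replaced by (k!)^γ, after which the sum is the binomial expansion of (M + l)^k.
-/
theorem abs_binomDeriv_le {F M γ : ℝ} {f : ℝ → ℝ} (hf : IsGevrey F M γ f) (hF : 0 ≤ F) (hM : 0 ≤ M)
    (hγ : 0 ≤ γ) {ε : ℝ} (hε : 0 < ε) (a b : ℝ) (k : ℕ) {t : ℝ} (ht : 0 ≤ t) :
    |binomDeriv ε a b f k t| ≤ F * ((k ! : ℝ) ^ γ * (M + a ^ 2 * b ^ 2 / (4 * ε)) ^ k) := by
  set l := a ^ 2 * b ^ 2 / (4 * ε) with hl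
  have hl0 : 0 ≤ l := by positivity
  unfold binomDeriv
  rw [← hl, add_pow, Finset.mul_sum, Finset.mul_sum]
  refine (Finset.abs_sum_le_sum_abs _ _).trans (Finset.sum_le_sum fun m hm => ?_)
  have hm' : m ≤ k := Nat.lt_succ_iff.1 (Finset.mem_range.1 hm)
  rw [abs_mul, abs_of_nonneg (by positivity)]
  calc _ ≤ (k.choose m : ℝ) * l ^ (k - m) * (F * M ^ m * (k ! : ℝ) ^ γ) := by
        refine mul_le_mul_of_nonneg_left ((hf.bound m t ht).trans ?_) (by positivity)
        have : (m ! : ℝ) ≤ (k ! : ℝ) := by exact_mod_cast Nat.factorial_le hm'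
        gcongr
    _ = _ := by ring

/-! ### Classical functions with explicit derivatives -/

/-- `v` is of class `C^{2,1}` on `[0,1] × S` with derivatives `v_x = v1`, `v_xx = v2`,
`v_t = vt`. -/
structure C21On (S : Set ℝ) (v v1 v2 vt : ℝ → ℝ → ℝ) : Prop where
  d1 : ∀ t ∈ S, ∀ x ∈ Icc (0 : ℝ) 1, HasDerivWithinAt (fun y => v y t) (v1 x t) (Icc 0 1) x
  d2 : ∀ t ∈ S, ∀ x ∈ Icc (0 : ℝ) 1, HasDerivWithinAt (fun y => v1 y t) (v2 x t) (Icc 0 1) x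
  dt : ∀ t ∈ S, ∀ x ∈ Icc (0 : ℝ) 1, HasDerivWithinAt (fun s => v x s) (vt x t) S t
  c0 : ContinuousOn (fun p : ℝ × ℝ => v p.1 p.2) (Icc 0 1 ×ˢ S)
  c1 : ContinuousOn (fun p : ℝ × ℝ => v1 p.1 p.2) (Icc 0 1 ×ˢ S)
  c2 : ContinuousOn (fun p : ℝ × ℝ => v2 p.1 p.2) (Icc 0 1 ×ˢ S)
  ct : ContinuousOn (fun p : ℝ × ℝ => vt p.1 p.2) (Icc 0 1 ×ˢ S)

namespace C21On

variable {S : Set ℝ} {v v1 v2 vt w w1 w2 wt : ℝ → ℝ → ℝ}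

theorem dx_eq (h : C21On S v v1 v2 vt) {x t : ℝ} (hx : x ∈ Icc (0 : ℝ) 1) (ht : t ∈ S) :
    dx v x t = v1 x t := D_eq hx (h.d1 t ht x hx)

theorem dxx_eq (h : C21On S v v1 v2 vt) {x t : ℝ} (hx : x ∈ Icc (0 : ℝ) 1) (ht : t ∈ S) :
    dxx v x t = v2 x t :=
  D_eq hx ((h.d2 t ht x hx).congr (fun _ hy => h.dx_eq hy ht) (h.dx_eq hx ht))

theorem dt_eq (h : C21On S v v1 v2 vt) (hS : UniqueDiffOn ℝ S) {x t : ℝ}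
    (hx : x ∈ Icc (0 : ℝ) 1) (ht : t ∈ S) : ViscousHJ.dt S v x t = vt x t :=
  (h.dt t ht x hx).derivWithin (hS t ht)

theorem isC21 (h : C21On S v v1 v2 vt) (hS : UniqueDiffOn ℝ S) : IsC21 S v where
  diff_x := fun t ht x hx => (h.d1 t ht x hx).differentiableWithinAt
  diff_xx := fun t ht x hx => ((h.d2 t ht x hx).congr (fun _ hy => h.dx_eq hy ht)
    (h.dx_eq hx ht)).differentiableWithinAt
  diff_t := fun x hx t ht => (h.dt t ht x hx).differentiableWithinAt
  cont := h.c0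
  cont_x := h.c1.congr fun _ hp => h.dx_eq hp.1 hp.2
  cont_xx := h.c2.congr fun _ hp => h.dxx_eq hp.1 hp.2
  cont_t := h.ct.congr fun _ hp => h.dt_eq hS hp.1 hp.2

theorem of_isC21 (h : IsC21 S v) : C21On S v (dx v) (dxx v) (ViscousHJ.dt S v) where
  d1 := fun t ht x hx => (h.diff_x t ht x hx).hasDerivWithinAt
  d2 := fun t ht x hx => (h.diff_xx t ht x hx).hasDerivWithinAt
  dt := fun t ht x hx => (h.diff_t x hx t ht).hasDerivWithinAt
  c0 := h.cont
  c1 := h.cont_x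
  c2 := h.cont_xx
  ct := h.cont_t

theorem mono {T : Set ℝ} (h : C21On S v v1 v2 vt) (hT : T ⊆ S) : C21On T v v1 v2 vt where
  d1 := fun t ht => h.d1 t (hT ht)
  d2 := fun t ht => h.d2 t (hT ht)
  dt := fun t ht x hx => (h.dt t (hT ht) x hx).mono hT
  c0 := h.c0.mono (prod_mono_right hT)
  c1 := h.c1.mono (prod_mono_right hT)
  c2 := h.c2.mono (prod_mono_right hT)
  ct := h.ct.mono (prod_mono_right hT)

theorem add (h : C21On S v v1 v2 vt) (k : C21On S w w1 w2 wt) :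
    C21On S (fun x t => v x t + w x t) (fun x t => v1 x t + w1 x t) (fun x t => v2 x t + w2 x t)
      (fun x t => vt x t + wt x t) where
  d1 := fun t ht x hx => (h.d1 t ht x hx).add (k.d1 t ht x hx)
  d2 := fun t ht x hx => (h.d2 t ht x hx).add (k.d2 t ht x hx)
  dt := fun t ht x hx => (h.dt t ht x hx).add (k.dt t ht x hx)
  c0 := h.c0.add k.c0
  c1 := h.c1.add k.c1
  c2 := h.c2.add k.c2
  ct := h.ct.add k.ct

theorem sub (h : C21On S v v1 v2 vt) (k : C21On S w w1 w2 wt) :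
    C21On S (fun x t => v x t - w x t) (fun x t => v1 x t - w1 x t) (fun x t => v2 x t - w2 x t)
      (fun x t => vt x t - wt x t) where
  d1 := fun t ht x hx => (h.d1 t ht x hx).sub (k.d1 t ht x hx)
  d2 := fun t ht x hx => (h.d2 t ht x hx).sub (k.d2 t ht x hx)
  dt := fun t ht x hx => (h.dt t ht x hx).sub (k.dt t ht x hx)
  c0 := h.c0.sub k.c0
  c1 := h.c1.sub k.c1
  c2 := h.c2.sub k.c2
  ct := h.ct.sub k.ct

/-- The exponential weight. -/
theorem exp_mul (h : C21On S v v1 v2 vt) (κ : ℝ) :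
    C21On S (fun x t => Real.exp (κ * x) * v x t)
      (fun x t => Real.exp (κ * x) * (v1 x t + κ * v x t))
      (fun x t => Real.exp (κ * x) * (v2 x t + 2 * κ * v1 x t + κ ^ 2 * v x t))
      (fun x t => Real.exp (κ * x) * vt x t) := by
  have he : ∀ x : ℝ, HasDerivWithinAt (fun x => Real.exp (κ * x)) (Real.exp (κ * x) * κ)
      (Icc 0 1) x := fun x => by
    have := ((hasDerivAt_id x).const_mul κ).exp.hasDerivWithinAt (s := Icc 0 1)
    simpa using this
  have hc : ContinuousOn (fun p : ℝ × ℝ => Real.exp (κ * p.1)) (Icc 0 1 ×ˢ S) := by fun_prop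
  exact {
    d1 := fun t ht x hx => ((he x).mul (h.d1 t ht x hx)).congr_deriv (by ring)
    d2 := fun t ht x hx => ((he x).mul ((h.d2 t ht x hx).add
      ((h.d1 t ht x hx).const_mul κ))).congr_deriv (by
        simp only [Pi.add_apply]
        ring)
    dt := fun t ht x hx => (h.dt t ht x hx).const_mul _
    c0 := hc.mul h.c0
    c1 := hc.mul (h.c1.add (h.c0.const_mul κ))
    c2 := hc.mul ((h.c2.add (h.c1.const_mul (2 * κ))).add (h.c0.const_mul (κ ^ 2)))
    ct := hc.mul h.ct }

theorem add_const (h : C21On S v v1 v2 vt) (c : ℝ) :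
    C21On S (fun x t => v x t + c) v1 v2 vt :=
  { h with
    d1 := fun t ht x hx => (h.d1 t ht x hx).add_const c
    dt := fun t ht x hx => (h.dt t ht x hx).add_const c
    c0 := h.c0.add_const c }

theorem const_mul (h : C21On S v v1 v2 vt) (c : ℝ) :
    C21On S (fun x t => c * v x t) (fun x t => c * v1 x t) (fun x t => c * v2 x t)
      (fun x t => c * vt x t) where
  d1 := fun t ht x hx => (h.d1 t ht x hx).const_mul c
  d2 := fun t ht x hx => (h.d2 t ht x hx).const_mul c
  dt := fun t ht x hx => (h.dt t ht x hx).const_mul c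
  c0 := h.c0.const_mul c
  c1 := h.c1.const_mul c
  c2 := h.c2.const_mul c
  ct := h.ct.const_mul c

theorem log (h : C21On S v v1 v2 vt) (hpos : ∀ x ∈ Icc (0 : ℝ) 1, ∀ t ∈ S, 0 < v x t) :
    C21On S (fun x t => Real.log (v x t)) (fun x t => v1 x t / v x t)
      (fun x t => v2 x t / v x t - (v1 x t / v x t) ^ 2) (fun x t => vt x t / v x t) where
  d1 := fun t ht x hx => (h.d1 t ht x hx).log (hpos x hx t ht).ne'
  d2 := fun t ht x hx => ((h.d2 t ht x hx).div (h.d1 t ht x hx) (hpos x hx t ht).ne').congr_deriv (by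
    have := (hpos x hx t ht).ne'
    field_simp)
  dt := fun t ht x hx => (h.dt t ht x hx).log (hpos x hx t ht).ne'
  c0 := h.c0.log fun p hp => (hpos p.1 hp.1 p.2 hp.2).ne'
  c1 := h.c1.div h.c0 fun p hp => (hpos p.1 hp.1 p.2 hp.2).ne'
  c2 := (h.c2.div h.c0 fun p hp => (hpos p.1 hp.1 p.2 hp.2).ne').sub
    ((h.c1.div h.c0 fun p hp => (hpos p.1 hp.1 p.2 hp.2).ne').pow 2)
  ct := h.ct.div h.c0 fun p hp => (hpos p.1 hp.1 p.2 hp.2).ne'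

theorem exp (h : C21On S v v1 v2 vt) :
    C21On S (fun x t => Real.exp (v x t)) (fun x t => Real.exp (v x t) * v1 x t)
      (fun x t => Real.exp (v x t) * (v2 x t + v1 x t ^ 2)) (fun x t => Real.exp (v x t) * vt x t) where
  d1 := fun t ht x hx => (h.d1 t ht x hx).exp
  d2 := fun t ht x hx => ((h.d1 t ht x hx).exp.mul (h.d2 t ht x hx)).congr_deriv (by ring)
  dt := fun t ht x hx => (h.dt t ht x hx).exp
  c0 := h.c0.rexp
  c1 := h.c0.rexp.mul h.c1
  c2 := h.c0.rexp.mul (h.c2.add (h.c1.pow 2))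
  ct := h.c0.rexp.mul h.ct

end C21On

/-! ### The Hopf–Cole transformation -/

/-- The inverse Hopf–Cole transformation. -/
def hopfU (ε a b : ℝ) (v : ℝ → ℝ → ℝ) (x t : ℝ) : ℝ :=
  -(ε / a) * Real.log (Real.exp (a * b / (2 * ε) * x) * v x t + 1)

/-- The spatial derivative of `hopfU`. -/
def hopfU1 (ε a b : ℝ) (v v1 : ℝ → ℝ → ℝ) (x t : ℝ) : ℝ :=
  -(ε / a) * (Real.exp (a * b / (2 * ε) * x) * (v1 x t + a * b / (2 * ε) * v x t)
    / (Real.exp (a * b / (2 * ε) * x) * v x t + 1))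

/-- The second spatial derivative of `hopfU`. -/
def hopfU2 (ε a b : ℝ) (v v1 v2 : ℝ → ℝ → ℝ) (x t : ℝ) : ℝ :=
  -(ε / a) * (Real.exp (a * b / (2 * ε) * x) * (v2 x t + 2 * (a * b / (2 * ε)) * v1 x t
      + (a * b / (2 * ε)) ^ 2 * v x t) / (Real.exp (a * b / (2 * ε) * x) * v x t + 1)
    - (Real.exp (a * b / (2 * ε) * x) * (v1 x t + a * b / (2 * ε) * v x t)
      / (Real.exp (a * b / (2 * ε) * x) * v x t + 1)) ^ 2)

/-- The time derivative of `hopfU`. -/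
def hopfUt (ε a b : ℝ) (v vt : ℝ → ℝ → ℝ) (x t : ℝ) : ℝ :=
  -(ε / a) * (Real.exp (a * b / (2 * ε) * x) * vt x t
    / (Real.exp (a * b / (2 * ε) * x) * v x t + 1))

theorem C21On.hopfU {S : Set ℝ} {v v1 v2 vt : ℝ → ℝ → ℝ} (h : C21On S v v1 v2 vt) (ε a b : ℝ)
    (hpos : ∀ x ∈ Icc (0 : ℝ) 1, ∀ t ∈ S, 0 < Real.exp (a * b / (2 * ε) * x) * v x t + 1) :
    C21On S (hopfU ε a b v) (hopfU1 ε a b v v1) (hopfU2 ε a b v v1 v2) (hopfUt ε a b v vt) :=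
  (((h.exp_mul (a * b / (2 * ε))).add_const 1).log hpos).const_mul (-(ε / a))

/-- The Hopf–Cole transformation turns the heat equation into the viscous Hamilton–Jacobi
equation. -/
theorem hopf_pde {ε a : ℝ} (hε : 0 < ε) (ha : a ≠ 0) (b : ℝ) {v v1 v2 vt : ℝ → ℝ → ℝ} {x t : ℝ}
    (hpos : 0 < Real.exp (a * b / (2 * ε) * x) * v x t + 1)
    (hv : vt x t = ε * v2 x t - a ^ 2 * b ^ 2 / (4 * ε) * v x t) :
    hopfUt ε a b v vt x t = ε * hopfU2 ε a b v v1 v2 x t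
      - a * hopfU1 ε a b v v1 x t * (b + hopfU1 ε a b v v1 x t) := by
  unfold hopfUt hopfU1 hopfU2
  rw [hv]
  set E := Real.exp (a * b / (2 * ε) * x)
  have hne := hpos.ne'
  field_simp
  ring

/-- The Hopf–Cole transformation. -/
def hopfV (ε a b : ℝ) (u : ℝ → ℝ → ℝ) (x t : ℝ) : ℝ :=
  Real.exp (-(a * b / (2 * ε)) * x) * (Real.exp (-(a / ε) * u x t) + -1)

/-- The spatial derivative of `hopfV`. -/
def hopfV1 (ε a b : ℝ) (u u1 : ℝ → ℝ → ℝ) (x t : ℝ) : ℝ :=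
  Real.exp (-(a * b / (2 * ε)) * x) * (Real.exp (-(a / ε) * u x t) * (-(a / ε) * u1 x t)
    + -(a * b / (2 * ε)) * (Real.exp (-(a / ε) * u x t) + -1))

/-- The second spatial derivative of `hopfV`. -/
def hopfV2 (ε a b : ℝ) (u u1 u2 : ℝ → ℝ → ℝ) (x t : ℝ) : ℝ :=
  Real.exp (-(a * b / (2 * ε)) * x) * (Real.exp (-(a / ε) * u x t) * (-(a / ε) * u2 x t
      + (-(a / ε) * u1 x t) ^ 2)
    + 2 * -(a * b / (2 * ε)) * (Real.exp (-(a / ε) * u x t) * (-(a / ε) * u1 x t))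
    + (-(a * b / (2 * ε))) ^ 2 * (Real.exp (-(a / ε) * u x t) + -1))

/-- The time derivative of `hopfV`. -/
def hopfVt (ε a b : ℝ) (u ut : ℝ → ℝ → ℝ) (x t : ℝ) : ℝ :=
  Real.exp (-(a * b / (2 * ε)) * x) * (Real.exp (-(a / ε) * u x t) * (-(a / ε) * ut x t))

theorem C21On.hopfV {S : Set ℝ} {u u1 u2 ut : ℝ → ℝ → ℝ} (h : C21On S u u1 u2 ut) (ε a b : ℝ) :
    C21On S (hopfV ε a b u) (hopfV1 ε a b u u1) (hopfV2 ε a b u u1 u2) (hopfVt ε a b u ut) :=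
  ((h.const_mul (-(a / ε))).exp.add_const (-1)).exp_mul (-(a * b / (2 * ε)))

theorem hopfV_pde {ε a : ℝ} (hε : 0 < ε) (ha : a ≠ 0) (b : ℝ) {u u1 u2 ut : ℝ → ℝ → ℝ} {x t : ℝ}
    (hu : ut x t = ε * u2 x t - a * u1 x t * (b + u1 x t)) :
    hopfVt ε a b u ut x t = ε * hopfV2 ε a b u u1 u2 x t
      - a ^ 2 * b ^ 2 / (4 * ε) * hopfV ε a b u x t := by
  unfold hopfVt hopfV2 hopfV
  rw [hu]
  set E := Real.exp (-(a * b / (2 * ε)) * x)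
  set G := Real.exp (-(a / ε) * u x t)
  field_simp
  ring

theorem exp_mul_hopfV (ε a b : ℝ) (u : ℝ → ℝ → ℝ) (x t : ℝ) :
    Real.exp (a * b / (2 * ε) * x) * hopfV ε a b u x t + 1 = Real.exp (-(a / ε) * u x t) := by
  unfold hopfV
  rw [← mul_assoc, ← Real.exp_add, neg_mul, add_neg_cancel, Real.exp_zero]
  ring

theorem exp_hopfU {ε a : ℝ} (hε : 0 < ε) (ha : a ≠ 0) (b : ℝ) {v : ℝ → ℝ → ℝ} {x t : ℝ}
    (hpos : 0 < Real.exp (a * b / (2 * ε) * x) * v x t + 1) :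
    Real.exp (-(a / ε) * hopfU ε a b v x t) = Real.exp (a * b / (2 * ε) * x) * v x t + 1 := by
  unfold hopfU
  rw [← mul_assoc, neg_mul_neg, div_mul_div_cancel₀ hε.ne', div_self ha, one_mul, Real.exp_log hpos]

/-! ### The reference trajectory -/

/-- `n!` times the `n`-th Taylor coefficient of `v^r(·,t)` at `x₀`. -/
def refCoef (ε a b x₀ : ℝ) (y₁ y₂ : ℝ → ℝ) (n : ℕ) (t : ℝ) : ℝ :=
  1 / ε ^ (n / 2) * binomDeriv ε a b (if n % 2 = 0 then y1v ε a b x₀ y₁ else y2v ε a b x₀ y₁ y₂)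
    (n / 2) t

/-- The `j`-th spatial derivative of `v^r`. -/
def refField (ε a b x₀ : ℝ) (y₁ y₂ : ℝ → ℝ) (j : ℕ) (x t : ℝ) : ℝ :=
  ∑' n : ℕ, (x - x₀) ^ n / (n ! : ℝ) * refCoef ε a b x₀ y₁ y₂ (n + j) t

/-- The ratio of the majorants of consecutive coefficients. -/
def refRatio (ε a b L : ℝ) : ℝ := max 1 ((L + a ^ 2 * b ^ 2 / (4 * ε)) / ε)

/-- The transformed outputs are Gevrey functions of order less than two. -/
structure RefData (ε a b x₀ : ℝ) (y₁ y₂ : ℝ → ℝ) (A L γ : ℝ) : Prop where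
  hε : 0 < ε
  hx₀ : x₀ ∈ Icc (0 : ℝ) 1
  hA : 0 ≤ A
  hL : 0 ≤ L
  hγ₀ : 0 ≤ γ
  hγ : γ < 2
  h1 : IsGevrey A L γ (y1v ε a b x₀ y₁)
  h2 : IsGevrey A L γ (y2v ε a b x₀ y₁ y₂)

namespace RefData

variable {ε a b x₀ : ℝ} {y₁ y₂ : ℝ → ℝ} {A L γ : ℝ}

theorem output (h : RefData ε a b x₀ y₁ y₂ A L γ) (n : ℕ) :
    IsGevrey A L γ (if n % 2 = 0 then y1v ε a b x₀ y₁ else y2v ε a b x₀ y₁ y₂) := by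
  split_ifs
  exacts [h.h1, h.h2]

theorem abs_coef_le (h : RefData ε a b x₀ y₁ y₂ A L γ) (n : ℕ) {t : ℝ} (ht : 0 ≤ t) :
    |refCoef ε a b x₀ y₁ y₂ n t|
      ≤ A * (((n / 2)! : ℝ) ^ γ * refRatio ε a b L ^ (n / 2)) := by
  have hε := h.hε
  have hA := h.hA
  have hl : 0 ≤ L + a ^ 2 * b ^ 2 / (4 * ε) := add_nonneg h.hL (by positivity)
  have h1 := abs_binomDeriv_le (h.output n) h.hA h.hL h.hγ₀ hε a b (n / 2) ht
  rw [refCoef, abs_mul, abs_of_nonneg (by positivity)]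
  calc _ ≤ 1 / ε ^ (n / 2) * (A * (((n / 2)! : ℝ) ^ γ * (L + a ^ 2 * b ^ 2 / (4 * ε)) ^ (n / 2))) :=
        mul_le_mul_of_nonneg_left h1 (by positivity)
    _ = A * (((n / 2)! : ℝ) ^ γ * ((L + a ^ 2 * b ^ 2 / (4 * ε)) / ε) ^ (n / 2)) := by
        rw [div_pow]; ring
    _ ≤ _ := by
        have : (L + a ^ 2 * b ^ 2 / (4 * ε)) / ε ≤ refRatio ε a b L := le_max_right _ _
        gcongr

theorem one_le_refRatio (ε a b L : ℝ) : 1 ≤ refRatio ε a b L := le_max_left _ _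

/-- A majorant independent of t that also serves the first two space derivatives: shifting the index
by j ≤ 2 raises its half by at most one, which explains the shift in `gevreyMaj`. -/
theorem term_le (h : RefData ε a b x₀ y₁ y₂ A L γ) {j : ℕ} (hj : j ≤ 2) (n : ℕ) {t : ℝ}
    (ht : 0 ≤ t) : 2 ^ n / (n ! : ℝ) * |refCoef ε a b x₀ y₁ y₂ (n + j) t|
      ≤ A * gevreyMaj γ (refRatio ε a b L) n := by
  have hQ := one_le_refRatio ε a b L
  have hQ0 : 0 ≤ refRatio ε a b L := by linarith
  have hγ₀ := h.hγ₀
  have hA := h.hA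
  have hle : (n + j) / 2 ≤ n / 2 + 1 := by omega
  calc _ ≤ 2 ^ n / (n ! : ℝ) * (A * (((n / 2 + 1)! : ℝ) ^ γ * refRatio ε a b L ^ (n / 2 + 1))) := by
        refine mul_le_mul_of_nonneg_left ((h.abs_coef_le (n + j) ht).trans ?_) (by positivity)
        have h1 : (((n + j) / 2)! : ℝ) ≤ ((n / 2 + 1)! : ℝ) := by
          exact_mod_cast Nat.factorial_le hle
        have h2 := pow_le_pow_right₀ hQ hle
        gcongr
    _ = _ := by unfold gevreyMaj; ring

theorem summable_maj (h : RefData ε a b x₀ y₁ y₂ A L γ) :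
    Summable fun n => A * gevreyMaj γ (refRatio ε a b L) n :=
  (summable_gevreyMaj h.hγ (one_le_refRatio ε a b L)).mul_left A

theorem abs_term_le (h : RefData ε a b x₀ y₁ y₂ A L γ) {j : ℕ} (hj : j ≤ 2) (n : ℕ) {x t : ℝ}
    (hx : x ∈ Icc (0 : ℝ) 1) (ht : 0 ≤ t) :
    |(x - x₀) ^ n / (n ! : ℝ) * refCoef ε a b x₀ y₁ y₂ (n + j) t|
      ≤ A * gevreyMaj γ (refRatio ε a b L) n := by
  refine le_trans ?_ (h.term_le hj n ht)
  rw [abs_mul, abs_div, abs_pow, abs_of_nonneg (by positivity : (0 : ℝ) ≤ (n ! : ℝ))]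
  have : |x - x₀| ≤ 2 := abs_le.2 ⟨by linarith [hx.1, h.hx₀.2], by linarith [hx.2, h.hx₀.1]⟩
  gcongr

theorem summable_term (h : RefData ε a b x₀ y₁ y₂ A L γ) {j : ℕ} (hj : j ≤ 2) {x t : ℝ}
    (hx : x ∈ Icc (0 : ℝ) 1) (ht : 0 ≤ t) :
    Summable fun n : ℕ => (x - x₀) ^ n / (n ! : ℝ) * refCoef ε a b x₀ y₁ y₂ (n + j) t :=
  Summable.of_norm_bounded h.summable_maj fun n => h.abs_term_le hj n hx ht

theorem abs_refField_le (h : RefData ε a b x₀ y₁ y₂ A L γ) {j : ℕ} (hj : j ≤ 2) {x t : ℝ}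
    (hx : x ∈ Icc (0 : ℝ) 1) (ht : 0 ≤ t) : |refField ε a b x₀ y₁ y₂ j x t|
      ≤ A * ∑' n, gevreyMaj γ (refRatio ε a b L) n := by
  rw [← tsum_mul_left]
  exact tsum_of_norm_bounded
    (f := fun n : ℕ => (x - x₀) ^ n / (n ! : ℝ) * refCoef ε a b x₀ y₁ y₂ (n + j) t) h.summable_maj.hasSum fun n => h.abs_term_le hj n hx ht

/-- This recursion between coefficients n and n + 2 is the equation v_t = ε v_xx - l v read on
Taylor coefficients. -/
theorem hasDeriv_coef (h : RefData ε a b x₀ y₁ y₂ A L γ) (n : ℕ) {t : ℝ} (ht : 0 ≤ t) :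
    HasDerivWithinAt (refCoef ε a b x₀ y₁ y₂ n) (ε * refCoef ε a b x₀ y₁ y₂ (n + 2) t
      - a ^ 2 * b ^ 2 / (4 * ε) * refCoef ε a b x₀ y₁ y₂ n t) (Ici 0) t := by
  have hε := h.hε.ne'
  refine ((hasDerivWithinAt_binomDeriv (h.output n) ε a b (n / 2) ht).const_mul
    (1 / ε ^ (n / 2))).congr_deriv ?_
  unfold refCoef
  rw [show (n + 2) % 2 = n % 2 by omega, show (n + 2) / 2 = n / 2 + 1 by omega, pow_succ]
  field_simp
  ring

theorem continuousOn_coef (h : RefData ε a b x₀ y₁ y₂ A L γ) (n : ℕ) :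
    ContinuousOn (refCoef ε a b x₀ y₁ y₂ n) (Ici 0) := fun _ ht =>
  (h.hasDeriv_coef n ht).continuousWithinAt

theorem continuousOn_refField (h : RefData ε a b x₀ y₁ y₂ A L γ) {j : ℕ} (hj : j ≤ 2) :
    ContinuousOn (fun p : ℝ × ℝ => refField ε a b x₀ y₁ y₂ j p.1 p.2) (Icc 0 1 ×ˢ Ici 0) := by
  refine continuousOn_tsum (fun n => ?_) h.summable_maj fun n p hp => h.abs_term_le hj n hp.1 hp.2
  refine ContinuousOn.mul (by fun_prop) ?_
  exact (h.continuousOn_coef (n + j)).comp continuousOn_snd fun p hp => hp.2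

theorem hasDeriv_refField (h : RefData ε a b x₀ y₁ y₂ A L γ) {j : ℕ} (hj : j ≤ 1) {x t : ℝ}
    (hx : x ∈ Icc (0 : ℝ) 1) (ht : 0 ≤ t) :
    HasDerivWithinAt (fun y => refField ε a b x₀ y₁ y₂ j y t) (refField ε a b x₀ y₁ y₂ (j + 1) x t)
      (Icc 0 1) x := by
  -- In fact |x - x₀| ≤ 1; the open interval of radius 2 leaves room for differentiation, and
  -- accounts for the factor 2^n in `gevreyMaj`.
  have hX : |x - x₀| < 2 := abs_lt.2 ⟨by linarith [hx.1, h.hx₀.2], by linarith [hx.2, h.hx₀.1]⟩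
  have key := hasDerivAt_expSeries (a := fun n => refCoef ε a b x₀ y₁ y₂ (n + j) t) h.summable_maj
    h.summable_maj (fun n => h.term_le (by omega) n ht)
    (fun n => by
      have := h.term_le (j := j + 1) (by omega) n ht
      rwa [show n + (j + 1) = n + 1 + j by omega] at this) hX
  have := key.comp x ((hasDerivAt_id x).sub_const x₀)
  refine this.hasDerivWithinAt.congr_deriv ?_
  unfold refField
  rw [mul_one]
  refine tsum_congr fun n => ?_
  rw [show n + (j + 1) = n + 1 + j by omega]

theorem hasDeriv_time (h : RefData ε a b x₀ y₁ y₂ A L γ) {x t : ℝ} (hx : x ∈ Icc (0 : ℝ) 1)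
    (ht : 0 ≤ t) : HasDerivWithinAt (fun s => refField ε a b x₀ y₁ y₂ 0 x s)
      (ε * refField ε a b x₀ y₁ y₂ 2 x t
        - a ^ 2 * b ^ 2 / (4 * ε) * refField ε a b x₀ y₁ y₂ 0 x t) (Ici 0) t := by
  have hε := h.hε
  set l := a ^ 2 * b ^ 2 / (4 * ε) with hl
  have hl0 : 0 ≤ l := by positivity
  have key := hasDerivWithinAt_tsum_Ici
    (c := fun n t => (x - x₀) ^ n / (n ! : ℝ) * refCoef ε a b x₀ y₁ y₂ (n + 0) t)
    (d := fun n t => (x - x₀) ^ n / (n ! : ℝ) * (ε * refCoef ε a b x₀ y₁ y₂ (n + 2) t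
      - l * refCoef ε a b x₀ y₁ y₂ n t))
    (u := fun n => (ε + l) * (A * gevreyMaj γ (refRatio ε a b L) n)) (h.summable_maj.mul_left _)
    (fun n t ht => (h.hasDeriv_coef n ht).const_mul _)
    (fun n => (((h.continuousOn_coef (n + 2)).const_mul ε).sub
      ((h.continuousOn_coef n).const_mul l)).const_mul _)
    (fun n t ht => by
      have b2 := abs_le.1 (h.abs_term_le (j := 2) le_rfl n hx ht)
      have b0 := abs_le.1 (h.abs_term_le (j := 0) (by norm_num) n hx ht)
      rw [add_zero] at b0
      rw [abs_le]
      have i1 := mul_le_mul_of_nonneg_left b2.1 hε.le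
      have i2 := mul_le_mul_of_nonneg_left b2.2 hε.le
      have i3 := mul_le_mul_of_nonneg_left b0.1 hl0
      have i4 := mul_le_mul_of_nonneg_left b0.2 hl0
      constructor <;> linarith)
    (h.summable_term (by norm_num) hx le_rfl) ht
  refine key.congr_deriv ?_
  unfold refField
  rw [← tsum_mul_left, ← tsum_mul_left, ← Summable.tsum_sub
    ((h.summable_term le_rfl hx ht).mul_left ε) ((h.summable_term (by norm_num) hx ht).mul_left l)]
  refine tsum_congr fun n => ?_
  rw [add_zero]
  ring

theorem even_term (n : ℕ) (x t : ℝ) : (x - x₀) ^ (2 * n) / ((2 * n)! : ℝ)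
    * refCoef ε a b x₀ y₁ y₂ (2 * n) t = vrEven ε a b x₀ y₁ x t n := by
  unfold refCoef vrEven
  rw [if_pos (by omega), show 2 * n / 2 = n by omega]
  ring

theorem odd_term (n : ℕ) (x t : ℝ) : (x - x₀) ^ (2 * n + 1) / ((2 * n + 1)! : ℝ)
    * refCoef ε a b x₀ y₁ y₂ (2 * n + 1) t = vrOdd ε a b x₀ y₁ y₂ x t n := by
  unfold refCoef vrOdd
  rw [if_neg (by omega), show (2 * n + 1) / 2 = n by omega]
  ring

theorem summable_even (h : RefData ε a b x₀ y₁ y₂ A L γ) {x t : ℝ} (hx : x ∈ Icc (0 : ℝ) 1)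
    (ht : 0 ≤ t) : Summable (vrEven ε a b x₀ y₁ x t) := by
  have := (h.summable_term (j := 0) (by norm_num) hx ht).comp_injective
    (i := fun n : ℕ => 2 * n) fun m n hmn => by simpa using hmn
  exact this.congr fun n => even_term n x t

theorem summable_odd (h : RefData ε a b x₀ y₁ y₂ A L γ) {x t : ℝ} (hx : x ∈ Icc (0 : ℝ) 1)
    (ht : 0 ≤ t) : Summable (vrOdd ε a b x₀ y₁ y₂ x t) := by
  have := (h.summable_term (j := 0) (by norm_num) hx ht).comp_injective
    (i := fun n : ℕ => 2 * n + 1) fun m n hmn => by simpa using hmn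
  exact this.congr fun n => odd_term n x t

/-- The even and odd series merge into one Taylor series, which is easier to differentiate. -/
theorem vr_eq (h : RefData ε a b x₀ y₁ y₂ A L γ) {x t : ℝ} (hx : x ∈ Icc (0 : ℝ) 1)
    (ht : 0 ≤ t) : vr ε a b x₀ y₁ y₂ x t = refField ε a b x₀ y₁ y₂ 0 x t := by
  unfold vr refField
  rw [← tsum_even_add_odd
    (f := fun n : ℕ => (x - x₀) ^ n / (n ! : ℝ) * refCoef ε a b x₀ y₁ y₂ (n + 0) t) ((h.summable_even hx ht).congr fun n => (even_term n x t).symm)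
    ((h.summable_odd hx ht).congr fun n => (odd_term n x t).symm)]
  congr 1
  · exact tsum_congr fun n => (even_term n x t).symm
  · exact tsum_congr fun n => (odd_term n x t).symm

theorem c21On (h : RefData ε a b x₀ y₁ y₂ A L γ) :
    C21On (Ici 0) (vr ε a b x₀ y₁ y₂) (refField ε a b x₀ y₁ y₂ 1) (refField ε a b x₀ y₁ y₂ 2)
      (fun x t => ε * refField ε a b x₀ y₁ y₂ 2 x t
        - a ^ 2 * b ^ 2 / (4 * ε) * vr ε a b x₀ y₁ y₂ x t) where
  d1 := fun t ht x hx => (h.hasDeriv_refField (j := 0) (by norm_num) hx ht).congr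
    (fun y hy => h.vr_eq hy ht) (h.vr_eq hx ht)
  d2 := fun t ht x hx => h.hasDeriv_refField le_rfl hx ht
  dt := fun t ht x hx => by
    rw [h.vr_eq hx ht]
    exact (h.hasDeriv_time hx ht).congr (fun s hs => h.vr_eq hx hs) (h.vr_eq hx ht)
  c0 := (h.continuousOn_refField (by norm_num)).congr fun p hp => h.vr_eq hp.1 hp.2
  c1 := h.continuousOn_refField (by norm_num)
  c2 := h.continuousOn_refField le_rfl
  ct := ((h.continuousOn_refField le_rfl).const_mul ε).sub
    (((h.continuousOn_refField (j := 0) (by norm_num)).congr fun p hp =>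
      h.vr_eq hp.1 hp.2).const_mul _)

theorem refField_self (j : ℕ) (t : ℝ) :
    refField ε a b x₀ y₁ y₂ j x₀ t = refCoef ε a b x₀ y₁ y₂ j t := by
  unfold refField
  rw [tsum_eq_single 0 fun n hn => by simp [hn]]
  simp

theorem U0r_eq (h : RefData ε a b x₀ y₁ y₂ A L γ) {t : ℝ} (ht : 0 ≤ t) : U0r ε a b x₀ y₁ y₂ t
    = hopfU1 ε a b (vr ε a b x₀ y₁ y₂) (refField ε a b x₀ y₁ y₂ 1) 0 t := by
  rw [U0r, h.c21On.dx_eq zero_mem_Icc ht, hopfU1]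
  simp only [mul_zero, Real.exp_zero, one_mul, add_comm]

theorem U1r_eq (h : RefData ε a b x₀ y₁ y₂ A L γ) {t : ℝ} (ht : 0 ≤ t) : U1r ε a b x₀ y₁ y₂ t
    = hopfU1 ε a b (vr ε a b x₀ y₁ y₂) (refField ε a b x₀ y₁ y₂ 1) 1 t := by
  rw [U1r, h.c21On.dx_eq one_mem_Icc ht, hopfU1]
  simp only [mul_one, add_comm (1 : ℝ)]
  ring

theorem isReference (h : RefData ε a b x₀ y₁ y₂ A L γ) (ha : a ≠ 0)
    (hpos : ∀ x ∈ Icc (0 : ℝ) 1, ∀ t, 0 ≤ t →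
      0 < Real.exp (a * b / (2 * ε) * x) * vr ε a b x₀ y₁ y₂ x t + 1) :
    IsReference ε a b x₀ y₁ y₂ := by
  have hε := h.hε
  have hc := h.c21On
  have hU : C21On (Ici 0) (ur ε a b x₀ y₁ y₂) _ _ _ := hc.hopfU ε a b hpos
  have hv0 : ∀ t, 0 ≤ t → vr ε a b x₀ y₁ y₂ x₀ t = y1v ε a b x₀ y₁ t := fun t ht => by
    rw [h.vr_eq h.hx₀ ht, refField_self]
    simp [refCoef, binomDeriv_zero]
  have hv1 : ∀ t, refField ε a b x₀ y₁ y₂ 1 x₀ t = y2v ε a b x₀ y₁ y₂ t := fun t => by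
    rw [refField_self]
    simp [refCoef, binomDeriv_zero]
  have hexp : ∀ z, Real.exp (a * b / (2 * ε) * x₀) * (Real.exp (-(a * b / (2 * ε)) * x₀) * z) = z :=
    fun z => by rw [← mul_assoc, ← Real.exp_add, neg_mul, add_neg_cancel, Real.exp_zero, one_mul]
  refine ⟨fun x hx t ht => h.summable_even hx ht, fun x hx t ht => h.summable_odd hx ht, hpos,
    hU.isC21 (uniqueDiffOn_Ici 0), fun x hx t ht => ?_, fun t ht => ?_, fun t ht => ?_,
    fun t ht => ?_, fun t ht => ?_⟩
  · rw [hU.dt_eq (uniqueDiffOn_Ici 0) hx ht, hU.dxx_eq hx ht, hU.dx_eq hx ht]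
    exact hopf_pde hε ha b (hpos x hx t ht) rfl
  · rw [hU.dx_eq zero_mem_Icc ht, h.U0r_eq ht]
  · rw [hU.dx_eq one_mem_Icc ht, h.U1r_eq ht]
  · unfold ur
    rw [hv0 t ht, y1v, hexp, sub_add_cancel, Real.log_exp]
    field_simp
  · rw [hU.dx_eq h.hx₀ ht, hopfU1, hv0 t ht, hv1, mul_add, mul_left_comm _ (a * b / (2 * ε)), y1v, y2v,
      hexp, hexp, sub_add_cancel]
    have := Real.exp_pos (-(a / ε) * y₁ t)
    field_simp
    ring

end RefData

/-! ### Continuity in `H²` -/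

/-- Compactness of [0,1] upgrades joint continuity to continuity in time uniform in x. -/
theorem tendsto_sup_sub {T : Set ℝ} {w : ℝ → ℝ → ℝ} {s : ℝ} (hs : s ∈ T)
    (hw : ContinuousOn (fun p : ℝ × ℝ => w p.1 p.2) (Icc 0 1 ×ˢ T)) {η : ℝ} (hη : 0 < η) :
    ∀ᶠ t in 𝓝[T] s, ∀ x ∈ Icc (0 : ℝ) 1, |w x t - w x s| ≤ η := by
  have hc : ContinuousOn (Function.uncurry fun t x => w x t) (T ×ˢ Icc 0 1) :=
    hw.comp continuous_swap.continuousOn fun p hp => ⟨hp.2, hp.1⟩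
  obtain ⟨v, hv, h⟩ := isCompact_Icc.mem_uniformity_of_prod hc hs (Metric.dist_mem_uniformity hη)
  filter_upwards [hv] with t ht x hx
  exact (h t ht x hx).le

theorem tendsto_L2norm_sub {T : Set ℝ} {w : ℝ → ℝ → ℝ} {s : ℝ} (hs : s ∈ T)
    (hw : ContinuousOn (fun p : ℝ × ℝ => w p.1 p.2) (Icc 0 1 ×ˢ T)) :
    Tendsto (fun t => L2norm fun x => w x t - w x s) (𝓝[T] s) (𝓝 0) := by
  rw [Metric.tendsto_nhds]
  intro η hη
  filter_upwards [tendsto_sup_sub hs hw (half_pos hη)] with t ht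
  rw [Real.dist_0_eq_abs, abs_of_nonneg (L2norm_nonneg _)]
  exact (L2norm_le_of_bound (half_pos hη).le ht).trans_lt (half_lt_self hη)

/-- A curve in `H²(0,1)` on `[t₀,∞)` with explicit derivatives. -/
structure H2Field (t₀ : ℝ) (u u1 u2 : ℝ → ℝ → ℝ) : Prop where
  c0 : ContinuousOn (fun p : ℝ × ℝ => u p.1 p.2) (Icc 0 1 ×ˢ Ici t₀)
  c1 : ContinuousOn (fun p : ℝ × ℝ => u1 p.1 p.2) (Icc 0 1 ×ˢ Ici t₀)
  c2 : ContinuousOn (fun p : ℝ × ℝ => u2 p.1 p.2) (Icc 0 1 ×ˢ Ioi t₀)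
  h2 : ∀ t, t₀ ≤ t → HasH2 (fun x => u x t) (fun x => u1 x t) (fun x => u2 x t)
  l2 : Tendsto (fun t => L2norm fun x => u2 x t - u2 x t₀) (𝓝[>] t₀) (𝓝 0)

namespace H2Field

variable {t₀ : ℝ} {u u1 u2 w w1 w2 : ℝ → ℝ → ℝ}

theorem continuousH2 (h : H2Field t₀ u u1 u2) : ContinuousH2 t₀ u where
  mem := fun t ht => (h.h2 t ht).memH2
  cont := fun s hs => by
    -- At the initial time the second derivative is known to be continuous only in L²; at later
    -- times joint continuity is available.
    have l2 : Tendsto (fun t => L2norm fun x => u2 x t - u2 x s) (𝓝[Ici t₀] s) (𝓝 0) := by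
      rcases eq_or_lt_of_le hs with rfl | hs'
      · rw [← Ioi_insert, nhdsWithin_insert, tendsto_sup]
        refine ⟨?_, h.l2⟩
        rw [tendsto_pure_left]
        intro U hU
        simpa [L2norm] using mem_of_mem_nhds hU
      · have := tendsto_L2norm_sub (mem_Ioi.2 hs') h.c2
        rwa [nhdsWithin_eq_nhds.2 (Ioi_mem_nhds hs'), ← nhdsWithin_eq_nhds.2 (Ici_mem_nhds hs')]
          at this
    have := ((tendsto_L2norm_sub (mem_Ici.2 hs) h.c0).add
      (tendsto_L2norm_sub (mem_Ici.2 hs) h.c1)).add l2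
    simp only [add_zero] at this
    refine this.congr' ?_
    filter_upwards [self_mem_nhdsWithin] with t ht
    rw [((h.h2 t ht).sub (h.h2 s hs)).H2norm_eq]

theorem add (h : H2Field t₀ u u1 u2) (k : H2Field t₀ w w1 w2) :
    H2Field t₀ (fun x t => u x t + w x t) (fun x t => u1 x t + w1 x t)
      (fun x t => u2 x t + w2 x t) where
  c0 := h.c0.add k.c0
  c1 := h.c1.add k.c1
  c2 := h.c2.add k.c2
  h2 := fun t ht => (h.h2 t ht).add (k.h2 t ht)
  l2 := by
    refine squeeze_zero' (Eventually.of_forall fun t => L2norm_nonneg _) ?_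
      (by simpa using h.l2.add k.l2)
    filter_upwards [self_mem_nhdsWithin] with t ht
    have h1 : L2I fun x => u2 x t - u2 x t₀ := (h.h2 t (le_of_lt ht)).memLp.sub (h.h2 t₀ le_rfl).memLp
    have h2 : L2I fun x => w2 x t - w2 x t₀ := (k.h2 t (le_of_lt ht)).memLp.sub (k.h2 t₀ le_rfl).memLp
    refine (le_of_eq ?_).trans (L2norm_add_le h1 h2)
    congr 1
    funext x
    ring

theorem of_c21On {ut : ℝ → ℝ → ℝ} (h : C21On (Ici t₀) u u1 u2 ut) : H2Field t₀ u u1 u2 where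
  c0 := h.c0
  c1 := h.c1
  c2 := h.c2.mono (prod_mono_right Ioi_subset_Ici_self)
  h2 := fun t ht => HasH2.of_hasDeriv (h.d1 t ht) (h.d2 t ht)
    (h.c2.comp (f := fun x => (x, t)) (by fun_prop) fun x hx => ⟨hx, ht⟩)
  l2 := (tendsto_L2norm_sub (mem_Ici.2 le_rfl) h.c2).mono_left
    (nhdsWithin_mono _ Ioi_subset_Ici_self)

/-- Time-dependent counterpart of `HasH2.of_deriv_eq_mul_add`. The only factor not continuous up to
t₀ is u2, and it enters linearly with a uniformly continuous coefficient p, so L² convergence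
survives. -/
theorem of_deriv_eq_mul_add {g p p1 q q1 : ℝ → ℝ → ℝ} (h : H2Field t₀ u u1 u2)
    (hg : ∀ t, t₀ ≤ t → ∀ x ∈ Icc (0 : ℝ) 1,
      HasDerivWithinAt (fun y => g y t) (p x t * u1 x t + q x t) (Icc 0 1) x)
    (hp : ∀ t, t₀ ≤ t → ∀ x ∈ Icc (0 : ℝ) 1,
      HasDerivWithinAt (fun y => p y t) (p1 x t) (Icc 0 1) x)
    (hq : ∀ t, t₀ ≤ t → ∀ x ∈ Icc (0 : ℝ) 1,
      HasDerivWithinAt (fun y => q y t) (q1 x t) (Icc 0 1) x)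
    (cg : ContinuousOn (fun z : ℝ × ℝ => g z.1 z.2) (Icc 0 1 ×ˢ Ici t₀))
    (cp : ContinuousOn (fun z : ℝ × ℝ => p z.1 z.2) (Icc 0 1 ×ˢ Ici t₀))
    (cp1 : ContinuousOn (fun z : ℝ × ℝ => p1 z.1 z.2) (Icc 0 1 ×ˢ Ici t₀))
    (cq : ContinuousOn (fun z : ℝ × ℝ => q z.1 z.2) (Icc 0 1 ×ˢ Ici t₀))
    (cq1 : ContinuousOn (fun z : ℝ × ℝ => q1 z.1 z.2) (Icc 0 1 ×ˢ Ici t₀)) :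
    H2Field t₀ g (fun x t => p x t * u1 x t + q x t)
      (fun x t => p1 x t * u1 x t + p x t * u2 x t + q1 x t) := by
  have hsub : Icc (0 : ℝ) 1 ×ˢ Ioi t₀ ⊆ Icc 0 1 ×ˢ Ici t₀ := prod_mono_right Ioi_subset_Ici_self
  have cA : ContinuousOn (fun z : ℝ × ℝ => p1 z.1 z.2 * u1 z.1 z.2 + q1 z.1 z.2)
      (Icc 0 1 ×ˢ Ici t₀) := (cp1.mul h.c1).add cq1
  have hslice : ∀ {f : ℝ → ℝ → ℝ}, ContinuousOn (fun z : ℝ × ℝ => f z.1 z.2) (Icc 0 1 ×ˢ Ici t₀) →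
      ∀ t, t₀ ≤ t → ContinuousOn (fun x => f x t) (Icc 0 1) := fun hf t ht =>
    hf.comp (f := fun x => (x, t)) (by fun_prop) fun x hx => ⟨hx, ht⟩
  have hh2 : ∀ t, t₀ ≤ t → HasH2 (fun x => g x t) (fun x => p x t * u1 x t + q x t)
      (fun x => p1 x t * u1 x t + p x t * u2 x t + q1 x t) := fun t ht =>
    (h.h2 t ht).of_deriv_eq_mul_add (hg t ht) (hp t ht) (hq t ht) (hslice cp1 t ht) (hslice cq1 t ht)
  refine ⟨cg, (cp.mul h.c1).add cq, ?_, hh2, ?_⟩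
  · exact (((cp1.mul h.c1).mono hsub).add ((cp.mono hsub).mul h.c2)).add (cq1.mono hsub)
  · have hm0 := (h.h2 t₀ le_rfl).memLp
    obtain ⟨P, hP⟩ := isCompact_Icc.exists_bound_of_continuousOn (hslice cp t₀ le_rfl)
    have hP0 : 0 ≤ P := (norm_nonneg _).trans (hP 0 zero_mem_Icc)
    rw [Metric.tendsto_nhds]
    intro η hη
    set N := L2norm fun x => u2 x t₀ with hN
    have hN0 : 0 ≤ N := L2norm_nonneg _
    -- The three errors add up to at most (P + 1)ρ + ρN + ρ, hence to at most η/4; ρ ≤ 1 keeps |p|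
    -- below P + 1 near t₀.
    set ρ := min 1 (η / (4 * (P + N + 2))) with hρ
    have hρ0 : 0 < ρ := by positivity
    have hle : 𝓝[>] t₀ ≤ 𝓝[≥] t₀ := nhdsWithin_mono _ Ioi_subset_Ici_self
    have hl2 := (Metric.tendsto_nhds.1 h.l2) ρ hρ0
    filter_upwards [hle (tendsto_sup_sub (w := fun x t => p1 x t * u1 x t + q1 x t) (mem_Ici.2 le_rfl) cA hρ0),
      hle (tendsto_sup_sub (mem_Ici.2 le_rfl) cp hρ0), hl2, self_mem_nhdsWithin] with t hA hB hC ht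
    have hm1 : L2I fun x => u2 x t - u2 x t₀ := (h.h2 t (le_of_lt ht)).memLp.sub hm0
    rw [Real.dist_0_eq_abs, abs_of_nonneg (L2norm_nonneg _)] at hC ⊢
    have key := L2norm_le_of_le (f := fun x => p1 x t * u1 x t + p x t * u2 x t + q1 x t
        - (p1 x t₀ * u1 x t₀ + p x t₀ * u2 x t₀ + q1 x t₀)) (by positivity : 0 ≤ P + 1) hρ0.le hρ0.le
      hm1 hm0 fun x hx => by
        have e : p1 x t * u1 x t + p x t * u2 x t + q1 x t
            - (p1 x t₀ * u1 x t₀ + p x t₀ * u2 x t₀ + q1 x t₀)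
            = p x t * (u2 x t - u2 x t₀) + (p x t - p x t₀) * u2 x t₀
              + (p1 x t * u1 x t + q1 x t - (p1 x t₀ * u1 x t₀ + q1 x t₀)) := by ring
        rw [e]
        have hpt : |p x t| ≤ P + 1 := by
          have i1 := hB x hx
          have i2 : |p x t₀| ≤ P := hP x hx
          have i3 : ρ ≤ 1 := min_le_left _ _
          have i4 : |p x t| ≤ |p x t - p x t₀| + |p x t₀| := by
            have := abs_add_le (p x t - p x t₀) (p x t₀)
            simpa using this
          linarith
        refine (abs_add_three _ _ _).trans ?_
        rw [abs_mul, abs_mul]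
        exact add_le_add (add_le_add (mul_le_mul_of_nonneg_right hpt (abs_nonneg _))
          (mul_le_mul_of_nonneg_right (hB x hx) (abs_nonneg _))) (hA x hx)
    refine key.trans_lt ?_
    have hρ2 : ρ * (4 * (P + N + 2)) ≤ η := by
      rw [← le_div_iff₀ (by positivity)]
      exact min_le_right _ _
    have := mul_le_mul_of_nonneg_left hC.le (by positivity : 0 ≤ P + 1)
    rw [← hN]
    nlinarith

end H2Field

theorem continuous_ext_uncurry : Continuous fun p : CI × ℝ => ext p.1 p.2 := by
  have h : Continuous fun p : CI × ℝ => p.1 (projIcc 0 1 zero_le_one p.2) := by fun_prop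
  exact h

theorem ParaCurve.c21On {Z Z1 Z2 Zt : ℝ → CI} (h : ParaCurve Z Z1 Z2 Zt) (t₀ : ℝ) :
    C21On (Ioi t₀) (fun x t => ext (Z (t - t₀)) x) (fun x t => ext (Z1 (t - t₀)) x)
      (fun x t => ext (Z2 (t - t₀)) x) (fun x t => ext (Zt (t - t₀)) x) := by
  have hc : ∀ {W : ℝ → CI}, ContinuousOn W (Ioi 0) →
      ContinuousOn (fun p : ℝ × ℝ => ext (W (p.2 - t₀)) p.1) (Icc 0 1 ×ˢ Ioi t₀) := fun {W} hW =>
    continuous_ext_uncurry.comp_continuousOn (ContinuousOn.prodMk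
      (hW.comp (f := fun p : ℝ × ℝ => p.2 - t₀) (by fun_prop) fun p hp => mem_Ioi.2 (sub_pos.2 (mem_Ioi.1 hp.2)))
      continuousOn_fst)
  refine ⟨fun t ht => h.d1 _ (sub_pos.2 ht).le, fun t ht => h.d2 _ (sub_pos.2 ht),
    fun t ht x hx => ?_, hc (h.cont.mono Ioi_subset_Ici_self), hc (h.cont1.mono Ioi_subset_Ici_self),
    hc h.cont2, hc h.contt⟩
  have h1 : HasDerivAt (fun t => Z (t - t₀)) (Zt (t - t₀)) t := by
    have := (h.dt (t - t₀) (sub_pos.2 ht)).scomp t ((hasDerivAt_id t).sub_const t₀)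
    rw [one_smul] at this
    exact this
  have h2 := (ContinuousMap.evalCLM ℝ (⟨x, hx⟩ : Icc (0 : ℝ) 1) : CI →L[ℝ] ℝ).hasFDerivAt.comp_hasDerivAt
    t h1
  have e : ∀ F : CI, ext F x = (ContinuousMap.evalCLM ℝ (⟨x, hx⟩ : Icc (0 : ℝ) 1) : CI →L[ℝ] ℝ) F :=
    fun F => ext_of_mem F hx
  simp only [e]
  exact h2.hasDerivWithinAt

theorem H2Curve.exists_h2Field {Z Z1 Z2 Zt : ℝ → CI} (h : H2Curve Z Z1 Z2 Zt) (t₀ : ℝ) :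
    ∃ z2, H2Field t₀ (fun x t => ext (Z (t - t₀)) x) (fun x t => ext (Z1 (t - t₀)) x) z2 := by
  obtain ⟨f2, hf, ht⟩ := h.h2
  have hc : ∀ {W : ℝ → CI}, ContinuousOn W (Ici 0) →
      ContinuousOn (fun p : ℝ × ℝ => ext (W (p.2 - t₀)) p.1) (Icc 0 1 ×ˢ Ici t₀) := fun {W} hW =>
    continuous_ext_uncurry.comp_continuousOn (ContinuousOn.prodMk
      (hW.comp (f := fun p : ℝ × ℝ => p.2 - t₀) (by fun_prop) fun p hp => mem_Ici.2 (sub_nonneg.2 (mem_Ici.1 hp.2)))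
      continuousOn_fst)
  -- `Z2` is meaningful only for positive times; at t₀ it is replaced by the weak second derivative
  -- of the initial profile.
  refine ⟨fun x t => if t = t₀ then f2 x else ext (Z2 (t - t₀)) x, hc h.cont, hc h.cont1, ?_,
    fun t htt => ?_, ?_⟩
  · refine (h.c21On t₀).c2.congr fun p hp => ?_
    simp only [if_neg (ne_of_gt (mem_Ioi.1 hp.2))]
  · rcases eq_or_lt_of_le htt with rfl | htt'
    · simpa using hf
    · simp only [if_neg (ne_of_gt htt')]
      exact HasH2.of_hasDeriv (h.d1 _ (sub_pos.2 htt').le) (h.d2 _ (sub_pos.2 htt'))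
        (continuous_ext _).continuousOn
  · have hshift : Tendsto (fun t => t - t₀) (𝓝[>] t₀) (𝓝[>] 0) := by
      refine tendsto_nhdsWithin_iff.2 ⟨?_, ?_⟩
      · have : Tendsto (fun t : ℝ => t - t₀) (𝓝 t₀) (𝓝 (t₀ - t₀)) :=
          (continuous_sub_right t₀).tendsto t₀
        rw [sub_self] at this
        exact this.mono_left nhdsWithin_le_nhds
      · filter_upwards [self_mem_nhdsWithin] with t ht
        exact mem_Ioi.2 (sub_pos.2 (mem_Ioi.1 ht))
    refine (ht.comp hshift).congr' ?_
    filter_upwards [self_mem_nhdsWithin] with t ht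
    simp only [Function.comp_apply, if_neg (ne_of_gt (mem_Ioi.1 ht)), if_true]

/-! ### Boundary conditions and norms under the Hopf–Cole transformation -/

theorem hopfV_hopfU {ε a : ℝ} (hε : 0 < ε) (ha : a ≠ 0) (b : ℝ) {v : ℝ → ℝ → ℝ} {x t : ℝ}
    (hpos : 0 < Real.exp (a * b / (2 * ε) * x) * v x t + 1) :
    hopfV ε a b (hopfU ε a b v) x t = v x t := by
  rw [hopfV, exp_hopfU hε ha b hpos, add_neg_cancel_right, ← mul_assoc, ← Real.exp_add, neg_mul,
    neg_add_cancel, Real.exp_zero, one_mul]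

theorem hopfV1_hopfU1 {ε a : ℝ} (hε : 0 < ε) (ha : a ≠ 0) (b : ℝ) {v v1 : ℝ → ℝ → ℝ} {x t : ℝ}
    (hpos : 0 < Real.exp (a * b / (2 * ε) * x) * v x t + 1) :
    hopfV1 ε a b (hopfU ε a b v) (hopfU1 ε a b v v1) x t = v1 x t := by
  rw [hopfV1, exp_hopfU hε ha b hpos, hopfU1]
  have e : Real.exp (-(a * b / (2 * ε)) * x) = (Real.exp (a * b / (2 * ε) * x))⁻¹ := by
    rw [← Real.exp_neg, neg_mul]
  rw [e]
  have hE := Real.exp_pos (a * b / (2 * ε) * x)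
  generalize Real.exp (a * b / (2 * ε) * x) = E at *
  have hne := hpos.ne'
  field_simp
  ring

/-- A feedback law for `u` is an affine boundary condition for the transformed variable. -/
theorem feedback_iff {ε a : ℝ} (hε : 0 < ε) (ha : a ≠ 0) (κ k I R u r u1 : ℝ) :
    u1 = -(ε / a) * Real.exp (a / ε * (u - r)) * ((k + κ) * (Real.exp (-(a / ε) * (u - r)) - 1)
        - Real.exp (a / ε * r) * I) + R * Real.exp (a / ε * (u - r)) ↔
    (Real.exp (-(a / ε) * u) * (-(a / ε) * u1) + -κ * (Real.exp (-(a / ε) * u) + -1))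
      - (Real.exp (-(a / ε) * r) * (-(a / ε) * R) + -κ * (Real.exp (-(a / ε) * r) + -1))
      = k * (Real.exp (-(a / ε) * u) - Real.exp (-(a / ε) * r)) - I := by
  have e1 : Real.exp (a / ε * (u - r)) = Real.exp (a / ε * u) / Real.exp (a / ε * r) := by
    rw [← Real.exp_sub, mul_sub]
  have e2 : Real.exp (-(a / ε) * (u - r)) = Real.exp (a / ε * r) / Real.exp (a / ε * u) := by
    rw [← Real.exp_sub]; congr 1; ring
  have e3 : ∀ z, Real.exp (-(a / ε) * z) = (Real.exp (a / ε * z))⁻¹ := fun z => by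
    rw [← Real.exp_neg, neg_mul]
  rw [e1, e2, e3 u, e3 r]
  have hX := Real.exp_pos (a / ε * u)
  have hY := Real.exp_pos (a / ε * r)
  generalize Real.exp (a / ε * u) = X at *
  generalize Real.exp (a / ε * r) = Y at *
  -- The defects of the two boundary conditions differ by the nonzero factor -(a/ε)e^{-au/ε}, so
  -- they vanish together.
  have key : ((X⁻¹ * (-(a / ε) * u1) + -κ * (X⁻¹ + -1)) - (Y⁻¹ * (-(a / ε) * R) + -κ * (Y⁻¹ + -1))
      - (k * (X⁻¹ - Y⁻¹) - I))
      = -(a / ε) * X⁻¹ * (u1 - (-(ε / a) * (X / Y) * ((k + κ) * (Y / X - 1) - Y * I) + R * (X / Y))) := by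
    field_simp
    ring
  have hne : -(a / ε) * X⁻¹ ≠ 0 := mul_ne_zero (neg_ne_zero.2 (div_ne_zero ha hε.ne')) (by positivity)
  rw [← sub_eq_zero, ← sub_eq_zero (b := k * (X⁻¹ - Y⁻¹) - I), key, mul_eq_zero]
  exact (or_iff_right hne).symm

/-- The transformed tracking error `ṽ`. -/
def errV (ε a b x₀ : ℝ) (y₁ y₂ : ℝ → ℝ) (u : ℝ → ℝ → ℝ) (x t : ℝ) : ℝ :=
  hopfV ε a b u x t - vr ε a b x₀ y₁ y₂ x t

/-- The spatial derivative of `errV`. -/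
def errV1 (ε a b x₀ : ℝ) (y₁ y₂ : ℝ → ℝ) (u u1 : ℝ → ℝ → ℝ) (x t : ℝ) : ℝ :=
  hopfV1 ε a b u u1 x t - refField ε a b x₀ y₁ y₂ 1 x t

variable {ε a b x₀ : ℝ} {y₁ y₂ : ℝ → ℝ} {A L γ : ℝ}

/-- v^r is itself the Hopf–Cole image of u^r, so the transformed error is a weighted difference of
two exponentials. -/
theorem errV_eq (hε : 0 < ε) (ha : a ≠ 0) {u : ℝ → ℝ → ℝ} {x t : ℝ}
    (hpos : 0 < Real.exp (a * b / (2 * ε) * x) * vr ε a b x₀ y₁ y₂ x t + 1) :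
    errV ε a b x₀ y₁ y₂ u x t = Real.exp (-(a * b / (2 * ε)) * x)
      * (Real.exp (-(a / ε) * u x t) - Real.exp (-(a / ε) * ur ε a b x₀ y₁ y₂ x t)) := by
  have e := hopfV_hopfU hε ha b hpos
  change hopfV ε a b (ur ε a b x₀ y₁ y₂) x t = _ at e
  rw [errV, ← e]
  unfold hopfV
  ring

theorem errV1_eq (hε : 0 < ε) (ha : a ≠ 0) {u u1 : ℝ → ℝ → ℝ} {x t : ℝ}
    (hpos : 0 < Real.exp (a * b / (2 * ε) * x) * vr ε a b x₀ y₁ y₂ x t + 1) :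
    errV1 ε a b x₀ y₁ y₂ u u1 x t = hopfV1 ε a b u u1 x t - hopfV1 ε a b (ur ε a b x₀ y₁ y₂)
      (hopfU1 ε a b (vr ε a b x₀ y₁ y₂) (refField ε a b x₀ y₁ y₂ 1)) x t := by
  have e := hopfV1_hopfU1 (v1 := refField ε a b x₀ y₁ y₂ 1) hε ha b hpos
  rw [errV1, ← e]
  rfl

/-- The quantity fed to the observer is the boundary value of the transformed error, although it is
computed from u and u^r only. -/
theorem meas0_eq (hε : 0 < ε) (ha : a ≠ 0) {u : ℝ → ℝ → ℝ} {t : ℝ}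
    (hpos : 0 < Real.exp (a * b / (2 * ε) * 0) * vr ε a b x₀ y₁ y₂ 0 t + 1) :
    meas0 ε a (fun x => ur ε a b x₀ y₁ y₂ x t) (fun x => u x t - ur ε a b x₀ y₁ y₂ x t)
      = errV ε a b x₀ y₁ y₂ u 0 t := by
  rw [errV_eq hε ha hpos, meas0, sub_mul, ← Real.exp_add, mul_zero, Real.exp_zero]
  ring_nf

theorem meas1_eq (hε : 0 < ε) (ha : a ≠ 0) {u : ℝ → ℝ → ℝ} {t : ℝ}
    (hpos : 0 < Real.exp (a * b / (2 * ε) * 1) * vr ε a b x₀ y₁ y₂ 1 t + 1) :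
    meas1 ε a b (fun x => ur ε a b x₀ y₁ y₂ x t) (fun x => u x t - ur ε a b x₀ y₁ y₂ x t)
      = errV ε a b x₀ y₁ y₂ u 1 t := by
  rw [errV_eq hε ha hpos, meas1, sub_eq_add_neg (-(a * b / (2 * ε))), Real.exp_add,
    mul_left_comm, mul_one, sub_mul, ← neg_mul, ← Real.exp_add]
  ring_nf

/-- The boundary conditions of the closed loop are linear in the transformed variables. -/
theorem RefData.boundary_iff (h : RefData ε a b x₀ y₁ y₂ A L γ) (ha : a ≠ 0) (c₁ c₂ : ℝ) {t : ℝ}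
    (ht : 0 ≤ t) (hpos : ∀ x ∈ Icc (0 : ℝ) 1,
      0 < Real.exp (a * b / (2 * ε) * x) * vr ε a b x₀ y₁ y₂ x t + 1)
    {u u1 m m1 : ℝ → ℝ → ℝ} (hu0 : D (fun x => u x t) 0 = u1 0 t) (hu1 : D (fun x => u x t) 1 = u1 1 t)
    (hm0 : D (fun x => m x t) 0 = m1 0 t) (hm1 : D (fun x => m x t) 1 = m1 1 t) :
    BoundaryConditions ε a b x₀ c₁ c₂ y₁ y₂ t (fun x => u x t) (fun x => m x t) ↔
      LinBC (c₁ / ε) (c₂ / ε) (fun x => errV ε a b x₀ y₁ y₂ u x t)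
        (fun x => errV1 ε a b x₀ y₁ y₂ u u1 x t) (fun x => m x t) (fun x => m1 x t) := by
  have hε := h.hε
  have M0 := meas0_eq (u := u) hε ha (hpos 0 zero_mem_Icc)
  have M1 := meas1_eq (u := u) hε ha (hpos 1 one_mem_Icc)
  have P0 : D (fun x => u x t) 0 = U0 ε a b c₁ (U0r ε a b x₀ y₁ y₂ t)
      (fun x => ur ε a b x₀ y₁ y₂ x t) (fun x => u x t - ur ε a b x₀ y₁ y₂ x t) (fun x => m x t) ↔
      errV1 ε a b x₀ y₁ y₂ u u1 0 t = kern (c₁ / ε) 0 0 * errV ε a b x₀ y₁ y₂ u 0 t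
        - ∫ y in (0 : ℝ)..1, kernX (c₁ / ε) 0 y * m y t := by
    rw [hu0, U0, h.U0r_eq ht, errV1_eq hε ha (hpos 0 zero_mem_Icc), errV_eq hε ha (hpos 0 zero_mem_Icc)]
    simp only [ctrlKernel_eq_kern, ctrlKernelX_eq_kernX]
    rw [feedback_iff hε ha]
    unfold hopfV1
    simp only [mul_zero, Real.exp_zero, one_mul]
  have P1 : D (fun x => u x t) 1 = U1 ε a b c₁ (U1r ε a b x₀ y₁ y₂ t)
      (fun x => ur ε a b x₀ y₁ y₂ x t) (fun x => u x t - ur ε a b x₀ y₁ y₂ x t) (fun x => m x t) ↔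
      errV1 ε a b x₀ y₁ y₂ u u1 1 t = kern (c₁ / ε) 1 1 * errV ε a b x₀ y₁ y₂ u 1 t
        + ∫ y in (0 : ℝ)..1, kernX (c₁ / ε) 1 y * m y t := by
    rw [hu1, U1, h.U1r_eq ht, errV1_eq hε ha (hpos 1 one_mem_Icc), errV_eq hε ha (hpos 1 one_mem_Icc)]
    simp only [ctrlKernel_eq_kern, ctrlKernelX_eq_kernX]
    set J := ∫ y in (0 : ℝ)..1, kernX (c₁ / ε) 1 y * m y t
    -- The integral term has the opposite sign and an additional weight e^{ab/(2ε)} at x = 1;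
    -- absorbing both into the integral reduces this end to the form treated by `feedback_iff`.
    have e : ∀ z, z + Real.exp (a * b / (2 * ε) + a / ε * ur ε a b x₀ y₁ y₂ 1 t) * J
        = z - Real.exp (a / ε * ur ε a b x₀ y₁ y₂ 1 t) * (-(Real.exp (a * b / (2 * ε)) * J)) :=
      fun z => by rw [Real.exp_add]; ring
    rw [e, feedback_iff hε ha]
    unfold hopfV1
    have hE := Real.exp_pos (a * b / (2 * ε))
    have e2 : Real.exp (-(a * b / (2 * ε)) * 1) = (Real.exp (a * b / (2 * ε)))⁻¹ := by
      rw [← Real.exp_neg, mul_one]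
    rw [e2]
    generalize Real.exp (a * b / (2 * ε)) = E at *
    rw [← mul_sub, inv_mul_eq_iff_eq_mul₀ hE.ne']
    have e3 : ∀ X : ℝ, E * (kern (c₁ / ε) 1 1 * (E⁻¹ * X) + J)
        = kern (c₁ / ε) 1 1 * X - -(E * J) := fun X => by
      field_simp
      ring
    rw [e3]
  constructor
  · intro hb
    have p0 := P0.1 hb.plant0
    have p1 := P1.1 hb.plant1
    refine ⟨p0, p1, ?_, ?_⟩
    · have := hb.obs0
      rw [hm0, V0, M0, p00_eq, ctrlKernel_eq_kern] at this
      simp only [ctrlKernelX_eq_kernX] at this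
      rw [p0, this]
      ring
    · have := hb.obs1
      rw [hm1, V1, M1, p11_eq, ctrlKernel_eq_kern] at this
      simp only [ctrlKernelX_eq_kernX] at this
      rw [p1, this]
      ring
  · intro hb
    have p0 := hb.plant0
    have p1 := hb.plant1
    refine ⟨P0.2 p0, P1.2 p1, ?_, ?_⟩
    · have := hb.obs0
      rw [hm0, V0, M0, p00_eq, ctrlKernel_eq_kern]
      simp only [ctrlKernelX_eq_kernX] at *
      rw [this, p0]
      ring
    · have := hb.obs1
      rw [hm1, V1, M1, p11_eq, ctrlKernel_eq_kern]
      simp only [ctrlKernelX_eq_kernX] at *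
      rw [this, p1]
      ring

/-! ### Small references, and Lipschitz bounds for the Hopf–Cole map around them -/

/-- Uniform bounds on the reference trajectory. -/
structure RefBound (ε a b x₀ : ℝ) (y₁ y₂ : ℝ → ℝ) (B : ℝ) : Prop where
  lower : ∀ x ∈ Icc (0 : ℝ) 1, ∀ t, 0 ≤ t →
    1 / 2 ≤ Real.exp (a * b / (2 * ε) * x) * vr ε a b x₀ y₁ y₂ x t + 1
  upper : ∀ x ∈ Icc (0 : ℝ) 1, ∀ t, 0 ≤ t →
    Real.exp (a * b / (2 * ε) * x) * vr ε a b x₀ y₁ y₂ x t + 1 ≤ 2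
  deriv : ∀ x ∈ Icc (0 : ℝ) 1, ∀ t, 0 ≤ t → |Real.exp (a * b / (2 * ε) * x)
    * (refField ε a b x₀ y₁ y₂ 1 x t + a * b / (2 * ε) * vr ε a b x₀ y₁ y₂ x t)| ≤ B

theorem exp_mul_le {κ x : ℝ} (hx : x ∈ Icc (0 : ℝ) 1) : Real.exp (κ * x) ≤ Real.exp |κ| := by
  refine Real.exp_le_exp.2 ((mul_le_mul_of_nonneg_right (le_abs_self κ) hx.1).trans ?_)
  exact mul_le_of_le_one_right (abs_nonneg κ) hx.2

/-- For small outputs the reference trajectory is well defined and bounded. -/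
theorem exists_reference (ε a b x₀ M γ : ℝ) (hε : 0 < ε) (hx₀ : x₀ ∈ Icc (0 : ℝ) 1)
    (hM : 0 < M) (hγ₁ : 1 ≤ γ) (hγ₂ : γ < 2) :
    ∃ μ₁ : ℝ, 0 < μ₁ ∧ ∀ F : ℝ, 0 < F → F ≤ μ₁ → ∀ y₁ y₂ : ℝ → ℝ, IsGevrey F M γ y₁ →
      IsGevrey F M γ y₂ → ∃ A L B, RefData ε a b x₀ y₁ y₂ A L γ ∧ RefBound ε a b x₀ y₁ y₂ B := by
  obtain ⟨C, hC, H⟩ := exists_gevrey_outputs ε a b x₀ M γ hM hγ₁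
  set S := ∑' n, gevreyMaj γ (refRatio ε a b (4 * M)) n with hS
  have hS0 : 0 ≤ S := tsum_nonneg fun n => gevreyMaj_nonneg (RefData.one_le_refRatio ε a b _) n
  set E := Real.exp |a * b / (2 * ε)| with hE
  have hE0 : 0 < E := Real.exp_pos _
  -- The first bound on F gives |a/ε| F ≤ 1, as the exponential estimates require; the second gives
  -- |e^{abx/(2ε)} v^r| ≤ 1/2.
  refine ⟨min (1 / (|a / ε| + 1)) (1 / (2 * (E * C * S + 1))), by positivity,
    fun F hF hFμ y₁ y₂ h1 h2 => ?_⟩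
  have hF1 : |a / ε| * F ≤ 1 := by
    have := hFμ.trans (min_le_left _ _)
    rw [le_div_iff₀ (by positivity)] at this
    linarith
  have hF2 : E * (C * F * S) ≤ 1 / 2 := by
    have := hFμ.trans (min_le_right _ _)
    rw [le_div_iff₀ (by positivity)] at this
    linarith
  obtain ⟨g1, g2⟩ := H F hF hF1 y₁ y₂ h1 h2
  have hR : RefData ε a b x₀ y₁ y₂ (C * F) (4 * M) γ :=
    ⟨hε, hx₀, by positivity, by positivity, by linarith, hγ₂, g1, g2⟩
  have hv : ∀ x ∈ Icc (0 : ℝ) 1, ∀ t, 0 ≤ t → |vr ε a b x₀ y₁ y₂ x t| ≤ C * F * S :=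
    fun x hx t ht => by
      rw [hR.vr_eq hx ht]
      exact hR.abs_refField_le (by norm_num) hx ht
  have hEv : ∀ x ∈ Icc (0 : ℝ) 1, ∀ t, 0 ≤ t →
      |Real.exp (a * b / (2 * ε) * x) * vr ε a b x₀ y₁ y₂ x t| ≤ 1 / 2 := fun x hx t ht => by
    rw [abs_mul, Real.abs_exp]
    exact (mul_le_mul (exp_mul_le hx) (hv x hx t ht) (abs_nonneg _) hE0.le).trans hF2
  refine ⟨C * F, 4 * M, E * (C * F * S + |a * b / (2 * ε)| * (C * F * S)), hR,
    fun x hx t ht => ?_, fun x hx t ht => ?_, fun x hx t ht => ?_⟩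
  · linarith [(abs_le.1 (hEv x hx t ht)).1]
  · linarith [(abs_le.1 (hEv x hx t ht)).2]
  · rw [abs_mul, Real.abs_exp]
    refine mul_le_mul (exp_mul_le hx) ((abs_add_le _ _).trans (add_le_add
      (hR.abs_refField_le (by norm_num) hx ht) ?_)) (abs_nonneg _) hE0.le
    rw [abs_mul]
    exact mul_le_mul_of_nonneg_left (hv x hx t ht) (abs_nonneg _)

/-- From log y ≤ y - 1 in both directions. The level 1/4 is what is left of the lower bound 1/2 at
the reference after a perturbation of size at most 1/4. -/
theorem abs_log_sub_log_le {p q : ℝ} (hp : 1 / 4 ≤ p) (hq : 1 / 4 ≤ q) :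
    |Real.log p - Real.log q| ≤ 4 * |p - q| := by
  have key : ∀ {p q : ℝ}, 1 / 4 ≤ p → 1 / 4 ≤ q → Real.log p - Real.log q ≤ 4 * |p - q| :=
    fun {p q} hp hq => by
      have hp0 : 0 < p := by linarith
      have hq0 : 0 < q := by linarith
      rw [← Real.log_div hp0.ne' hq0.ne']
      have h1 := Real.log_le_sub_one_of_pos (div_pos hp0 hq0)
      have h2 : p / q - 1 ≤ 4 * |p - q| := by
        rw [div_sub_one hq0.ne', div_le_iff₀ hq0]
        nlinarith [le_abs_self (p - q), abs_nonneg (p - q)]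
      linarith
  rw [abs_le]
  have h1 := key hp hq
  have h2 := key hq hp
  rw [abs_sub_comm] at h2
  constructor <;> linarith

variable {ε a b x₀ : ℝ} {y₁ y₂ : ℝ → ℝ} {B : ℝ}

/-- The tracking error is controlled by the transformed tracking error. -/
theorem RefBound.exists_hopfU_le (h : RefBound ε a b x₀ y₁ y₂ B) :
    ∃ C, 0 < C ∧ ∀ (V V1 : ℝ → ℝ → ℝ) (x t : ℝ), x ∈ Icc (0 : ℝ) 1 → 0 ≤ t →
      Real.exp (a * b / (2 * ε) * x) * |V x t| ≤ 1 / 4 →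
      |hopfU ε a b (fun x t => vr ε a b x₀ y₁ y₂ x t + V x t) x t - ur ε a b x₀ y₁ y₂ x t|
        ≤ C * |V x t| ∧
      |hopfU1 ε a b (fun x t => vr ε a b x₀ y₁ y₂ x t + V x t)
          (fun x t => refField ε a b x₀ y₁ y₂ 1 x t + V1 x t) x t
        - hopfU1 ε a b (vr ε a b x₀ y₁ y₂) (refField ε a b x₀ y₁ y₂ 1) x t|
        ≤ C * |V x t| + C * |V1 x t| := by
  have hB : 0 ≤ B := (abs_nonneg _).trans (h.deriv 0 zero_mem_Icc 0 le_rfl)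
  set K := a * b / (2 * ε) with hK
  set E := Real.exp |K| with hE
  have hE0 : 0 < E := Real.exp_pos _
  set r := |ε / a| with hr
  have hr0 : 0 ≤ r := abs_nonneg _
  refine ⟨r * (4 * E * (1 + |K|) + 8 * B * E) + 1, by positivity, fun V V1 x t hx ht hsm => ?_⟩
  set e := Real.exp (K * x) with he
  have he0 : 0 < e := Real.exp_pos _
  have heE : e ≤ E := exp_mul_le hx
  have hl := h.lower x hx t ht
  have hd := h.deriv x hx t ht
  have n0 := abs_nonneg (V x t)
  have n1 := abs_nonneg (V1 x t)
  have nK := abs_nonneg K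
  have hw : |e * V x t| ≤ 1 / 4 := by rwa [abs_mul, abs_of_pos he0]
  have hwE : |e * V x t| ≤ E * |V x t| := by
    rw [abs_mul, abs_of_pos he0]
    exact mul_le_mul_of_nonneg_right heE n0
  have hw1E : |e * (V1 x t + K * V x t)| ≤ E * (|V1 x t| + |K| * |V x t|) := by
    rw [abs_mul, abs_of_pos he0]
    refine mul_le_mul heE ((abs_add_le _ _).trans_eq (by rw [abs_mul])) (abs_nonneg _) hE0.le
  have hsum : e * (vr ε a b x₀ y₁ y₂ x t + V x t) + 1
      = e * vr ε a b x₀ y₁ y₂ x t + 1 + e * V x t := by ring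
  have hsum1 : e * (refField ε a b x₀ y₁ y₂ 1 x t + V1 x t + K * (vr ε a b x₀ y₁ y₂ x t + V x t))
      = e * (refField ε a b x₀ y₁ y₂ 1 x t + K * vr ε a b x₀ y₁ y₂ x t) + e * (V1 x t + K * V x t) := by
    ring
  constructor
  · unfold hopfU ur
    rw [← mul_sub, abs_mul, abs_neg, ← hr, ← hK, ← he, hsum]
    set p := e * vr ε a b x₀ y₁ y₂ x t + 1
    have h1 := abs_log_sub_log_le (p := p + e * V x t) (q := p) (by linarith [(abs_le.1 hw).1])
      (by linarith)
    rw [add_sub_cancel_left] at h1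
    calc r * _ ≤ r * (4 * (E * |V x t|)) :=
          mul_le_mul_of_nonneg_left (h1.trans (by linarith)) hr0
      _ ≤ _ := by
        have : 0 ≤ r * (4 * E * |K| + 8 * B * E) * |V x t| := by positivity
        linarith
  · unfold hopfU1
    rw [← mul_sub, abs_mul, abs_neg, ← hr, ← hK, ← he, hsum, hsum1]
    set p := e * vr ε a b x₀ y₁ y₂ x t + 1
    set p1 := e * (refField ε a b x₀ y₁ y₂ 1 x t + K * vr ε a b x₀ y₁ y₂ x t)
    set w := e * V x t
    set w1 := e * (V1 x t + K * V x t)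
    have hp0 : 0 < p := by linarith
    have hq : 1 / 4 ≤ p + w := by linarith [(abs_le.1 hw).1]
    have hq0 : 0 < p + w := by linarith
    -- The denominators are at least 1/4 and 1/8, whence the constants 4 and 8; the bound on p1
    -- comes from the reference.
    have e1 : (p1 + w1) / (p + w) - p1 / p = w1 / (p + w) - p1 * w / ((p + w) * p) := by
      field_simp
      ring
    have b1 : |w1 / (p + w)| ≤ 4 * |w1| := by
      rw [abs_div, abs_of_pos hq0, div_le_iff₀ hq0]
      nlinarith [abs_nonneg w1]
    have b2 : |p1 * w / ((p + w) * p)| ≤ 8 * (B * |w|) := by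
      rw [abs_div, abs_mul, abs_of_pos (mul_pos hq0 hp0), div_le_iff₀ (mul_pos hq0 hp0)]
      have i1 : |p1| * |w| ≤ B * |w| := mul_le_mul_of_nonneg_right hd (abs_nonneg w)
      have i2 : 1 / 8 ≤ (p + w) * p := by nlinarith
      have i3 : 0 ≤ B * |w| := by positivity
      nlinarith
    have b3 : |(p1 + w1) / (p + w) - p1 / p| ≤ 4 * |w1| + 8 * (B * |w|) := by
      rw [e1]
      exact (abs_sub _ _).trans (add_le_add b1 b2)
    have b4 := mul_le_mul_of_nonneg_left hwE hB
    calc r * _ ≤ r * (4 * (E * (|V1 x t| + |K| * |V x t|)) + 8 * (B * (E * |V x t|))) :=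
          mul_le_mul_of_nonneg_left (b3.trans (by linarith)) hr0
      _ ≤ _ := by
        have i1 : 0 ≤ r * (4 * E) * |V x t| := by positivity
        have i2 : 0 ≤ r * (4 * E * |K| + 8 * B * E) * |V1 x t| := by positivity
        linarith

/-- The transformed tracking error is controlled by the tracking error. -/
theorem RefBound.exists_errV_le (h : RefBound ε a b x₀ y₁ y₂ B) (hε : 0 < ε) (ha : a ≠ 0) :
    ∃ C, 0 < C ∧ ∀ (u u1 : ℝ → ℝ → ℝ) (x t : ℝ), x ∈ Icc (0 : ℝ) 1 → 0 ≤ t →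
      |u x t - ur ε a b x₀ y₁ y₂ x t| ≤ 1 →
      |errV ε a b x₀ y₁ y₂ u x t| ≤ C * |u x t - ur ε a b x₀ y₁ y₂ x t| ∧
      |errV1 ε a b x₀ y₁ y₂ u u1 x t| ≤ C * |u x t - ur ε a b x₀ y₁ y₂ x t|
        + C * |u1 x t - hopfU1 ε a b (vr ε a b x₀ y₁ y₂) (refField ε a b x₀ y₁ y₂ 1) x t| := by
  have hB : 0 ≤ B := (abs_nonneg _).trans (h.deriv 0 zero_mem_Icc 0 le_rfl)
  set K := a * b / (2 * ε) with hK
  set E := Real.exp |-K| with hE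
  have hE0 : 0 < E := Real.exp_pos _
  set α := |a / ε| with hα
  have hα0 : 0 ≤ α := abs_nonneg _
  set G := 2 * (α * Real.exp α) with hG
  have hG0 : 0 ≤ G := by positivity
  set R := |ε / a| * (2 * B) with hR
  have hR0 : 0 ≤ R := by positivity
  refine ⟨E * (α * (2 * Real.exp α + G * R) + (|K| + 1) * G) + 1, by positivity,
    fun u u1 x t hx ht hsm => ?_⟩
  have hl := h.lower x hx t ht
  have hpos : 0 < Real.exp (K * x) * vr ε a b x₀ y₁ y₂ x t + 1 := by linarith
  have hq : Real.exp (-(a / ε) * ur ε a b x₀ y₁ y₂ x t)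
      = Real.exp (K * x) * vr ε a b x₀ y₁ y₂ x t + 1 := exp_hopfU hε ha b hpos
  rw [errV_eq hε ha hpos, errV1_eq hε ha hpos]
  unfold hopfV1
  rw [← hK]
  set r := ur ε a b x₀ y₁ y₂ x t with hr
  set r1 := hopfU1 ε a b (vr ε a b x₀ y₁ y₂) (refField ε a b x₀ y₁ y₂ 1) x t with hr1
  set e := Real.exp (-K * x) with he
  have he0 : 0 < e := Real.exp_pos _
  have heE : e ≤ E := exp_mul_le hx
  set p := Real.exp (-(a / ε) * u x t) with hp
  set q := Real.exp (-(a / ε) * r) with hqd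
  have hq0 : 0 < q := Real.exp_pos _
  have hq2 : q ≤ 2 := by rw [hq]; exact h.upper x hx t ht
  set d := |u x t - r| with hd
  have hd0 : 0 ≤ d := abs_nonneg _
  have hz : |-(a / ε) * (u x t - r)| = α * d := by rw [abs_mul, abs_neg]
  have hzα : α * d ≤ α := mul_le_of_le_one_right hα0 hsm
  -- Factoring out the reference exponential q ≤ 2 leaves e^z - 1 with |z| ≤ |a/ε|, which is
  -- Lipschitz there.
  have hpq : p = q * Real.exp (-(a / ε) * (u x t - r)) := by
    rw [hp, hqd, ← Real.exp_add]; congr 1; ring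
  have hp2 : |p| ≤ 2 * Real.exp α := by
    rw [abs_of_pos (a := p) (Real.exp_pos _), hpq]
    refine mul_le_mul hq2 (Real.exp_le_exp.2 ((le_abs_self _).trans ?_)) (Real.exp_pos _).le
      (by norm_num)
    rw [hz]; exact hzα
  have hdiff : |p - q| ≤ G * d := by
    have e1 : p - q = q * (Real.exp (-(a / ε) * (u x t - r)) - 1) := by rw [hpq]; ring
    have e2 := abs_exp_sub_one_le_mul (-(a / ε) * (u x t - r))
    rw [hz] at e2
    have e3 : α * d * Real.exp (α * d) ≤ α * d * Real.exp α :=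
      mul_le_mul_of_nonneg_left (Real.exp_le_exp.2 hzα) (by positivity)
    rw [e1, abs_mul, abs_of_pos hq0]
    calc q * _ ≤ 2 * (α * d * Real.exp α) := mul_le_mul hq2 (e2.trans e3) (abs_nonneg _) (by norm_num)
      _ = G * d := by rw [hG]; ring
  have hr1' : |r1| ≤ R := by
    rw [hr1, hopfU1, abs_mul, abs_neg, hR]
    refine mul_le_mul_of_nonneg_left ?_ (abs_nonneg _)
    rw [abs_div, abs_of_pos hpos, div_le_iff₀ hpos]
    have := h.deriv x hx t ht
    nlinarith
  set d1 := |u1 x t - r1| with hd1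
  have hd10 : 0 ≤ d1 := abs_nonneg _
  constructor
  · rw [abs_mul, abs_of_pos he0]
    calc e * |p - q| ≤ E * (G * d) := mul_le_mul heE hdiff (abs_nonneg _) hE0.le
      _ ≤ _ := by
        have : 0 ≤ (E * (α * (2 * Real.exp α + G * R) + |K| * G) + 1) * d := by positivity
        linarith
  · have e1 : e * (p * (-(a / ε) * u1 x t) + -K * (p + -1)) - e * (q * (-(a / ε) * r1) + -K * (q + -1))
        = e * (-(a / ε) * (p * (u1 x t - r1) + (p - q) * r1) + -K * (p - q)) := by ring
    rw [e1, abs_mul, abs_of_pos he0]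
    have i1 : |p * (u1 x t - r1) + (p - q) * r1| ≤ 2 * Real.exp α * d1 + G * d * R := by
      refine (abs_add_le _ _).trans ?_
      rw [abs_mul, abs_mul]
      exact add_le_add (mul_le_mul_of_nonneg_right hp2 hd10)
        (mul_le_mul hdiff hr1' (abs_nonneg _) (by positivity))
    have i2 : |-(a / ε) * (p * (u1 x t - r1) + (p - q) * r1) + -K * (p - q)|
        ≤ α * (2 * Real.exp α * d1 + G * d * R) + |K| * (G * d) := by
      refine (abs_add_le _ _).trans ?_
      rw [abs_mul, abs_mul, abs_neg, abs_neg]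
      exact add_le_add (mul_le_mul_of_nonneg_left i1 hα0)
        (mul_le_mul_of_nonneg_left hdiff (abs_nonneg _))
    calc e * _ ≤ E * (α * (2 * Real.exp α * d1 + G * d * R) + |K| * (G * d)) :=
          mul_le_mul heE i2 (abs_nonneg _) hE0.le
      _ ≤ _ := by
        have j1 : 0 ≤ (E * (α * (2 * Real.exp α) + G) + 1) * d := by positivity
        have j2 : 0 ≤ (E * (α * (G * R) + (|K| + 1) * G) + 1) * d1 := by positivity
        linarith

/-! ### Existence of closed-loop solutions -/

theorem hopfU_hopfV {ε a : ℝ} (hε : 0 < ε) (ha : a ≠ 0) (b : ℝ) (u : ℝ → ℝ → ℝ) (x t : ℝ) :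
    hopfU ε a b (hopfV ε a b u) x t = u x t := by
  rw [hopfU, exp_mul_hopfV, Real.log_exp]
  field_simp

theorem HasH2.hopfV {u u1 : ℝ → ℝ → ℝ} {u2 : ℝ → ℝ} {t : ℝ}
    (h : HasH2 (fun x => u x t) (fun x => u1 x t) u2) (ε a b : ℝ) :
    ∃ w2, HasH2 (fun x => hopfV ε a b u x t) (fun x => hopfV1 ε a b u u1 x t) w2 := by
  set κ := -(a * b / (2 * ε)) with hκ
  set α := -(a / ε) with hα
  have hE : ∀ x, HasDerivWithinAt (fun y => Real.exp (κ * y)) (Real.exp (κ * x) * κ) (Icc 0 1) x :=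
    fun x => by
      have := ((hasDerivAt_id x).const_mul κ).exp.hasDerivWithinAt (s := Icc 0 1)
      simpa using this
  have hG : ∀ x ∈ Icc (0 : ℝ) 1, HasDerivWithinAt (fun y => Real.exp (α * u y t))
      (Real.exp (α * u x t) * (α * u1 x t)) (Icc 0 1) x := fun x hx =>
    ((h.deriv x hx).const_mul α).exp
  have cu := h.continuousOn
  have cu1 := h.continuousOn_deriv
  have key := h.of_deriv_eq_mul_add
    (g := fun x => Real.exp (κ * x) * (Real.exp (α * u x t) + -1))
    (p := fun x => Real.exp (κ * x) * (Real.exp (α * u x t) * α))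
    (p1 := fun x => Real.exp (κ * x) * κ * (Real.exp (α * u x t) * α)
      + Real.exp (κ * x) * (Real.exp (α * u x t) * (α * u1 x t) * α))
    (q := fun x => Real.exp (κ * x) * (κ * (Real.exp (α * u x t) + -1)))
    (q1 := fun x => Real.exp (κ * x) * κ * (κ * (Real.exp (α * u x t) + -1))
      + Real.exp (κ * x) * (κ * (Real.exp (α * u x t) * (α * u1 x t))))
    (fun x hx => ((hE x).mul ((hG x hx).add_const (-1))).congr_deriv (by ring))
    (fun x hx => (hE x).mul ((hG x hx).mul_const α))
    (fun x hx => (hE x).mul (((hG x hx).add_const (-1)).const_mul κ))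
    (by fun_prop) (by fun_prop)
  refine ⟨_, key.congr (fun _ _ => rfl) fun x _ => ?_⟩
  unfold hopfV1
  ring

/-- Where the argument of the logarithm is positive, the derivative of the image is p v_x + q with p
and q continuously differentiable in x, so H² regularity and L² continuity of the second derivative
pass through. -/
theorem H2Field.hopfU {t₀ : ℝ} {v v1 v2 : ℝ → ℝ → ℝ} (h : H2Field t₀ v v1 v2) (ε a b : ℝ)
    (hpos : ∀ x ∈ Icc (0 : ℝ) 1, ∀ t, t₀ ≤ t → 0 < Real.exp (a * b / (2 * ε) * x) * v x t + 1) :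
    ∃ w2, H2Field t₀ (hopfU ε a b v) (hopfU1 ε a b v v1) w2 := by
  set κ := a * b / (2 * ε) with hκ
  have hE : ∀ x, HasDerivWithinAt (fun y => Real.exp (κ * y)) (Real.exp (κ * x) * κ) (Icc 0 1) x :=
    fun x => by
      have := ((hasDerivAt_id x).const_mul κ).exp.hasDerivWithinAt (s := Icc 0 1)
      simpa using this
  have hv : ∀ t, t₀ ≤ t → ∀ x ∈ Icc (0 : ℝ) 1,
      HasDerivWithinAt (fun y => v y t) (v1 x t) (Icc 0 1) x := fun t ht => (h.h2 t ht).deriv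
  have hh : ∀ t, t₀ ≤ t → ∀ x ∈ Icc (0 : ℝ) 1,
      HasDerivWithinAt (fun y => Real.exp (κ * y) * v y t + 1)
        (Real.exp (κ * x) * κ * v x t + Real.exp (κ * x) * v1 x t) (Icc 0 1) x := fun t ht x hx =>
    ((hE x).mul (hv t ht x hx)).add_const 1
  have hne : ∀ z ∈ Icc (0 : ℝ) 1 ×ˢ Ici t₀, Real.exp (κ * z.1) * v z.1 z.2 + 1 ≠ 0 :=
    fun z hz => (hpos z.1 hz.1 z.2 hz.2).ne'
  have hne2 : ∀ z ∈ Icc (0 : ℝ) 1 ×ˢ Ici t₀, (Real.exp (κ * z.1) * v z.1 z.2 + 1) ^ 2 ≠ 0 :=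
    fun z hz => pow_ne_zero 2 (hne z hz)
  have c0 := h.c0
  have c1 := h.c1
  have key := h.of_deriv_eq_mul_add
    (g := ViscousHJ.hopfU ε a b v)
    (p := fun x t => -(ε / a) * (Real.exp (κ * x) / (Real.exp (κ * x) * v x t + 1)))
    (p1 := fun x t => -(ε / a) * ((Real.exp (κ * x) * κ * (Real.exp (κ * x) * v x t + 1)
      - Real.exp (κ * x) * (Real.exp (κ * x) * κ * v x t + Real.exp (κ * x) * v1 x t))
        / (Real.exp (κ * x) * v x t + 1) ^ 2))
    (q := fun x t => -(ε / a) * (Real.exp (κ * x) * κ * v x t / (Real.exp (κ * x) * v x t + 1)))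
    (q1 := fun x t => -(ε / a) * (((Real.exp (κ * x) * κ * κ * v x t
      + Real.exp (κ * x) * κ * v1 x t) * (Real.exp (κ * x) * v x t + 1)
      - Real.exp (κ * x) * κ * v x t * (Real.exp (κ * x) * κ * v x t + Real.exp (κ * x) * v1 x t))
        / (Real.exp (κ * x) * v x t + 1) ^ 2))
    (fun t ht x hx => (((hh t ht x hx).log (hpos x hx t ht).ne').const_mul (-(ε / a))).congr_deriv
      (by ring))
    (fun t ht x hx => ((hE x).div (hh t ht x hx) (hpos x hx t ht).ne').const_mul (-(ε / a)))
    (fun t ht x hx => ((((hE x).mul_const κ).mul (hv t ht x hx)).div (hh t ht x hx)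
      (hpos x hx t ht).ne').const_mul (-(ε / a)))
    (by
      refine continuousOn_const.mul (ContinuousOn.log ?_ hne)
      fun_prop)
    (by
      refine continuousOn_const.mul (ContinuousOn.div ?_ ?_ hne) <;> fun_prop)
    (by
      refine continuousOn_const.mul (ContinuousOn.div ?_ ?_ hne2) <;> fun_prop)
    (by
      refine continuousOn_const.mul (ContinuousOn.div ?_ ?_ hne) <;> fun_prop)
    (by
      refine continuousOn_const.mul (ContinuousOn.div ?_ ?_ hne2) <;> fun_prop)
  have e : (fun x t => -(ε / a) * (Real.exp (κ * x) / (Real.exp (κ * x) * v x t + 1)) * v1 x t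
      + -(ε / a) * (Real.exp (κ * x) * κ * v x t / (Real.exp (κ * x) * v x t + 1)))
      = hopfU1 ε a b v v1 := by
    funext x t
    unfold hopfU1
    ring
  rw [e] at key
  exact ⟨_, key⟩

theorem isClassKL_mul_exp {K δ : ℝ} (hK : 0 < K) (hδ : 0 < δ) :
    IsClassKL fun s t => K * Real.exp (-δ * t) * s where
  cont := by fun_prop
  classK := fun t _ => ⟨by fun_prop,
    fun x _ y _ hxy => mul_lt_mul_of_pos_left hxy (by positivity), by simp⟩
  anti := fun s hs t _ t' _ htt => by
    have : Real.exp (-δ * t') ≤ Real.exp (-δ * t) := Real.exp_le_exp.2 (by nlinarith)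
    exact mul_le_mul_of_nonneg_right (mul_le_mul_of_nonneg_left this hK.le) hs
  tendsto := fun s _ => by
    have h1 : Tendsto (fun t => Real.exp (-δ * t)) atTop (𝓝 0) :=
      Real.tendsto_exp_atBot.comp ((tendsto_const_mul_atBot_of_neg (by linarith)).2 tendsto_id)
    simpa using (h1.const_mul K).mul_const s

theorem LinBC.congr {q₁ q₂ : ℝ} {v v1 m m1 v' v1' m' m1' : ℝ → ℝ} (h : LinBC q₁ q₂ v v1 m m1)
    (hv : ∀ x ∈ Icc (0 : ℝ) 1, v' x = v x) (hv1 : ∀ x ∈ Icc (0 : ℝ) 1, v1' x = v1 x)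
    (hm : ∀ x ∈ Icc (0 : ℝ) 1, m' x = m x) (hm1 : ∀ x ∈ Icc (0 : ℝ) 1, m1' x = m1 x) :
    LinBC q₁ q₂ v' v1' m' m1' := by
  have hI : ∀ z, ∫ y in (0 : ℝ)..1, kernX q₁ z y * m' y = ∫ y in (0 : ℝ)..1, kernX q₁ z y * m y :=
    fun z => intervalIntegral.integral_congr fun y hy => by
      rw [uIcc_of_le zero_le_one] at hy
      simp only [hm y hy]
  constructor
  · rw [hv1 0 zero_mem_Icc, hv 0 zero_mem_Icc, hI]; exact h.plant0
  · rw [hv1 1 one_mem_Icc, hv 1 one_mem_Icc, hI]; exact h.plant1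
  · rw [hm1 0 zero_mem_Icc, hv1 0 zero_mem_Icc, hv 0 zero_mem_Icc, hm 0 zero_mem_Icc]; exact h.obs0
  · rw [hm1 1 one_mem_Icc, hv1 1 one_mem_Icc, hv 1 one_mem_Icc, hm 1 one_mem_Icc]; exact h.obs1

variable {ε a b x₀ : ℝ} {y₁ y₂ : ℝ → ℝ} {A L γ B : ℝ}

theorem RefBound.pos (h : RefBound ε a b x₀ y₁ y₂ B) {x : ℝ} (hx : x ∈ Icc (0 : ℝ) 1) {t : ℝ}
    (ht : 0 ≤ t) : 0 < Real.exp (a * b / (2 * ε) * x) * vr ε a b x₀ y₁ y₂ x t + 1 :=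
  lt_of_lt_of_le (by norm_num) (h.lower x hx t ht)

theorem RefData.hasH2_ur (h : RefData ε a b x₀ y₁ y₂ A L γ) (hB : RefBound ε a b x₀ y₁ y₂ B)
    {t : ℝ} (ht : 0 ≤ t) : HasH2 (fun x => ur ε a b x₀ y₁ y₂ x t)
      (fun x => hopfU1 ε a b (vr ε a b x₀ y₁ y₂) (refField ε a b x₀ y₁ y₂ 1) x t)
      (fun x => hopfU2 ε a b (vr ε a b x₀ y₁ y₂) (refField ε a b x₀ y₁ y₂ 1)
        (refField ε a b x₀ y₁ y₂ 2) x t) :=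
  (H2Field.of_c21On (h.c21On.hopfU ε a b fun _ hx _ ht => hB.pos hx ht)).h2 t ht

/-- Compatible initial data close to the reference give small compatible initial data of the
linear closed loop. -/
theorem exists_linear_initial (h : RefData ε a b x₀ y₁ y₂ A L γ) (hB : RefBound ε a b x₀ y₁ y₂ B)
    (ha : a ≠ 0) (c₁ c₂ : ℝ) : ∃ C, 0 < C ∧ ∀ t₀, 0 ≤ t₀ → ∀ u₀ v₀ : ℝ → ℝ, MemH2 u₀ → MemH2 v₀ →
      BoundaryConditions ε a b x₀ c₁ c₂ y₁ y₂ t₀ u₀ v₀ → Omega ε a b x₀ y₁ y₂ t₀ u₀ v₀ ≤ 1 →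
      ∃ (V0 V10 M0 M10 : CI) (v2 m2 : ℝ → ℝ), HasH2 (ext V0) (ext V10) v2 ∧
        HasH2 (ext M0) (ext M10) m2 ∧
        LinBC (c₁ / ε) (c₂ / ε) (ext V0) (ext V10) (ext M0) (ext M10) ∧
        (∀ x ∈ Icc (0 : ℝ) 1, ext V0 x = errV ε a b x₀ y₁ y₂ (fun x _ => u₀ x) x t₀) ∧
        (∀ x ∈ Icc (0 : ℝ) 1, ext M0 x = v₀ x) ∧
        normH1 V0 V10 + normH1 M0 M10 ≤ C * Omega ε a b x₀ y₁ y₂ t₀ u₀ v₀ := by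
  obtain ⟨C, hC, hCe⟩ := hB.exists_errV_le h.hε ha
  refine ⟨2 * C + 1, by positivity, fun t₀ ht₀ u₀ v₀ hu₀ hv₀ hbc hsm => ?_⟩
  set Ω := Omega ε a b x₀ y₁ y₂ t₀ u₀ v₀ with hΩ
  have hu := hu₀.hasH2
  have hv := hv₀.hasH2
  have hd := hu.sub (h.hasH2_ur hB ht₀)
  set r1 := hopfU1 ε a b (vr ε a b x₀ y₁ y₂) (refField ε a b x₀ y₁ y₂ 1) with hr1
  set d0 : ℝ → ℝ := fun x => u₀ x - ur ε a b x₀ y₁ y₂ x t₀ with hd0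
  set d1 : ℝ → ℝ := fun x => D u₀ x - r1 x t₀ with hd1
  have hΩ' : Ω = L2norm d0 + L2norm d1 + (L2norm v₀ + L2norm (D v₀)) := by
    rw [hΩ, Omega, hd.H1norm_eq, hv.H1norm_eq]
  -- Smallness in H¹ is converted into the pointwise bound under which the Hopf–Cole estimate holds.
  have hsup : ∀ x ∈ Icc (0 : ℝ) 1, |d0 x| ≤ 1 := fun x hx => by
    have := abs_le_L2norm_add hd.deriv hd.continuousOn_deriv hx
    have h1 := L2norm_nonneg v₀
    have h2 := L2norm_nonneg (D v₀)
    change |d0 x| ≤ L2norm d0 + L2norm d1 at this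
    linarith
  obtain ⟨w2, hw⟩ := HasH2.hopfV (u := fun x _ => u₀ x) (u1 := fun x _ => D u₀ x) (t := t₀) hu ε a b
  have hV := hw.sub ((H2Field.of_c21On h.c21On).h2 t₀ ht₀)
  change HasH2 (fun x => errV ε a b x₀ y₁ y₂ (fun x _ => u₀ x) x t₀)
    (fun x => errV1 ε a b x₀ y₁ y₂ (fun x _ => u₀ x) (fun x _ => D u₀ x) x t₀) _ at hV
  have e0 := fun x (hx : x ∈ Icc (0 : ℝ) 1) => ext_toCI hV.continuousOn hx
  have e1 := fun x (hx : x ∈ Icc (0 : ℝ) 1) => ext_toCI hV.continuousOn_deriv hx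
  have f0 := fun x (hx : x ∈ Icc (0 : ℝ) 1) => ext_toCI hv.continuousOn hx
  have f1 := fun x (hx : x ∈ Icc (0 : ℝ) 1) => ext_toCI hv.continuousOn_deriv hx
  have hb := (h.boundary_iff ha c₁ c₂ ht₀ (fun x hx => hB.pos hx ht₀) (u := fun x _ => u₀ x)
    (u1 := fun x _ => D u₀ x) (m := fun x _ => v₀ x) (m1 := fun x _ => D v₀ x)
    rfl rfl rfl rfl).1 hbc
  refine ⟨_, _, _, _, _, _, hV.congr e0 e1, hv.congr f0 f1, hb.congr e0 e1 f0 f1, e0, f0, ?_⟩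
  have i0 : L2I d0 := L2I.of_continuousOn hd.continuousOn
  have i1 : L2I d1 := L2I.of_continuousOn hd.continuousOn_deriv
  have n0 := L2norm_le_of_le (f := fun x => errV ε a b x₀ y₁ y₂ (fun x _ => u₀ x) x t₀)
    hC.le le_rfl le_rfl i0 i1 (fun x hx => by
      have := (hCe (fun x _ => u₀ x) (fun x _ => D u₀ x) x t₀ hx ht₀ (hsup x hx)).1
      rw [zero_mul, add_zero, add_zero]; exact this)
  have n1 := L2norm_le_of_le
    (f := fun x => errV1 ε a b x₀ y₁ y₂ (fun x _ => u₀ x) (fun x _ => D u₀ x) x t₀)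
    hC.le hC.le le_rfl i0 i1 (fun x hx => by
      have := (hCe (fun x _ => u₀ x) (fun x _ => D u₀ x) x t₀ hx ht₀ (hsup x hx)).2
      rw [add_zero]; exact this)
  rw [normH1, normH1, L2norm_congr e0, L2norm_congr e1, L2norm_congr f0, L2norm_congr f1, hΩ']
  have p0 := L2norm_nonneg d0
  have p1 := L2norm_nonneg d1
  have p2 := L2norm_nonneg v₀
  have p3 := L2norm_nonneg (D v₀)
  have q1 := mul_nonneg hC.le p1
  have q2 := mul_nonneg hC.le p2
  have q3 := mul_nonneg hC.le p3
  linarith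

variable {ε a b x₀ : ℝ} {y₁ y₂ : ℝ → ℝ} {A L γ B : ℝ}

/-- Small compatible data have a closed-loop solution that converges exponentially to the
reference. -/
theorem exists_closedLoopSolution (h : RefData ε a b x₀ y₁ y₂ A L γ)
    (hB : RefBound ε a b x₀ y₁ y₂ B) (ha : a ≠ 0) {c₁ c₂ : ℝ} (hc₁ : 0 < c₁) (hc₂ : 0 < c₂) :
    ∃ μ K δ, 0 < μ ∧ 0 < K ∧ 0 < δ ∧ ∀ t₀, 0 ≤ t₀ → ∀ u₀ v₀ : ℝ → ℝ, MemH2 u₀ → MemH2 v₀ →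
      BoundaryConditions ε a b x₀ c₁ c₂ y₁ y₂ t₀ u₀ v₀ → Omega ε a b x₀ y₁ y₂ t₀ u₀ v₀ < μ →
      ∃ u v, IsClosedLoopSolution ε a b x₀ c₁ c₂ y₁ y₂ t₀ u₀ v₀ u v ∧
        ∀ t, t₀ ≤ t → Omega ε a b x₀ y₁ y₂ t (fun x => u x t) (fun x => v x t)
          ≤ K * Real.exp (-δ * (t - t₀)) * Omega ε a b x₀ y₁ y₂ t₀ u₀ v₀ := by
  have hε := h.hε
  obtain ⟨C₁, hC₁, hinit⟩ := exists_linear_initial h hB ha c₁ c₂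
  obtain ⟨C₂, δ, hC₂, hδ, hlin⟩ := exists_linear_closed_loop hε
    (l := a ^ 2 * b ^ 2 / (4 * ε)) (by positivity) (div_pos hc₁ hε) (div_pos hc₂ hε)
  obtain ⟨C₃, hC₃, hU⟩ := hB.exists_hopfU_le
  set κ := a * b / (2 * ε) with hκ
  set E := Real.exp |κ| with hE
  have hE0 : 0 < E := Real.exp_pos _
  -- The bound 1 serves the transformation of the initial data; the other makes e^{κx}|ṽ| ≤ 1/4 at
  -- all times. In K the factor C₃ occurs twice, once for the error and once for its derivative.
  refine ⟨min 1 (1 / (4 * (E * (C₂ * C₁)))), (2 * C₃ + 1) * (C₂ * C₁), δ, by positivity,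
    by positivity, hδ, fun t₀ ht₀ u₀ v₀ hu₀ hv₀ hbc hsm => ?_⟩
  set Ω := Omega ε a b x₀ y₁ y₂ t₀ u₀ v₀ with hΩ
  obtain ⟨V0, V10, M0, M10, v2, m2, hV0, hM0, hb0, eV0, eM0, hn0⟩ :=
    hinit t₀ ht₀ u₀ v₀ hu₀ hv₀ hbc (hsm.le.trans (min_le_left _ _))
  obtain ⟨V, V1, V2, Vt, M, M1, M2, Mt, cV, cM, iV, iM, pV, pM, bc, dec⟩ :=
    hlin V0 V10 M0 M10 v2 m2 hV0 hM0 hb0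
  have hdec : ∀ t, 0 ≤ t → normH1 (V t) (V1 t) + normH1 (M t) (M1 t)
      ≤ C₂ * C₁ * Real.exp (-δ * t) * Ω := fun t ht => by
    refine (dec t ht).trans ?_
    calc C₂ * Real.exp (-δ * t) * (normH1 V0 V10 + normH1 M0 M10)
        ≤ C₂ * Real.exp (-δ * t) * (C₁ * Ω) := mul_le_mul_of_nonneg_left hn0 (by positivity)
      _ = _ := by ring
  have hΩ0 : 0 ≤ Ω := by
    have h1 := normH1_nonneg V0 V10
    have h2 := normH1_nonneg M0 M10
    exact nonneg_of_mul_nonneg_right (by linarith : 0 ≤ C₁ * Ω) hC₁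
  have hsmall : ∀ t, 0 ≤ t → ∀ x ∈ Icc (0 : ℝ) 1, Real.exp (κ * x) * |ext (V t) x| ≤ 1 / 4 :=
    fun t ht x hx => by
      have h1 := (abs_ext_le (V t) x).trans (norm_le_normH1 (cV.d1 t ht))
      have h2 := normH1_nonneg (M t) (M1 t)
      have h3 := hdec t ht
      have h4 : Real.exp (-δ * t) ≤ 1 := Real.exp_le_one_iff.2 (by nlinarith)
      have h5 : C₂ * C₁ * Real.exp (-δ * t) * Ω ≤ C₂ * C₁ * Ω := by
        refine mul_le_mul_of_nonneg_right ?_ hΩ0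
        exact mul_le_of_le_one_right (by positivity) h4
      have h6 : Ω ≤ 1 / (4 * (E * (C₂ * C₁))) := hsm.le.trans (min_le_right _ _)
      have h7 := (le_div_iff₀ (by positivity)).1 h6
      calc Real.exp (κ * x) * |ext (V t) x| ≤ E * (C₂ * C₁ * Ω) :=
            mul_le_mul (exp_mul_le hx) (by linarith) (abs_nonneg _) hE0.le
        _ ≤ 1 / 4 := by linarith
  set Vf : ℝ → ℝ → ℝ := fun x t => ext (V (t - t₀)) x with hVf
  set Vf1 : ℝ → ℝ → ℝ := fun x t => ext (V1 (t - t₀)) x with hVf1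
  -- The solution is the inverse Hopf–Cole image of v^r + ṽ, with ṽ from the linear loop started at
  -- time 0 and shifted to t₀.
  set w : ℝ → ℝ → ℝ := fun x t => vr ε a b x₀ y₁ y₂ x t + Vf x t with hw
  set w1 : ℝ → ℝ → ℝ := fun x t => refField ε a b x₀ y₁ y₂ 1 x t + Vf1 x t with hw1
  have hpos : ∀ x ∈ Icc (0 : ℝ) 1, ∀ t, t₀ ≤ t → 0 < Real.exp (κ * x) * w x t + 1 :=
    fun x hx t ht => by
      have h1 := hB.lower x hx t (ht₀.trans ht)
      have h2 := hsmall (t - t₀) (sub_nonneg.2 ht) x hx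
      have h3 : -(Real.exp (κ * x) * |ext (V (t - t₀)) x|)
          ≤ Real.exp (κ * x) * ext (V (t - t₀)) x := by
        rw [← mul_neg]
        exact mul_le_mul_of_nonneg_left (neg_abs_le _) (Real.exp_pos _).le
      have h4 : Real.exp (κ * x) * w x t + 1
          = (Real.exp (κ * x) * vr ε a b x₀ y₁ y₂ x t + 1)
            + Real.exp (κ * x) * ext (V (t - t₀)) x := by
        simp only [hw, hVf]; ring
      rw [h4]
      linarith
  have hT : Ici t₀ ⊆ Ici (0 : ℝ) := Ici_subset_Ici.2 ht₀
  have hT' : Ioi t₀ ⊆ Ici (0 : ℝ) := Ioi_subset_Ici_self.trans hT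
  obtain ⟨z2, hz⟩ := cV.exists_h2Field t₀
  obtain ⟨n2, hnf⟩ := cM.exists_h2Field t₀
  obtain ⟨W2, hW⟩ := ((H2Field.of_c21On (h.c21On.mono hT)).add hz).hopfU ε a b hpos
  have cVf := cV.toParaCurve.c21On t₀
  have cMf := cM.toParaCurve.c21On t₀
  have cw := (h.c21On.mono hT').add cVf
  have cu := cw.hopfU ε a b fun x hx t ht => hpos x hx t (le_of_lt ht)
  have eV : ∀ x ∈ Icc (0 : ℝ) 1, ∀ t, t₀ ≤ t →
      errV ε a b x₀ y₁ y₂ (hopfU ε a b w) x t = Vf x t := fun x hx t ht => by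
    rw [errV, hopfV_hopfU hε ha b (hpos x hx t ht)]
    simp only [hw]; ring
  have eV1 : ∀ x ∈ Icc (0 : ℝ) 1, ∀ t, t₀ ≤ t →
      errV1 ε a b x₀ y₁ y₂ (hopfU ε a b w) (hopfU1 ε a b w w1) x t = Vf1 x t := fun x hx t ht => by
    rw [errV1, hopfV1_hopfU1 hε ha b (hpos x hx t ht)]
    simp only [hw1]; ring
  refine ⟨hopfU ε a b w, fun x t => ext (M (t - t₀)) x, ⟨hW.continuousH2, hnf.continuousH2,
    cu.isC21 isOpen_Ioi.uniqueDiffOn, cMf.isC21 isOpen_Ioi.uniqueDiffOn, fun x hx t ht => ?_,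
    fun x hx t ht => ?_, fun t ht => ?_, fun x hx => ?_, fun x hx => ?_⟩, fun t ht => ?_⟩
  · rw [cu.dt_eq isOpen_Ioi.uniqueDiffOn hx ht, cu.dxx_eq hx ht, cu.dx_eq hx ht]
    refine hopf_pde hε ha b (hpos x hx t (le_of_lt ht)) ?_
    have := congrArg (fun F : CI => ext F x) (pV (t - t₀) (sub_pos.2 ht))
    simp only [ext_sub, ext_smul] at this
    simp only [this]
    ring
  · have p0 : t₀ ≤ t := le_of_lt ht
    rw [cMf.dt_eq isOpen_Ioi.uniqueDiffOn hx ht, cMf.dxx_eq hx ht,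
      meas0_eq (u := hopfU ε a b w) hε ha (hB.pos zero_mem_Icc (ht₀.trans p0)),
      meas1_eq (u := hopfU ε a b w) hε ha (hB.pos one_mem_Icc (ht₀.trans p0)),
      eV 0 zero_mem_Icc t p0, eV 1 one_mem_Icc t p0, p1_eq, p2_eq]
    have := congrArg (fun F : CI => ext F x) (pM (t - t₀) (sub_pos.2 ht))
    simp only [ext_sub, ext_smul, ext_add, ext_kernXProfile _ _ hx] at this
    simp only [this, hVf]
    ring
  · refine (h.boundary_iff ha c₁ c₂ (ht₀.trans ht) (fun x hx => hB.pos hx (ht₀.trans ht))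
      (u := hopfU ε a b w) (u1 := hopfU1 ε a b w w1) (m := fun x t => ext (M (t - t₀)) x)
      (m1 := fun x t => ext (M1 (t - t₀)) x) ((hW.h2 t ht).D_eq zero_mem_Icc)
      ((hW.h2 t ht).D_eq one_mem_Icc) ((hnf.h2 t ht).D_eq zero_mem_Icc)
      ((hnf.h2 t ht).D_eq one_mem_Icc)).2 ?_
    exact (bc (t - t₀) (sub_nonneg.2 ht)).congr (fun x hx => eV x hx t ht)
      (fun x hx => eV1 x hx t ht) (fun _ _ => rfl) (fun _ _ => rfl)
  · have e : w x t₀ = hopfV ε a b (fun x _ => u₀ x) x t₀ := by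
      simp only [hw, hVf, sub_self, iV, eV0 x hx, errV]
      ring
    have := hopfU_hopfV hε ha b (fun x _ => u₀ x) x t₀
    rw [← this, hopfU, hopfU, e]
  · simp only [sub_self, iM, eM0 x hx]
  · have ht0 := ht₀.trans ht
    have hs := sub_nonneg.2 ht
    have hd := (hW.h2 t ht).sub (h.hasH2_ur hB ht0)
    rw [Omega, hd.H1norm_eq, (hnf.h2 t ht).H1norm_eq]
    have i0 : L2I (fun x => Vf x t) := L2I_ext _
    have i1 : L2I (fun x => Vf1 x t) := L2I_ext _
    have n0 := L2norm_le_of_le (f := fun x => hopfU ε a b w x t - ur ε a b x₀ y₁ y₂ x t)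
      hC₃.le le_rfl le_rfl i0 i1 (fun x hx => by
        have := (hU Vf Vf1 x t hx ht0 (hsmall _ hs x hx)).1
        rw [zero_mul, add_zero, add_zero]; exact this)
    have n1 := L2norm_le_of_le (f := fun x => hopfU1 ε a b w w1 x t
        - hopfU1 ε a b (vr ε a b x₀ y₁ y₂) (refField ε a b x₀ y₁ y₂ 1) x t)
      hC₃.le hC₃.le le_rfl i0 i1 (fun x hx => by
        have := (hU Vf Vf1 x t hx ht0 (hsmall _ hs x hx)).2
        rw [add_zero]; exact this)
    have hde := mul_le_mul_of_nonneg_left (hdec (t - t₀) hs) (by positivity : 0 ≤ 2 * C₃ + 1)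
    rw [normH1, normH1] at hde
    change L2norm _ ≤ C₃ * L2norm (ext (V (t - t₀))) + 0 * L2norm (ext (V1 (t - t₀))) + 0 at n0
    change L2norm _ ≤ C₃ * L2norm (ext (V (t - t₀))) + C₃ * L2norm (ext (V1 (t - t₀))) + 0 at n1
    have p0 := L2norm_nonneg (ext (V (t - t₀)))
    have p1 := L2norm_nonneg (ext (V1 (t - t₀)))
    have p2 := L2norm_nonneg (ext (M (t - t₀)))
    have p3 := L2norm_nonneg (ext (M1 (t - t₀)))
    have q1 := mul_nonneg hC₃.le p1
    have q2 := mul_nonneg hC₃.le p2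
    have q3 := mul_nonneg hC₃.le p3
    change L2norm _ + L2norm _ + (L2norm (ext (M (t - t₀))) + L2norm (ext (M1 (t - t₀)))) ≤ _
    linarith

/-! ### Uniqueness -/

theorem continuousOn_slice {T : Set ℝ} {w : ℝ → ℝ → ℝ}
    (hw : ContinuousOn (fun p : ℝ × ℝ => w p.1 p.2) (Icc 0 1 ×ˢ T)) {t : ℝ} (ht : t ∈ T) :
    ContinuousOn (fun x => w x t) (Icc 0 1) :=
  hw.comp (f := fun x => (x, t)) (by fun_prop) fun _ hx => ⟨hx, ht⟩

/-- Continuity in time with values in H² is uniform in x by the Sobolev embedding. Hence the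
solutions compared below attain their initial values continuously. -/
theorem ContinuousH2.continuousOn {t₀ : ℝ} {u : ℝ → ℝ → ℝ} (h : ContinuousH2 t₀ u) :
    ContinuousOn (fun p : ℝ × ℝ => u p.1 p.2) (Icc 0 1 ×ˢ Ici t₀) := by
  rintro ⟨x, s⟩ ⟨hx, hs⟩
  have hx : x ∈ Icc (0 : ℝ) 1 := hx
  have hs : t₀ ≤ s := hs
  have h1 : Tendsto (fun p : ℝ × ℝ => u p.1 s) (𝓝[Icc 0 1 ×ˢ Ici t₀] (x, s)) (𝓝 (u x s)) :=
    ((h.mem s hs).hasH2.continuousOn x hx).tendsto.comp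
      (tendsto_fst.mono_left (by rw [nhdsWithin_prod_eq]) |>.mono_right le_rfl)
  have h2 : Tendsto (fun p : ℝ × ℝ => H2norm (fun x => u x p.2 - u x s))
      (𝓝[Icc 0 1 ×ˢ Ici t₀] (x, s)) (𝓝 0) :=
    (h.cont s hs).comp (tendsto_snd.mono_left (by rw [nhdsWithin_prod_eq]))
  have h3 : Tendsto (fun p : ℝ × ℝ => u p.1 p.2 - u p.1 s) (𝓝[Icc 0 1 ×ˢ Ici t₀] (x, s)) (𝓝 0) := by
    refine squeeze_zero_norm' ?_ h2
    filter_upwards [self_mem_nhdsWithin] with p hp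
    have hd := ((h.mem p.2 hp.2).hasH2).sub (h.mem s hs).hasH2
    have := abs_le_L2norm_add hd.deriv hd.continuousOn_deriv hp.1
    rw [hd.H2norm_eq]
    exact this.trans (le_add_of_nonneg_right (L2norm_nonneg _))
  have h4 := h3.add h1
  simp only [sub_add_cancel, zero_add] at h4
  exact h4

/-- Differentiation under the integral; the dominating constant comes from a compact time window
that stays away from t₀, where the time derivative need not be bounded. -/
theorem C21On.hasDerivAt_energy {t₀ : ℝ} {w w1 w2 wt : ℝ → ℝ → ℝ}
    (h : C21On (Ioi t₀) w w1 w2 wt) {t : ℝ} (ht : t₀ < t) :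
    HasDerivAt (fun s => ∫ x in (0 : ℝ)..1, w x s ^ 2) (∫ x in (0 : ℝ)..1, 2 * (w x t * wt x t)) t := by
  set r := (t - t₀) / 2 with hr
  have hr0 : 0 < r := half_pos (sub_pos.2 ht)
  have hsub : Icc (t - r) (t + r) ⊆ Ioi t₀ := fun s hs => by
    have := hs.1
    exact mem_Ioi.2 (by rw [hr] at this; linarith)
  have hcF : ContinuousOn (fun p : ℝ × ℝ => 2 * (w p.1 p.2 * wt p.1 p.2)) (Icc 0 1 ×ˢ Ioi t₀) :=
    continuousOn_const.mul (h.c0.mul h.ct)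
  obtain ⟨C, hC⟩ := (isCompact_Icc.prod isCompact_Icc).exists_bound_of_continuousOn
    (hcF.mono (prod_mono_right hsub))
  have hm : ∀ {g : ℝ → ℝ}, ContinuousOn g (Icc 0 1) →
      AEStronglyMeasurable g (volume.restrict (uIoc 0 1)) := fun hg => by
    rw [uIoc_of_le zero_le_one]
    exact (hg.mono Ioc_subset_Icc_self).aestronglyMeasurable measurableSet_Ioc
  refine (intervalIntegral.hasDerivAt_integral_of_dominated_loc_of_deriv_le
    (F := fun s x => w x s ^ 2) (F' := fun s x => 2 * (w x s * wt x s))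
    (s := Icc (t - r) (t + r)) (bound := fun _ => C)
    (Icc_mem_nhds (by linarith) (by linarith)) ?_ ?_ ?_ (ae_of_all _ fun x hx s hs => ?_) (by simp)
    (ae_of_all _ fun x hx s hs => ?_)).2
  · filter_upwards [Ioi_mem_nhds ht] with s hs
    exact hm ((continuousOn_slice h.c0 hs).pow 2)
  · refine ContinuousOn.intervalIntegrable ?_
    rw [uIcc_of_le zero_le_one]
    exact (continuousOn_slice h.c0 ht).pow 2
  · exact hm (continuousOn_slice (w := fun x s => 2 * (w x s * wt x s)) hcF ht)
  · rw [uIoc_of_le zero_le_one] at hx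
    exact hC (x, s) ⟨Ioc_subset_Icc_self hx, hs⟩
  · rw [uIoc_of_le zero_le_one] at hx
    have := ((h.dt s (hsub hs) x (Ioc_subset_Icc_self hx)).hasDerivAt
      (Ioi_mem_nhds (hsub hs))).pow 2
    exact this.congr_deriv (by norm_num; ring)

/-- Integration by parts in the energy identity. -/
theorem integral_mul_deriv2 {f f1 f2 : ℝ → ℝ}
    (h1 : ∀ x ∈ Icc (0 : ℝ) 1, HasDerivWithinAt f (f1 x) (Icc 0 1) x)
    (h2 : ∀ x ∈ Icc (0 : ℝ) 1, HasDerivWithinAt f1 (f2 x) (Icc 0 1) x)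
    (hc : ContinuousOn f2 (Icc 0 1)) :
    ∫ x in (0 : ℝ)..1, f x * f2 x
      = f 1 * f1 1 - f 0 * f1 0 - ∫ x in (0 : ℝ)..1, f1 x ^ 2 := by
  have hc1 : ContinuousOn f1 (Icc 0 1) := fun y hy => (h2 y hy).continuousWithinAt
  have hI : uIcc (0 : ℝ) 1 = Icc 0 1 := uIcc_of_le zero_le_one
  rw [intervalIntegral.integral_mul_deriv_eq_deriv_mul_of_hasDerivWithinAt
    (u := f) (v := f1) (u' := f1) (v' := f2) (by rwa [hI]) (by rwa [hI])
    (ContinuousOn.intervalIntegrable (by rwa [hI])) (ContinuousOn.intervalIntegrable (by rwa [hI]))]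
  simp only [sq]

theorem sq_integral_kernel_le {k f : ℝ → ℝ} {K : ℝ} (hf : ContinuousOn f (Icc 0 1)) (hK : 0 ≤ K)
    (hk : ∀ x ∈ Icc (0 : ℝ) 1, |k x| ≤ K) :
    (∫ x in (0 : ℝ)..1, k x * f x) ^ 2 ≤ K ^ 2 * ∫ x in (0 : ℝ)..1, f x ^ 2 := by
  have hL := L2I.of_continuousOn hf
  have h1 : |∫ x in (0 : ℝ)..1, k x * f x| ≤ K * L2norm f := by
    have e : ∫ x in (0 : ℝ)..1, K * |f x| = K * ∫ x in (0 : ℝ)..1, |f x| :=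
      intervalIntegral.integral_const_mul _ _
    refine (intervalIntegral.norm_integral_le_of_norm_le (f := fun x => k x * f x)
      (g := fun x => K * |f x|) zero_le_one (ae_of_all _ fun x hx => ?_)
      (hL.integrable.abs.const_mul K)).trans ?_
    · rw [norm_mul]
      exact mul_le_mul_of_nonneg_right (hk x (Ioc_subset_Icc_self hx)) (abs_nonneg _)
    · rw [e]
      exact mul_le_mul_of_nonneg_left (integral_abs_le_L2norm hL) hK
  rw [← sq_abs, ← L2norm_sq, ← mul_pow]
  exact pow_le_pow_left₀ (abs_nonneg _) h1 2

theorem LinBC.sub {q₁ q₂ : ℝ} {v v1 m m1 v' v1' m' m1' : ℝ → ℝ} (h : LinBC q₁ q₂ v v1 m m1)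
    (h' : LinBC q₁ q₂ v' v1' m' m1') (hm : ContinuousOn m (Icc 0 1))
    (hm' : ContinuousOn m' (Icc 0 1)) :
    LinBC q₁ q₂ (fun x => v x - v' x) (fun x => v1 x - v1' x) (fun x => m x - m' x)
      (fun x => m1 x - m1' x) := by
  have hi : ∀ z {f : ℝ → ℝ}, ContinuousOn f (Icc 0 1) →
      IntervalIntegrable (fun y => kernX q₁ z y * f y) volume 0 1 := fun z f hf => by
    refine ContinuousOn.intervalIntegrable ?_
    rw [uIcc_of_le zero_le_one]
    exact (continuous_kernX_right q₁ z).continuousOn.mul hf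
  have hI : ∀ z, ∫ y in (0 : ℝ)..1, kernX q₁ z y * (m y - m' y)
      = (∫ y in (0 : ℝ)..1, kernX q₁ z y * m y) - ∫ y in (0 : ℝ)..1, kernX q₁ z y * m' y := fun z => by
    rw [← intervalIntegral.integral_sub (hi z hm) (hi z hm')]
    simp only [mul_sub]
  constructor
  · rw [hI, h.plant0, h'.plant0]; ring
  · rw [hI, h.plant1, h'.plant1]; ring
  · rw [h.obs0, h'.obs0]; ring
  · rw [h.obs1, h'.obs1]; ring

/-- The quadratic form of the boundary terms in the energy identity is bounded by the traces and
the energy. -/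
theorem boundary_form_le {K a0 a1 b0 b1 k0 k1 l0 l1 I0 I1 J0 J1 Y : ℝ} (hk0 : |k0| ≤ K)
    (hk1 : |k1| ≤ K) (hl0 : |l0| ≤ K) (hl1 : |l1| ≤ K) (hI0 : I0 ^ 2 ≤ Y) (hI1 : I1 ^ 2 ≤ Y)
    (hJ0 : J0 ^ 2 ≤ Y) (hJ1 : J1 ^ 2 ≤ Y) :
    a1 * (k1 * a1 + I1) - a0 * (k0 * a0 - I0)
      + (b1 * (k1 * a1 + I1 - l1 * (a1 - b1)) - b0 * (k0 * a0 - I0 - l0 * (a0 - b0)))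
      - ((a0 - b0) * J0 + (a1 - b1) * J1)
      ≤ (8 * K + 8) * (a0 ^ 2 + a1 ^ 2 + b0 ^ 2 + b1 ^ 2) + 8 * Y := by
  set S := a0 ^ 2 + a1 ^ 2 + b0 ^ 2 + b1 ^ 2 with hS
  have hK : 0 ≤ K := (abs_nonneg _).trans hk0
  -- The form has eight quadratic terms, each at most K S, and eight products of a trace with an
  -- integral, each at most S + Y.
  have quad : ∀ k p q : ℝ, |k| ≤ K → p ^ 2 + q ^ 2 ≤ 2 * S → |k * (p * q)| ≤ K * S := by
    intro k p q hk hpq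
    rw [abs_mul]
    refine mul_le_mul hk ?_ (abs_nonneg _) hK
    exact abs_le.2 ⟨by nlinarith [sq_nonneg (p + q)], by nlinarith [sq_nonneg (p - q)]⟩
  have lin : ∀ p I : ℝ, p ^ 2 ≤ S → I ^ 2 ≤ Y → |p * I| ≤ S + Y := by
    intro p I hp hI
    exact abs_le.2 ⟨by nlinarith [sq_nonneg (p + I), sq_nonneg p, sq_nonneg I],
      by nlinarith [sq_nonneg (p - I), sq_nonneg p, sq_nonneg I]⟩
  have s0 := sq_nonneg a0
  have s1 := sq_nonneg a1
  have s2 := sq_nonneg b0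
  have s3 := sq_nonneg b1
  have p0 : a0 ^ 2 ≤ S := by linarith
  have p1 : a1 ^ 2 ≤ S := by linarith
  have p2 : b0 ^ 2 ≤ S := by linarith
  have p3 : b1 ^ 2 ≤ S := by linarith
  have e1 := (abs_le.1 (quad k1 a1 a1 hk1 (by linarith))).2
  have e2 := (abs_le.1 (quad k0 a0 a0 hk0 (by linarith))).1
  have e3 := (abs_le.1 (quad k1 b1 a1 hk1 (by linarith))).2
  have e4 := (abs_le.1 (quad l1 b1 a1 hl1 (by linarith))).1
  have e5 := (abs_le.1 (quad l1 b1 b1 hl1 (by linarith))).2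
  have e6 := (abs_le.1 (quad k0 b0 a0 hk0 (by linarith))).1
  have e7 := (abs_le.1 (quad l0 b0 a0 hl0 (by linarith))).2
  have e8 := (abs_le.1 (quad l0 b0 b0 hl0 (by linarith))).1
  have f1 := (abs_le.1 (lin a1 I1 p1 hI1)).2
  have f2 := (abs_le.1 (lin a0 I0 p0 hI0)).2
  have f3 := (abs_le.1 (lin b1 I1 p3 hI1)).2
  have f4 := (abs_le.1 (lin b0 I0 p2 hI0)).2
  have f5 := (abs_le.1 (lin a0 J0 p0 hJ0)).1
  have f6 := (abs_le.1 (lin b0 J0 p2 hJ0)).2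
  have f7 := (abs_le.1 (lin a1 J1 p1 hJ1)).1
  have f8 := (abs_le.1 (lin b1 J1 p3 hJ1)).2
  linarith

/-- A nonnegative function with `E' ≤ K E` that vanishes at the initial time is zero. -/
theorem eq_zero_of_deriv_le {t₀ K : ℝ} {E E' : ℝ → ℝ} (hE : ∀ t, t₀ < t → HasDerivAt E (E' t) t)
    (hle : ∀ t, t₀ < t → E' t ≤ K * E t) (h0 : ∀ t, t₀ < t → 0 ≤ E t)
    (hlim : Tendsto E (𝓝[>] t₀) (𝓝 0)) {t : ℝ} (ht : t₀ < t) : E t = 0 := by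
  -- Grönwall by integrating factor: G is nonincreasing and tends to 0 at t₀, hence G ≤ 0.
  set G : ℝ → ℝ := fun s => Real.exp (-K * s) * E s with hG
  have hd : ∀ s, t₀ < s → HasDerivAt G (Real.exp (-K * s) * (E' s - K * E s)) s := fun s hs => by
    have h1 : HasDerivAt (fun s => Real.exp (-K * s)) (Real.exp (-K * s) * -K) s := by
      simpa using ((hasDerivAt_id s).const_mul (-K)).exp
    exact (h1.mul (hE s hs)).congr_deriv (by ring)
  have hanti : AntitoneOn G (Ioi t₀) := by
    refine antitoneOn_of_deriv_nonpos (convex_Ioi t₀)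
      (fun s hs => (hd s hs).continuousAt.continuousWithinAt)
      (fun s hs => ?_) fun s hs => ?_
    · rw [interior_Ioi] at hs
      exact (hd s hs).differentiableAt.differentiableWithinAt
    · rw [interior_Ioi] at hs
      rw [(hd s hs).deriv]
      exact mul_nonpos_of_nonneg_of_nonpos (Real.exp_pos _).le (sub_nonpos.2 (hle s hs))
  have hGl : Tendsto G (𝓝[>] t₀) (𝓝 0) := by
    have h1 : Tendsto (fun s => Real.exp (-K * s)) (𝓝[>] t₀) (𝓝 (Real.exp (-K * t₀))) :=
      (Continuous.tendsto (by fun_prop) t₀).mono_left nhdsWithin_le_nhds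
    simpa only [mul_zero] using h1.mul hlim
  have h1 : G t ≤ 0 := by
    refine ge_of_tendsto hGl ?_
    filter_upwards [Ioo_mem_nhdsGT ht] with s hs
    exact hanti (mem_Ioi.2 hs.1) (mem_Ioi.2 ht) hs.2.le
  have h2 : E t ≤ 0 := nonpos_of_mul_nonpos_right h1 (Real.exp_pos _)
  exact le_antisymm h2 (h0 t ht)

theorem eq_zero_of_integral_sq_eq_zero {f : ℝ → ℝ} (hf : ContinuousOn f (Icc 0 1))
    (h : ∫ x in (0 : ℝ)..1, f x ^ 2 = 0) : ∀ x ∈ Icc (0 : ℝ) 1, f x = 0 := by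
  intro x hx
  by_contra hne
  have := intervalIntegral.integral_pos zero_lt_one (hf.pow 2) (fun _ _ => sq_nonneg _)
    ⟨x, hx, sq_pos_of_ne_zero hne⟩
  exact this.ne' h

/-- The linear closed loop with zero initial data has only the zero solution. -/
theorem linear_closed_loop_unique {ε l q₁ q₂ t₀ : ℝ} (hε : 0 < ε) (hl : 0 ≤ l)
    {d d1 d2 dt m m1 m2 mt : ℝ → ℝ → ℝ} (hd : C21On (Ioi t₀) d d1 d2 dt)
    (hm : C21On (Ioi t₀) m m1 m2 mt)
    (cd : ContinuousOn (fun p : ℝ × ℝ => d p.1 p.2) (Icc 0 1 ×ˢ Ici t₀))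
    (cm : ContinuousOn (fun p : ℝ × ℝ => m p.1 p.2) (Icc 0 1 ×ˢ Ici t₀))
    (d0 : ∀ x ∈ Icc (0 : ℝ) 1, d x t₀ = 0) (m0 : ∀ x ∈ Icc (0 : ℝ) 1, m x t₀ = 0)
    (ed : ∀ x ∈ Icc (0 : ℝ) 1, ∀ t, t₀ < t → dt x t = ε * d2 x t - l * d x t)
    (em : ∀ x ∈ Icc (0 : ℝ) 1, ∀ t, t₀ < t → mt x t = ε * m2 x t - l * m x t
      - ε * (kernX q₂ 0 x * (d 0 t - m 0 t) + kernX q₂ 1 x * (d 1 t - m 1 t)))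
    (bc : ∀ t, t₀ < t → LinBC q₁ q₂ (fun x => d x t) (fun x => d1 x t) (fun x => m x t)
      (fun x => m1 x t)) :
    ∀ t, t₀ < t → ∀ x ∈ Icc (0 : ℝ) 1, d x t = 0 ∧ m x t = 0 := by
  have hkb : ∀ q y, ∃ C, ∀ x ∈ Icc (0 : ℝ) 1, |kernX q y x| ≤ C := fun q y =>
    isCompact_Icc.exists_bound_of_continuousOn (continuous_kernX_right q y).continuousOn
  obtain ⟨A0, hA0⟩ := hkb q₁ 0
  obtain ⟨A1, hA1⟩ := hkb q₁ 1
  obtain ⟨B0, hB0⟩ := hkb q₂ 0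
  obtain ⟨B1, hB1⟩ := hkb q₂ 1
  set K := |kern q₁ 0 0| + |kern q₁ 1 1| + |kern q₂ 0 0| + |kern q₂ 1 1| + |A0| + |A1| + |B0| + |B1|
    with hK
  have n1 := abs_nonneg (kern q₁ 0 0)
  have n2 := abs_nonneg (kern q₁ 1 1)
  have n3 := abs_nonneg (kern q₂ 0 0)
  have n4 := abs_nonneg (kern q₂ 1 1)
  have n5 := abs_nonneg A0
  have n6 := abs_nonneg A1
  have n7 := abs_nonneg B0
  have n8 := abs_nonneg B1
  have hK0 : 0 ≤ K := by positivity
  have le_K : ∀ {A z : ℝ}, |A| ≤ K → z ≤ A → z ≤ K := fun h1 h2 => h2.trans ((le_abs_self _).trans h1)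
  have hKA0 : ∀ x ∈ Icc (0 : ℝ) 1, |kernX q₁ 0 x| ≤ K := fun x hx => le_K (by linarith) (hA0 x hx)
  have hKA1 : ∀ x ∈ Icc (0 : ℝ) 1, |kernX q₁ 1 x| ≤ K := fun x hx => le_K (by linarith) (hA1 x hx)
  have hKB0 : ∀ x ∈ Icc (0 : ℝ) 1, |kernX q₂ 0 x| ≤ K := fun x hx => le_K (by linarith) (hB0 x hx)
  have hKB1 : ∀ x ∈ Icc (0 : ℝ) 1, |kernX q₂ 1 x| ≤ K := fun x hx => le_K (by linarith) (hB1 x hx)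
  have hii : ∀ {g : ℝ → ℝ}, ContinuousOn g (Icc 0 1) → IntervalIntegrable g volume 0 1 :=
    fun hg => ContinuousOn.intervalIntegrable (by rwa [uIcc_of_le zero_le_one])
  -- Chosen so that (8K + 8)·2η = 1: after the trace inequality the derivative part of the boundary
  -- terms is exactly absorbed by the dissipation.
  set η := 1 / (16 * K + 16) with hη
  have hη0 : 0 < η := by positivity
  set E : ℝ → ℝ := fun t => (∫ x in (0 : ℝ)..1, d x t ^ 2) + ∫ x in (0 : ℝ)..1, m x t ^ 2 with hE
  have hE' := fun t (ht : t₀ < t) => (hd.hasDerivAt_energy ht).add (hm.hasDerivAt_energy ht)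
  have hlim : Tendsto E (𝓝[>] t₀) (𝓝 0) := by
    have key : ∀ {w : ℝ → ℝ → ℝ}, ContinuousOn (fun p : ℝ × ℝ => w p.1 p.2) (Icc 0 1 ×ˢ Ici t₀) →
        (∀ x ∈ Icc (0 : ℝ) 1, w x t₀ = 0) →
        Tendsto (fun t => ∫ x in (0 : ℝ)..1, w x t ^ 2) (𝓝[>] t₀) (𝓝 0) := fun {w} cw w0 => by
      have h1 := ((tendsto_L2norm_sub (mem_Ici.2 le_rfl) cw).mono_left
        (nhdsWithin_mono t₀ Ioi_subset_Ici_self)).pow 2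
      have h2 : ∀ t, (L2norm fun x => w x t - w x t₀) ^ 2 = ∫ x in (0 : ℝ)..1, w x t ^ 2 := fun t => by
        rw [← L2norm_sq, L2norm_congr (g := fun x => w x t) fun x hx => by rw [w0 x hx, sub_zero]]
      simpa [h2] using h1
    simpa using (key cd d0).add (key cm m0)
  have hle : ∀ t, t₀ < t → (∫ x in (0 : ℝ)..1, 2 * (d x t * dt x t))
      + (∫ x in (0 : ℝ)..1, 2 * (m x t * mt x t))
      ≤ 2 * ε * ((8 * K + 8) * (2 * (1 + 1 / η)) + 8 * K ^ 2) * E t := by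
    intro t ht
    have hb := bc t ht
    have sd := continuousOn_slice hd.c0 ht
    have sd1 := continuousOn_slice hd.c1 ht
    have sd2 := continuousOn_slice hd.c2 ht
    have sm := continuousOn_slice hm.c0 ht
    have sm1 := continuousOn_slice hm.c1 ht
    have sm2 := continuousOn_slice hm.c2 ht
    set X := ∫ x in (0 : ℝ)..1, d x t ^ 2 with hX
    set Y := ∫ x in (0 : ℝ)..1, m x t ^ 2 with hY
    set X1 := ∫ x in (0 : ℝ)..1, d1 x t ^ 2 with hX1
    set Y1 := ∫ x in (0 : ℝ)..1, m1 x t ^ 2 with hY1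
    have pX : 0 ≤ X := integral_sq_nonneg _
    have pY : 0 ≤ Y := integral_sq_nonneg _
    have eD : ∫ x in (0 : ℝ)..1, 2 * (d x t * dt x t)
        = 2 * (ε * (d 1 t * d1 1 t - d 0 t * d1 0 t - X1) - l * X) := by
      have : ∫ x in (0 : ℝ)..1, 2 * (d x t * dt x t)
          = ∫ x in (0 : ℝ)..1, 2 * (ε * (d x t * d2 x t) - l * d x t ^ 2) := by
        refine intervalIntegral.integral_congr fun x hx => ?_
        rw [uIcc_of_le zero_le_one] at hx
        simp only [ed x hx t ht]
        ring
      rw [this, intervalIntegral.integral_const_mul, intervalIntegral.integral_sub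
        (hii (by fun_prop)) (hii (by fun_prop)), intervalIntegral.integral_const_mul,
        intervalIntegral.integral_const_mul, integral_mul_deriv2 (hd.d1 t ht) (hd.d2 t ht) sd2]
    have ck0 := (continuous_kernX_right q₂ 0).continuousOn (s := Icc (0 : ℝ) 1)
    have ck1 := (continuous_kernX_right q₂ 1).continuousOn (s := Icc (0 : ℝ) 1)
    set J0 := ∫ x in (0 : ℝ)..1, kernX q₂ 0 x * m x t with hJ0
    set J1 := ∫ x in (0 : ℝ)..1, kernX q₂ 1 x * m x t with hJ1
    have eM : ∫ x in (0 : ℝ)..1, 2 * (m x t * mt x t)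
        = 2 * (ε * (m 1 t * m1 1 t - m 0 t * m1 0 t - Y1) - l * Y
          - ε * ((d 0 t - m 0 t) * J0 + (d 1 t - m 1 t) * J1)) := by
      have : ∫ x in (0 : ℝ)..1, 2 * (m x t * mt x t)
          = ∫ x in (0 : ℝ)..1, 2 * (ε * (m x t * m2 x t) - l * m x t ^ 2
            - ε * ((d 0 t - m 0 t) * (kernX q₂ 0 x * m x t)
              + (d 1 t - m 1 t) * (kernX q₂ 1 x * m x t))) := by
        refine intervalIntegral.integral_congr fun x hx => ?_
        rw [uIcc_of_le zero_le_one] at hx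
        simp only [em x hx t ht]
        ring
      rw [this, intervalIntegral.integral_const_mul, intervalIntegral.integral_sub
        (hii (by fun_prop)) (hii (by fun_prop)), intervalIntegral.integral_sub
        (hii (by fun_prop)) (hii (by fun_prop)), intervalIntegral.integral_const_mul,
        intervalIntegral.integral_const_mul, intervalIntegral.integral_const_mul,
        intervalIntegral.integral_add (hii (by fun_prop)) (hii (by fun_prop)),
        intervalIntegral.integral_const_mul, intervalIntegral.integral_const_mul,
        integral_mul_deriv2 (hm.d1 t ht) (hm.d2 t ht) sm2]
    have hform := boundary_form_le (K := K) (a0 := d 0 t) (a1 := d 1 t) (b0 := m 0 t) (b1 := m 1 t)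
      (k0 := kern q₁ 0 0) (k1 := kern q₁ 1 1) (l0 := kern q₂ 0 0) (l1 := kern q₂ 1 1)
      (Y := K ^ 2 * Y) (by linarith) (by linarith) (by linarith) (by linarith)
      (sq_integral_kernel_le sm hK0 hKA0) (sq_integral_kernel_le sm hK0 hKA1)
      (sq_integral_kernel_le sm hK0 hKB0) (sq_integral_kernel_le sm hK0 hKB1)
    have td0 := sq_le_integral_add (hd.d1 t ht) sd1 zero_mem_Icc hη0
    have td1 := sq_le_integral_add (hd.d1 t ht) sd1 one_mem_Icc hη0
    have tm0 := sq_le_integral_add (hm.d1 t ht) sm1 zero_mem_Icc hη0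
    have tm1 := sq_le_integral_add (hm.d1 t ht) sm1 one_mem_Icc hη0
    -- The observer conditions refer to the plant fluxes; once these are substituted, all four
    -- fluxes are expressed by traces and kernel integrals.
    have b1 := hb.plant0
    have b2 := hb.plant1
    have b3 := hb.obs0
    have b4 := hb.obs1
    rw [b1] at b3
    rw [b2] at b4
    rw [eD, eM, b1, b2, b3, b4]
    rw [← hX, ← hX1] at td0 td1
    rw [← hY, ← hY1] at tm0 tm1
    have hS : d 0 t ^ 2 + d 1 t ^ 2 + m 0 t ^ 2 + m 1 t ^ 2
        ≤ 2 * (1 + 1 / η) * (X + Y) + 2 * η * (X1 + Y1) := by linarith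
    have hη1 : (8 * K + 8) * (2 * η) = 1 := by rw [hη]; field_simp; ring
    have hS' := mul_le_mul_of_nonneg_left hS (by positivity : 0 ≤ 8 * K + 8)
    have hS2 : (8 * K + 8) * (2 * (1 + 1 / η) * (X + Y) + 2 * η * (X1 + Y1))
        = (8 * K + 8) * (2 * (1 + 1 / η)) * (X + Y) + (X1 + Y1) := by
      rw [mul_add, ← mul_assoc, ← mul_assoc _ (2 * η), hη1, one_mul]
    have hKX : 0 ≤ 8 * K ^ 2 * X := by positivity
    have hfin := mul_le_mul_of_nonneg_left (hform.trans (add_le_add_left (hS'.trans hS2.le) _))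
      (by positivity : 0 ≤ 2 * ε)
    have hlX := mul_nonneg hl pX
    have hlY := mul_nonneg hl pY
    have hεK := mul_nonneg (by positivity : 0 ≤ 2 * ε) hKX
    have hEt : E t = X + Y := rfl
    rw [hEt]
    linarith
  intro t ht
  have hE0 := eq_zero_of_deriv_le hE' hle
    (fun t _ => add_nonneg (integral_sq_nonneg _) (integral_sq_nonneg _)) hlim ht
  have p1 : 0 ≤ ∫ x in (0 : ℝ)..1, d x t ^ 2 := integral_sq_nonneg _
  have p2 : 0 ≤ ∫ x in (0 : ℝ)..1, m x t ^ 2 := integral_sq_nonneg _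
  have hE1 : (∫ x in (0 : ℝ)..1, d x t ^ 2) + ∫ x in (0 : ℝ)..1, m x t ^ 2 = 0 := hE0
  intro x hx
  exact ⟨eq_zero_of_integral_sq_eq_zero (continuousOn_slice hd.c0 ht) (by linarith) x hx,
    eq_zero_of_integral_sq_eq_zero (continuousOn_slice hm.c0 ht) (by linarith) x hx⟩

variable {ε a b x₀ : ℝ} {y₁ y₂ : ℝ → ℝ} {A L γ B : ℝ}

/-- Closed-loop solutions are determined by their initial data. -/
theorem IsClosedLoopSolution.unique (h : RefData ε a b x₀ y₁ y₂ A L γ)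
    (hB : RefBound ε a b x₀ y₁ y₂ B) (ha : a ≠ 0) {c₁ c₂ t₀ : ℝ} (ht₀ : 0 ≤ t₀) {u₀ v₀ : ℝ → ℝ}
    {u v u' v' : ℝ → ℝ → ℝ} (hs : IsClosedLoopSolution ε a b x₀ c₁ c₂ y₁ y₂ t₀ u₀ v₀ u v)
    (hs' : IsClosedLoopSolution ε a b x₀ c₁ c₂ y₁ y₂ t₀ u₀ v₀ u' v') :
    ∀ x ∈ Icc (0 : ℝ) 1, ∀ t, t₀ ≤ t → u' x t = u x t ∧ v' x t = v x t := by
  have hε := h.hε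
  have cV := C21On.hopfV (C21On.of_isC21 hs.c21_u) ε a b
  have cV' := C21On.hopfV (C21On.of_isC21 hs'.c21_u) ε a b
  have cM := C21On.of_isC21 hs.c21_v
  have cM' := C21On.of_isC21 hs'.c21_v
  have cu := hs.contH2_u.continuousOn
  have cu' := hs'.contH2_u.continuousOn
  have cv := hs.contH2_v.continuousOn
  have cv' := hs'.contH2_v.continuousOn
  have hmeas0 : ∀ (w : ℝ → ℝ → ℝ) t, t₀ < t →
      meas0 ε a (fun z => ur ε a b x₀ y₁ y₂ z t) (fun z => w z t - ur ε a b x₀ y₁ y₂ z t)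
        = errV ε a b x₀ y₁ y₂ w 0 t := fun w t ht =>
    meas0_eq hε ha (hB.pos zero_mem_Icc (ht₀.trans ht.le))
  have hmeas1 : ∀ (w : ℝ → ℝ → ℝ) t, t₀ < t →
      meas1 ε a b (fun z => ur ε a b x₀ y₁ y₂ z t) (fun z => w z t - ur ε a b x₀ y₁ y₂ z t)
        = errV ε a b x₀ y₁ y₂ w 1 t := fun w t ht =>
    meas1_eq hε ha (hB.pos one_mem_Icc (ht₀.trans ht.le))
  have hcont : ∀ {w : ℝ → ℝ → ℝ}, ContinuousOn (fun p : ℝ × ℝ => w p.1 p.2) (Icc 0 1 ×ˢ Ici t₀) →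
      ContinuousOn (fun p : ℝ × ℝ => hopfV ε a b w p.1 p.2) (Icc 0 1 ×ˢ Ici t₀) := fun hw => by
    unfold hopfV
    fun_prop
  -- v^r drops out of the difference of the Hopf–Cole images, and the map u ↦ v is injective without
  -- any sign condition; so no smallness of the competing solution is needed.
  have key := linear_closed_loop_unique (q₁ := c₁ / ε) (q₂ := c₂ / ε) (l := a ^ 2 * b ^ 2 / (4 * ε))
    hε (by positivity) (cV'.sub cV) (cM'.sub cM) ((hcont cu').sub (hcont cu)) (cv'.sub cv)
    (fun x hx => by simp only [hopfV, hs.init_u x hx, hs'.init_u x hx, sub_self])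
    (fun x hx => by simp only [hs.init_v x hx, hs'.init_v x hx, sub_self])
    (fun x hx t ht => by
      simp only [hopfV_pde hε ha b (hs.plant x hx t ht), hopfV_pde hε ha b (hs'.plant x hx t ht)]
      ring)
    (fun x hx t ht => by
      have e := hs.observer x hx t ht
      have e' := hs'.observer x hx t ht
      rw [hmeas0 u t ht, hmeas1 u t ht, p1_eq, p2_eq, errV, errV] at e
      rw [hmeas0 u' t ht, hmeas1 u' t ht, p1_eq, p2_eq, errV, errV] at e'
      simp only [e, e']
      ring)
    (fun t ht => by
      have t0 := ht₀.trans ht.le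
      have e := (h.boundary_iff ha c₁ c₂ t0 (fun x hx => hB.pos hx t0) (u := u) (u1 := dx u)
        (m := v) (m1 := dx v) rfl rfl rfl rfl).1 (hs.boundary t ht.le)
      have e' := (h.boundary_iff ha c₁ c₂ t0 (fun x hx => hB.pos hx t0) (u := u') (u1 := dx u')
        (m := v') (m1 := dx v') rfl rfl rfl rfl).1 (hs'.boundary t ht.le)
      refine (e'.sub e (continuousOn_slice cv' ht.le) (continuousOn_slice cv ht.le)).congr
        (fun x _ => ?_) (fun x _ => ?_) (fun _ _ => rfl) (fun _ _ => rfl)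
      · simp only [errV]; ring
      · simp only [errV1]; ring)
  intro x hx t ht
  rcases ht.eq_or_lt with rfl | ht
  · exact ⟨(hs'.init_u x hx).trans (hs.init_u x hx).symm,
      (hs'.init_v x hx).trans (hs.init_v x hx).symm⟩
  · obtain ⟨k1, k2⟩ := key t ht x hx
    refine ⟨?_, sub_eq_zero.1 k2⟩
    rw [← hopfU_hopfV hε ha b u' x t, ← hopfU_hopfV hε ha b u x t, hopfU, hopfU, sub_eq_zero.1 k1]

end ViscousHJ

end

/-! ### The main theorem -/

theorem theorem3 (ε a b x₀ M γ : ℝ) (hε : 0 < ε) (ha : a ≠ 0) (hx₀ : x₀ ∈ Set.Icc (0 : ℝ) 1)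
    (hM : 0 < M) (hγ₁ : 1 ≤ γ) (hγ₂ : γ < 2) :
    ∃ μ₁ : ℝ, 0 < μ₁ ∧ ∀ F : ℝ, 0 < F → F ≤ μ₁ → ∀ y₁ y₂ : ℝ → ℝ,
      ViscousHJ.IsGevrey F M γ y₁ → ViscousHJ.IsGevrey F M γ y₂ →
      ViscousHJ.IsReference ε a b x₀ y₁ y₂ ∧
      ∀ c₁ c₂ : ℝ, 0 < c₁ → 0 < c₂ →
      ∃ μ : ℝ, 0 < μ ∧ ∃ β : ℝ → ℝ → ℝ, ViscousHJ.IsClassKL β ∧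
      ∀ t₀ : ℝ, 0 ≤ t₀ → ∀ u₀ v₀ : ℝ → ℝ,
        ViscousHJ.MemH2 u₀ → ViscousHJ.MemH2 v₀ →
        ViscousHJ.BoundaryConditions ε a b x₀ c₁ c₂ y₁ y₂ t₀ u₀ v₀ →
        ViscousHJ.Omega ε a b x₀ y₁ y₂ t₀ u₀ v₀ < μ →
        ∃ u v : ℝ → ℝ → ℝ,
          ViscousHJ.IsClosedLoopSolution ε a b x₀ c₁ c₂ y₁ y₂ t₀ u₀ v₀ u v ∧
          (∀ t : ℝ, t₀ ≤ t →
            ViscousHJ.Omega ε a b x₀ y₁ y₂ t (fun x => u x t) (fun x => v x t) ≤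
              β (ViscousHJ.Omega ε a b x₀ y₁ y₂ t₀ u₀ v₀) (t - t₀)) ∧
          ∀ u' v' : ℝ → ℝ → ℝ,
            ViscousHJ.IsClosedLoopSolution ε a b x₀ c₁ c₂ y₁ y₂ t₀ u₀ v₀ u' v' →
            ∀ x ∈ Set.Icc (0 : ℝ) 1, ∀ t : ℝ, t₀ ≤ t → u' x t = u x t ∧ v' x t = v x t := by
  obtain ⟨μ₁, hμ₁, href⟩ := ViscousHJ.exists_reference ε a b x₀ M γ hε hx₀ hM hγ₁ hγ₂
  refine ⟨μ₁, hμ₁, fun F hF hFμ y₁ y₂ hy₁ hy₂ => ?_⟩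
  -- These bounds hold for all t ≥ 0; hence the smallness threshold and the decay constants obtained
  -- from them do not depend on t₀.
  obtain ⟨A, L, B, h, hB⟩ := href F hF hFμ y₁ y₂ hy₁ hy₂
  refine ⟨h.isReference ha fun x hx t ht => hB.pos hx ht, fun c₁ c₂ hc₁ hc₂ => ?_⟩
  obtain ⟨μ, K, δ, hμ, hK, hδ, hex⟩ := ViscousHJ.exists_closedLoopSolution h hB ha hc₁ hc₂
  refine ⟨μ, hμ, _, ViscousHJ.isClassKL_mul_exp hK hδ, fun t₀ ht₀ u₀ v₀ hu₀ hv₀ hbc hsm => ?_⟩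
  obtain ⟨u, v, hs, hdec⟩ := hex t₀ ht₀ u₀ v₀ hu₀ hv₀ hbc hsm
  exact ⟨u, v, hs, hdec, fun u' v' hs' => hs.unique h hB ha ht₀ hs'⟩
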